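/- **Setting.** Let $S$ be a finite set of places of $\mathbb Q$ of odd cardinality containing $\infty$ and a prime $p$, and let $N^+\ge 1$ be a square-free integer not divisible by any prime of $S$; assume that $N=N^+\prod_{\ell\in S,\,\ell\ne\infty}\ell$ is odd. Let $B$ be the quaternion algebra over $\mathbb Q$ ramified exactly at $S\setminus\{p\}$, let $R\subset B$ be an Eichler $\mathbb Z[1/p]$-order of level $N^+$, let $\Gamma$ be the group of elements of reduced norm $1$ in $R$, and assume that $\bar\Gamma=\Gamma/\{\pm1\}$ is torsion-free. Let $V\subset B$ be the space of elements of trace zero, $Q$ the restriction of the reduced norm to $V$, and $\langle v,w\rangle=Q(v+w)-Q(v)-Q(w)$; $B^\times$ acts on $V$ by conjugation. Let $C_V$ be the conic of isotropic lines in $V$, identified with $\mathbb P^1$ over $\mathbb Q_p$ by means of an isomorphism $B_{\mathbb Q_p}\simeq M_2(\mathbb Q_p)$ (a line of nilpotent matrices is sent to its kernel), and let $\mathscr H_p=C_V(\mathbb C_p)\setminus C_V(\mathbb Q_p)$. For $0\ne v\in V$ let $\Delta(v)$ be the sum of the points of $\mathscr H_p$ orthogonal to $v$. Let $\mathcal D_S$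 be the set of integers $D$ such that $D=Q(v)$ for some $0\ne v\in V$ with $\Delta(v)\neq0$. **Tree.** Let $\mathcal T$ be the Bruhat–Tits tree: its vertices are the unimodular $\mathbb Z_p$-lattices in $V_{\mathbb Q_p}$, and $L,L'$ are joined by an edge if $[L:L\cap L']=[L':L\cap L']=p$. Fix one of the two parities on the vertices for which each edge joins an even and an odd vertex. Let $\mathrm{red}:\mathscr H_p\to\mathcal T$ be the reduction map. For a vertex $L$ put $\mathcal A_L=\mathrm{red}^{-1}(L)$, and let $\mathcal W_L$ be the preimage of $L$ together with all open edges having $L$ as an endpoint. A finite divisor $\mathscr D$ on $\mathscr H_p$ has strong degree $0$ in an even (resp. odd) sense if $\deg(\mathscr D\cap\mathcal W_L)=0$ for all even (resp. odd) $L$ and $\deg(\mathscr D\cap\mathcal A_L)=0$ for all odd (resp. even) $L$. Let $\pi:\mathscr H_p\to\Gamma\backslash\mathscr H_p$ be the projection. A divisor $\Delta$ on $\Gamma\backslash\mathscr H_p$ has strong degree $0$ if there are $\mathscr D_e,\mathscr D_o$ of strong degree $0$ in an even and in an odd sense respectively with $\pi_*\mathscr D_e=\pi_*\mathscr D_o=\Delta$.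 **Function and divisors.** Let $\Phi:V_{\mathbb A^{p,\infty}}\to\mathbb Z$ be a Schwartz–Bruhat function, invariant under conjugation by $\hat R^\times$, with $\Phi(pv)=\Phi(v)$ for $v\in V$ and $\Phi(0)=0$, such that for each $D\in\mathcal D_S$ the divisor $$\Delta_\Phi(D)=\sum_{v\in\Gamma\backslash V,\ Q(v)=D}\frac{\Phi(v)}{\#\mathrm{Stab}_{\bar\Gamma}(v)}\,\pi_*\Delta(v)$$ on $\Gamma\backslash\mathscr H_p$ has strong degree $0$. (In particular $\Phi$ may be any *convenient* function, that is, one which moreover is invariant under $K_0(4N)^{(p)}$ acting through the Weil representation.) **Theta values.** For degree zero divisors $\mathscr D_0,\mathscr D_1$ on $C_V(\mathbb C_p)$ with disjoint supports let $[\mathscr D_0;\mathscr D_1]=f_{\mathscr D_0}(\mathscr D_1)$, where $f_{\mathscr D_0}$ is a rational function with divisor $\mathscr D_0$. For $\mathscr D\in\mathrm{Div}^0(\mathscr H_p)$ and $\gamma\in\Gamma$ put $$j_{\mathscr D}(\gamma)=\prod_{\alpha\in\bar\Gamma}\big[(\gamma\eta)-(\eta);\alpha\mathscr D\big]\in\mathbb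 C_p,$$ where $\eta\in\mathscr H_p$ is any point outside the $\Gamma$-orbit of the support of $\mathscr D$. **Lattices.** Let $\gamma\in\Gamma$ be hyperbolic at $p$. Its eigenvalues on $V_{\mathbb Q_p}$ are $\varpi,1,\varpi^{-1}$, where $\varpi$ is chosen so that the eigenline $V[\varpi]$ is the attractive fixed point of $\gamma$ on $C_V$ (and $V[\varpi^{-1}]$ the repulsive one), that is, $\mathrm{ord}_p(\varpi)=-2t$ with an integer $t>0$. Let $L_0$ be an even unimodular $\mathbb Z_p$-lattice with $L_0=L_0[\varpi]\oplus L_0[1]\oplus L_0[\varpi^{-1}]$, where $L_0[\lambda]$ is the intersection of $L_0$ with the $\lambda$-eigenspace of $\gamma$, and let $w_0^+,e,w_0^-$ be generators of these three summands. For $j\ge0$ put $w_j^{\pm}=p^{\pm j}w_0^{\pm}$ and $L_j=\mathbb Z_pw_j^+\oplus\mathbb Z_pe\oplus\mathbb Z_pw_j^-$. For $D\in\mathcal D_S$ and $n\ge0$ put $$L_j^{\pm}[n]=\{v\in L_j\cap V\mid Q(v)=Dp^{2n},\ \langle v,w_j^{\pm}\rangle\in\mathbb Z_p^\times\}.$$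 **Theorem 6.4.** Let $D\in\mathcal D_S$. The infinite products defining the values $j$ below converge unconditionally, and the following hold. 1. Suppose $\mathrm{ord}_p(D)=0$, and let $\mathscr D_\Phi(D)$ be a divisor on $\mathscr H_p$ of strong degree $0$ (in an even or in an odd sense) with $\pi_*\mathscr D_\Phi(D)=\Delta_\Phi(D)$. Then $$j_{\mathscr D_\Phi(D)}(\gamma)=\lim_{n\to\infty}\prod_{j=0}^{2t-1}\frac{\prod_{v\in L_j^+[n]}\langle w_0^+,v\rangle^{\Phi(v)}}{\prod_{v\in L_j^-[n]}\langle w_0^-,v\rangle^{\Phi(v)}}.$$ 2. Suppose $\mathrm{ord}_p(D)=1$, and let $\mathscr D_\Phi(D)_e,\mathscr D_\Phi(D)_o$ be divisors on $\mathscr H_p$ of strong degree $0$ in an even and in an odd sense respectively with $\pi_*\mathscr D_\Phi(D)_e=\pi_*\mathscr D_\Phi(D)_o=\Delta_\Phi(D)$. Then $$j_{\mathscr D_\Phi(D)_e}(\gamma)\cdot j_{\mathscr D_\Phi(D)_o}(\gamma)=\lim_{n\to\infty}\prod_{j=0}^{2t-1}\frac{\prod_{v\in L_j^+[n]\cup L_j^+[n+1]}\langle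 w_0^+,v\rangle^{\Phi(v)}}{\prod_{v\in L_j^-[n]\cup L_j^-[n+1]}\langle w_0^-,v\rangle^{\Phi(v)}}.$$ (In the inner products only finitely many $v$ have $\Phi(v)\ne0$.) -/

import Mathlib

open scoped LinearAlgebra.Projectivization RestrictedProduct
open Filter Topology

noncomputable section

namespace HeegnerTheta

/-! ### Quaternion algebras over `ℚ` and their trace zero part -/

/-- The base change to the `ℚ`-algebra `K` of the quaternion algebra `B = (a, b)` over `ℚ`,
with basis `1, i, j, k`, where `i ^ 2 = a`, `j ^ 2 = b` and `k = i * j = - j * i`. -/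
abbrev Quat (a b : ℚ) (K : Type*) [CommRing K] [Algebra ℚ K] : Type _ :=
  QuaternionAlgebra K (algebraMap ℚ K a) 0 (algebraMap ℚ K b)

/-- The coordinate space of the trace zero part `V` of `B` (base changed to `K`): the vector
`v` stands for the trace zero quaternion `v 0 * i + v 1 * j + v 2 * k`. -/
abbrev Vec (K : Type*) : Type _ := Fin 3 → K

section Algebra

variable (a b : ℚ) {K : Type*} [CommRing K] [Algebra ℚ K]

/-- The trace zero quaternion with given coordinates. -/
def toQuat (v : Vec K) : Quat a b K := ⟨0, v 0, v 1, v 2⟩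

variable {a b}

/-- The coordinates of the trace zero part of a quaternion. -/
def imag (x : Quat a b K) : Vec K := ![x.imI, x.imJ, x.imK]

/-- The reduced norm `x * x̄`. -/
def nrd (x : Quat a b K) : K := (x * star x).re

theorem nrd_mul (x y : Quat a b K) : nrd (x * y) = nrd x * nrd y := by
  simp [nrd]; ring

theorem nrd_one : nrd (1 : Quat a b K) = 1 := by simp [nrd]

theorem re_mul_comm (x y : Quat a b K) : (x * y).re = (y * x).re := by
  simp; ring

theorem toQuat_imag (x : Quat a b K) (h : x.re = 0) : toQuat a b (imag x) = x := by
  ext <;> simp [toQuat, imag, h]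

theorem imag_toQuat (v : Vec K) : imag (toQuat a b v) = v := by
  funext i; fin_cases i <;> simp [toQuat, imag]

theorem toQuat_conj (x : (Quat a b K)ˣ) (v : Vec K) :
    toQuat a b (imag ((x : Quat a b K) * toQuat a b v * ((x⁻¹ : (Quat a b K)ˣ) : Quat a b K))) =
      (x : Quat a b K) * toQuat a b v * ((x⁻¹ : (Quat a b K)ˣ) : Quat a b K) := by
  apply toQuat_imag
  rw [re_mul_comm, ← mul_assoc]
  simp [toQuat]

/-- Conjugation `v ↦ x v x⁻¹` on trace zero quaternions, as a group homomorphism from the unit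
group of `B_K` to the linear automorphisms of `V_K`. -/
def conj : (Quat a b K)ˣ →* LinearMap.GeneralLinearGroup K (Vec K) :=
  MonoidHom.toHomUnits
    { toFun := fun x =>
        { toFun := fun v => imag
            ((x : Quat a b K) * toQuat a b v * ((x⁻¹ : (Quat a b K)ˣ) : Quat a b K))
          map_add' := fun v w => by
            have h : toQuat a b (v + w) = toQuat a b v + toQuat a b w := by
              ext <;> simp [toQuat]
            rw [h, mul_add, add_mul]
            funext i; fin_cases i <;> simp [imag]
          map_smul' := fun c v => by
            have h : toQuat a b (c • v) = c • toQuat a b v := by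
              ext <;> simp [toQuat]
            rw [h, mul_smul_comm, smul_mul_assoc]
            funext i; fin_cases i <;> simp [imag] }
      map_one' := by
        refine LinearMap.ext fun v => ?_
        change imag _ = v
        simp [imag_toQuat]
      map_mul' := fun x y => by
        refine LinearMap.ext fun v => ?_
        change imag _ = imag ((x : Quat a b K) * toQuat a b (imag _) *
          ((x⁻¹ : (Quat a b K)ˣ) : Quat a b K))
        rw [toQuat_conj]
        simp [mul_assoc] }

variable (K)

/-- The ring homomorphism `B → B_K`. -/
def baseChange : Quat a b ℚ →+* Quat a b K where
  toFun x := ⟨algebraMap ℚ K x.re, algebraMap ℚ K x.imI, algebraMap ℚ K x.imJ,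
    algebraMap ℚ K x.imK⟩
  map_one' := by ext <;> simp
  map_zero' := by ext <;> simp
  map_add' x y := by ext <;> simp
  map_mul' x y := by ext <;> simp

/-- The action of `Bˣ` on `V_K` by conjugation. -/
def conjRat : (Quat a b ℚ)ˣ →* LinearMap.GeneralLinearGroup K (Vec K) :=
  conj.comp (Units.map (baseChange (a := a) (b := b) K : Quat a b ℚ →* Quat a b K))

variable {K}
variable (a b)

/-- The quadratic form on `V_K` given by the reduced norm. -/
def quadForm (v : Vec K) : K := nrd (toQuat a b v)

/-- The symmetric bilinear form `⟨v, w⟩ = Q (v + w) - Q v - Q w`. -/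
def pairing (v w : Vec K) : K := quadForm a b (v + w) - quadForm a b v - quadForm a b w

end Algebra

/-- `B_K` is a division algebra. For `K = ℝ` or `K = ℚ_ℓ`: the algebra `B` is ramified at the
corresponding place. -/
def IsDivision (a b : ℚ) (K : Type*) [CommRing K] [Algebra ℚ K] : Prop :=
  ∀ x : Quat a b K, x ≠ 0 → IsUnit x

/-! ### Eichler `ℤ[1/p]`-orders and their norm one units -/

/-- The ring `ℤ[1/p]`. -/
abbrev ZInv (p : ℕ) : Subalgebra ℤ ℚ := Algebra.adjoin ℤ {(p : ℚ)⁻¹}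

section Orders

variable {a b : ℚ} {p : ℕ}

/-- A `ℤ[1/p]`-order: a subring that is a finitely generated `ℤ[1/p]`-submodule and spans `B`. -/
def IsOrder (R : Subalgebra (ZInv p) (Quat a b ℚ)) : Prop :=
  (Subalgebra.toSubmodule R).FG ∧ Submodule.span ℚ (R : Set (Quat a b ℚ)) = ⊤

/-- A maximal `ℤ[1/p]`-order. -/
def IsMaximalOrder (R : Subalgebra (ZInv p) (Quat a b ℚ)) : Prop :=
  IsOrder R ∧ ∀ R' : Subalgebra (ZInv p) (Quat a b ℚ), IsOrder R' → R ≤ R' → R' = R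

/-- An Eichler order of level `M`: an intersection of two maximal orders that has index `M`
in one (equivalently both) of them. -/
def IsEichlerOrder (R : Subalgebra (ZInv p) (Quat a b ℚ)) (M : ℕ) : Prop :=
  ∃ O₁ O₂ : Subalgebra (ZInv p) (Quat a b ℚ), IsMaximalOrder O₁ ∧ IsMaximalOrder O₂ ∧
    R = O₁ ⊓ O₂ ∧
    (Subalgebra.toSubmodule R).toAddSubgroup.relIndex
      (Subalgebra.toSubmodule O₁).toAddSubgroup = M

/-- The group `Γ` of elements of reduced norm one in `R`. -/
def normOne (R : Subalgebra (ZInv p) (Quat a b ℚ)) : Subgroup (Quat a b ℚ)ˣ where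
  carrier := {u | (u : Quat a b ℚ) ∈ R ∧ ((u⁻¹ : (Quat a b ℚ)ˣ) : Quat a b ℚ) ∈ R ∧
    nrd (u : Quat a b ℚ) = 1}
  one_mem' := by simp [R.one_mem, nrd_one]
  mul_mem' := by
    rintro x y ⟨hx, hx', hxn⟩ ⟨hy, hy', hyn⟩
    refine ⟨by simpa using R.mul_mem hx hy, by simpa using R.mul_mem hy' hx', ?_⟩
    rw [Units.val_mul, nrd_mul, hxn, hyn, one_mul]
  inv_mem' := by
    rintro x ⟨hx, hx', hxn⟩
    refine ⟨hx', by simpa using hx, ?_⟩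
    have h : nrd ((x : Quat a b ℚ) * ((x⁻¹ : (Quat a b ℚ)ˣ) : Quat a b ℚ)) = 1 := by
      rw [Units.mul_inv, nrd_one]
    rwa [nrd_mul, hxn, one_mul] at h

/-- The image of `Γ` in the linear automorphisms of `V_K`. For a field `K` the kernel of the
action of `Γ` is `{±1}`, so this group is `Γ / {±1}`. -/
abbrev GammaBar (R : Subalgebra (ZInv p) (Quat a b ℚ)) (K : Type*) [CommRing K] [Algebra ℚ K] :
    Subgroup (LinearMap.GeneralLinearGroup K (Vec K)) :=
  (normOne R).map (conjRat K)

end Orders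

/-! ### Adeles away from `p` and `∞` -/

/-- The primes different from `p`. -/
abbrev PrimesAway (p : ℕ) : Type := {l : ℕ // l.Prime ∧ l ≠ p}

instance factPrimeAway {p : ℕ} (l : PrimesAway p) : Fact (l : ℕ).Prime := ⟨l.2.1⟩

/-- The ring of finite adeles of `ℚ` away from `p`. -/
abbrev AdeleAway (p : ℕ) : Type :=
  Πʳ l : PrimesAway p, [ℚ_[(l : ℕ)], PadicInt.subring (l : ℕ)]

/-- The diagonal embedding of `ℚ`. -/
def diagQ (p : ℕ) : ℚ →+* AdeleAway p where
  toFun q := ⟨fun l => (q : ℚ_[(l : ℕ)]), by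
    have hfin : {l : PrimesAway p | (l : ℕ) ∣ q.den}.Finite := by
      refine Set.Finite.of_finite_image (f := fun l : PrimesAway p => (l : ℕ)) ?_
        (fun _ _ _ _ h => Subtype.ext h)
      refine (Set.finite_Iic q.den).subset ?_
      rintro _ ⟨l, hl, rfl⟩
      exact Nat.le_of_dvd q.den_pos hl
    refine Filter.mem_of_superset hfin.compl_mem_cofinite fun l hl => ?_
    exact Padic.norm_rat_le_one hl⟩
  map_one' := by ext l; simp
  map_zero' := by ext l; simp
  map_add' x y := by ext l; exact Rat.cast_add x y
  map_mul' x y := by ext l; exact Rat.cast_mul x y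

instance algebraAdele (p : ℕ) : Algebra ℚ (AdeleAway p) := (diagQ p).toAlgebra

/-- The subring of integral adeles away from `p`. -/
def zHat (p : ℕ) : Subring (AdeleAway p) where
  carrier := {x | ∀ l : PrimesAway p, x l ∈ PadicInt.subring (l : ℕ)}
  one_mem' := fun l => (PadicInt.subring (l : ℕ)).one_mem
  zero_mem' := fun l => (PadicInt.subring (l : ℕ)).zero_mem
  add_mem' := fun hx hy l => (PadicInt.subring (l : ℕ)).add_mem (hx l) (hy l)
  mul_mem' := fun hx hy l => (PadicInt.subring (l : ℕ)).mul_mem (hx l) (hy l)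
  neg_mem' := fun hx l => (PadicInt.subring (l : ℕ)).neg_mem (hx l)

/-- The subring `R̂ = R ⊗ ℤ̂^(p)` of `B ⊗ 𝔸^{p,∞}`, as a module over the integral adeles. -/
def orderHat {a b : ℚ} {p : ℕ} (R : Subalgebra (ZInv p) (Quat a b ℚ)) :
    Submodule (zHat p) (Quat a b (AdeleAway p)) :=
  Submodule.span (zHat p) (baseChange (AdeleAway p) '' (R : Set (Quat a b ℚ)))

/-- The value at a rational vector of a function on `V ⊗ 𝔸^{p,∞}`. -/
def ratVal {p : ℕ} (Φ : Vec (AdeleAway p) → ℤ) (v : Vec ℚ) : ℤ :=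
  Φ fun i => algebraMap ℚ (AdeleAway p) (v i)

/-! ### The `p`-adic upper half plane and the Bruhat--Tits tree -/

section PAdic

variable (a b : ℚ) (p : ℕ) [Fact p.Prime]

/-- The inclusion `V_{ℚ_p} → V_{ℂ_p}`. -/
def toCp (v : Vec ℚ_[p]) : Vec ℂ_[p] := fun i => algebraMap ℚ_[p] ℂ_[p] (v i)

/-- The inclusion `V → V_{ℚ_p}`. -/
def toQp (v : Vec ℚ) : Vec ℚ_[p] := fun i => algebraMap ℚ ℚ_[p] (v i)

/-- The lines in `V_{ℂ_p}`. -/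
abbrev Pt : Type _ := ℙ ℂ_[p] (Vec ℂ_[p])

/-- The `ℂ_p`-points `C_V(ℂ_p) - C_V(ℚ_p)` of the `p`-adic upper half plane: the isotropic
lines in `V_{ℂ_p}` that are not spanned by a vector of `V_{ℚ_p}`. -/
def halfPlane : Set (Pt p) :=
  {z | (∀ x ∈ z.submodule, quadForm a b x = 0) ∧
    ¬ ∃ v : Vec ℚ_[p], v ≠ 0 ∧ toCp p v ∈ z.submodule}

/-- The divisor `Δ(v)`: the sum of the points of the upper half plane that are orthogonal
to `v`. -/
def pointDivisor (v : Vec ℚ) : Pt p →₀ ℤ :=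
  ∑ᶠ z ∈ {z : Pt p | z ∈ halfPlane a b p ∧
      ∀ x ∈ z.submodule, pairing a b x (toCp p (toQp p v)) = 0},
    Finsupp.single z 1

/-- The set of `D` which are the length of some `v ∈ V - {0}` with `Δ(v) ≠ 0`. -/
def discSet : Set ℤ :=
  {D | ∃ v : Vec ℚ, v ≠ 0 ∧ quadForm a b v = (D : ℚ) ∧ pointDivisor a b p v ≠ 0}

variable {p}

/-- Unimodular `ℤ_p`-lattices in `V_{ℚ_p}`, the vertices of the Bruhat--Tits tree (`p` odd). -/
def IsUnimodular (L : Submodule ℤ_[p] (Vec ℚ_[p])) : Prop :=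
  L.FG ∧ Submodule.span ℚ_[p] (L : Set (Vec ℚ_[p])) = ⊤ ∧
    ∀ v, v ∈ L ↔ ∀ w ∈ L, ‖pairing a b v w‖ ≤ 1

/-- Two lattices are `p`-neighbours if their intersection has index `p` in both of them. -/
def IsNeighbour (L L' : Submodule ℤ_[p] (Vec ℚ_[p])) : Prop :=
  (L ⊓ L').toAddSubgroup.relIndex L.toAddSubgroup = p ∧
    (L ⊓ L').toAddSubgroup.relIndex L'.toAddSubgroup = p

/-- A parity on the vertices of the tree: `par L` says that `L` is even, and every edge connects
an even and an odd vertex. -/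
def IsParity (par : Submodule ℤ_[p] (Vec ℚ_[p]) → Prop) : Prop :=
  ∀ L L', IsUnimodular a b L → IsUnimodular a b L' → IsNeighbour L L' → (par L' ↔ ¬ par L)

/-- For a subset `I` of `ℂ_p` the vectors `c • y` with `c ∈ I` and `y ∈ L ⊗ 𝒪_{ℂ_p}`. If `I` is
an ideal of `𝒪_{ℂ_p}` this is `I ⬝ (L ⊗ 𝒪_{ℂ_p})`. -/
def latticeMul (I : Set ℂ_[p]) (L : Submodule ℤ_[p] (Vec ℚ_[p])) : Set (Vec ℂ_[p]) :=
  {x | ∃ c ∈ I, ∃ y ∈ Submodule.span (𝓞_ℂ_[p]) (toCp p '' (L : Set (Vec ℚ_[p]))), x = c • y}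

/-- The line `z` is congruent to the line spanned by `v ∈ L` modulo the ideal `I`, with respect
to the integral structure given by `L`. -/
def CongMod (I : Set ℂ_[p]) (L : Submodule ℤ_[p] (Vec ℚ_[p])) (z : Pt p) (v : Vec ℚ_[p]) : Prop :=
  ∃ x ∈ z.submodule, x - toCp p v ∈ latticeMul I L

variable (p) in
/-- The maximal ideal of the ring of integers of `ℂ_p`. -/
def maxIdeal : Set ℂ_[p] := {c | ‖c‖ < 1}

variable (p) in
/-- The ideal of the ring of integers of `ℂ_p` generated by `p`. -/
def pIdeal : Set ℂ_[p] := {c | ‖c‖ ≤ ‖(p : ℂ_[p])‖}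

/-- A vector of `L` that is not in `p L`. -/
def IsPrimitiveIn (L : Submodule ℤ_[p] (Vec ℚ_[p])) (v : Vec ℚ_[p]) : Prop :=
  v ∈ L ∧ ¬ ∃ w ∈ L, v = (p : ℤ_[p]) • w

/-- The affinoid `𝒜_L`, the preimage of the vertex `L` under the reduction map: the complement
in the upper half plane of the residue discs of the `𝔽_p`-rational points of the reduction
of `C_V` with respect to `L`. -/
def affinoid (L : Submodule ℤ_[p] (Vec ℚ_[p])) : Set (Pt p) :=
  {z | z ∈ halfPlane a b p ∧
    ¬ ∃ v, IsPrimitiveIn L v ∧ ‖quadForm a b v‖ < 1 ∧ CongMod (maxIdeal p) L z v}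

/-- The preimage under the reduction map of the (open) edge joining the neighbours `L` and `L'`:
the points congruent to the isotropic line `ℓ` in the image of `L ∩ L'` in `L / p L` modulo the
maximal ideal, but not modulo `p`. -/
def edgeAnnulus (L L' : Submodule ℤ_[p] (Vec ℚ_[p])) : Set (Pt p) :=
  {z | z ∈ halfPlane a b p ∧
    ∃ v, IsPrimitiveIn L v ∧ v ∈ L' ∧ ‖quadForm a b v‖ < 1 ∧
      CongMod (maxIdeal p) L z v ∧ ¬ CongMod (pIdeal p) L z v}

/-- The wide open `𝒲_L`, the preimage under the reduction map of the vertex `L` together with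
all the open edges that have `L` as an endpoint. -/
def wideOpen (L : Submodule ℤ_[p] (Vec ℚ_[p])) : Set (Pt p) :=
  {z | z ∈ affinoid a b L ∨
    ∃ L', IsUnimodular a b L' ∧ IsNeighbour L L' ∧ z ∈ edgeAnnulus a b L L'}

/-! ### Divisors -/

open Classical in
/-- The degree of `𝒟 ∩ U`. -/
def degOn (U : Set (Pt p)) (𝒟 : Pt p →₀ ℤ) : ℤ := 𝒟.sum fun z m => if z ∈ U then m else 0

/-- Finite divisors on the upper half plane of strong degree `0` in an even sense, with respect
to the parity `par`. -/
def IsStrongZeroEven (par : Submodule ℤ_[p] (Vec ℚ_[p]) → Prop) (𝒟 : Pt p →₀ ℤ) : Prop :=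
  (∀ z ∈ 𝒟.support, z ∈ halfPlane a b p) ∧
    ∀ L, IsUnimodular a b L →
      (par L → degOn (wideOpen a b L) 𝒟 = 0) ∧ (¬ par L → degOn (affinoid a b L) 𝒟 = 0)

/-- Strong degree `0` in an odd sense: the roles of even and odd vertices are exchanged. -/
def IsStrongZeroOdd (par : Submodule ℤ_[p] (Vec ℚ_[p]) → Prop) (𝒟 : Pt p →₀ ℤ) : Prop :=
  (∀ z ∈ 𝒟.support, z ∈ halfPlane a b p) ∧
    ∀ L, IsUnimodular a b L →
      (¬ par L → degOn (wideOpen a b L) 𝒟 = 0) ∧ (par L → degOn (affinoid a b L) 𝒟 = 0)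

variable {a b}

/-- The space of `Γ`-orbits of points. -/
abbrev QuotPt (R : Subalgebra (ZInv p) (Quat a b ℚ)) : Type _ :=
  MulAction.orbitRel.Quotient (GammaBar R ℂ_[p]) (Pt p)

/-- The pushforward `π_*` of divisors to the quotient by `Γ`, with rational coefficients. -/
def pushforward (R : Subalgebra (ZInv p) (Quat a b ℚ)) (𝒟 : Pt p →₀ ℤ) : QuotPt R →₀ ℚ :=
  Finsupp.mapDomain (fun z => (Quotient.mk _ z : QuotPt R))
    (𝒟.mapRange (fun m : ℤ => (m : ℚ)) (by simp))

open Classical in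
/-- The divisor `Δ_Φ(D)` on the quotient: the sum over representatives `v` of `Γ \ V` with
`Q(v) = D` of `Φ(v) / #Stab(v)` times the image of `Δ(v)`. -/
def heegnerDivisor (R : Subalgebra (ZInv p) (Quat a b ℚ)) (Φ : Vec (AdeleAway p) → ℤ) (D : ℤ) :
    QuotPt R →₀ ℚ :=
  ∑ᶠ o : MulAction.orbitRel.Quotient (GammaBar R ℚ) (Vec ℚ),
    if quadForm a b o.out = (D : ℚ) then
      ((Nat.card (MulAction.stabilizer (GammaBar R ℚ) o.out) : ℚ)⁻¹ * (ratVal Φ o.out : ℚ)) •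
        pushforward R (pointDivisor a b p o.out)
    else 0

/-- The conditions on the Schwartz--Bruhat function `Φ`: it is locally constant with compact
support, invariant under `R̂ˣ` and under multiplication by `p`, vanishes at `0`, and all its
divisors `Δ_Φ(D)` are of strong degree `0`. (No invariance under a congruence subgroup of the
metaplectic group is imposed, which only makes the class of functions larger.) -/
structure IsConvenient (R : Subalgebra (ZInv p) (Quat a b ℚ))
    (par : Submodule ℤ_[p] (Vec ℚ_[p]) → Prop) (Φ : Vec (AdeleAway p) → ℤ) : Prop where
  locallyConstant : IsLocallyConstant Φ
  compactSupport : HasCompactSupport Φ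
  unitInvariant : ∀ u : (Quat a b (AdeleAway p))ˣ,
    (u : Quat a b (AdeleAway p)) ∈ orderHat R →
    ((u⁻¹ : (Quat a b (AdeleAway p))ˣ) : Quat a b (AdeleAway p)) ∈ orderHat R →
    ∀ v, Φ (conj u • v) = Φ v
  mulInvariant : ∀ v : Vec ℚ, ratVal Φ ((p : ℚ) • v) = ratVal Φ v
  map_zero : Φ 0 = 0
  strongZero : ∀ D ∈ discSet a b p,
    (∃ 𝒟 : Pt p →₀ ℤ, IsStrongZeroEven a b par 𝒟 ∧ pushforward R 𝒟 = heegnerDivisor R Φ D) ∧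
    (∃ 𝒟 : Pt p →₀ ℤ, IsStrongZeroOdd a b par 𝒟 ∧ pushforward R 𝒟 = heegnerDivisor R Φ D)

/-! ### Weil symbols and theta values -/

/-- The `2 × 2` matrix over `ℂ_p` of a trace zero quaternion, for a given splitting
`ι : B_{ℚ_p} ≃ M₂(ℚ_p)`. -/
def matrixOf (ι : Quat a b ℚ_[p] ≃ₐ[ℚ_[p]] Matrix (Fin 2) (Fin 2) ℚ_[p]) (x : Vec ℂ_[p]) :
    Matrix (Fin 2) (Fin 2) ℂ_[p] :=
  ∑ i : Fin 3, x i • (ι (toQuat a b (Pi.single i 1))).map (algebraMap ℚ_[p] ℂ_[p])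

open Classical in
/-- The identification of the conic with the projective line, by sending a line of nilpotent
matrices to its kernel: homogeneous coordinates of the point corresponding to `z`. -/
def kerCoord (ι : Quat a b ℚ_[p] ≃ₐ[ℚ_[p]] Matrix (Fin 2) (Fin 2) ℚ_[p]) (z : Pt p) :
    Fin 2 → ℂ_[p] :=
  if h : ∃ u : Fin 2 → ℂ_[p], u ≠ 0 ∧ ∀ x ∈ z.submodule, (matrixOf ι x).mulVec u = 0 then
    h.choose else 0

/-- The rational function with divisor `𝒟` (of degree `0`) on the projective line, in
homogeneous coordinates: the product of the `(z₀ x₁ - z₁ x₀) ^ m_x`. -/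
def ratFun (ι : Quat a b ℚ_[p] ≃ₐ[ℚ_[p]] Matrix (Fin 2) (Fin 2) ℚ_[p]) (𝒟 : Pt p →₀ ℤ)
    (z : Pt p) : ℂ_[p] :=
  𝒟.prod fun x m =>
    (kerCoord ι z 0 * kerCoord ι x 1 - kerCoord ι z 1 * kerCoord ι x 0) ^ m

/-- The Weil symbol `[𝒟₀; 𝒟₁] = f_{𝒟₀}(𝒟₁)` of two degree zero divisors with disjoint supports. -/
def weilSymbol (ι : Quat a b ℚ_[p] ≃ₐ[ℚ_[p]] Matrix (Fin 2) (Fin 2) ℚ_[p])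
    (𝒟₀ 𝒟₁ : Pt p →₀ ℤ) : ℂ_[p] :=
  𝒟₁.prod fun y n => ratFun ι 𝒟₀ y ^ n

/-- The factor `[(γ η) - (η); α 𝒟]`, for `α ∈ Γ / {±1}`, of the infinite product
defining `j_𝒟(γ)`. -/
def thetaFactor (R : Subalgebra (ZInv p) (Quat a b ℚ))
    (ι : Quat a b ℚ_[p] ≃ₐ[ℚ_[p]] Matrix (Fin 2) (Fin 2) ℚ_[p])
    (𝒟 : Pt p →₀ ℤ) (η : Pt p) (γ : (Quat a b ℚ)ˣ) (α : GammaBar R ℂ_[p]) : ℂ_[p] :=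
  weilSymbol ι (Finsupp.single (conjRat ℂ_[p] γ • η) 1 - Finsupp.single η 1)
    (Finsupp.mapDomain (fun z => α • z) 𝒟)

/-- `j_𝒟(γ) = [(γ η) - (η); 𝒟]_Γ`. -/
def thetaValue (R : Subalgebra (ZInv p) (Quat a b ℚ))
    (ι : Quat a b ℚ_[p] ≃ₐ[ℚ_[p]] Matrix (Fin 2) (Fin 2) ℚ_[p])
    (𝒟 : Pt p →₀ ℤ) (η : Pt p) (γ : (Quat a b ℚ)ˣ) : ℂ_[p] :=
  ∏' α : GammaBar R ℂ_[p], thetaFactor R ι 𝒟 η γ α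

/-- Admissible base points: `η` is in the upper half plane and not in the `Γ`-orbit of the
support of `𝒟`. -/
def IsBasePoint (R : Subalgebra (ZInv p) (Quat a b ℚ)) (𝒟 : Pt p →₀ ℤ) (η : Pt p) : Prop :=
  η ∈ halfPlane a b p ∧ ∀ α : GammaBar R ℂ_[p], ∀ z ∈ 𝒟.support, α • z ≠ η

/-! ### The lattices attached to a hyperbolic element -/

/-- `L[μ]`: the intersection of `L` with the `μ`-eigenspace of `γ` on `V_{ℚ_p}`. -/
def eigenPart (γ : (Quat a b ℚ)ˣ) (μ : ℚ_[p]) (L : Submodule ℤ_[p] (Vec ℚ_[p])) :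
    Submodule ℤ_[p] (Vec ℚ_[p]) :=
  L ⊓ (Module.End.eigenspace (conjRat ℚ_[p] γ).val μ).restrictScalars ℤ_[p]

/-- The data attached to an element `γ` hyperbolic at `p`: its eigenvalues on `V_{ℚ_p}` are
`ϖ, 1, ϖ⁻¹` with `ord_p(ϖ) = - 2 t < 0`, so that the `ϖ`-eigenline is the attractive fixed point
of `γ` and the `ϖ⁻¹`-eigenline the repulsive one; `L₀` is an even unimodular lattice of depth `0`,
and `wp`, `e`, `wm` are generators of `L₀[ϖ]`, `L₀[1]` and `L₀[ϖ⁻¹]`. -/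
structure IsHyperbolicFrame (par : Submodule ℤ_[p] (Vec ℚ_[p]) → Prop) (γ : (Quat a b ℚ)ˣ)
    (ϖ : ℚ_[p]) (t : ℕ) (L₀ : Submodule ℤ_[p] (Vec ℚ_[p])) (wp e wm : Vec ℚ_[p]) : Prop where
  hasEigenvalue : Module.End.HasEigenvalue (conjRat ℚ_[p] γ).val ϖ
  t_pos : 0 < t
  norm_eq : ‖ϖ‖ = (p : ℝ) ^ (2 * t)
  unimodular : IsUnimodular a b L₀
  even : par L₀
  depth_zero : L₀ = eigenPart γ ϖ L₀ ⊔ eigenPart γ 1 L₀ ⊔ eigenPart γ ϖ⁻¹ L₀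
  span_wp : eigenPart γ ϖ L₀ = Submodule.span ℤ_[p] {wp}
  span_e : eigenPart γ 1 L₀ = Submodule.span ℤ_[p] {e}
  span_wm : eigenPart γ ϖ⁻¹ L₀ = Submodule.span ℤ_[p] {wm}

/-- `L_j = p ^ j L₀[ϖ] ⊕ L₀[1] ⊕ p ^ (-j) L₀[ϖ⁻¹]`. -/
def latticeJ (wp e wm : Vec ℚ_[p]) (j : ℕ) : Submodule ℤ_[p] (Vec ℚ_[p]) :=
  Submodule.span ℤ_[p] {(p : ℚ_[p]) ^ j • wp, e, ((p : ℚ_[p]) ^ j)⁻¹ • wm}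

variable (a b)

/-- `L_j⁺[n]`: the vectors `v ∈ L_j ∩ V` with `Q(v) = D p ^ (2 n)` such that `⟨v, p ^ j wp⟩` is a
`p`-adic unit. -/
def lPlus (wp e wm : Vec ℚ_[p]) (D : ℤ) (j n : ℕ) : Set (Vec ℚ) :=
  {v | toQp p v ∈ latticeJ wp e wm j ∧ quadForm a b v = (D : ℚ) * (p : ℚ) ^ (2 * n) ∧
    ‖pairing a b (toQp p v) ((p : ℚ_[p]) ^ j • wp)‖ = 1}

/-- `L_j⁻[n]`: the vectors `v ∈ L_j ∩ V` with `Q(v) = D p ^ (2 n)` such that `⟨v, p ^ (-j) wm⟩`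
is a `p`-adic unit. -/
def lMinus (wp e wm : Vec ℚ_[p]) (D : ℤ) (j n : ℕ) : Set (Vec ℚ) :=
  {v | toQp p v ∈ latticeJ wp e wm j ∧ quadForm a b v = (D : ℚ) * (p : ℚ) ^ (2 * n) ∧
    ‖pairing a b (toQp p v) (((p : ℚ_[p]) ^ j)⁻¹ • wm)‖ = 1}

/-- The product of `⟨w, v⟩ ^ Φ(v)` over `v ∈ A`. (In the cases of interest `A` contains only
finitely many `v` with `Φ(v) ≠ 0`.) -/
def weightedProd (Φ : Vec (AdeleAway p) → ℤ) (w : Vec ℚ_[p]) (A : Set (Vec ℚ)) : ℚ_[p] :=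
  ∏ᶠ v ∈ A, pairing a b w (toQp p v) ^ ratVal Φ v

end PAdic

end HeegnerTheta

end

open HeegnerTheta

noncomputable section

namespace HeegnerTheta

set_option linter.unusedSectionVars false
set_option linter.unusedVariables false
/-! ### Infinite products in ultrametric fields -/

section Ultrametric

variable {F : Type*} [NormedField F] [IsUltrametricDist F]

theorem norm_sub_le_max' (x y : F) : ‖x - y‖ ≤ max ‖x‖ ‖y‖ := by
  have := IsUltrametricDist.norm_add_le_max x (-y)
  rwa [norm_neg, ← sub_eq_add_neg] at this

theorem norm_sub_le_of_le {x y z : F} {c : ℝ} (h₁ : ‖x - y‖ ≤ c) (h₂ : ‖y - z‖ ≤ c) :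
    ‖x - z‖ ≤ c := by
  have := IsUltrametricDist.norm_add_le_max (x - y) (y - z)
  rw [sub_add_sub_cancel] at this
  exact this.trans (max_le h₁ h₂)

theorem norm_sub_lt_of_lt {x y z : F} {c : ℝ} (h₁ : ‖x - y‖ < c) (h₂ : ‖y - z‖ < c) :
    ‖x - z‖ < c := by
  have := IsUltrametricDist.norm_add_le_max (x - y) (y - z)
  rw [sub_add_sub_cancel] at this
  exact this.trans_lt (max_lt h₁ h₂)

theorem norm_eq_of_norm_sub_lt {x y : F} (h : ‖x - y‖ < ‖x‖) : ‖y‖ = ‖x‖ := by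
  have h1 : ‖y‖ ≤ ‖x‖ := by
    have := norm_sub_le_max' x (x - y)
    rw [sub_sub_cancel] at this
    exact this.trans (max_le le_rfl h.le)
  refine le_antisymm h1 ?_
  have := IsUltrametricDist.norm_add_le_max (x - y) y
  rw [sub_add_cancel] at this
  rcases le_max_iff.1 this with h2 | h2
  · exact absurd h2 (not_le.2 h)
  · exact h2

theorem norm_eq_one_of_near {x : F} {ε : ℝ} (hε : ε < 1) (h : ‖x - 1‖ ≤ ε) : ‖x‖ = 1 := by
  have : ‖(1 : F) - x‖ < ‖(1 : F)‖ := by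
    rw [norm_sub_rev, norm_one]; exact h.trans_lt hε
  rw [norm_eq_of_norm_sub_lt this, norm_one]

theorem mul_near_one {x y : F} {ε : ℝ} (hε : ε < 1) (hx : ‖x - 1‖ ≤ ε) (hy : ‖y - 1‖ ≤ ε) :
    ‖x * y - 1‖ ≤ ε := by
  refine norm_sub_le_of_le (y := y) ?_ hy
  have : x * y - y = (x - 1) * y := by ring
  rw [this, norm_mul, norm_eq_one_of_near hε hy, mul_one]
  exact hx

theorem inv_near_one {x : F} {ε : ℝ} (hε : ε < 1) (hx : ‖x - 1‖ ≤ ε) : ‖x⁻¹ - 1‖ ≤ ε := by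
  have h1 := norm_eq_one_of_near hε hx
  have h0 : x ≠ 0 := by rintro rfl; simp at h1
  have : x⁻¹ - 1 = x⁻¹ * (1 - x) := by field_simp
  rw [this, norm_mul, norm_inv, h1, norm_sub_rev]
  simpa using hx

theorem pow_near_one {x : F} {ε : ℝ} (hε : ε < 1) (h0 : 0 ≤ ε) (hx : ‖x - 1‖ ≤ ε) (n : ℕ) :
    ‖x ^ n - 1‖ ≤ ε := by
  induction n with
  | zero => simpa using h0
  | succ k ih => rw [pow_succ]; exact mul_near_one hε ih hx

theorem zpow_near_one {x : F} {ε : ℝ} (hε : ε < 1) (h0 : 0 ≤ ε) (hx : ‖x - 1‖ ≤ ε) (n : ℤ) :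
    ‖x ^ n - 1‖ ≤ ε := by
  cases n with
  | ofNat n => simpa using pow_near_one hε h0 hx n
  | negSucc n => rw [zpow_negSucc]; exact inv_near_one hε (pow_near_one hε h0 hx _)

theorem prod_near_one {ι : Type*} (s : Finset ι) (f : ι → F) {ε : ℝ} (hε : ε < 1) (h0 : 0 ≤ ε)
    (hf : ∀ i ∈ s, ‖f i - 1‖ ≤ ε) : ‖∏ i ∈ s, f i - 1‖ ≤ ε := by
  classical
  induction s using Finset.induction_on with
  | empty => simpa using h0
  | insert a s ha ih =>
    rw [Finset.prod_insert ha]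
    exact mul_near_one hε (hf a (Finset.mem_insert_self a s))
      (ih fun i hi => hf i (Finset.mem_insert_of_mem hi))

theorem multipliable_of_tendsto_cofinite [CompleteSpace F] {ι : Type*} {f : ι → F}
    (hf : ∀ ε : ℝ, 0 < ε → {i | ¬ ‖f i - 1‖ ≤ ε}.Finite) : Multipliable f := by
  classical
  have key : ∀ ε : ℝ, 0 < ε → ∃ s : Finset ι, ∀ t : Finset ι, s ⊆ t →
      ‖∏ i ∈ t \ s, f i - 1‖ ≤ min ε (1 / 2) := by
    intro ε hε
    have h2 : (0 : ℝ) < min ε (1 / 2) := by positivity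
    refine ⟨(hf _ h2).toFinset, fun t _ => prod_near_one _ _ ?_ h2.le ?_⟩
    · exact (min_le_right _ _).trans_lt (by norm_num)
    · intro i hi
      by_contra h
      exact (Finset.mem_sdiff.1 hi).2 ((hf _ h2).mem_toFinset.2 h)
  obtain ⟨s₀, hs₀⟩ := key 1 one_pos
  have hC : ∀ t, s₀ ⊆ t → ‖∏ i ∈ t, f i‖ = ‖∏ i ∈ s₀, f i‖ := by
    intro t ht
    rw [← Finset.prod_sdiff ht, norm_mul,
      norm_eq_one_of_near (ε := 1 / 2) (by norm_num) ((hs₀ t ht).trans (min_le_right _ _)), one_mul]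
  have hcau : CauchySeq fun s : Finset ι => ∏ i ∈ s, f i := by
    rw [Metric.cauchySeq_iff']
    intro ε hε
    set C := ‖∏ i ∈ s₀, f i‖ with hCdef
    have hC0 : 0 ≤ C := norm_nonneg _
    obtain ⟨s₁, hs₁⟩ := key (ε / (C + 1)) (by positivity)
    refine ⟨s₀ ∪ s₁, fun t ht => ?_⟩
    have ht1 : s₁ ⊆ t := (Finset.union_subset_iff.1 ht).2
    have ha := hs₁ t ht1
    have hb := hs₁ (s₀ ∪ s₁) Finset.subset_union_right
    have hlt : ∀ x : F, min (ε / (C + 1)) (1 / 2) < 1 :=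
      fun _ => (min_le_right _ _).trans_lt (by norm_num)
    have hnb := inv_near_one (hlt 0) hb
    have hq := mul_near_one (hlt 0) ha hnb
    have e1 : ∏ i ∈ t, f i - ∏ i ∈ s₀ ∪ s₁, f i =
        (∏ i ∈ s₀ ∪ s₁, f i) *
          ((∏ i ∈ t \ s₁, f i) * (∏ i ∈ (s₀ ∪ s₁) \ s₁, f i)⁻¹ - 1) := by
      have h0 : ∏ i ∈ (s₀ ∪ s₁) \ s₁, f i ≠ 0 := by
        intro h
        have := norm_eq_one_of_near (hlt 0) hb
        rw [h, norm_zero] at this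
        exact zero_ne_one this
      rw [← Finset.prod_sdiff ht1,
        ← Finset.prod_sdiff (Finset.subset_union_right : s₁ ⊆ s₀ ∪ s₁)]
      field_simp
    simp only [dist_eq_norm]
    rw [e1, norm_mul, hC _ Finset.subset_union_left]
    calc C * _ ≤ C * (ε / (C + 1)) := by
          gcongr; exact hq.trans (min_le_left _ _)
      _ < ε := by
          rw [mul_div_assoc', div_lt_iff₀ (by positivity)]
          nlinarith
  exact cauchySeq_tendsto_of_complete hcau

end Ultrametric

/-! ### The distance to `ℚ_p` -/

section Distance

variable {p : ℕ} [Fact p.Prime] {F : Type*} [NormedField F] [NormedAlgebra ℚ_[p] F]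

local notation "ι" => algebraMap ℚ_[p] F

theorem exists_nearest (ζ : F) : ∃ b : ℚ_[p], ∀ c : ℚ_[p], ‖ζ - ι b‖ ≤ ‖ζ - ι c‖ := by
  have hc : Continuous fun c : ℚ_[p] => ‖ζ - ι c‖ :=
    (continuous_const.sub (algebraMapCLM ℚ_[p] F).continuous).norm
  refine hc.exists_forall_le ?_
  have h1 : Tendsto (fun c : ℚ_[p] => ‖c‖ - ‖ζ‖) (cocompact ℚ_[p]) atTop :=
    tendsto_atTop_add_const_right _ _ tendsto_norm_cocompact_atTop
  refine tendsto_atTop_mono (fun c => ?_) h1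
  have := norm_sub_norm_le (ι c) ζ
  rwa [norm_algebraMap', norm_sub_rev] at this

variable (p) in
/-- An element of `ℚ_p` nearest to `ζ`. -/
def nearest (ζ : F) : ℚ_[p] := (exists_nearest (p := p) ζ).choose

variable (p) in
/-- The distance from `ζ` to `ℚ_p`. -/
def rho (ζ : F) : ℝ := ‖ζ - ι (nearest p ζ)‖

theorem rho_le (ζ : F) (c : ℚ_[p]) : rho p ζ ≤ ‖ζ - ι c‖ :=
  (exists_nearest (p := p) ζ).choose_spec c

theorem rho_le_norm (ζ : F) : rho p ζ ≤ ‖ζ‖ := by simpa using rho_le (p := p) ζ 0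

theorem rho_nonneg (ζ : F) : 0 ≤ rho p ζ := norm_nonneg _

variable (p) in
/-- The element `ζ` is not in `ℚ_p`. -/
def Irrat (ζ : F) : Prop := ∀ b : ℚ_[p], ι b ≠ ζ

theorem rho_pos {ζ : F} (h : Irrat p ζ) : 0 < rho p ζ := by
  rw [rho, norm_pos_iff, sub_ne_zero]
  exact (h _).symm

theorem Irrat.ne_zero {ζ : F} (h : Irrat p ζ) : ζ ≠ 0 := by
  rintro rfl; exact h 0 (map_zero _)

theorem irrat_of_rho_pos {ζ : F} (h : 0 < rho p ζ) : Irrat p ζ := by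
  rintro b rfl
  have := rho_le (p := p) (ι b) b
  simp at this
  linarith

theorem le_rho {ζ : F} {c : ℝ} (h : ∀ b : ℚ_[p], c ≤ ‖ζ - ι b‖) : c ≤ rho p ζ := h _

theorem rho_eq_of {ζ : F} {c : ℝ} (h : ∀ b : ℚ_[p], c ≤ ‖ζ - ι b‖) (b₀ : ℚ_[p])
    (h₀ : ‖ζ - ι b₀‖ = c) : rho p ζ = c :=
  le_antisymm (h₀ ▸ rho_le ζ b₀) (le_rho h)

theorem rho_add (ζ : F) (c : ℚ_[p]) : rho p (ζ + ι c) = rho p ζ := by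
  refine rho_eq_of (fun b => ?_) (nearest p ζ + c) ?_
  · have := rho_le ζ (b - c)
    rwa [map_sub, sub_sub_eq_add_sub] at this
  · rw [map_add, add_sub_add_right_eq_sub]; rfl

theorem rho_mul (ζ : F) {c : ℚ_[p]} (hc : c ≠ 0) : rho p (ι c * ζ) = ‖c‖ * rho p ζ := by
  refine rho_eq_of (fun b => ?_) (c * nearest p ζ) ?_
  · have h := rho_le ζ (c⁻¹ * b)
    have e : ι c * ζ - ι b = ι c * (ζ - ι (c⁻¹ * b)) := by
      rw [mul_sub, ← map_mul, mul_inv_cancel_left₀ hc]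
    rw [e, norm_mul, norm_algebraMap']
    gcongr
  · rw [map_mul, ← mul_sub, norm_mul, norm_algebraMap']; rfl

variable [IsUltrametricDist F]

theorem one_lt_p : (1 : ℝ) < p := by exact_mod_cast (Fact.out : p.Prime).one_lt

theorem p_pos : (0 : ℝ) < p := zero_lt_one.trans one_lt_p

theorem norm_zpow_of_ne {b : ℚ_[p]} (hb : b ≠ 0) : ∃ n : ℤ, ‖b‖ = (p : ℝ) ^ n :=
  ⟨_, Padic.norm_eq_zpow_neg_valuation hb⟩

/-- If `ζ` is closer to `ℚ_p` than to `0`, then its norm is that of an element of `ℚ_p`. -/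
theorem norm_zpow_of_rho_lt {ζ : F} (h : rho p ζ < ‖ζ‖) : ∃ n : ℤ, ‖ζ‖ = (p : ℝ) ^ n := by
  have h1 : ‖ι (nearest p ζ)‖ = ‖ζ‖ := norm_eq_of_norm_sub_lt h
  rw [norm_algebraMap'] at h1
  have h0 : nearest p ζ ≠ 0 := by
    intro h0
    rw [h0, norm_zero] at h1
    rw [← h1] at h
    exact absurd (rho_nonneg (p := p) ζ) (not_le.2 h)
  rw [← h1]
  exact norm_zpow_of_ne h0

theorem rho_inv {ζ : F} (hζ : Irrat p ζ) : rho p ζ⁻¹ = rho p ζ / ‖ζ‖ ^ 2 := by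
  have hζ0 := hζ.ne_zero
  have hn : 0 < ‖ζ‖ := norm_pos_iff.2 hζ0
  have hle := rho_le_norm (p := p) ζ
  have hbase : rho p ζ / ‖ζ‖ ^ 2 ≤ ‖ζ‖⁻¹ := by
    rw [div_le_iff₀ (by positivity), pow_two, inv_mul_cancel_left₀ hn.ne']
    exact hle
  have hlow : ∀ b : ℚ_[p], rho p ζ / ‖ζ‖ ^ 2 ≤ ‖ζ⁻¹ - ι b‖ := by
    intro b
    by_cases hb : ‖ζ⁻¹ - ι b‖ < ‖ζ⁻¹‖
    · have hb1 := norm_eq_of_norm_sub_lt hb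
      have hb0 : b ≠ 0 := by
        rintro rfl
        simp only [map_zero, norm_zero, norm_inv] at hb1
        exact (inv_pos.2 hn).ne hb1
      have hιb : ι b ≠ 0 := by simpa using hb0
      have e : ζ⁻¹ - ι b = -((ζ - ι b⁻¹) * (ζ⁻¹ * ι b)) := by
        rw [map_inv₀]; field_simp; ring
      rw [e, norm_neg, norm_mul, norm_mul, hb1, norm_inv, div_eq_mul_inv, pow_two, mul_inv]
      gcongr
      exact rho_le ζ _
    · rw [norm_inv] at hb
      exact hbase.trans (not_lt.1 hb)
  by_cases h : rho p ζ < ‖ζ‖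
  · have h1 : ‖ι (nearest p ζ)‖ = ‖ζ‖ := norm_eq_of_norm_sub_lt h
    have h0 : ι (nearest p ζ) ≠ 0 := norm_pos_iff.1 (h1 ▸ hn)
    refine rho_eq_of hlow (nearest p ζ)⁻¹ ?_
    have e : ζ⁻¹ - ι (nearest p ζ)⁻¹ = -((ζ - ι (nearest p ζ)) * (ζ⁻¹ * (ι (nearest p ζ))⁻¹)) := by
      rw [map_inv₀]; field_simp; ring
    rw [e, norm_neg, norm_mul, norm_mul, norm_inv, norm_inv, h1, div_eq_mul_inv, pow_two, mul_inv]
    rfl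
  · have h' : rho p ζ = ‖ζ‖ := le_antisymm hle (not_lt.1 h)
    refine rho_eq_of hlow 0 ?_
    rw [h', map_zero, sub_zero, norm_inv]
    field_simp

end Distance

/-! ### The partition of the upper half plane into affinoids and wide opens -/

section Labels

variable {p : ℕ} [Fact p.Prime] {F : Type*} [NormedField F] [NormedAlgebra ℚ_[p] F]

local notation "ι" => algebraMap ℚ_[p] F

theorem p_zpow_lt {m n : ℤ} : (p : ℝ) ^ m < (p : ℝ) ^ n ↔ m < n := zpow_lt_zpow_iff_right₀ one_lt_p

theorem p_zpow_le {m n : ℤ} : (p : ℝ) ^ m ≤ (p : ℝ) ^ n ↔ m ≤ n := zpow_le_zpow_iff_right₀ one_lt_p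

theorem p_zpow_pos (m : ℤ) : (0 : ℝ) < (p : ℝ) ^ m := zpow_pos p_pos m

theorem p_zpow_inj {m n : ℤ} (h : (p : ℝ) ^ m = (p : ℝ) ^ n) : m = n :=
  zpow_right_injective₀ p_pos one_lt_p.ne' h

variable (p) in
/-- The point at distance `d` from `ℚ_p` belongs to a wide open of level `r`, if `r` has the
parity of `s`, or to an affinoid of level `r`, otherwise. -/
def IsLev (s : ℤ) (d : ℝ) (r : ℤ) : Prop :=
  (Even (r + s) ∧ (p : ℝ) ^ (-r - 1) < d ∧ d < (p : ℝ) ^ (1 - r)) ∨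
    (¬ Even (r + s) ∧ d = (p : ℝ) ^ (-r))

theorem exists_isLev (s : ℤ) {d : ℝ} (hd : 0 < d) : ∃ r, IsLev p s d r := by
  obtain ⟨n, hn1, hn2⟩ := exists_mem_Ico_zpow (y := (p : ℝ)) hd (one_lt_p (p := p))
  rcases hn1.eq_or_lt with h | h
  · by_cases he : Even (-n + s)
    · refine ⟨-n, Or.inl ⟨he, ?_, ?_⟩⟩
      · rw [← h, p_zpow_lt]; omega
      · rw [← h, p_zpow_lt]; omega
    · exact ⟨-n, Or.inr ⟨he, by rw [neg_neg, h]⟩⟩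
  · by_cases he : Even (-n + s)
    · refine ⟨-n, Or.inl ⟨he, lt_of_le_of_lt ?_ h, hn2.trans_le ?_⟩⟩ <;>
        rw [p_zpow_le] <;> omega
    · refine ⟨-n - 1, Or.inl ⟨?_, lt_of_le_of_lt ?_ h, hn2.trans_le ?_⟩⟩
      · rw [Int.even_add, Int.even_sub] at *
        grind
      · rw [p_zpow_le]; omega
      · rw [p_zpow_le]; omega

theorem IsLev.bounds {s : ℤ} {d : ℝ} {r : ℤ} (h : IsLev p s d r) :
    (p : ℝ) ^ (-r - 1) < d ∧ d < (p : ℝ) ^ (1 - r) := by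
  rcases h with ⟨-, h⟩ | ⟨-, h⟩
  · exact h
  · rw [h, p_zpow_lt, p_zpow_lt]; omega

theorem IsLev.unique {s : ℤ} {d : ℝ} {r r' : ℤ} (h : IsLev p s d r) (h' : IsLev p s d r') :
    r = r' := by
  have hb := h.bounds
  have hb' := h'.bounds
  have h1 := (p_zpow_lt (p := p)).1 (hb.1.trans hb'.2)
  have h2 := (p_zpow_lt (p := p)).1 (hb'.1.trans hb.2)
  rcases h with ⟨he, -⟩ | ⟨he, hd⟩ <;> rcases h' with ⟨he', -⟩ | ⟨he', hd'⟩
  · rw [Int.even_add] at he he'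
    have : Even r ↔ Even r' := by tauto
    have h3 : Even (r - r') := Int.even_sub.2 this
    obtain ⟨k, hk⟩ := h3
    omega
  · rw [hd', p_zpow_lt, p_zpow_lt] at hb; omega
  · rw [hd, p_zpow_lt, p_zpow_lt] at hb'; omega
  · exact neg_injective (p_zpow_inj (p := p) (hd.symm.trans hd'))

open Classical in
variable (p) in
/-- The level of the part of the partition containing `ζ`. -/
def lev (s : ℤ) (ζ : F) : ℤ := if h : ∃ r, IsLev p s (rho p ζ) r then h.choose else 0

theorem isLev_lev (s : ℤ) {ζ : F} (h : Irrat p ζ) : IsLev p s (rho p ζ) (lev p s ζ) := by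
  have := exists_isLev (p := p) s (rho_pos h)
  rw [lev, dif_pos this]
  exact this.choose_spec

theorem lev_eq {s : ℤ} {ζ : F} {r : ℤ} (h : IsLev p s (rho p ζ) r) : lev p s ζ = r := by
  have : ∃ r, IsLev p s (rho p ζ) r := ⟨r, h⟩
  rw [lev, dif_pos this]
  exact this.choose_spec.unique h

variable (p) in
/-- The part of the partition containing `ζ`: its level and the corresponding ball in `ℚ_p`. -/
def lab (s : ℤ) (ζ : F) : ℤ × Set ℚ_[p] :=
  (lev p s ζ, {b | ‖ζ - ι b‖ < (p : ℝ) ^ (1 - lev p s ζ)})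

theorem nearest_mem (s : ℤ) {ζ : F} (h : Irrat p ζ) :
    ‖ζ - ι (nearest p ζ)‖ < (p : ℝ) ^ (1 - lev p s ζ) := (isLev_lev s h).bounds.2

variable [IsUltrametricDist F]

theorem lab_eq_iff {s : ℤ} {ζ ζ' : F} (h : Irrat p ζ) (h' : Irrat p ζ') :
    lab p s ζ = lab p s ζ' ↔ lev p s ζ = lev p s ζ' ∧ ‖ζ - ζ'‖ < (p : ℝ) ^ (1 - lev p s ζ) := by
  constructor
  · intro hl
    have h1 : lev p s ζ = lev p s ζ' := congrArg Prod.fst hl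
    refine ⟨h1, ?_⟩
    have h2 : nearest p ζ ∈ (lab p s ζ').2 := by
      rw [← hl]; exact nearest_mem s h
    refine norm_sub_lt_of_lt (nearest_mem s h) ?_
    rw [norm_sub_rev, h1]; exact h2
  · rintro ⟨h1, h2⟩
    refine Prod.ext h1 ?_
    ext b
    simp only [lab, Set.mem_ofPred_eq]
    rw [← h1]
    constructor
    · intro hb
      exact norm_sub_lt_of_lt (by rwa [norm_sub_rev]) hb
    · intro hb
      exact norm_sub_lt_of_lt h2 hb

theorem lab_eq_of_mem {s : ℤ} {ζ : F} {r : ℤ} {a : ℚ_[p]} (h : IsLev p s (rho p ζ) r)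
    (ha : ‖ζ - ι a‖ < (p : ℝ) ^ (1 - r)) :
    lab p s ζ = (r, {b : ℚ_[p] | ‖a - b‖ < (p : ℝ) ^ (1 - r)}) := by
  have hr := lev_eq h
  refine Prod.ext hr ?_
  ext b
  simp only [lab, Set.mem_ofPred_eq, hr]
  rw [← norm_algebraMap' F (a - b), map_sub]
  constructor
  · intro hb
    exact norm_sub_lt_of_lt (by rwa [norm_sub_rev]) hb
  · intro hb
    exact norm_sub_lt_of_lt ha hb

theorem irrat_add {ζ : F} (h : Irrat p ζ) (c : ℚ_[p]) : Irrat p (ζ + ι c) := by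
  apply irrat_of_rho_pos; rw [rho_add]; exact rho_pos h

theorem irrat_mul {ζ : F} (h : Irrat p ζ) {c : ℚ_[p]} (hc : c ≠ 0) : Irrat p (ι c * ζ) := by
  apply irrat_of_rho_pos; rw [rho_mul _ hc]
  exact mul_pos (norm_pos_iff.2 hc) (rho_pos h)

theorem irrat_inv {ζ : F} (h : Irrat p ζ) : Irrat p ζ⁻¹ := by
  intro b hb
  refine h b⁻¹ ?_
  rw [map_inv₀, hb, inv_inv]

theorem lab_add {s : ℤ} {ζ ζ' : F} (h : Irrat p ζ) (h' : Irrat p ζ')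
    (hl : lab p s ζ = lab p s ζ') (c : ℚ_[p]) : lab p s (ζ + ι c) = lab p s (ζ' + ι c) := by
  rw [lab_eq_iff h h'] at hl
  have e : ∀ x : F, lev p s (x + ι c) = lev p s x := fun x => by unfold lev; rw [rho_add]
  rw [lab_eq_iff (irrat_add h c) (irrat_add h' c), e, e, add_sub_add_right_eq_sub]
  exact hl

theorem isLev_mul {s : ℤ} {d : ℝ} {r n : ℤ} (h : IsLev p s d r) (hn : Even n) :
    IsLev p s ((p : ℝ) ^ n * d) (r - n) := by
  have hp : (0 : ℝ) < p := p_pos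
  have he : Even (r - n + s) ↔ Even (r + s) := by
    rw [Int.even_add, Int.even_sub, Int.even_add]; tauto
  have hpn := p_zpow_pos (p := p) n
  rcases h with ⟨h1, h2, h3⟩ | ⟨h1, h2⟩
  · refine Or.inl ⟨he.2 h1, ?_, ?_⟩
    · rw [show -(r - n) - 1 = n + (-r - 1) by ring, zpow_add₀ hp.ne']
      gcongr
    · rw [show 1 - (r - n) = n + (1 - r) by ring, zpow_add₀ hp.ne']
      gcongr
  · refine Or.inr ⟨fun h => h1 (he.1 h), ?_⟩
    rw [show -(r - n) = n + (-r) by ring, zpow_add₀ hp.ne', h2]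

theorem lev_mul (s : ℤ) {ζ : F} (h : Irrat p ζ) {c : ℚ_[p]} {n : ℤ} (hn : Even n)
    (hc : ‖c‖ = (p : ℝ) ^ n) : lev p s (ι c * ζ) = lev p s ζ - n := by
  apply lev_eq
  have hc0 : c ≠ 0 := norm_pos_iff.1 (hc ▸ p_zpow_pos n)
  rw [rho_mul _ hc0, hc]
  exact isLev_mul (isLev_lev s h) hn

theorem lab_mul {s : ℤ} {ζ ζ' : F} (h : Irrat p ζ) (h' : Irrat p ζ')
    (hl : lab p s ζ = lab p s ζ') {c : ℚ_[p]} {n : ℤ} (hn : Even n) (hc : ‖c‖ = (p : ℝ) ^ n) :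
    lab p s (ι c * ζ) = lab p s (ι c * ζ') := by
  have hc0 : c ≠ 0 := norm_pos_iff.1 (hc ▸ p_zpow_pos n)
  rw [lab_eq_iff h h'] at hl
  rw [lab_eq_iff (irrat_mul h hc0) (irrat_mul h' hc0), lev_mul s h hn hc, lev_mul s h' hn hc, hl.1]
  refine ⟨rfl, ?_⟩
  rw [← hl.1, ← mul_sub, norm_mul, norm_algebraMap', hc,
    show 1 - (lev p s ζ - n) = n + (1 - lev p s ζ) by ring, zpow_add₀ p_pos.ne']
  have := p_zpow_pos (p := p) n
  have := hl.2
  gcongr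

theorem norm_inv_sub_inv {ζ ζ' : F} (h : ζ ≠ 0) (h' : ζ' ≠ 0) :
    ‖ζ⁻¹ - ζ'⁻¹‖ = ‖ζ - ζ'‖ * (‖ζ‖⁻¹ * ‖ζ'‖⁻¹) := by
  have : ζ⁻¹ - ζ'⁻¹ = -((ζ - ζ') * (ζ⁻¹ * ζ'⁻¹)) := by field_simp; ring
  rw [this, norm_neg, norm_mul, norm_mul, norm_inv, norm_inv]

/-- The level of `ζ⁻¹` if the ball of `ζ` contains `0`. -/
theorem isLev_inv_of_lt {s : ℤ} {ζ : F} {r : ℤ} (h : Irrat p ζ) (hr : IsLev p s (rho p ζ) r)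
    (hlt : ‖ζ‖ < (p : ℝ) ^ (1 - r)) :
    IsLev p s (rho p ζ⁻¹) (-r) ∧ ‖ζ⁻¹‖ < (p : ℝ) ^ (1 - -r) := by
  have hp : (0 : ℝ) < p := p_pos
  have hζ : 0 < ‖ζ‖ := norm_pos_iff.2 h.ne_zero
  have hρ := rho_pos h
  have hle := rho_le_norm (p := p) ζ
  have hb := hr.bounds
  have he : Even (-r + s) ↔ Even (r + s) := by
    rw [Int.even_add, Int.even_add, even_neg]
  have hup : ‖ζ⁻¹‖ < (p : ℝ) ^ (1 - -r) := by
    rw [norm_inv, show 1 - -r = -(-r - 1) by ring, zpow_neg]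
    exact inv_strictAnti₀ (p_zpow_pos _) (hb.1.trans_le hle)
  refine ⟨?_, hup⟩
  have hlow : rho p ζ < ‖ζ‖ → ‖ζ‖ ≤ (p : ℝ) ^ (-r) := by
    intro hlt'
    obtain ⟨n, hn⟩ := norm_zpow_of_rho_lt hlt'
    rw [hn, p_zpow_lt] at hlt
    rw [hn, p_zpow_le]
    omega
  rcases hr with ⟨h1, h2, h3⟩ | ⟨h1, h2⟩
  · refine Or.inl ⟨he.2 h1, ?_, (rho_le_norm _).trans_lt hup⟩
    rcases hle.lt_or_eq with hlt' | heq
    · have h4 := hlow hlt'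
      rw [rho_inv h, lt_div_iff₀ (by positivity)]
      calc (p : ℝ) ^ (- -r - 1) * ‖ζ‖ ^ 2 ≤ (p : ℝ) ^ (- -r - 1) * ((p : ℝ) ^ (-r)) ^ 2 := by
            gcongr
        _ = (p : ℝ) ^ (-r - 1) := by
            rw [pow_two, ← zpow_add₀ hp.ne', ← zpow_add₀ hp.ne']; congr 1; ring
        _ < rho p ζ := h2
    · rw [rho_inv h, heq, pow_two, div_mul_cancel_left₀ hζ.ne',
        show - -r - 1 = -(1 - r) by ring, zpow_neg]
      exact inv_strictAnti₀ hζ hlt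
  · refine Or.inr ⟨fun h => h1 (he.1 h), ?_⟩
    have heq : rho p ζ = ‖ζ‖ := by
      rcases hle.lt_or_eq with hlt' | heq
      · have := hlow hlt'
        rw [← h2] at this
        exact absurd hlt' (not_lt.2 this)
      · exact heq
    rw [rho_inv h, ← heq, h2, pow_two, div_mul_cancel_left₀ (p_zpow_pos _).ne', zpow_neg,
      zpow_neg, zpow_neg]

theorem lab_inv {s : ℤ} {ζ ζ' : F} (h : Irrat p ζ) (h' : Irrat p ζ')
    (hl : lab p s ζ = lab p s ζ') : lab p s ζ⁻¹ = lab p s ζ'⁻¹ := by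
  have hp : (0 : ℝ) < p := p_pos
  rw [lab_eq_iff h h'] at hl
  obtain ⟨hl1, hl2⟩ := hl
  have hr := isLev_lev s h
  have hr' := isLev_lev s h'
  rw [← hl1] at hr'
  rw [lab_eq_iff (irrat_inv h) (irrat_inv h')]
  generalize lev p s ζ = r at *
  by_cases hlt : ‖ζ‖ < (p : ℝ) ^ (1 - r)
  · have hlt' : ‖ζ'‖ < (p : ℝ) ^ (1 - r) := by
      have := norm_sub_le_max' ζ (ζ - ζ')
      rw [sub_sub_cancel] at this
      exact this.trans_lt (max_lt hlt hl2)
    obtain ⟨h1, h2⟩ := isLev_inv_of_lt h hr hlt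
    obtain ⟨h1', h2'⟩ := isLev_inv_of_lt h' hr' hlt'
    rw [lev_eq h1, lev_eq h1']
    exact ⟨rfl, (norm_sub_le_max' _ _).trans_lt (max_lt h2 h2')⟩
  · rw [not_lt] at hlt
    have hn : ‖ζ'‖ = ‖ζ‖ := norm_eq_of_norm_sub_lt (hl2.trans_le hlt)
    obtain ⟨n, hn2⟩ := norm_zpow_of_rho_lt (hr.bounds.2.trans_le hlt)
    have key : ∀ x : F, Irrat p x → ‖x‖ = (p : ℝ) ^ n → IsLev p s (rho p x) r →
        lev p s x⁻¹ = r + 2 * n := by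
      intro x hx hxn hxr
      apply lev_eq
      have := isLev_mul (n := -(2 * n)) hxr ⟨-n, by ring⟩
      rw [sub_neg_eq_add] at this
      rw [rho_inv hx, hxn, div_eq_inv_mul]
      convert this using 2
      rw [← zpow_natCast, ← zpow_mul, zpow_neg, mul_comm]
      rfl
    rw [key ζ h hn2 hr, key ζ' h' (hn.trans hn2) hr']
    refine ⟨rfl, ?_⟩
    rw [norm_inv_sub_inv h.ne_zero h'.ne_zero, hn, hn2,
      show 1 - (r + 2 * n) = (1 - r) + (-n + -n) by ring, zpow_add₀ hp.ne' (1 - r),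
      zpow_add₀ hp.ne' (-n), zpow_neg]
    have := p_zpow_pos (p := p) n
    gcongr

/-! ### Möbius transformations -/

/-- The Möbius transformation with the given matrix. -/
def mob (a b c d : ℚ_[p]) (ζ : F) : F := (ι a * ζ + ι b) / (ι c * ζ + ι d)

theorem mob_denom_ne {a b c d : ℚ_[p]} (hdet : a * d - b * c = 1) {ζ : F} (h : Irrat p ζ) :
    ι c * ζ + ι d ≠ 0 := by
  intro h0
  by_cases hc : c = 0
  · subst hc
    simp only [map_zero, zero_mul, zero_add, map_eq_zero] at h0
    subst h0
    simp at hdet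
  · refine h (-d / c) ?_
    have hc' : ι c ≠ 0 := by simpa using hc
    rw [map_div₀, map_neg, div_eq_iff hc']
    linear_combination (-1 : F) * h0

theorem mob_of_ne {a b c d : ℚ_[p]} (hdet : a * d - b * c = 1) {ζ : F} (h : Irrat p ζ)
    (hc : c ≠ 0) : mob a b c d ζ = (ι (-c ^ 2) * (ζ + ι (d / c)))⁻¹ + ι (a / c) := by
  have hd := mob_denom_ne hdet h
  have hc' : ι c ≠ 0 := by simpa using hc
  have hdet' : ι a * ι d - ι b * ι c = 1 := by rw [← map_mul, ← map_mul, ← map_sub, hdet, map_one]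
  have e : ι (-c ^ 2) * (ζ + ι (d / c)) = -(ι c * (ι c * ζ + ι d)) := by
    simp only [map_neg, map_pow, map_div₀]
    field_simp
  rw [e, mob, map_div₀]
  generalize hj : ι c * ζ + ι d = j at *
  field_simp
  linear_combination ι a * hj - hdet'

theorem norm_sq_even {c : ℚ_[p]} (hc : c ≠ 0) : ∃ n : ℤ, Even n ∧ ‖c ^ 2‖ = (p : ℝ) ^ n := by
  obtain ⟨n, hn⟩ := norm_zpow_of_ne hc
  refine ⟨n + n, ⟨n, rfl⟩, ?_⟩
  rw [norm_pow, hn, pow_two, zpow_add₀ p_pos.ne']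

/-- The partition is invariant under Möbius transformations of determinant one. -/
theorem lab_mob {a b c d : ℚ_[p]} (hdet : a * d - b * c = 1) {s : ℤ} {ζ ζ' : F} (h : Irrat p ζ)
    (h' : Irrat p ζ') (hl : lab p s ζ = lab p s ζ') :
    lab p s (mob a b c d ζ) = lab p s (mob a b c d ζ') := by
  by_cases hc : c = 0
  · subst hc
    have hd : d ≠ 0 := by rintro rfl; simp at hdet
    have ha : a ≠ 0 := by rintro rfl; simp at hdet
    have hda : d = a⁻¹ := by
      field_simp; linear_combination hdet
    have e : ∀ x : F, mob a b 0 d x = ι (a ^ 2) * x + ι (b / d) := by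
      intro x
      have : ι a ≠ 0 := by simpa using ha
      simp only [mob, hda, map_zero, zero_mul, zero_add, map_div₀, map_pow, map_inv₀]
      field_simp
    rw [e, e]
    obtain ⟨n, hn, hn2⟩ := norm_sq_even ha
    exact lab_add (irrat_mul h (pow_ne_zero 2 ha)) (irrat_mul h' (pow_ne_zero 2 ha))
      (lab_mul h h' hl hn hn2) _
  · have hc2 : -c ^ 2 ≠ 0 := neg_ne_zero.2 (pow_ne_zero 2 hc)
    rw [mob_of_ne hdet h hc, mob_of_ne hdet h' hc]
    obtain ⟨n, hn, hn2⟩ := norm_sq_even hc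
    rw [← norm_neg] at hn2
    have i1 := irrat_add h (d / c)
    have i1' := irrat_add h' (d / c)
    exact lab_add (irrat_inv (irrat_mul i1 hc2)) (irrat_inv (irrat_mul i1' hc2))
      (lab_inv (irrat_mul i1 hc2) (irrat_mul i1' hc2) (lab_mul i1 i1' (lab_add h h' hl _) hn hn2)) _

variable (p) in
/-- A bounded region of the upper half plane. -/
def Bdd (M : ℝ) (ζ : F) : Prop := ‖ζ‖ ≤ M ∧ M⁻¹ ≤ rho p ζ

theorem Bdd.irrat {M : ℝ} (hM : 0 < M) {ζ : F} (h : Bdd p M ζ) : Irrat p ζ :=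
  irrat_of_rho_pos ((inv_pos.2 hM).trans_le h.2)

theorem exists_bdd {ζ : F} (h : Irrat p ζ) : ∃ M₀ : ℝ, ∀ M, M₀ ≤ M → Bdd p M ζ := by
  refine ⟨max ‖ζ‖ (rho p ζ)⁻¹, fun M hM => ⟨(le_max_left _ _).trans hM, ?_⟩⟩
  exact inv_le_of_inv_le₀ (rho_pos h) ((le_max_right _ _).trans hM)

theorem Bdd.norm_le {M : ℝ} (hM : 1 ≤ M) {ζ : F} (h : Bdd p M ζ) (c d : ℚ_[p]) :
    ‖c‖ ≤ M ^ 2 * ‖ι c * ζ + ι d‖ ∧ ‖d‖ ≤ M ^ 2 * ‖ι c * ζ + ι d‖ := by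
  have hM0 : 0 < M := zero_lt_one.trans_le hM
  have h1 : ‖c‖ ≤ M * ‖ι c * ζ + ι d‖ := by
    by_cases hc : c = 0
    · subst hc; simp; positivity
    · have hc' : ι c ≠ 0 := by simpa using hc
      have e : ι c * ζ + ι d = ι c * (ζ - ι (-d / c)) := by
        rw [map_div₀, map_neg]; field_simp; ring
      rw [e, norm_mul, norm_algebraMap']
      have h2 := h.2.trans (rho_le ζ (-d / c))
      calc ‖c‖ = M * (‖c‖ * M⁻¹) := by field_simp
        _ ≤ _ := by gcongr
  have h3 : ‖c‖ ≤ M ^ 2 * ‖ι c * ζ + ι d‖ := by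
    refine h1.trans ?_
    have := norm_nonneg (ι c * ζ + ι d)
    gcongr
    nlinarith
  refine ⟨h3, ?_⟩
  have h4 : ‖d‖ ≤ max ‖ι c * ζ + ι d‖ ‖ι c * ζ‖ := by
    have := norm_sub_le_max' (ι c * ζ + ι d) (ι c * ζ)
    rwa [add_sub_cancel_left, norm_algebraMap'] at this
  refine h4.trans (max_le ?_ ?_)
  · exact le_mul_of_one_le_left (norm_nonneg _) (one_le_pow₀ hM)
  · rw [norm_mul, norm_algebraMap']
    calc ‖c‖ * ‖ζ‖ ≤ (M * ‖ι c * ζ + ι d‖) * M := by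
          gcongr; exact h.1
      _ = _ := by ring

/-- A Möbius transformation of determinant one mapping a bounded point to a bounded point is
bounded. -/
theorem norm_le_of_bdd_mob {a b c d : ℚ_[p]} (hdet : a * d - b * c = 1) {M : ℝ} (hM : 1 ≤ M)
    {ζ : F} (h : Bdd p M ζ) (h' : Bdd p M (mob a b c d ζ)) :
    ‖a‖ ≤ M ^ 3 ∧ ‖b‖ ≤ M ^ 3 ∧ ‖c‖ ≤ M ^ 3 ∧ ‖d‖ ≤ M ^ 3 := by
  have hM0 : 0 < M := zero_lt_one.trans_le hM
  have hi := h.irrat hM0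
  have hne := mob_denom_ne hdet hi
  set j := ι c * ζ + ι d with hj
  have hjpos : 0 < ‖j‖ := norm_pos_iff.2 hne
  obtain ⟨hc, hd⟩ := h.norm_le hM c d
  obtain ⟨ha, hb⟩ := h.norm_le hM a b
  have hnum : ι a * ζ + ι b = j * mob a b c d ζ := by
    rw [mob, ← hj, mul_div_cancel₀ _ hne]
  have hnum' : ‖ι a * ζ + ι b‖ ≤ ‖j‖ * M := by
    rw [hnum, norm_mul]; gcongr; exact h'.1
  have hinv1 : ι (-c) * mob a b c d ζ + ι a = j⁻¹ := by
    have hdet' : ι a * ι d - ι b * ι c = 1 := by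
      rw [← map_mul, ← map_mul, ← map_sub, hdet, map_one]
    rw [mob, map_neg, ← hj]
    field_simp
    linear_combination hdet' + ι a * hj
  have hinv2 : ι d * mob a b c d ζ + ι (-b) = ζ * j⁻¹ := by
    have hdet' : ι a * ι d - ι b * ι c = 1 := by
      rw [← map_mul, ← map_mul, ← map_sub, hdet, map_one]
    rw [mob, map_neg, ← hj]
    field_simp
    linear_combination ζ * hdet' - ι b * hj
  obtain ⟨hc2, ha2⟩ := h'.norm_le hM (-c) a
  obtain ⟨hd2, hb2⟩ := h'.norm_le hM d (-b)
  rw [hinv1, norm_inv] at hc2 ha2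
  rw [hinv2, norm_mul, norm_inv] at hd2 hb2
  rw [norm_neg] at hc2 hb2
  have hζM := h.1
  have fin : ∀ x : ℝ, 0 ≤ x → x ≤ M ^ 2 * (‖j‖ * M) → x ≤ M ^ 2 * (M * ‖j‖⁻¹) → x ≤ M ^ 3 := by
    intro x hx h1 h2
    have h3 : x * x ≤ M ^ 3 * M ^ 3 := by
      calc x * x ≤ (M ^ 2 * (‖j‖ * M)) * (M ^ 2 * (M * ‖j‖⁻¹)) := by gcongr
        _ = M ^ 3 * M ^ 3 := by field_simp
    exact abs_le_of_sq_le_sq' (by nlinarith) (by positivity) |>.2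
  have up : ∀ x : ℝ, x ≤ M ^ 2 * ‖j‖ → x ≤ M ^ 2 * (‖j‖ * M) := fun x hx => hx.trans (by
    gcongr; exact le_mul_of_one_le_right hjpos.le hM)
  have up2 : ∀ x : ℝ, x ≤ M ^ 2 * ‖j‖⁻¹ → x ≤ M ^ 2 * (M * ‖j‖⁻¹) := fun x hx => hx.trans (by
    gcongr; exact le_mul_of_one_le_left (by positivity) hM)
  have up3 : ∀ x : ℝ, x ≤ M ^ 2 * (‖ζ‖ * ‖j‖⁻¹) → x ≤ M ^ 2 * (M * ‖j‖⁻¹) := fun x hx =>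
    hx.trans (by gcongr)
  refine ⟨fin _ (norm_nonneg _) (ha.trans ?_) (up2 _ ha2), fin _ (norm_nonneg _) (hb.trans ?_)
    (up3 _ hb2), fin _ (norm_nonneg _) (up _ hc) (up2 _ hc2),
    fin _ (norm_nonneg _) (up _ hd) (up3 _ hd2)⟩
  · gcongr
  · gcongr

end Labels

/-! ### Theta products -/

section Theta

variable {p : ℕ} [Fact p.Prime] {F : Type*} [NormedField F] [NormedAlgebra ℚ_[p] F]
  [IsUltrametricDist F]

local notation "ι" => algebraMap ℚ_[p] F

theorem norm_sub_eq_of_lt {x y : F} (h : ‖y‖ < ‖x‖) : ‖x - y‖ = ‖x‖ :=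
  norm_eq_of_norm_sub_lt (by rwa [sub_sub_cancel])

theorem norm_sub_le_rho {s : ℤ} {ζ ζ' : F} (h : Irrat p ζ) (h' : Irrat p ζ')
    (hl : lab p s ζ = lab p s ζ') : ‖ζ - ζ'‖ ≤ (p : ℝ) ^ 2 * rho p ζ := by
  rw [lab_eq_iff h h'] at hl
  refine hl.2.le.trans ?_
  have hb := (isLev_lev s h).bounds.1
  rw [show 1 - lev p s ζ = 2 + (-lev p s ζ - 1) by ring, zpow_add₀ p_pos.ne']
  have : (p : ℝ) ^ (2 : ℤ) = (p : ℝ) ^ 2 := rfl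
  rw [this]
  have := p_pos (p := p)
  gcongr

/-- A rational function with divisor `η' - η`. -/
def twoPoint (η η' ζ : F) : F := (ζ - η') / (ζ - η)

theorem twoPoint_ratio {η η' ζ ζ' : F} (h1 : ζ ≠ η) (h4 : ζ' ≠ η') (h3 : ζ' ≠ η) :
    twoPoint η η' ζ / twoPoint η η' ζ' - 1 = (ζ - ζ') * (η' - η) / ((ζ - η) * (ζ' - η')) := by
  rw [← sub_ne_zero] at h1 h4 h3
  rw [twoPoint, twoPoint]
  field_simp
  ring

/-- Near `ℙ¹(ℚ_p)` the function `twoPoint` is nearly constant on the parts of the partition. -/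
theorem exists_twoPoint_near {η η' : F} (hη : Irrat p η) (hη' : Irrat p η') {ε : ℝ} (hε : 0 < ε) :
    ∃ M : ℝ, ∀ (s : ℤ) (ζ ζ' : F), Irrat p ζ → Irrat p ζ' → lab p s ζ = lab p s ζ' →
      ζ ≠ η → ζ' ≠ η → ζ' ≠ η' → ¬ Bdd p M ζ →
        ‖twoPoint η η' ζ / twoPoint η η' ζ' - 1‖ ≤ ε := by
  have hρ := rho_pos hη
  have hρ' := rho_pos hη'
  have hp := p_pos (p := p)
  set q : ℝ := (p : ℝ) ^ 2 with hq
  have hq1 : 1 ≤ q := one_le_pow₀ one_lt_p.le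
  set c := ‖η' - η‖ with hc
  have hc0 : 0 ≤ c := norm_nonneg _
  refine ⟨1 + q * ‖η‖ + q * ‖η'‖ + q / rho p η + q / rho p η' + q * c / ε
    + q * c / (rho p η * rho p η' * ε), ?_⟩
  intro s ζ ζ' h h' hl h1 h3 h4 hB
  set M := 1 + q * ‖η‖ + q * ‖η'‖ + q / rho p η + q / rho p η' + q * c / ε
    + q * c / (rho p η * rho p η' * ε) with hM
  have t1 : 0 ≤ q * ‖η‖ := by positivity
  have t2 : 0 ≤ q * ‖η'‖ := by positivity
  have t3 : 0 ≤ q / rho p η := by positivity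
  have t4 : 0 ≤ q / rho p η' := by positivity
  have t5 : 0 ≤ q * c / ε := by positivity
  have t6 : 0 ≤ q * c / (rho p η * rho p η' * ε) := by positivity
  have hM0 : 0 < M := by linarith
  have hd1 := norm_sub_le_rho h h' hl
  have hd2 := norm_sub_le_rho h' h hl.symm
  rw [norm_sub_rev] at hd2
  rw [twoPoint_ratio h1 h4 h3, norm_div, norm_mul, norm_mul]
  by_cases hζM : ‖ζ‖ ≤ M
  · have hlt : rho p ζ < M⁻¹ := by
      by_contra hcon
      exact hB ⟨hζM, not_lt.1 hcon⟩
    have key : ∀ x : F, ∀ y : F, ‖x - ι (nearest p ζ)‖ ≤ q * M⁻¹ → q / rho p y < M →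
        0 < rho p y → rho p y ≤ ‖x - y‖ := by
      intro x y hx hy hy0
      have h5 : q * M⁻¹ < rho p y := by
        rw [div_lt_iff₀ hy0] at hy
        rw [← div_eq_mul_inv, div_lt_iff₀ hM0]
        linarith
      have h6 : ‖y - ι (nearest p ζ)‖ ≤ ‖x - y‖ := by
        by_contra hcon
        rw [not_le] at hcon
        have h7 := norm_sub_lt_of_lt (x := y) (y := x) (z := ι (nearest p ζ))
          (c := ‖y - ι (nearest p ζ)‖) (by rwa [norm_sub_rev])
          ((hx.trans_lt h5).trans_le (rho_le y _))
        exact lt_irrefl _ h7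
      exact (rho_le y _).trans h6
    have e1 : ‖ζ - ι (nearest p ζ)‖ ≤ q * M⁻¹ :=
      hlt.le.trans (le_mul_of_one_le_left (by positivity) hq1)
    have e2 : ‖ζ' - ι (nearest p ζ)‖ ≤ q * M⁻¹ := by
      refine norm_sub_le_of_le ?_ e1
      rw [norm_sub_rev]
      exact hd1.trans (by gcongr)
    have b1 := key ζ η e1 (by linarith) hρ
    have b2 := key ζ' η' e2 (by linarith) hρ'
    calc ‖ζ - ζ'‖ * c / (‖ζ - η‖ * ‖ζ' - η'‖) ≤ (q * M⁻¹) * c / (rho p η * rho p η') := by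
          gcongr
          exact hd1.trans (by gcongr)
      _ = (q * c / (rho p η * rho p η' * ε)) * M⁻¹ * ε := by field_simp
      _ ≤ M * M⁻¹ * ε := by gcongr; linarith
      _ = ε := by field_simp
  · rw [not_le] at hζM
    have hζζ : ‖ζ‖ ≤ q * ‖ζ'‖ := by
      have h5 : ‖ζ‖ ≤ max ‖ζ - ζ'‖ ‖ζ'‖ := by
        have := IsUltrametricDist.norm_add_le_max (ζ - ζ') ζ'
        rwa [sub_add_cancel] at this
      refine h5.trans (max_le (hd2.trans ?_) (le_mul_of_one_le_left (norm_nonneg _) hq1))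
      gcongr
      exact rho_le_norm _
    have hη1 : ‖η‖ ≤ q * ‖η‖ := le_mul_of_one_le_left (norm_nonneg _) hq1
    have b1 : ‖ζ - η‖ = ‖ζ‖ := norm_sub_eq_of_lt (by linarith)
    have b2 : ‖ζ' - η'‖ = ‖ζ'‖ := by
      refine norm_sub_eq_of_lt (lt_of_mul_lt_mul_left (a := q) ?_ (by positivity))
      linarith
    rw [b1, b2]
    have hz : 0 < ‖ζ‖ := hM0.trans hζM
    have hz' : 0 < ‖ζ'‖ := norm_pos_iff.2 h'.ne_zero
    have h6 : ‖ζ - ζ'‖ ≤ q * ‖ζ'‖ := hd2.trans (by gcongr; exact rho_le_norm _)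
    calc ‖ζ - ζ'‖ * c / (‖ζ‖ * ‖ζ'‖) ≤ (q * ‖ζ'‖) * c / (‖ζ‖ * ‖ζ'‖) := by gcongr
      _ = q * c / ‖ζ‖ := by field_simp
      _ ≤ q * c / (q * c / ε + 1) := by
          gcongr; linarith
      _ ≤ ε := by
          rw [div_le_iff₀ (by positivity), mul_add, mul_div_cancel₀ _ hε.ne']
          linarith

theorem zpow_sum_of_ne {T : Type*} (Z : Finset T) (n : T → ℤ) {x : F} (hx : x ≠ 0) :
    x ^ ∑ y ∈ Z, n y = ∏ y ∈ Z, x ^ n y := by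
  classical
  induction Z using Finset.induction_on with
  | empty => simp
  | insert a t ha ih => rw [Finset.sum_insert ha, Finset.prod_insert ha, zpow_add₀ hx, ih]

theorem prod_zpow_ratio {T : Type*} (Z : Finset T) (f : T → F) (n : T → ℤ) (h0 : ∑ y ∈ Z, n y = 0)
    {x : F} (hx : x ≠ 0) : ∏ y ∈ Z, f y ^ n y = ∏ y ∈ Z, (f y / x) ^ n y := by
  simp_rw [div_zpow, Finset.prod_div_distrib]
  rw [← zpow_sum_of_ne Z n hx, h0, zpow_zero, div_one]

theorem twoPoint_ne_zero {η η' ζ : F} (h : ζ ≠ η) (h' : ζ ≠ η') : twoPoint η η' ζ ≠ 0 :=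
  div_ne_zero (sub_ne_zero.2 h') (sub_ne_zero.2 h)

/-- A product of values of `twoPoint` over a divisor of degree zero which is supported on one part
of the partition. -/
theorem exists_prod_twoPoint_near (T : Type*) {η η' : F} (hη : Irrat p η) (hη' : Irrat p η')
    {ε : ℝ} (hε : 0 < ε) :
    ∃ M : ℝ, ∀ (s : ℤ) (Z : Finset T) (x : T → F) (n : T → ℤ),
      (∀ y ∈ Z, Irrat p (x y) ∧ x y ≠ η ∧ x y ≠ η') →
      (∀ y ∈ Z, ∀ y' ∈ Z, lab p s (x y) = lab p s (x y')) → ∑ y ∈ Z, n y = 0 →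
      (∀ y ∈ Z, ¬ Bdd p M (x y)) → ‖∏ y ∈ Z, twoPoint η η' (x y) ^ n y - 1‖ ≤ ε := by
  obtain ⟨M, hM⟩ := exists_twoPoint_near hη hη' (ε := min ε (1 / 2)) (by positivity)
  refine ⟨M, fun s Z x n hx hl h0 hB => ?_⟩
  rcases Z.eq_empty_or_nonempty with rfl | ⟨y₀, hy₀⟩
  · simpa using hε.le
  · obtain ⟨i0, e0, e0'⟩ := hx y₀ hy₀
    rw [prod_zpow_ratio Z _ n h0 (twoPoint_ne_zero e0 e0')]
    refine (prod_near_one (ε := min ε (1 / 2)) _ _ ?_ (by positivity) fun y hy => ?_).trans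
      (min_le_left _ _)
    · exact (min_le_right _ _).trans_lt (by norm_num)
    · obtain ⟨i1, e1, e1'⟩ := hx y hy
      refine zpow_near_one ((min_le_right _ _).trans_lt (by norm_num)) (by positivity) ?_ _
      exact hM s _ _ i1 i0 (hl y hy y₀ hy₀) e1 e0 e0' (hB y hy)

variable (p) in
/-- The points of the upper half plane with a given label. -/
def part (s : ℤ) (P : ℤ × Set ℚ_[p]) : Set F := {ζ | Irrat p ζ ∧ lab p s ζ = P}

theorem exists_part_bdd (s : ℤ) (P : ℤ × Set ℚ_[p]) :
    ∃ M : ℝ, ∀ ζ ∈ part (F := F) p s P, Bdd p M ζ := by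
  by_cases h : (part (F := F) p s P).Nonempty
  · obtain ⟨ζ₀, h0, hl0⟩ := h
    refine ⟨max (max ‖ζ₀‖ ((p : ℝ) ^ (1 - lev p s ζ₀))) ((p : ℝ) ^ (-lev p s ζ₀ - 1))⁻¹, ?_⟩
    rintro ζ ⟨h1, hl⟩
    rw [← hl0] at hl
    have hl' := (lab_eq_iff h1 h0).1 hl
    constructor
    · refine le_trans ?_ (le_max_left _ _)
      have := IsUltrametricDist.norm_add_le_max ζ₀ (ζ - ζ₀)
      rw [add_sub_cancel] at this
      refine this.trans (max_le_max le_rfl ?_)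
      rw [← hl'.1]
      exact hl'.2.le
    · rw [inv_le_comm₀ (lt_of_lt_of_le (inv_pos.2 (p_zpow_pos _)) (le_max_right _ _))
        (rho_pos h1)]
      refine le_trans ?_ (le_max_right _ _)
      have hb := (isLev_lev s h1).bounds.1
      rw [hl'.1] at hb
      exact inv_anti₀ (p_zpow_pos _) hb.le
  · exact ⟨0, fun ζ hζ => (h ⟨ζ, hζ⟩).elim⟩

section Orbit

variable {G X : Type*} (act : G → X → F) (D : X →₀ ℤ)

open Classical in
/-- The multiplicity of `ζ` in the sum of the translates of the divisor `D`. -/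
def orbitMult (ζ : F) : ℤ := ∑ᶠ α : G, ∑ y ∈ D.support with act α y = ζ, D y

variable {act D}

open Classical in
/-- The sum of the translates of a divisor restricted to a part of the partition. -/
theorem exists_orbitMult_part
    (hirr : ∀ α, ∀ y ∈ D.support, Irrat p (act α y))
    (hfin : ∀ M : ℝ, {α | ∃ y ∈ D.support, Bdd p M (act α y)}.Finite) (s : ℤ)
    (hdeg : ∀ α P, ∑ y ∈ D.support with lab p s (act α y) = P, D y = 0) (P : ℤ × Set ℚ_[p]) :
    ∃ (A : Finset G) (Z : Finset F), (∀ α, (∃ y ∈ D.support, lab p s (act α y) = P) → α ∈ A) ∧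
      (∀ ζ ∈ Z, ζ ∈ part p s P) ∧ (∀ ζ ∈ Z, ∃ α, ∃ y ∈ D.support, act α y = ζ) ∧
      (∀ ζ ∈ part p s P, ζ ∉ Z → orbitMult act D ζ = 0) ∧
      ∑ ζ ∈ Z, orbitMult act D ζ = 0 ∧
      ∀ h : F → F, (∀ ζ ∈ Z, h ζ ≠ 0) →
        ∏ α ∈ A, ∏ y ∈ D.support with lab p s (act α y) = P, h (act α y) ^ D y =
        ∏ ζ ∈ Z, h ζ ^ orbitMult act D ζ := by
  obtain ⟨M, hM⟩ := exists_part_bdd (F := F) s P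
  set A := (hfin M).toFinset with hA
  have hmem : ∀ α, (∃ y ∈ D.support, lab p s (act α y) = P) → α ∈ A := by
    rintro α ⟨y, hy, hl⟩
    rw [hA, Set.Finite.mem_toFinset]
    exact ⟨y, hy, hM _ ⟨hirr α y hy, hl⟩⟩
  set Z : Finset F := ((A ×ˢ D.support).filter fun q => lab p s (act q.1 q.2) = P).image
    fun q => act q.1 q.2 with hZ
  have hZP : ∀ ζ ∈ Z, ζ ∈ part p s P := by
    intro ζ hζ
    simp only [hZ, Finset.mem_image, Finset.mem_filter, Finset.mem_product] at hζ
    obtain ⟨⟨α, y⟩, ⟨⟨h1, h2⟩, h3⟩, rfl⟩ := hζ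
    exact ⟨hirr α y h2, h3⟩
  have hN : ∀ ζ ∈ part p s P, orbitMult act D ζ =
      ∑ α ∈ A, ∑ y ∈ D.support with act α y = ζ, D y := by
    rintro ζ ⟨-, hζ⟩
    refine finsum_eq_sum_of_support_subset _ fun α hα => ?_
    rw [Function.mem_support] at hα
    obtain ⟨y, hy, -⟩ := Finset.exists_ne_zero_of_sum_ne_zero hα
    rw [Finset.mem_filter] at hy
    exact Finset.mem_coe.2 (hmem α ⟨y, hy.1, by rw [hy.2, hζ]⟩)
  have hfilter : ∀ ζ ∈ Z, ∀ α, (D.support.filter fun y => act α y = ζ) =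
      (D.support.filter fun y => lab p s (act α y) = P).filter fun y => act α y = ζ := by
    intro ζ hζ α
    ext y
    simp only [Finset.mem_filter]
    constructor
    · rintro ⟨h1, h2⟩
      exact ⟨⟨h1, by rw [h2]; exact (hZP ζ hζ).2⟩, h2⟩
    · rintro ⟨⟨h1, -⟩, h2⟩
      exact ⟨h1, h2⟩
  have hmaps : ∀ α ∈ A, ∀ y ∈ D.support.filter (fun y => lab p s (act α y) = P), act α y ∈ Z := by
    intro α hα y hy
    rw [Finset.mem_filter] at hy
    rw [hZ, Finset.mem_image]
    exact ⟨(α, y), by simpa [hα] using hy, rfl⟩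
  refine ⟨A, Z, hmem, hZP, ?_, ?_, ?_, ?_⟩
  · intro ζ hζ
    simp only [hZ, Finset.mem_image, Finset.mem_filter, Finset.mem_product] at hζ
    obtain ⟨⟨α, y⟩, ⟨⟨h1, h2⟩, h3⟩, rfl⟩ := hζ
    exact ⟨α, y, h2, rfl⟩
  · intro ζ hζ hζZ
    rw [hN ζ hζ]
    refine Finset.sum_eq_zero fun α hα => Finset.sum_eq_zero fun y hy => ?_
    rw [Finset.mem_filter] at hy
    refine (hζZ ?_).elim
    rw [← hy.2]
    exact hmaps α hα y (Finset.mem_filter.2 ⟨hy.1, by rw [hy.2]; exact hζ.2⟩)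
  · rw [Finset.sum_congr rfl fun ζ hζ => hN ζ (hZP ζ hζ), Finset.sum_comm]
    refine Finset.sum_eq_zero fun α hα => ?_
    rw [← hdeg α P, ← Finset.sum_fiberwise_of_maps_to (hmaps α hα)]
    exact Finset.sum_congr rfl fun ζ hζ => by rw [hfilter ζ hζ]
  · intro h hh
    have e1 : ∀ ζ ∈ Z, h ζ ^ orbitMult act D ζ =
        ∏ α ∈ A, ∏ y ∈ D.support with act α y = ζ, h ζ ^ D y := by
      intro ζ hζ
      rw [hN ζ (hZP ζ hζ), zpow_sum_of_ne _ _ (hh ζ hζ)]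
      exact Finset.prod_congr rfl fun α _ => zpow_sum_of_ne _ _ (hh ζ hζ)
    rw [Finset.prod_congr rfl e1, Finset.prod_comm]
    refine Finset.prod_congr rfl fun α hα => ?_
    rw [← Finset.prod_fiberwise_of_maps_to (hmaps α hα)]
    refine Finset.prod_congr rfl fun ζ hζ => ?_
    rw [hfilter ζ hζ]
    refine Finset.prod_congr rfl fun y hy => ?_
    rw [(Finset.mem_filter.1 hy).2]

open Classical in
/-- The theta product of a divisor of strong degree zero can be computed part by part. -/
theorem exists_hasProd_theta [CompleteSpace F]
    (hirr : ∀ α, ∀ y ∈ D.support, Irrat p (act α y))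
    (hfin : ∀ M : ℝ, {α | ∃ y ∈ D.support, Bdd p M (act α y)}.Finite) (s : ℤ)
    (hdeg : ∀ α P, ∑ y ∈ D.support with lab p s (act α y) = P, D y = 0)
    {η η' : F} (hη : Irrat p η) (hη' : Irrat p η')
    (hne : ∀ α, ∀ y ∈ D.support, act α y ≠ η ∧ act α y ≠ η') :
    ∃ J : F, HasProd (fun α => ∏ y ∈ D.support, twoPoint η η' (act α y) ^ D y) J ∧
      HasProd (fun P => ∏ᶠ ζ ∈ part p s P, twoPoint η η' ζ ^ orbitMult act D ζ) J := by
  set f : G × (ℤ × Set ℚ_[p]) → F := fun q =>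
    ∏ y ∈ D.support with lab p s (act q.1 y) = q.2, twoPoint η η' (act q.1 y) ^ D y with hf
  have hmul : Multipliable f := by
    refine multipliable_of_tendsto_cofinite fun ε hε => ?_
    obtain ⟨M, hM⟩ := exists_prod_twoPoint_near X hη hη' hε
    refine (((hfin M).toFinset ×ˢ D.support).image
      fun q => (q.1, lab p s (act q.1 q.2))).finite_toSet.subset ?_
    rintro ⟨α, P⟩ hbad
    by_contra hcon
    refine hbad (hM s _ _ _ ?_ ?_ (hdeg α P) ?_)
    · intro y hy
      exact ⟨hirr α y (Finset.mem_filter.1 hy).1, hne α y (Finset.mem_filter.1 hy).1⟩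
    · intro y hy y' hy'
      rw [(Finset.mem_filter.1 hy).2, (Finset.mem_filter.1 hy').2]
    · intro y hy hB
      rw [Finset.mem_filter] at hy
      refine hcon ?_
      simp only [Finset.coe_image, Set.mem_image, Finset.mem_coe, Finset.mem_product,
        Set.Finite.mem_toFinset]
      exact ⟨(α, y), ⟨⟨y, hy.1, hB⟩, hy.1⟩, by rw [hy.2]⟩
  obtain ⟨J, hJ⟩ := hmul
  refine ⟨J, ?_, ?_⟩
  · refine hJ.prod_fiberwise fun α => ?_
    have := hasProd_prod_of_ne_finset_one (f := fun P => f (α, P))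
      (s := D.support.image fun y => lab p s (act α y)) (L := SummationFilter.unconditional _)
      (fun P hP => by
        refine Finset.prod_eq_one fun y hy => ?_
        rw [Finset.mem_filter] at hy
        exact (hP (Finset.mem_image.2 ⟨y, hy⟩)).elim)
    convert this using 1
    rw [← Finset.prod_fiberwise_of_maps_to (g := fun y => lab p s (act α y))
      (t := D.support.image fun y => lab p s (act α y))
      (fun y hy => Finset.mem_image_of_mem _ hy)]
  · have hJ' : HasProd (fun q : (ℤ × Set ℚ_[p]) × G => f (q.2, q.1)) J :=
      ((Equiv.prodComm (ℤ × Set ℚ_[p]) G).hasProd_iff (f := f)).2 hJ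
    refine hJ'.prod_fiberwise fun P => ?_
    obtain ⟨A, Z, hA, hZ, hZa, hZ0, -, hprod⟩ := exists_orbitMult_part hirr hfin s hdeg P
    have := hasProd_prod_of_ne_finset_one (f := fun α => f (α, P))
      (s := A) (L := SummationFilter.unconditional _)
      (fun α hα => by
        refine Finset.prod_eq_one fun y hy => ?_
        rw [Finset.mem_filter] at hy
        exact (hα (hA α ⟨y, hy⟩)).elim)
    convert this using 1
    rw [finprod_mem_eq_prod_of_subset (t := Z)]
    · refine (hprod _ fun ζ hζ => ?_).symm
      obtain ⟨α, y, hy, rfl⟩ := hZa ζ hζ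
      exact twoPoint_ne_zero (hne α y hy).1 (hne α y hy).2
    · rintro ζ ⟨h1, h2⟩
      rw [Function.mem_mulSupport] at h2
      by_contra hcon
      exact h2 (by rw [hZ0 ζ h1 hcon, zpow_zero])
    · exact fun ζ hζ => hZ ζ hζ

end Orbit

end Theta

/-! ### Products over the orbits of a hyperbolic element -/

section Telescope

variable {p : ℕ} [Fact p.Prime] {F : Type*} [NormedField F] [NormedAlgebra ℚ_[p] F]
  [IsUltrametricDist F]

local notation "ι" => algebraMap ℚ_[p] F

variable {c : ℚ_[p]} {t : ℕ}

theorem zpow_norm (hc : ‖c‖ = (p : ℝ) ^ (2 * t)) (k : ℤ) :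
    ‖c ^ k‖ = (p : ℝ) ^ (2 * (t : ℤ) * k) := by
  rw [norm_zpow, hc, ← zpow_natCast, ← zpow_mul]
  push_cast
  rfl

theorem ne_zero_of_norm (hc : ‖c‖ = (p : ℝ) ^ (2 * t)) : c ≠ 0 :=
  norm_pos_iff.1 (hc ▸ pow_pos p_pos _)

variable (p) in
/-- The labels of level in `[0, 2t)`. -/
abbrev FundLabel (t : ℕ) : Type := {P : ℤ × Set ℚ_[p] // 0 ≤ P.1 ∧ P.1 < 2 * t}

/-- The action of the powers of `c` on labels. -/
def labShift (c : ℚ_[p]) (t : ℕ) (k : ℤ) (P : ℤ × Set ℚ_[p]) : ℤ × Set ℚ_[p] :=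
  (P.1 - 2 * t * k, {b | c ^ (-k) * b ∈ P.2})

theorem labShift_add (hc : c ≠ 0) (k l : ℤ) (P : ℤ × Set ℚ_[p]) :
    labShift c t k (labShift c t l P) = labShift c t (k + l) P := by
  refine Prod.ext ?_ ?_
  · simp only [labShift]; ring
  · ext b
    simp only [labShift, Set.mem_ofPred_eq]
    rw [← mul_assoc, ← zpow_add₀ hc, neg_add_rev]

theorem labShift_zero (P : ℤ × Set ℚ_[p]) : labShift c t 0 P = P := by
  refine Prod.ext ?_ ?_ <;> simp [labShift]

theorem lab_zpow_mul (hc : ‖c‖ = (p : ℝ) ^ (2 * t)) (s k : ℤ) {ζ : F} (h : Irrat p ζ) :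
    lab p s (ι (c ^ k) * ζ) = labShift c t k (lab p s ζ) := by
  have hc0 := ne_zero_of_norm hc
  have hn := zpow_norm hc k
  have hlev := lev_mul s h (n := 2 * t * k) ⟨t * k, by ring⟩ hn
  refine Prod.ext hlev ?_
  ext b
  simp only [labShift, Set.mem_ofPred_eq, lab, hlev]
  have e : ι (c ^ k) * ζ - ι b = ι (c ^ k) * (ζ - ι (c ^ (-k) * b)) := by
    rw [mul_sub, ← map_mul, ← mul_assoc, ← zpow_add₀ hc0, add_neg_cancel, zpow_zero, one_mul]
  rw [e, norm_mul, norm_algebraMap', hn,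
    show 1 - (lev p s ζ - 2 * t * k) = 2 * t * k + (1 - lev p s ζ) by ring,
    zpow_add₀ p_pos.ne']
  exact mul_lt_mul_iff_right₀ (p_zpow_pos _)

theorem mem_part_shift (hc : ‖c‖ = (p : ℝ) ^ (2 * t)) (s k : ℤ) (P : ℤ × Set ℚ_[p]) (ζ : F) :
    ι (c ^ k) * ζ ∈ part p s (labShift c t k P) ↔ ζ ∈ part p s P := by
  have hc0 := ne_zero_of_norm hc
  have hck : c ^ k ≠ 0 := zpow_ne_zero _ hc0
  constructor
  · rintro ⟨h1, h2⟩
    have h3 : Irrat p ζ := by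
      have := irrat_mul h1 (inv_ne_zero hck)
      rwa [← mul_assoc, ← map_mul, inv_mul_cancel₀ hck, map_one, one_mul] at this
    refine ⟨h3, ?_⟩
    rw [lab_zpow_mul hc s k h3] at h2
    have := congrArg (labShift c t (-k)) h2
    rwa [labShift_add hc0, labShift_add hc0, neg_add_cancel, labShift_zero, labShift_zero] at this
  · rintro ⟨h1, h2⟩
    exact ⟨irrat_mul h1 hck, by rw [lab_zpow_mul hc s k h1, h2]⟩

/-- Every label is a unique translate of one of level in `[0, 2t)`. -/
def labEquiv (hc : c ≠ 0) (ht : 0 < t) : FundLabel p t × ℤ ≃ ℤ × Set ℚ_[p] where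
  toFun q := labShift c t q.2 q.1.1
  invFun P := (⟨labShift c t (P.1 / (2 * t)) P, by
    have ht' : (0 : ℤ) < 2 * t := by positivity
    have h1 := Int.emod_nonneg P.1 ht'.ne'
    have h2 := Int.emod_lt_of_pos P.1 ht'
    rw [Int.emod_def] at h1 h2
    exact ⟨h1, h2⟩⟩, -(P.1 / (2 * t)))
  left_inv := by
    rintro ⟨⟨P, hP0, hP1⟩, k⟩
    have hk : (P.1 - 2 * t * k) / (2 * t) = -k := by
      rw [show P.1 - 2 * t * k = P.1 + 2 * t * (-k) by ring,
        Int.add_mul_ediv_left _ _ (by positivity), Int.ediv_eq_zero_of_lt hP0 hP1, zero_add]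
    have hk' : (labShift c t k P).1 / (2 * t) = -k := hk
    refine Prod.ext (Subtype.ext ?_) ?_
    · change labShift c t ((labShift c t k P).1 / (2 * t)) (labShift c t k P) = P
      rw [hk', labShift_add hc, neg_add_cancel, labShift_zero]
    · change -((labShift c t k P).1 / (2 * t)) = k
      rw [hk', neg_neg]
  right_inv := by
    intro P
    change labShift c t (-(P.1 / (2 * t))) (labShift c t (P.1 / (2 * t)) P) = P
    rw [labShift_add hc, neg_add_cancel, labShift_zero]

theorem twoPoint_smul {a : F} (ha : a ≠ 0) (η η' ζ : F) :
    twoPoint η η' (a * ζ) = (ζ - a⁻¹ * η') / (ζ - a⁻¹ * η) := by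
  have e : ∀ x : F, a * ζ - x = a * (ζ - a⁻¹ * x) := fun x => by
    rw [mul_sub, mul_inv_cancel_left₀ ha]
  rw [twoPoint, e, e, mul_div_mul_left _ _ ha]

theorem prod_twoPoint_telescope (hc : c ≠ 0) (η ζ : F) (h : ∀ k : ℤ, ζ ≠ ι (c ^ k) * η) (K : ℕ) :
    ∏ k ∈ Finset.Ico (-K : ℤ) K, twoPoint η (ι c * η) (ι (c ^ k) * ζ) =
      (ζ - ι (c ^ ((K : ℤ) + 1)) * η) / (ζ - ι (c ^ (-(K : ℤ) + 1)) * η) := by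
  have hι : ∀ k : ℤ, ι (c ^ k) ≠ 0 := fun k => (map_ne_zero _).2 (zpow_ne_zero k hc)
  have hw : ∀ k : ℤ, ζ - ι (c ^ k) * η ≠ 0 := fun k => sub_ne_zero.2 (h k)
  have hg : ∀ k : ℤ, twoPoint η (ι c * η) (ι (c ^ k) * ζ) =
      (ζ - ι (c ^ (-k + 1)) * η) / (ζ - ι (c ^ (-k)) * η) := by
    intro k
    rw [twoPoint_smul (hι k), ← map_inv₀, ← zpow_neg, ← mul_assoc, ← map_mul, zpow_add₀ hc,
      zpow_one]
  induction K with
  | zero => simpa using (div_self (hw 1)).symm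
  | succ K ih =>
    have e : Finset.Ico (-((K + 1 : ℕ) : ℤ)) ((K + 1 : ℕ) : ℤ) =
        insert (-(K : ℤ) - 1) (insert (K : ℤ) (Finset.Ico (-K : ℤ) K)) := by
      ext x
      simp only [Finset.mem_Ico, Finset.mem_insert]
      push_cast
      omega
    rw [e, Finset.prod_insert, Finset.prod_insert, ih, hg, hg]
    · rw [Nat.cast_add, Nat.cast_one, show -(-(K : ℤ) - 1) + 1 = (K : ℤ) + 1 + 1 by ring,
        show -(-(K : ℤ) - 1) = (K : ℤ) + 1 by ring, show -((K : ℤ) + 1) + 1 = -(K : ℤ) by ring]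
      have h1 := hw ((K : ℤ) + 1)
      have h2 := hw (-(K : ℤ) + 1)
      have h3 := hw (-(K : ℤ))
      generalize ζ - ι (c ^ ((K : ℤ) + 1)) * η = w₁ at *
      generalize ζ - ι (c ^ (-(K : ℤ) + 1)) * η = w₂ at *
      generalize ζ - ι (c ^ (-(K : ℤ))) * η = w₃ at *
      field_simp
    · simp
    · simp only [Finset.mem_Ico, Finset.mem_insert]
      omega

theorem tendsto_Ico_int : Tendsto (fun K : ℕ => Finset.Ico (-K : ℤ) K) atTop atTop := by
  refine tendsto_atTop_finset_of_monotone ?_ ?_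
  · intro a b hab
    refine Finset.Ico_subset_Ico ?_ ?_ <;> omega
  · intro x
    refine ⟨x.natAbs + 1, ?_⟩
    rw [Finset.mem_Ico]
    omega

theorem hasProd_twoPoint_zpow [CompleteSpace F] (hc : ‖c‖ = (p : ℝ) ^ (2 * t)) (ht : 0 < t)
    {η : F} (hη : Irrat p η) (s : ℤ) (Z : Finset F) (n : F → ℤ) (h0 : ∑ ζ ∈ Z, n ζ = 0)
    (hl : ∀ ζ ∈ Z, ∀ ζ' ∈ Z, lab p s ζ = lab p s ζ') (hirr : ∀ ζ ∈ Z, Irrat p ζ)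
    (hne : ∀ ζ ∈ Z, ∀ k : ℤ, ζ ≠ ι (c ^ k) * η) :
    HasProd (fun k : ℤ => ∏ ζ ∈ Z, twoPoint η (ι c * η) (ι (c ^ k) * ζ) ^ n ζ)
      (∏ ζ ∈ Z, ζ ^ (-n ζ)) := by
  have hp := p_pos (p := p)
  have hc0 := ne_zero_of_norm hc
  have hck : ∀ k : ℤ, c ^ k ≠ 0 := fun k => zpow_ne_zero k hc0
  have hιc : ι c ≠ 0 := by simpa using hc0
  have hmul : Multipliable (fun k : ℤ => ∏ ζ ∈ Z, twoPoint η (ι c * η) (ι (c ^ k) * ζ) ^ n ζ) := by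
    rcases Z.eq_empty_or_nonempty with rfl | ⟨ζ₀, hζ₀⟩
    · simp [multipliable_one]
    refine multipliable_of_tendsto_cofinite fun ε hε => ?_
    obtain ⟨M, hM⟩ := exists_prod_twoPoint_near F hη (irrat_mul hη hc0) hε
    have hfin : {k : ℤ | ∃ ζ ∈ Z, Bdd p M (ι (c ^ k) * ζ)}.Finite := by
      have : {k : ℤ | ∃ ζ ∈ Z, Bdd p M (ι (c ^ k) * ζ)} =
          ⋃ ζ ∈ Z, {k : ℤ | Bdd p M (ι (c ^ k) * ζ)} := by
        ext k; simp
      rw [this]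
      refine Set.Finite.biUnion Z.finite_toSet fun ζ hζ => ?_
      have hi := hirr ζ hζ
      have hz : 0 < ‖ζ‖ := norm_pos_iff.2 hi.ne_zero
      have hr := rho_pos hi
      have hbig : ∀ B : ℝ, ∃ m : ℕ, B < (p : ℝ) ^ m := fun B =>
        pow_unbounded_of_one_lt B one_lt_p
      obtain ⟨m₁, hm₁⟩ := hbig (M / ‖ζ‖)
      obtain ⟨m₂, hm₂⟩ := hbig (M * rho p ζ)
      refine (Set.finite_Icc (-(m₂ : ℤ)) m₁).subset ?_
      rintro k ⟨hk1, hk2⟩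
      rw [norm_mul, norm_algebraMap', zpow_norm hc] at hk1
      rw [rho_mul _ (hck k), zpow_norm hc] at hk2
      have hM0 : 0 < M := (mul_pos (p_zpow_pos _) hz).trans_le hk1
      rw [← le_div_iff₀ hz] at hk1
      have h1 := hk1.trans_lt hm₁
      rw [← zpow_natCast, p_zpow_lt] at h1
      have h2 : (p : ℝ) ^ (-(2 * (t : ℤ) * k)) ≤ M * rho p ζ := by
        rw [zpow_neg, inv_le_iff_one_le_mul₀ (p_zpow_pos _)]
        calc (1 : ℝ) = M * M⁻¹ := by field_simp
          _ ≤ M * ((p : ℝ) ^ (2 * (t : ℤ) * k) * rho p ζ) := by gcongr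
          _ = _ := by ring
      have h3 := h2.trans_lt hm₂
      rw [← zpow_natCast, p_zpow_lt] at h3
      have ht' : (1 : ℤ) ≤ t := by exact_mod_cast ht
      rw [Set.mem_Icc]
      constructor
      · nlinarith
      · nlinarith
    refine hfin.subset fun k hk => ?_
    by_contra hcon
    refine hk (hM s Z _ n ?_ ?_ h0 ?_)
    · intro ζ hζ
      refine ⟨irrat_mul (hirr ζ hζ) (hck k), fun h => ?_, fun h => ?_⟩
      · refine hne ζ hζ (-k) ?_
        rw [← h, ← mul_assoc, ← map_mul, ← zpow_add₀ hc0, neg_add_cancel, zpow_zero, map_one,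
          one_mul]
      · refine hne ζ hζ (-k + 1) ?_
        rw [zpow_add₀ hc0, zpow_one, map_mul, mul_assoc, ← h, ← mul_assoc, ← map_mul,
          ← zpow_add₀ hc0, neg_add_cancel, zpow_zero, map_one, one_mul]
    · intro ζ hζ ζ' hζ'
      rw [lab_zpow_mul hc s k (hirr ζ hζ), lab_zpow_mul hc s k (hirr ζ' hζ'), hl ζ hζ ζ' hζ']
    · intro ζ hζ hB
      exact hcon ⟨ζ, hζ, hB⟩
  obtain ⟨J, hJ⟩ := hmul
  have h1 : Tendsto (fun K : ℕ => ∏ k ∈ Finset.Ico (-K : ℤ) K,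
      ∏ ζ ∈ Z, twoPoint η (ι c * η) (ι (c ^ k) * ζ) ^ n ζ) atTop (𝓝 J) := by
    have hJ' := hJ
    unfold HasProd at hJ'
    rw [SummationFilter.unconditional_filter] at hJ'
    exact hJ'.comp tendsto_Ico_int
  have h2 : Tendsto (fun K : ℕ => ∏ k ∈ Finset.Ico (-K : ℤ) K,
      ∏ ζ ∈ Z, twoPoint η (ι c * η) (ι (c ^ k) * ζ) ^ n ζ) atTop (𝓝 (∏ ζ ∈ Z, ζ ^ (-n ζ))) := by
    have hη0 : η ≠ 0 := hη.ne_zero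
    have e : ∀ K : ℕ, ∏ k ∈ Finset.Ico (-K : ℤ) K,
        ∏ ζ ∈ Z, twoPoint η (ι c * η) (ι (c ^ k) * ζ) ^ n ζ =
        ∏ ζ ∈ Z, ((1 - ι c⁻¹ ^ (K + 1) * (ζ / η)) /
          (ζ - ι c⁻¹ ^ K * (ι c * η))) ^ n ζ := by
      intro K
      rw [Finset.prod_comm]
      have hx : -(ι (c ^ ((K : ℤ) + 1)) * η) ≠ 0 :=
        neg_ne_zero.2 (mul_ne_zero ((map_ne_zero _).2 (hck _)) hη0)
      have : ∏ ζ ∈ Z, ∏ k ∈ Finset.Ico (-K : ℤ) K,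
          twoPoint η (ι c * η) (ι (c ^ k) * ζ) ^ n ζ =
          ∏ ζ ∈ Z, ((ζ - ι (c ^ ((K : ℤ) + 1)) * η) / (ζ - ι (c ^ (-(K : ℤ) + 1)) * η)) ^ n ζ :=
        Finset.prod_congr rfl fun ζ hζ => by
          rw [← prod_twoPoint_telescope hc0 η ζ (hne ζ hζ) K, ← Finset.prod_zpow]
      rw [this, prod_zpow_ratio Z _ n h0 hx]
      refine Finset.prod_congr rfl fun ζ hζ => ?_
      congr 1
      have e1 : ι (c ^ ((K : ℤ) + 1)) = ι c ^ (K + 1) := by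
        rw [← map_pow]; norm_cast
      have e2 : ι (c ^ (-(K : ℤ) + 1)) * η = ι c⁻¹ ^ K * (ι c * η) := by
        rw [zpow_add₀ hc0, zpow_neg, zpow_natCast, zpow_one, map_mul, map_inv₀, map_pow, map_inv₀,
          inv_pow, mul_assoc]
      have h3 : ζ - ι c⁻¹ ^ K * (ι c * η) ≠ 0 := by
        rw [← e2]; exact sub_ne_zero.2 (hne ζ hζ _)
      have e3 : ι c⁻¹ ^ (K + 1) = (ι c ^ (K + 1))⁻¹ := by rw [map_inv₀, inv_pow]
      have h4 : ι c ^ (K + 1) ≠ 0 := pow_ne_zero _ hιc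
      rw [e1, e2, e3]
      generalize ι c ^ (K + 1) = A at *
      generalize ζ - ι c⁻¹ ^ K * (ι c * η) = w at *
      field_simp
      ring
    simp_rw [e]
    have hlim : Tendsto (fun K : ℕ => ι c⁻¹ ^ K) atTop (𝓝 0) := by
      apply tendsto_pow_atTop_nhds_zero_of_norm_lt_one
      rw [norm_algebraMap', norm_inv, hc]
      exact inv_lt_one_of_one_lt₀ (one_lt_pow₀ one_lt_p (by omega))
    refine tendsto_finsetProd _ fun ζ hζ => ?_
    have hz := (hirr ζ hζ).ne_zero
    have h4 : Tendsto (fun K : ℕ => (1 - ι c⁻¹ ^ (K + 1) * (ζ / η)) /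
        (ζ - ι c⁻¹ ^ K * (ι c * η))) atTop (𝓝 ((1 - 0 * (ζ / η)) / (ζ - 0 * (ι c * η)))) := by
      refine Tendsto.div ?_ ?_ (by simpa using hz)
      · exact tendsto_const_nhds.sub (((tendsto_add_atTop_iff_nat 1).2 hlim).mul_const _)
      · exact tendsto_const_nhds.sub (hlim.mul_const _)
    have h5 := h4.zpow₀ (n ζ) (Or.inl (by simpa using hz))
    convert h5 using 2
    rw [zero_mul, zero_mul, sub_zero, sub_zero, one_div, inv_zpow, zpow_neg]
  rw [tendsto_nhds_unique h2 h1]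
  exact hJ

/-- The product of a theta function over all parts of the partition, computed on a fundamental
domain for a hyperbolic element. -/
theorem hasProd_fundLabel [CompleteSpace F] (hc : ‖c‖ = (p : ℝ) ^ (2 * t)) (ht : 0 < t)
    {η : F} (hη : Irrat p η) (s : ℤ) (n : F → ℤ) (hn : ∀ ζ, n (ι c * ζ) = n ζ)
    (hη0 : ∀ k : ℤ, n (ι (c ^ k) * η) = 0)
    (hZ : ∀ P, ∃ Z : Finset F, (∀ ζ ∈ Z, ζ ∈ part p s P) ∧
      (∀ ζ ∈ part p s P, ζ ∉ Z → n ζ = 0) ∧ ∑ ζ ∈ Z, n ζ = 0) {J : F}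
    (hJ : HasProd (fun P => ∏ᶠ ζ ∈ part p s P, twoPoint η (ι c * η) ζ ^ n ζ) J) :
    HasProd (fun P : FundLabel p t => ∏ᶠ ζ ∈ part (F := F) p s P.1, ζ ^ (-n ζ)) J := by
  classical
  have hc0 := ne_zero_of_norm hc
  have hck : ∀ k : ℤ, c ^ k ≠ 0 := fun k => zpow_ne_zero k hc0
  have hι : ∀ k : ℤ, ι (c ^ k) ≠ 0 := fun k => (map_ne_zero _).2 (hck k)
  have hnk : ∀ k : ℤ, ∀ ζ, n (ι (c ^ k) * ζ) = n ζ := by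
    intro k
    induction k with
    | zero => simp
    | succ k ih =>
      intro ζ
      rw [add_comm, zpow_add₀ hc0, map_mul, mul_assoc, zpow_one, hn, ih]
    | pred k ih =>
      intro ζ
      rw [← hn, ← mul_assoc, ← map_mul, mul_comm c, ← zpow_add_one₀ hc0, sub_add_cancel, ih]
  have hJ' := ((labEquiv (p := p) hc0 ht).hasProd_iff
    (f := fun P => ∏ᶠ ζ ∈ part p s P, twoPoint η (ι c * η) ζ ^ n ζ)).2 hJ
  refine hJ'.prod_fiberwise fun P => ?_
  obtain ⟨Z, hZ1, hZ2, hZ3⟩ := hZ P.1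
  set Z' := Z.filter fun ζ => n ζ ≠ 0 with hZ'
  have hZ3' : ∑ ζ ∈ Z', n ζ = 0 := by rw [hZ', Finset.sum_filter_ne_zero, hZ3]
  have hmain := hasProd_twoPoint_zpow hc ht hη s Z' n hZ3'
    (fun ζ hζ ζ' hζ' => by
      rw [(hZ1 ζ (Finset.mem_filter.1 hζ).1).2, (hZ1 ζ' (Finset.mem_filter.1 hζ').1).2])
    (fun ζ hζ => (hZ1 ζ (Finset.mem_filter.1 hζ).1).1)
    (fun ζ hζ k h => (Finset.mem_filter.1 hζ).2 (by rw [h, hη0]))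
  have e0 : ∏ᶠ ζ ∈ part (F := F) p s P.1, ζ ^ (-n ζ) = ∏ ζ ∈ Z', ζ ^ (-n ζ) := by
    refine finprod_mem_eq_prod_of_subset _ ?_ ?_
    · rintro ζ ⟨h1, h2⟩
      rw [Function.mem_mulSupport] at h2
      have h3 : n ζ ≠ 0 := fun h => h2 (by rw [h, neg_zero, zpow_zero])
      have h4 : ζ ∈ Z := by
        by_contra hcon; exact h3 (hZ2 ζ h1 hcon)
      exact Finset.mem_coe.2 (Finset.mem_filter.2 ⟨h4, h3⟩)
    · intro ζ hζ
      exact hZ1 ζ (Finset.mem_filter.1 hζ).1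
  rw [e0]
  convert hmain using 2 with k
  have e1 : ∏ᶠ ζ ∈ part p s (labShift c t k P.1), twoPoint η (ι c * η) ζ ^ n ζ =
      ∏ ζ ∈ Z'.image fun ζ => ι (c ^ k) * ζ, twoPoint η (ι c * η) ζ ^ n ζ := by
    refine finprod_mem_eq_prod_of_subset _ ?_ ?_
    · rintro ζ ⟨h1, h2⟩
      rw [Function.mem_mulSupport] at h2
      have h3 : n ζ ≠ 0 := fun h => h2 (by rw [h, zpow_zero])
      have h5 : ζ = ι (c ^ k) * ((ι (c ^ k))⁻¹ * ζ) := by rw [mul_inv_cancel_left₀ (hι k)]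
      rw [h5] at h1
      rw [mem_part_shift hc] at h1
      have h6 : n ((ι (c ^ k))⁻¹ * ζ) ≠ 0 := by rw [← hnk k, ← h5]; exact h3
      have h4 : (ι (c ^ k))⁻¹ * ζ ∈ Z := by
        by_contra hcon; exact h6 (hZ2 _ h1 hcon)
      rw [Finset.mem_coe, Finset.mem_image]
      exact ⟨_, Finset.mem_filter.2 ⟨h4, h6⟩, h5.symm⟩
    · intro ζ hζ
      rw [Finset.mem_coe, Finset.mem_image] at hζ
      obtain ⟨x, hx, rfl⟩ := hζ
      exact (mem_part_shift hc s k P.1 x).2 (hZ1 x (Finset.mem_filter.1 hx).1)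
  change ∏ᶠ ζ ∈ part p s (labShift c t k P.1), twoPoint η (ι c * η) ζ ^ n ζ = _
  rw [e1, Finset.prod_image fun x _ y _ hxy => mul_left_cancel₀ (hι k) hxy]
  exact Finset.prod_congr rfl fun ζ _ => by rw [hnk]

end Telescope

/-! ### Frames of the quadratic space of trace zero quaternions -/

section Frames

variable {a b : ℚ} {K : Type*} [Field K] [Algebra ℚ K]

theorem quadForm_eq (v : Vec K) : quadForm a b v =
    -(algebraMap ℚ K a) * v 0 ^ 2 - algebraMap ℚ K b * v 1 ^ 2 +
      algebraMap ℚ K a * algebraMap ℚ K b * v 2 ^ 2 := by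
  simp [quadForm, nrd, toQuat]; ring

theorem pairing_eq (v w : Vec K) : pairing a b v w =
    2 * (-(algebraMap ℚ K a) * (v 0 * w 0) - algebraMap ℚ K b * (v 1 * w 1) +
      algebraMap ℚ K a * algebraMap ℚ K b * (v 2 * w 2)) := by
  simp only [pairing, quadForm_eq, Pi.add_apply]; ring

theorem pairing_comm (v w : Vec K) : pairing a b v w = pairing a b w v := by
  simp only [pairing_eq]; ring

theorem pairing_add_left (v v' w : Vec K) :
    pairing a b (v + v') w = pairing a b v w + pairing a b v' w := by
  simp only [pairing_eq, Pi.add_apply]; ring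

theorem pairing_smul_left (c : K) (v w : Vec K) :
    pairing a b (c • v) w = c * pairing a b v w := by
  simp only [pairing_eq, Pi.smul_apply, smul_eq_mul]; ring

theorem pairing_add_right (v w w' : Vec K) :
    pairing a b v (w + w') = pairing a b v w + pairing a b v w' := by
  simp only [pairing_eq, Pi.add_apply]; ring

theorem pairing_smul_right (c : K) (v w : Vec K) :
    pairing a b v (c • w) = c * pairing a b v w := by
  simp only [pairing_eq, Pi.smul_apply, smul_eq_mul]; ring

theorem pairing_sub_left (v v' w : Vec K) :
    pairing a b (v - v') w = pairing a b v w - pairing a b v' w := by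
  simp only [pairing_eq, Pi.sub_apply]; ring

theorem pairing_zero_left (w : Vec K) : pairing a b 0 w = 0 := by simp [pairing_eq]

theorem pairing_self (v : Vec K) : pairing a b v v = 2 * quadForm a b v := by
  simp only [pairing_eq, quadForm_eq]; ring

theorem quadForm_smul (c : K) (v : Vec K) : quadForm a b (c • v) = c ^ 2 * quadForm a b v := by
  simp only [quadForm_eq, Pi.smul_apply, smul_eq_mul]; ring

theorem quadForm_add (v w : Vec K) :
    quadForm a b (v + w) = quadForm a b v + quadForm a b w + pairing a b v w := by
  simp only [pairing]; ring

variable (a b) in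
/-- A basis consisting of two isotropic vectors and a vector orthogonal to them. -/
structure IsFrame (wp e wm : Vec K) : Prop where
  quad_wp : quadForm a b wp = 0
  quad_wm : quadForm a b wm = 0
  pair_wp_e : pairing a b wp e = 0
  pair_wm_e : pairing a b wm e = 0
  pair_ne : pairing a b wp wm ≠ 0
  quad_e_ne : quadForm a b e ≠ 0

variable {wp e wm : Vec K}

theorem two_ne_zero_of_rat : (2 : K) ≠ 0 := by
  have : CharZero K := algebraRat.charZero K
  exact two_ne_zero

/-- The coordinates with respect to a frame. -/
def coordP (a b : ℚ) (wp e wm x : Vec K) : K := pairing a b wm x / pairing a b wp wm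

/-- The middle coordinate with respect to a frame. -/
def coordE (a b : ℚ) (wp e wm x : Vec K) : K := pairing a b e x / (2 * quadForm a b e)

/-- The last coordinate with respect to a frame. -/
def coordM (a b : ℚ) (wp e wm x : Vec K) : K := pairing a b wp x / pairing a b wp wm

namespace IsFrame

variable (h : IsFrame a b wp e wm)
include h

theorem pairing_comb (x y z : K) (v : Vec K) :
    pairing a b (x • wp + y • e + z • wm) v =
      x * pairing a b wp v + y * pairing a b e v + z * pairing a b wm v := by
  simp only [pairing_add_left, pairing_smul_left]

theorem pair_wp (x y z : K) :
    pairing a b wp (x • wp + y • e + z • wm) = z * pairing a b wp wm := by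
  rw [pairing_comm, h.pairing_comb, pairing_self, h.quad_wp, pairing_comm e, h.pair_wp_e,
    pairing_comm wm]
  ring

theorem pair_wm (x y z : K) :
    pairing a b wm (x • wp + y • e + z • wm) = x * pairing a b wp wm := by
  rw [pairing_comm, h.pairing_comb, pairing_self, h.quad_wm, pairing_comm e, h.pair_wm_e]
  ring

theorem pair_e (x y z : K) :
    pairing a b e (x • wp + y • e + z • wm) = y * (2 * quadForm a b e) := by
  rw [pairing_comm, h.pairing_comb, pairing_self, h.pair_wp_e, h.pair_wm_e]
  ring

theorem coordP_comb (x y z : K) : coordP a b wp e wm (x • wp + y • e + z • wm) = x := by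
  rw [coordP, h.pair_wm, mul_div_cancel_right₀ _ h.pair_ne]

theorem coordM_comb (x y z : K) : coordM a b wp e wm (x • wp + y • e + z • wm) = z := by
  rw [coordM, h.pair_wp, mul_div_cancel_right₀ _ h.pair_ne]

theorem coordE_comb (x y z : K) : coordE a b wp e wm (x • wp + y • e + z • wm) = y := by
  rw [coordE, h.pair_e, mul_div_cancel_right₀ _ (mul_ne_zero two_ne_zero_of_rat h.quad_e_ne)]

theorem quadForm_comb (x y z : K) : quadForm a b (x • wp + y • e + z • wm) =
    y ^ 2 * quadForm a b e + x * z * pairing a b wp wm := by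
  simp only [quadForm_add, quadForm_smul, h.quad_wp, h.quad_wm, pairing_add_left,
    pairing_smul_left, pairing_smul_right, h.pair_wp_e, pairing_comm e wm, h.pair_wm_e]
  ring

theorem eq_zero_of_pairing {x : Vec K} (h1 : pairing a b wp x = 0) (h2 : pairing a b e x = 0)
    (h3 : pairing a b wm x = 0) : x = 0 := by
  set M : Matrix (Fin 3) (Fin 3) K := !![wp 0, wp 1, wp 2; e 0, e 1, e 2; wm 0, wm 1, wm 2] with hM
  set A := algebraMap ℚ K a
  set B := algebraMap ℚ K b
  set T : Matrix (Fin 3) (Fin 3) K := !![-2 * A, 0, 0; 0, -2 * B, 0; 0, 0, 2 * A * B] with hT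
  have hG : M * T * M.transpose =
      !![0, 0, pairing a b wp wm; 0, 2 * quadForm a b e, 0; pairing a b wp wm, 0, 0] := by
    have e1 := h.quad_wp
    have e2 := h.quad_wm
    have e3 := h.pair_wp_e
    have e4 := h.pair_wm_e
    rw [quadForm_eq] at e1 e2
    rw [pairing_eq] at e3 e4
    rw [quadForm_eq, pairing_eq]
    change -A * _ - B * _ + A * B * _ = 0 at e1 e2
    change 2 * (-A * _ - B * _ + A * B * _) = 0 at e3 e4
    change _ = !![0, 0, 2 * (-A * _ - B * _ + A * B * _);
      0, 2 * (-A * _ - B * _ + A * B * _), 0; 2 * (-A * _ - B * _ + A * B * _), 0, 0]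
    clear_value A B
    ext i j
    fin_cases i <;> fin_cases j <;>
      simp [M, T, Matrix.mul_apply, Fin.sum_univ_three] <;>
      first
        | linear_combination 2 * e1
        | linear_combination 2 * e2
        | linear_combination e3
        | linear_combination e4
        | ring
  have hdet : (M * T).det ≠ 0 := by
    intro h0
    have h1 := congrArg Matrix.det hG
    rw [Matrix.det_mul, h0, zero_mul, Matrix.det_fin_three] at h1
    simp at h1
    have := h1
    have h2 : pairing a b wp wm * (2 * quadForm a b e) * pairing a b wp wm ≠ 0 :=
      mul_ne_zero (mul_ne_zero h.pair_ne (mul_ne_zero two_ne_zero_of_rat h.quad_e_ne)) h.pair_ne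
    apply h2
    have h3 := two_ne_zero_of_rat (K := K)
    grind
  refine Matrix.eq_zero_of_mulVec_eq_zero hdet ?_
  rw [pairing_eq] at h1 h2 h3
  change 2 * (-A * _ - B * _ + A * B * _) = 0 at h1 h2 h3
  clear_value A B
  ext i
  fin_cases i <;>
    simp [M, T, Matrix.mulVec, dotProduct, Matrix.mul_apply, Fin.sum_univ_three] <;>
    first
      | linear_combination h1
      | linear_combination h2
      | linear_combination h3

theorem decomp (x : Vec K) :
    x = coordP a b wp e wm x • wp + coordE a b wp e wm x • e + coordM a b wp e wm x • wm := by
  have h2 := two_ne_zero_of_rat (K := K)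
  have h3 := h.pair_ne
  have h4 := h.quad_e_ne
  have e : ∀ y z : Vec K, pairing a b y (x - z) = pairing a b y x - pairing a b y z := fun y z => by
    rw [pairing_comm, pairing_sub_left, pairing_comm x, pairing_comm z]
  rw [← sub_eq_zero]
  apply h.eq_zero_of_pairing
  · rw [e, h.pair_wp, coordM, div_mul_cancel₀ _ h3, sub_self]
  · rw [e, h.pair_e, coordE, div_mul_cancel₀ _ (mul_ne_zero h2 h4), sub_self]
  · rw [e, h.pair_wm, coordP, div_mul_cancel₀ _ h3, sub_self]

theorem ext {x y : Vec K} (h1 : coordP a b wp e wm x = coordP a b wp e wm y)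
    (h2 : coordE a b wp e wm x = coordE a b wp e wm y)
    (h3 : coordM a b wp e wm x = coordM a b wp e wm y) : x = y := by
  rw [h.decomp x, h1, h2, h3, ← h.decomp y]

theorem quadForm_eq_coord (x : Vec K) : quadForm a b x =
    coordE a b wp e wm x ^ 2 * quadForm a b e +
      coordP a b wp e wm x * coordM a b wp e wm x * pairing a b wp wm := by
  conv_lhs => rw [h.decomp x]
  exact h.quadForm_comb _ _ _

theorem pairing_eq_coord (x y : Vec K) : pairing a b x y =
    2 * quadForm a b e * (coordE a b wp e wm x * coordE a b wp e wm y) +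
      pairing a b wp wm * (coordP a b wp e wm x * coordM a b wp e wm y +
        coordM a b wp e wm x * coordP a b wp e wm y) := by
  have h2 := two_ne_zero_of_rat (K := K)
  have h3 := h.pair_ne
  have h4 := h.quad_e_ne
  conv_lhs => rw [h.decomp x]
  rw [h.pairing_comb]
  conv_lhs => rw [h.decomp y]
  rw [h.pair_wp, h.pair_wm, h.pair_e]
  ring

end IsFrame

theorem coordP_smul (c : K) (x : Vec K) :
    coordP a b wp e wm (c • x) = c * coordP a b wp e wm x := by
  rw [coordP, pairing_smul_right, mul_div_assoc]; rfl

theorem coordE_smul (c : K) (x : Vec K) :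
    coordE a b wp e wm (c • x) = c * coordE a b wp e wm x := by
  rw [coordE, pairing_smul_right, mul_div_assoc]; rfl

theorem coordM_smul (c : K) (x : Vec K) :
    coordM a b wp e wm (c • x) = c * coordM a b wp e wm x := by
  rw [coordM, pairing_smul_right, mul_div_assoc]; rfl

theorem coordP_add (x y : Vec K) :
    coordP a b wp e wm (x + y) = coordP a b wp e wm x + coordP a b wp e wm y := by
  rw [coordP, pairing_add_right, add_div]; rfl

theorem coordE_add (x y : Vec K) :
    coordE a b wp e wm (x + y) = coordE a b wp e wm x + coordE a b wp e wm y := by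
  rw [coordE, pairing_add_right, add_div]; rfl

theorem coordM_add (x y : Vec K) :
    coordM a b wp e wm (x + y) = coordM a b wp e wm x + coordM a b wp e wm y := by
  rw [coordM, pairing_add_right, add_div]; rfl

/-- The ratio `- Q(e) / ⟨w⁺, w⁻⟩`. -/
def kap (a b : ℚ) (wp e wm : Vec K) : K := -quadForm a b e / pairing a b wp wm

/-- The isotropic vector with parameter `ζ`. -/
def ptVec (a b : ℚ) (wp e wm : Vec K) (ζ : K) : Vec K :=
  (kap a b wp e wm * ζ ^ 2) • wp + ζ • e + (1 : K) • wm

theorem IsFrame.kap_ne (h : IsFrame a b wp e wm) : kap a b wp e wm ≠ 0 :=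
  div_ne_zero (neg_ne_zero.2 h.quad_e_ne) h.pair_ne

theorem IsFrame.kap_mul (h : IsFrame a b wp e wm) :
    kap a b wp e wm * pairing a b wp wm = -quadForm a b e := div_mul_cancel₀ _ h.pair_ne

theorem IsFrame.quadForm_ptVec (h : IsFrame a b wp e wm) (ζ : K) :
    quadForm a b (ptVec a b wp e wm ζ) = 0 := by
  rw [ptVec, h.quadForm_comb]
  linear_combination ζ ^ 2 * h.kap_mul

theorem IsFrame.ptVec_ne_zero (h : IsFrame a b wp e wm) (ζ : K) : ptVec a b wp e wm ζ ≠ 0 := by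
  intro h0
  have h1 := h.coordM_comb (kap a b wp e wm * ζ ^ 2) ζ 1
  rw [← ptVec, h0, coordM, pairing_comm, pairing_zero_left, zero_div] at h1
  exact zero_ne_one h1

theorem IsFrame.pairing_ptVec (h : IsFrame a b wp e wm) (ζ : K) (v : Vec K) :
    pairing a b (ptVec a b wp e wm ζ) v = pairing a b wp wm * coordP a b wp e wm v +
      2 * quadForm a b e * coordE a b wp e wm v * ζ -
        quadForm a b e * coordM a b wp e wm v * ζ ^ 2 := by
  rw [h.pairing_eq_coord, ptVec, h.coordE_comb, h.coordP_comb, h.coordM_comb]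
  linear_combination coordM a b wp e wm v * ζ ^ 2 * h.kap_mul

/-- An isotropic vector which is not a multiple of `w⁺`. -/
theorem IsFrame.eq_smul_ptVec (h : IsFrame a b wp e wm) {x : Vec K} (hx : quadForm a b x = 0)
    (h0 : coordM a b wp e wm x ≠ 0) : x = coordM a b wp e wm x •
      ptVec a b wp e wm (coordE a b wp e wm x / coordM a b wp e wm x) := by
  have h1 := h.kap_mul
  have h2 := h.pair_ne
  rw [h.quadForm_eq_coord] at hx
  apply h.ext
  · rw [coordP_smul, ptVec, h.coordP_comb]
    field_simp
    refine mul_right_cancel₀ h2 ?_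
    linear_combination hx - coordE a b wp e wm x ^ 2 * h1
  · rw [coordE_smul, ptVec, h.coordE_comb]
    field_simp
  · rw [coordM_smul, ptVec, h.coordM_comb, mul_one]

theorem IsFrame.eq_smul_wp (h : IsFrame a b wp e wm) {x : Vec K} (hx : quadForm a b x = 0)
    (h0 : coordM a b wp e wm x = 0) : x = coordP a b wp e wm x • wp := by
  rw [h.quadForm_eq_coord, h0, mul_zero, zero_mul, add_zero] at hx
  have h1 : coordE a b wp e wm x = 0 := by simpa [h.quad_e_ne] using hx
  conv_lhs => rw [h.decomp x, h0, h1, zero_smul, zero_smul, add_zero, add_zero]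

/-- The translated frame `(p ^ r w⁺, e + 2 κ a w⁺, p ^ (-r) x_a)`. -/
theorem IsFrame.shift (h : IsFrame a b wp e wm) (c : K) {q : K} (hq : q ≠ 0) :
    IsFrame a b (q • wp) (e + (2 * kap a b wp e wm * c) • wp)
      (q⁻¹ • ptVec a b wp e wm c) ∧
    pairing a b (q • wp) (q⁻¹ • ptVec a b wp e wm c) = pairing a b wp wm ∧
    quadForm a b (e + (2 * kap a b wp e wm * c) • wp) = quadForm a b e ∧
    ∀ ζ, ptVec a b (q • wp) (e + (2 * kap a b wp e wm * c) • wp)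
      (q⁻¹ • ptVec a b wp e wm c) ζ = q⁻¹ • ptVec a b wp e wm (c + q * ζ) := by
  have h1 : pairing a b (q • wp) (q⁻¹ • ptVec a b wp e wm c) = pairing a b wp wm := by
    rw [pairing_smul_left, pairing_smul_right, ptVec, h.pair_wp, one_mul, mul_inv_cancel_left₀ hq]
  have h2 : quadForm a b (e + (2 * kap a b wp e wm * c) • wp) = quadForm a b e := by
    rw [quadForm_add, quadForm_smul, h.quad_wp, pairing_smul_right, pairing_comm, h.pair_wp_e]
    ring
  refine ⟨⟨?_, ?_, ?_, ?_, ?_, ?_⟩, h1, h2, ?_⟩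
  · rw [quadForm_smul, h.quad_wp, mul_zero]
  · rw [quadForm_smul, h.quadForm_ptVec, mul_zero]
  · rw [pairing_smul_left, pairing_add_right, pairing_smul_right, h.pair_wp_e, pairing_self,
      h.quad_wp]
    ring
  · rw [pairing_smul_left, pairing_add_right, pairing_smul_right, pairing_comm _ wp,
      pairing_comm _ e]
    rw [ptVec, h.pair_e, h.pair_wp]
    linear_combination 2 * q⁻¹ * c * h.kap_mul
  · rw [h1]; exact h.pair_ne
  · rw [h2]; exact h.quad_e_ne
  · intro ζ
    rw [ptVec, kap, h1, h2, ← kap, ptVec, ptVec]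
    simp only [smul_add, smul_smul, ← add_assoc]
    ext i
    simp only [Pi.add_apply, Pi.smul_apply, smul_eq_mul]
    field_simp
    ring

end Frames

/-! ### Unimodular lattices and the reduction map in coordinates -/

section Lattices

variable {a b : ℚ} {p : ℕ} [Fact p.Prime]

local notation "ι" => algebraMap ℚ_[p] ℂ_[p]

theorem norm_iota (x : ℚ_[p]) : ‖ι x‖ = ‖x‖ := norm_algebraMap' ℂ_[p] x

theorem iota_rat (q : ℚ) : ι (algebraMap ℚ ℚ_[p] q) = algebraMap ℚ ℂ_[p] q := by simp

theorem quadForm_toCp (v : Vec ℚ_[p]) : quadForm a b (toCp p v) = ι (quadForm a b v) := by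
  simp only [quadForm_eq, map_add, map_sub, map_mul, map_neg, map_pow, iota_rat]
  rfl

theorem pairing_toCp (v w : Vec ℚ_[p]) :
    pairing a b (toCp p v) (toCp p w) = ι (pairing a b v w) := by
  simp only [pairing_eq, map_add, map_sub, map_mul, map_neg, map_ofNat, iota_rat]
  rfl

theorem toCp_add (v w : Vec ℚ_[p]) : toCp p (v + w) = toCp p v + toCp p w := by
  ext i; simp [toCp]

theorem toCp_smul (c : ℚ_[p]) (v : Vec ℚ_[p]) : toCp p (c • v) = ι c • toCp p v := by
  ext i; simp [toCp]

theorem toCp_injective : Function.Injective (toCp p) := by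
  intro v w h
  ext i
  exact (algebraMap ℚ_[p] ℂ_[p]).injective (congrFun h i)

variable {wp e wm : Vec ℚ_[p]}

theorem IsFrame.toCp (h : IsFrame a b wp e wm) :
    IsFrame a b (toCp p wp) (toCp p e) (toCp p wm) := by
  refine ⟨?_, ?_, ?_, ?_, ?_, ?_⟩
  · rw [quadForm_toCp, h.quad_wp, map_zero]
  · rw [quadForm_toCp, h.quad_wm, map_zero]
  · rw [pairing_toCp, h.pair_wp_e, map_zero]
  · rw [pairing_toCp, h.pair_wm_e, map_zero]
  · rw [pairing_toCp]; exact (map_ne_zero _).2 h.pair_ne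
  · rw [quadForm_toCp]; exact (map_ne_zero _).2 h.quad_e_ne

theorem coordP_toCp (v : Vec ℚ_[p]) : coordP a b (toCp p wp) (toCp p e) (toCp p wm) (toCp p v) =
    ι (coordP a b wp e wm v) := by
  rw [coordP, pairing_toCp, pairing_toCp, coordP, map_div₀]

theorem coordE_toCp (v : Vec ℚ_[p]) : coordE a b (toCp p wp) (toCp p e) (toCp p wm) (toCp p v) =
    ι (coordE a b wp e wm v) := by
  rw [coordE, pairing_toCp, quadForm_toCp, coordE, map_div₀, map_mul, map_ofNat]

theorem coordM_toCp (v : Vec ℚ_[p]) : coordM a b (toCp p wp) (toCp p e) (toCp p wm) (toCp p v) =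
    ι (coordM a b wp e wm v) := by
  rw [coordM, pairing_toCp, pairing_toCp, coordM, map_div₀]

theorem kap_toCp : kap a b (toCp p wp) (toCp p e) (toCp p wm) = ι (kap a b wp e wm) := by
  rw [kap, quadForm_toCp, pairing_toCp, kap, map_div₀, map_neg]

theorem ptVec_toCp (ζ : ℚ_[p]) : ptVec a b (toCp p wp) (toCp p e) (toCp p wm) (ι ζ) =
    toCp p (ptVec a b wp e wm ζ) := by
  simp only [ptVec, toCp_add, toCp_smul, kap_toCp, map_mul, map_pow, map_one]

/-- The point of the conic with parameter `ζ`. -/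
def pt (h : IsFrame a b wp e wm) (ζ : ℂ_[p]) : Pt p :=
  Projectivization.mk ℂ_[p] (ptVec a b (toCp p wp) (toCp p e) (toCp p wm) ζ)
    (h.toCp.ptVec_ne_zero ζ)

theorem mem_pt (h : IsFrame a b wp e wm) (ζ : ℂ_[p]) (x : Vec ℂ_[p]) :
    x ∈ (pt h ζ).submodule ↔ ∃ c : ℂ_[p], c • ptVec a b (toCp p wp) (toCp p e) (toCp p wm) ζ = x := by
  rw [pt, Projectivization.submodule_mk, Submodule.mem_span_singleton]

theorem pt_injective (h : IsFrame a b wp e wm) : Function.Injective (pt h) := by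
  intro ζ ζ' hz
  rw [pt, pt, Projectivization.mk_eq_mk_iff'] at hz
  obtain ⟨c, hc⟩ := hz
  have h1 := congrArg (coordM a b (toCp p wp) (toCp p e) (toCp p wm)) hc
  have h2 := congrArg (coordE a b (toCp p wp) (toCp p e) (toCp p wm)) hc
  rw [coordM_smul, ptVec, ptVec, h.toCp.coordM_comb, h.toCp.coordM_comb, mul_one] at h1
  rw [coordE_smul, ptVec, ptVec, h.toCp.coordE_comb, h.toCp.coordE_comb, h1, one_mul] at h2
  exact h2.symm

/-- The points of the upper half plane have parameters outside of `ℚ_p`. -/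
theorem mem_halfPlane_iff (h : IsFrame a b wp e wm) (z : Pt p) :
    z ∈ halfPlane a b p ↔ ∃ ζ, Irrat p ζ ∧ pt h ζ = z := by
  constructor
  · rintro ⟨h1, h2⟩
    have hz : z.rep ∈ z.submodule := by
      rw [Projectivization.submodule_eq]; exact Submodule.mem_span_singleton_self _
    have hq := h1 _ hz
    have hmk := z.mk_rep
    by_cases h0 : coordM a b (toCp p wp) (toCp p e) (toCp p wm) z.rep = 0
    · have h3 := h.toCp.eq_smul_wp hq h0
      refine (h2 ⟨wp, ?_, ?_⟩).elim
      · rintro rfl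
        exact h.pair_ne (pairing_zero_left _)
      · have hc : coordP a b (toCp p wp) (toCp p e) (toCp p wm) z.rep ≠ 0 := by
          intro hc
          rw [hc, zero_smul] at h3
          exact z.rep_nonzero h3
        have hwp : (coordP a b (toCp p wp) (toCp p e) (toCp p wm) z.rep)⁻¹ • z.rep = toCp p wp := by
          rw [inv_smul_eq_iff₀ hc]; exact h3
        rw [← hwp]
        exact z.submodule.smul_mem _ hz
    · have h3 := h.toCp.eq_smul_ptVec hq h0
      set ζ := coordE a b (toCp p wp) (toCp p e) (toCp p wm) z.rep /
        coordM a b (toCp p wp) (toCp p e) (toCp p wm) z.rep with hζ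
      have hpt : pt h ζ = z := by
        rw [← hmk, pt, Projectivization.mk_eq_mk_iff']
        refine ⟨(coordM a b (toCp p wp) (toCp p e) (toCp p wm) z.rep)⁻¹, ?_⟩
        rw [inv_smul_eq_iff₀ h0]; exact h3
      refine ⟨ζ, ?_, hpt⟩
      intro c hc
      refine h2 ⟨ptVec a b wp e wm c, h.ptVec_ne_zero c, ?_⟩
      rw [← hpt, mem_pt]
      exact ⟨1, by rw [one_smul, ← hc, ptVec_toCp]⟩
  · rintro ⟨ζ, hζ, rfl⟩
    constructor
    · intro x hx
      obtain ⟨c, rfl⟩ := (mem_pt h ζ x).1 hx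
      rw [quadForm_smul, h.toCp.quadForm_ptVec, mul_zero]
    · rintro ⟨v, hv, hx⟩
      obtain ⟨c, hc⟩ := (mem_pt h ζ _).1 hx
      have h1 := congrArg (coordM a b (toCp p wp) (toCp p e) (toCp p wm)) hc
      have h2 := congrArg (coordE a b (toCp p wp) (toCp p e) (toCp p wm)) hc
      rw [coordM_smul, ptVec, h.toCp.coordM_comb, coordM_toCp, mul_one] at h1
      rw [coordE_smul, ptVec, h.toCp.coordE_comb, coordE_toCp] at h2
      have hc0 : c ≠ 0 := by
        rintro rfl
        rw [zero_smul] at hc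
        apply hv
        apply toCp_injective
        rw [← hc]
        ext i; simp [HeegnerTheta.toCp]
      refine hζ (coordE a b wp e wm v / coordM a b wp e wm v) ?_
      rw [map_div₀, ← h1, ← h2, mul_div_cancel_left₀ _ hc0]

theorem mem_lattice_iff (h : IsFrame a b wp e wm) (v : Vec ℚ_[p]) :
    v ∈ Submodule.span ℤ_[p] {wp, e, wm} ↔ ‖coordP a b wp e wm v‖ ≤ 1 ∧
      ‖coordE a b wp e wm v‖ ≤ 1 ∧ ‖coordM a b wp e wm v‖ ≤ 1 := by
  rw [Submodule.mem_span_triple]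
  constructor
  · rintro ⟨x, y, z, rfl⟩
    change ‖coordP a b wp e wm ((x : ℚ_[p]) • wp + (y : ℚ_[p]) • e + (z : ℚ_[p]) • wm)‖ ≤ 1 ∧
      ‖coordE a b wp e wm ((x : ℚ_[p]) • wp + (y : ℚ_[p]) • e + (z : ℚ_[p]) • wm)‖ ≤ 1 ∧
      ‖coordM a b wp e wm ((x : ℚ_[p]) • wp + (y : ℚ_[p]) • e + (z : ℚ_[p]) • wm)‖ ≤ 1
    rw [h.coordP_comb, h.coordE_comb, h.coordM_comb]
    exact ⟨x.2, y.2, z.2⟩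
  · rintro ⟨h1, h2, h3⟩
    exact ⟨⟨_, h1⟩, ⟨_, h2⟩, ⟨_, h3⟩, (h.decomp v).symm⟩

theorem mem_complexInt_iff (x : ℂ_[p]) : x ∈ 𝓞_ℂ_[p] ↔ ‖x‖ ≤ 1 := by
  open Valuation MonoidWithZeroHom.ValueGroup₀ in
  rw [PadicComplexInt, Valuation.mem_valuationSubring_iff, PadicComplex.norm_eq_norm,
    Valuation.norm_def, PadicComplex.RankOne.hom_eq_embedding,
    embedding_restrict (PadicComplex.valued p).v x]
  rfl

theorem mem_latticeC_iff (h : IsFrame a b wp e wm) (x : Vec ℂ_[p]) :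
    x ∈ Submodule.span (𝓞_ℂ_[p])
      (toCp p '' (Submodule.span ℤ_[p] {wp, e, wm} : Set (Vec ℚ_[p]))) ↔
      ‖coordP a b (toCp p wp) (toCp p e) (toCp p wm) x‖ ≤ 1 ∧
      ‖coordE a b (toCp p wp) (toCp p e) (toCp p wm) x‖ ≤ 1 ∧
      ‖coordM a b (toCp p wp) (toCp p e) (toCp p wm) x‖ ≤ 1 := by
  constructor
  · intro hx
    induction hx using Submodule.span_induction with
    | mem x hx =>
      obtain ⟨v, hv, rfl⟩ := hx
      rw [coordP_toCp, coordE_toCp, coordM_toCp, norm_iota, norm_iota, norm_iota]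
      exact (mem_lattice_iff h v).1 hv
    | zero =>
      have : ∀ y : Vec ℂ_[p], pairing a b y 0 = 0 := fun y => by
        rw [pairing_comm, pairing_zero_left]
      simp [coordP, coordE, coordM, this]
    | add x y _ _ h1 h2 =>
      rw [coordP_add, coordE_add, coordM_add]
      exact ⟨(IsUltrametricDist.norm_add_le_max _ _).trans (max_le h1.1 h2.1),
        (IsUltrametricDist.norm_add_le_max _ _).trans (max_le h1.2.1 h2.2.1),
        (IsUltrametricDist.norm_add_le_max _ _).trans (max_le h1.2.2 h2.2.2)⟩
    | smul c x _ h1 =>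
      change ‖coordP a b (toCp p wp) (toCp p e) (toCp p wm) ((c : ℂ_[p]) • x)‖ ≤ 1 ∧
        ‖coordE a b (toCp p wp) (toCp p e) (toCp p wm) ((c : ℂ_[p]) • x)‖ ≤ 1 ∧
        ‖coordM a b (toCp p wp) (toCp p e) (toCp p wm) ((c : ℂ_[p]) • x)‖ ≤ 1
      have hc := (mem_complexInt_iff (c : ℂ_[p])).1 c.2
      rw [coordP_smul, coordE_smul, coordM_smul, norm_mul, norm_mul, norm_mul]
      exact ⟨mul_le_one₀ hc (norm_nonneg _) h1.1, mul_le_one₀ hc (norm_nonneg _) h1.2.1,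
        mul_le_one₀ hc (norm_nonneg _) h1.2.2⟩
  · rintro ⟨h1, h2, h3⟩
    rw [← mem_complexInt_iff] at h1 h2 h3
    rw [h.toCp.decomp x]
    have hm : ∀ w ∈ ({wp, e, wm} : Set (Vec ℚ_[p])), toCp p w ∈ Submodule.span (𝓞_ℂ_[p])
        (toCp p '' (Submodule.span ℤ_[p] {wp, e, wm} : Set (Vec ℚ_[p]))) := fun w hw =>
      Submodule.subset_span ⟨w, Submodule.subset_span hw, rfl⟩
    refine Submodule.add_mem _ (Submodule.add_mem _ ?_ ?_) ?_
    · exact Submodule.smul_mem _ (⟨_, h1⟩ : 𝓞_ℂ_[p]) (hm wp (by simp))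
    · exact Submodule.smul_mem _ (⟨_, h2⟩ : 𝓞_ℂ_[p]) (hm e (by simp))
    · exact Submodule.smul_mem _ (⟨_, h3⟩ : 𝓞_ℂ_[p]) (hm wm (by simp))

theorem norm_p_complex : ‖(p : ℂ_[p])‖ = (p : ℝ)⁻¹ := by
  have : (p : ℂ_[p]) = ι (p : ℚ_[p]) := by simp
  rw [this, norm_iota, Padic.norm_p]

theorem mem_latticeMul_max (h : IsFrame a b wp e wm) (x : Vec ℂ_[p]) :
    x ∈ latticeMul (maxIdeal p) (Submodule.span ℤ_[p] {wp, e, wm}) ↔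
      ‖coordP a b (toCp p wp) (toCp p e) (toCp p wm) x‖ < 1 ∧
      ‖coordE a b (toCp p wp) (toCp p e) (toCp p wm) x‖ < 1 ∧
      ‖coordM a b (toCp p wp) (toCp p e) (toCp p wm) x‖ < 1 := by
  set A := coordP a b (toCp p wp) (toCp p e) (toCp p wm) x with hA
  set B := coordE a b (toCp p wp) (toCp p e) (toCp p wm) x with hB
  set C := coordM a b (toCp p wp) (toCp p e) (toCp p wm) x with hC
  constructor
  · rintro ⟨c, hc, y, hy, hxy⟩
    change ‖c‖ < 1 at hc
    obtain ⟨h1, h2, h3⟩ := (mem_latticeC_iff h y).1 hy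
    rw [hA, hB, hC, hxy, coordP_smul, coordE_smul, coordM_smul, norm_mul, norm_mul, norm_mul]
    exact ⟨mul_lt_one_of_nonneg_of_lt_one_left (norm_nonneg _) hc h1,
      mul_lt_one_of_nonneg_of_lt_one_left (norm_nonneg _) hc h2,
      mul_lt_one_of_nonneg_of_lt_one_left (norm_nonneg _) hc h3⟩
  · rintro ⟨h1, h2, h3⟩
    obtain ⟨c, hc, hcA, hcB, hcC⟩ : ∃ c : ℂ_[p], ‖c‖ < 1 ∧ ‖A‖ ≤ ‖c‖ ∧ ‖B‖ ≤ ‖c‖ ∧ ‖C‖ ≤ ‖c‖ := by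
      rcases le_total ‖A‖ ‖B‖ with hab | hab <;> rcases le_total ‖B‖ ‖C‖ with hbc | hbc <;>
        rcases le_total ‖A‖ ‖C‖ with hac | hac
      · exact ⟨C, h3, by linarith, hbc, le_rfl⟩
      · exact ⟨C, h3, by linarith, hbc, le_rfl⟩
      · exact ⟨B, h2, hab, le_rfl, hbc⟩
      · exact ⟨B, h2, hab, le_rfl, hbc⟩
      · exact ⟨C, h3, hac, hbc, le_rfl⟩
      · exact ⟨A, h1, le_rfl, hab, hac⟩
      · exact ⟨A, h1, le_rfl, hab, by linarith⟩
      · exact ⟨A, h1, le_rfl, hab, hac⟩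
    by_cases hc0 : c = 0
    · subst hc0
      rw [norm_zero, norm_le_zero_iff] at hcA hcB hcC
      refine ⟨0, by simp [maxIdeal], 0, Submodule.zero_mem _, ?_⟩
      rw [h.toCp.decomp x, ← hA, ← hB, ← hC, hcA, hcB, hcC]
      simp
    · refine ⟨c, hc, c⁻¹ • x, ?_, by rw [smul_inv_smul₀ hc0]⟩
      rw [mem_latticeC_iff h, coordP_smul, coordE_smul, coordM_smul, norm_mul, norm_mul, norm_mul,
        norm_inv]
      have : 0 < ‖c‖ := norm_pos_iff.2 hc0
      refine ⟨?_, ?_, ?_⟩ <;> rw [inv_mul_le_iff₀ this, mul_one] <;> assumption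

theorem mem_latticeMul_p (h : IsFrame a b wp e wm) (x : Vec ℂ_[p]) :
    x ∈ latticeMul (pIdeal p) (Submodule.span ℤ_[p] {wp, e, wm}) ↔
      ‖coordP a b (toCp p wp) (toCp p e) (toCp p wm) x‖ ≤ (p : ℝ)⁻¹ ∧
      ‖coordE a b (toCp p wp) (toCp p e) (toCp p wm) x‖ ≤ (p : ℝ)⁻¹ ∧
      ‖coordM a b (toCp p wp) (toCp p e) (toCp p wm) x‖ ≤ (p : ℝ)⁻¹ := by
  have hp := p_pos (p := p)
  constructor
  · rintro ⟨c, hc, y, hy, hxy⟩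
    change ‖c‖ ≤ ‖(p : ℂ_[p])‖ at hc
    rw [norm_p_complex] at hc
    obtain ⟨h1, h2, h3⟩ := (mem_latticeC_iff h y).1 hy
    rw [hxy, coordP_smul, coordE_smul, coordM_smul, norm_mul, norm_mul, norm_mul]
    exact ⟨(mul_le_of_le_one_right (norm_nonneg _) h1).trans hc,
      (mul_le_of_le_one_right (norm_nonneg _) h2).trans hc,
      (mul_le_of_le_one_right (norm_nonneg _) h3).trans hc⟩
  · rintro ⟨h1, h2, h3⟩
    have hp0 : (p : ℂ_[p]) ≠ 0 := by
      rw [← norm_pos_iff, norm_p_complex]; positivity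
    refine ⟨p, (le_refl ‖(p : ℂ_[p])‖ :), (p : ℂ_[p])⁻¹ • x, ?_, by rw [smul_inv_smul₀ hp0]⟩
    rw [mem_latticeC_iff h, coordP_smul, coordE_smul, coordM_smul, norm_mul, norm_mul, norm_mul,
      norm_inv, norm_p_complex, inv_inv]
    refine ⟨?_, ?_, ?_⟩ <;> rw [← le_div_iff₀' hp, one_div] <;> assumption

/-- Congruences between points and vectors in coordinates. -/
theorem congMod_max_iff (h : IsFrame a b wp e wm) (ζ : ℂ_[p]) (v : Vec ℚ_[p]) :
    CongMod (maxIdeal p) (Submodule.span ℤ_[p] {wp, e, wm}) (pt h ζ) v ↔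
      ∃ c : ℂ_[p], ‖c * (ι (kap a b wp e wm) * ζ ^ 2) - ι (coordP a b wp e wm v)‖ < 1 ∧
        ‖c * ζ - ι (coordE a b wp e wm v)‖ < 1 ∧ ‖c - ι (coordM a b wp e wm v)‖ < 1 := by
  have key : ∀ c : ℂ_[p], c • ptVec a b (toCp p wp) (toCp p e) (toCp p wm) ζ - toCp p v ∈
      latticeMul (maxIdeal p) (Submodule.span ℤ_[p] {wp, e, wm}) ↔
      ‖c * (ι (kap a b wp e wm) * ζ ^ 2) - ι (coordP a b wp e wm v)‖ < 1 ∧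
        ‖c * ζ - ι (coordE a b wp e wm v)‖ < 1 ∧ ‖c - ι (coordM a b wp e wm v)‖ < 1 := by
    intro c
    rw [mem_latticeMul_max h, sub_eq_add_neg, ← neg_one_smul ℂ_[p] (toCp p v), coordP_add,
      coordE_add, coordM_add, coordP_smul, coordE_smul, coordM_smul, coordP_smul, coordE_smul,
      coordM_smul, coordP_toCp, coordE_toCp, coordM_toCp, ptVec, h.toCp.coordP_comb,
      h.toCp.coordE_comb, h.toCp.coordM_comb, kap_toCp, neg_one_mul, neg_one_mul, neg_one_mul,
      mul_one, ← sub_eq_add_neg, ← sub_eq_add_neg, ← sub_eq_add_neg]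
  constructor
  · rintro ⟨x, hx, hxv⟩
    obtain ⟨c, rfl⟩ := (mem_pt h ζ x).1 hx
    exact ⟨c, (key c).1 hxv⟩
  · rintro ⟨c, hc⟩
    exact ⟨_, (mem_pt h ζ _).2 ⟨c, rfl⟩, (key c).2 hc⟩

theorem congMod_p_iff (h : IsFrame a b wp e wm) (ζ : ℂ_[p]) (v : Vec ℚ_[p]) :
    CongMod (pIdeal p) (Submodule.span ℤ_[p] {wp, e, wm}) (pt h ζ) v ↔
      ∃ c : ℂ_[p], ‖c * (ι (kap a b wp e wm) * ζ ^ 2) - ι (coordP a b wp e wm v)‖ ≤ (p : ℝ)⁻¹ ∧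
        ‖c * ζ - ι (coordE a b wp e wm v)‖ ≤ (p : ℝ)⁻¹ ∧
        ‖c - ι (coordM a b wp e wm v)‖ ≤ (p : ℝ)⁻¹ := by
  have key : ∀ c : ℂ_[p], c • ptVec a b (toCp p wp) (toCp p e) (toCp p wm) ζ - toCp p v ∈
      latticeMul (pIdeal p) (Submodule.span ℤ_[p] {wp, e, wm}) ↔
      ‖c * (ι (kap a b wp e wm) * ζ ^ 2) - ι (coordP a b wp e wm v)‖ ≤ (p : ℝ)⁻¹ ∧
        ‖c * ζ - ι (coordE a b wp e wm v)‖ ≤ (p : ℝ)⁻¹ ∧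
        ‖c - ι (coordM a b wp e wm v)‖ ≤ (p : ℝ)⁻¹ := by
    intro c
    rw [mem_latticeMul_p h, sub_eq_add_neg, ← neg_one_smul ℂ_[p] (toCp p v), coordP_add,
      coordE_add, coordM_add, coordP_smul, coordE_smul, coordM_smul, coordP_smul, coordE_smul,
      coordM_smul, coordP_toCp, coordE_toCp, coordM_toCp, ptVec, h.toCp.coordP_comb,
      h.toCp.coordE_comb, h.toCp.coordM_comb, kap_toCp, neg_one_mul, neg_one_mul, neg_one_mul,
      mul_one, ← sub_eq_add_neg, ← sub_eq_add_neg, ← sub_eq_add_neg]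
  constructor
  · rintro ⟨x, hx, hxv⟩
    obtain ⟨c, rfl⟩ := (mem_pt h ζ x).1 hx
    exact ⟨c, (key c).1 hxv⟩
  · rintro ⟨c, hc⟩
    exact ⟨_, (mem_pt h ζ _).2 ⟨c, rfl⟩, (key c).2 hc⟩

end Lattices

section Reduction

variable {a b : ℚ} {p : ℕ} [Fact p.Prime]

local notation "ι" => algebraMap ℚ_[p] ℂ_[p]

variable (a b) in
/-- A frame generating a unimodular lattice (for `p` odd). -/
structure IsUnitFrame (wp e wm : Vec ℚ_[p]) : Prop where
  frame : IsFrame a b wp e wm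
  norm_pair : ‖pairing a b wp wm‖ = 1
  norm_e : ‖quadForm a b e‖ = 1

theorem norm_le_zpow_of_lt {x : ℚ_[p]} {n : ℤ} (h : ‖x‖ < (p : ℝ) ^ (n + 1)) :
    ‖x‖ ≤ (p : ℝ) ^ n := (Padic.norm_le_pow_iff_norm_lt_pow_add_one x n).2 h

theorem norm_le_p_inv {x : ℚ_[p]} (h : ‖x‖ < 1) : ‖x‖ ≤ (p : ℝ)⁻¹ := by
  have := norm_le_zpow_of_lt (p := p) (x := x) (n := -1) (by simpa using h)
  simpa using this

theorem norm_le_one_of_lt_p {x : ℚ_[p]} (h : ‖x‖ < p) : ‖x‖ ≤ 1 := by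
  have := norm_le_zpow_of_lt (p := p) (x := x) (n := 0) (by simpa using h)
  simpa using this

theorem norm_two_eq (hp2 : p ≠ 2) : ‖(2 : ℚ_[p])‖ = 1 := by
  have h : ¬ (p : ℤ) ∣ 2 := by
    intro h
    have h2 : p ∣ 2 := by exact_mod_cast h
    exact hp2 ((Nat.prime_dvd_prime_iff_eq Fact.out Nat.prime_two).1 h2)
  have h3 := (Padic.norm_intCast_lt_one_iff (p := p) (k := 2)).not.2 h
  have h4 := Padic.norm_int_le_one (p := p) 2
  push_cast at h3 h4
  exact le_antisymm h4 (not_lt.1 h3)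

variable {wp e wm : Vec ℚ_[p]}

theorem IsUnitFrame.shift (h : IsUnitFrame a b wp e wm) (c : ℚ_[p]) {q : ℚ_[p]} (hq : q ≠ 0) :
    IsUnitFrame a b (q • wp) (e + (2 * kap a b wp e wm * c) • wp)
      (q⁻¹ • ptVec a b wp e wm c) := by
  obtain ⟨h1, h2, h3, -⟩ := h.frame.shift c hq
  exact ⟨h1, by rw [h2, h.norm_pair], by rw [h3, h.norm_e]⟩

theorem IsUnitFrame.norm_kap (h : IsUnitFrame a b wp e wm) : ‖kap a b wp e wm‖ = 1 := by
  rw [kap, norm_div, norm_neg, h.norm_pair, h.norm_e, div_one]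

theorem mem_span_wp (h : IsFrame a b wp e wm) : wp ∈ Submodule.span ℤ_[p] {wp, e, wm} :=
  Submodule.subset_span (by simp)

theorem mem_span_e (h : IsFrame a b wp e wm) : e ∈ Submodule.span ℤ_[p] {wp, e, wm} :=
  Submodule.subset_span (by simp)

theorem mem_span_wm (h : IsFrame a b wp e wm) : wm ∈ Submodule.span ℤ_[p] {wp, e, wm} :=
  Submodule.subset_span (by simp)

theorem IsUnitFrame.isUnimodular (hp2 : p ≠ 2) (h : IsUnitFrame a b wp e wm) :
    IsUnimodular a b (Submodule.span ℤ_[p] {wp, e, wm}) := by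
  have hf := h.frame
  refine ⟨Submodule.fg_span (by simp), ?_, ?_⟩
  · rw [eq_top_iff]
    rintro x -
    rw [hf.decomp x]
    refine Submodule.add_mem _ (Submodule.add_mem _ ?_ ?_) ?_ <;>
      refine Submodule.smul_mem _ _ (Submodule.subset_span ?_)
    exacts [mem_span_wp hf, mem_span_e hf, mem_span_wm hf]
  · intro v
    constructor
    · intro hv w hw
      obtain ⟨h1, h2, h3⟩ := (mem_lattice_iff hf v).1 hv
      obtain ⟨k1, k2, k3⟩ := (mem_lattice_iff hf w).1 hw
      rw [hf.pairing_eq_coord]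
      refine (IsUltrametricDist.norm_add_le_max _ _).trans (max_le ?_ ?_)
      · rw [norm_mul, norm_mul, norm_two_eq hp2, h.norm_e, norm_mul]
        simpa using mul_le_one₀ h2 (norm_nonneg _) k2
      · rw [norm_mul, h.norm_pair, one_mul]
        refine (IsUltrametricDist.norm_add_le_max _ _).trans (max_le ?_ ?_) <;> rw [norm_mul]
        · exact mul_le_one₀ h1 (norm_nonneg _) k3
        · exact mul_le_one₀ h3 (norm_nonneg _) k1
    · intro hv
      rw [mem_lattice_iff hf, coordP, coordE, coordM, norm_div, norm_div, norm_div, norm_mul,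
        norm_two_eq hp2, h.norm_e, h.norm_pair, mul_one, div_one, div_one, div_one]
      refine ⟨?_, ?_, ?_⟩ <;> rw [pairing_comm] <;> apply hv
      exacts [mem_span_wm hf, mem_span_e hf, mem_span_wp hf]

theorem isPrimitiveIn_iff (h : IsFrame a b wp e wm) (v : Vec ℚ_[p]) :
    IsPrimitiveIn (Submodule.span ℤ_[p] {wp, e, wm}) v ↔
      v ∈ Submodule.span ℤ_[p] {wp, e, wm} ∧ ¬ (‖coordP a b wp e wm v‖ < 1 ∧
        ‖coordE a b wp e wm v‖ < 1 ∧ ‖coordM a b wp e wm v‖ < 1) := by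
  have hp := p_pos (p := p)
  have hp0 : (p : ℚ_[p]) ≠ 0 := by exact_mod_cast (Fact.out : p.Prime).ne_zero
  refine and_congr_right fun hv => not_congr ?_
  constructor
  · rintro ⟨w, hw, rfl⟩
    obtain ⟨h1, h2, h3⟩ := (mem_lattice_iff h w).1 hw
    change ‖coordP a b wp e wm ((p : ℚ_[p]) • w)‖ < 1 ∧
      ‖coordE a b wp e wm ((p : ℚ_[p]) • w)‖ < 1 ∧ ‖coordM a b wp e wm ((p : ℚ_[p]) • w)‖ < 1
    rw [coordP_smul, coordE_smul, coordM_smul, norm_mul, norm_mul, norm_mul]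
    have := Padic.norm_p_lt_one (p := p)
    exact ⟨mul_lt_one_of_nonneg_of_lt_one_left (norm_nonneg _) this h1,
      mul_lt_one_of_nonneg_of_lt_one_left (norm_nonneg _) this h2,
      mul_lt_one_of_nonneg_of_lt_one_left (norm_nonneg _) this h3⟩
  · rintro ⟨h1, h2, h3⟩
    refine ⟨(p : ℚ_[p])⁻¹ • v, ?_, ?_⟩
    · rw [mem_lattice_iff h, coordP_smul, coordE_smul, coordM_smul, norm_mul, norm_mul, norm_mul,
        norm_inv, Padic.norm_p, inv_inv]
      refine ⟨?_, ?_, ?_⟩ <;> rw [← le_div_iff₀' hp, one_div] <;> apply norm_le_p_inv <;> assumption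
    · change v = (p : ℚ_[p]) • _
      rw [smul_inv_smul₀ hp0]

/-- If a point of the residue disc of a primitive vector has its last coordinate in the maximal
ideal, then it is in the residue disc at infinity. -/
theorem coords_lt_of_coordM_lt (h : IsUnitFrame a b wp e wm) {ζ c : ℂ_[p]} (hζ : ‖ζ‖ ≤ 1)
    {v : Vec ℚ_[p]}
    (h1 : ‖c * (ι (kap a b wp e wm) * ζ ^ 2) - ι (coordP a b wp e wm v)‖ < 1)
    (h2 : ‖c * ζ - ι (coordE a b wp e wm v)‖ < 1) (h3 : ‖c - ι (coordM a b wp e wm v)‖ < 1)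
    (h4 : ‖coordM a b wp e wm v‖ < 1) :
    ‖coordP a b wp e wm v‖ < 1 ∧ ‖coordE a b wp e wm v‖ < 1 ∧ ‖coordM a b wp e wm v‖ < 1 := by
  have hc : ‖c‖ < 1 := by
    have := norm_sub_lt_of_lt (x := c) (y := ι (coordM a b wp e wm v)) (z := 0) h3
      (by rwa [sub_zero, norm_iota])
    rwa [sub_zero] at this
  have aux : ∀ x : ℂ_[p], ∀ y : ℚ_[p], ‖x‖ < 1 → ‖x - ι y‖ < 1 → ‖y‖ < 1 := by
    intro x y hx hxy
    have := norm_sub_lt_of_lt (x := ι y) (y := x) (z := 0) (by rwa [norm_sub_rev])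
      (by rwa [sub_zero])
    rwa [sub_zero, norm_iota] at this
  refine ⟨aux _ _ ?_ h1, aux _ _ ?_ h2, h4⟩
  · rw [norm_mul, norm_mul, norm_iota, h.norm_kap, one_mul, norm_pow]
    exact mul_lt_one_of_nonneg_of_lt_one_left (norm_nonneg _) hc (pow_le_one₀ (norm_nonneg _) hζ)
  · rw [norm_mul]
    exact mul_lt_one_of_nonneg_of_lt_one_left (norm_nonneg _) hc hζ

theorem pt_mem_halfPlane (h : IsFrame a b wp e wm) {ζ : ℂ_[p]} (hζ : Irrat p ζ) :
    pt h ζ ∈ halfPlane a b p := (mem_halfPlane_iff h _).2 ⟨ζ, hζ, rfl⟩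

theorem coord_wp (h : IsFrame a b wp e wm) : coordP a b wp e wm wp = 1 ∧
    coordE a b wp e wm wp = 0 ∧ coordM a b wp e wm wp = 0 := by
  have h1 := h.coordP_comb 1 0 0
  have h2 := h.coordE_comb 1 0 0
  have h3 := h.coordM_comb 1 0 0
  simp only [one_smul, zero_smul, add_zero] at h1 h2 h3
  exact ⟨h1, h2, h3⟩

theorem coord_ptVec (h : IsFrame a b wp e wm) (c : ℚ_[p]) :
    coordP a b wp e wm (ptVec a b wp e wm c) = kap a b wp e wm * c ^ 2 ∧
    coordE a b wp e wm (ptVec a b wp e wm c) = c ∧ coordM a b wp e wm (ptVec a b wp e wm c) = 1 :=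
  ⟨h.coordP_comb _ _ _, h.coordE_comb _ _ _, h.coordM_comb _ _ _⟩

theorem primitive_wp (h : IsFrame a b wp e wm) :
    IsPrimitiveIn (Submodule.span ℤ_[p] {wp, e, wm}) wp := by
  rw [isPrimitiveIn_iff h, (coord_wp h).1, norm_one]
  exact ⟨mem_span_wp h, fun h => lt_irrefl _ h.1⟩

theorem ptVec_mem (h : IsUnitFrame a b wp e wm) {c : ℚ_[p]} (hc : ‖c‖ ≤ 1) :
    ptVec a b wp e wm c ∈ Submodule.span ℤ_[p] {wp, e, wm} := by
  obtain ⟨h1, h2, h3⟩ := coord_ptVec h.frame c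
  rw [mem_lattice_iff h.frame, h1, h2, h3, norm_mul, h.norm_kap, norm_pow, one_mul, norm_one]
  exact ⟨pow_le_one₀ (norm_nonneg _) hc, hc, le_rfl⟩

theorem primitive_ptVec (h : IsUnitFrame a b wp e wm) {c : ℚ_[p]} (hc : ‖c‖ ≤ 1) :
    IsPrimitiveIn (Submodule.span ℤ_[p] {wp, e, wm}) (ptVec a b wp e wm c) := by
  obtain ⟨h1, h2, h3⟩ := coord_ptVec h.frame c
  rw [isPrimitiveIn_iff h.frame, h3, norm_one]
  exact ⟨ptVec_mem h hc, fun h => lt_irrefl _ h.2.2⟩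

theorem congMod_max_wp (h : IsUnitFrame a b wp e wm) {ζ : ℂ_[p]} (hζ : 1 < ‖ζ‖) :
    CongMod (maxIdeal p) (Submodule.span ℤ_[p] {wp, e, wm}) (pt h.frame ζ) wp := by
  obtain ⟨h1, h2, h3⟩ := coord_wp h.frame
  rw [congMod_max_iff h.frame, h1, h2, h3]
  have hk : ι (kap a b wp e wm) ≠ 0 := (map_ne_zero _).2 h.frame.kap_ne
  have hk1 : ‖ι (kap a b wp e wm)‖ = 1 := by rw [norm_iota, h.norm_kap]
  have hζ0 : ζ ≠ 0 := by rintro rfl; simp at hζ; linarith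
  have hlt := inv_lt_one_of_one_lt₀ hζ
  refine ⟨(ι (kap a b wp e wm) * ζ ^ 2)⁻¹, ?_, ?_, ?_⟩
  · rw [inv_mul_cancel₀ (mul_ne_zero hk (pow_ne_zero _ hζ0)), map_one, sub_self, norm_zero]
    exact one_pos
  · rw [map_zero, sub_zero, mul_inv, mul_assoc, pow_two, mul_inv, inv_mul_cancel_right₀ hζ0,
      norm_mul, norm_inv, norm_inv, hk1, inv_one, one_mul]
    exact hlt
  · rw [map_zero, sub_zero, norm_inv, norm_mul, hk1, one_mul, norm_pow, ← inv_pow]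
    exact pow_lt_one₀ (inv_nonneg.2 (norm_nonneg _)) hlt two_ne_zero

theorem congMod_max_ptVec (h : IsUnitFrame a b wp e wm) {ζ : ℂ_[p]} (hζ : ‖ζ‖ ≤ 1) {c : ℚ_[p]}
    (hc : ‖c‖ ≤ 1) (hζc : ‖ζ - ι c‖ < 1) :
    CongMod (maxIdeal p) (Submodule.span ℤ_[p] {wp, e, wm}) (pt h.frame ζ)
      (ptVec a b wp e wm c) := by
  obtain ⟨h1, h2, h3⟩ := coord_ptVec h.frame c
  rw [congMod_max_iff h.frame, h1, h2, h3]
  refine ⟨1, ?_, by rwa [one_mul], by simp⟩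
  have e1 : 1 * (ι (kap a b wp e wm) * ζ ^ 2) - ι (kap a b wp e wm * c ^ 2) =
      ι (kap a b wp e wm) * ((ζ - ι c) * (ζ + ι c)) := by
    rw [map_mul, map_pow]; ring
  rw [e1, norm_mul, norm_iota, h.norm_kap, one_mul, norm_mul]
  refine mul_lt_one_of_nonneg_of_lt_one_left (norm_nonneg _) hζc ?_
  exact (IsUltrametricDist.norm_add_le_max _ _).trans (max_le hζ (by rwa [norm_iota]))

theorem norm_le_one_of_near {ζ : ℂ_[p]} (hζ : ‖ζ‖ < p) {c : ℚ_[p]} (hc : ‖ζ - ι c‖ < 1) :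
    ‖c‖ ≤ 1 ∧ ‖ζ‖ ≤ 1 := by
  have h1 : ‖c‖ ≤ 1 := by
    apply norm_le_one_of_lt_p
    have := norm_sub_lt_of_lt (x := ι c) (y := ζ) (z := 0)
      (by rw [norm_sub_rev]; exact hc.trans (one_lt_p (p := p))) (by rwa [sub_zero])
    rwa [sub_zero, norm_iota] at this
  refine ⟨h1, ?_⟩
  have := norm_sub_le_of_le (x := ζ) (y := ι c) (z := 0) hc.le (by rwa [sub_zero, norm_iota])
  rwa [sub_zero] at this

theorem mem_affinoid_iff (h : IsUnitFrame a b wp e wm) {ζ : ℂ_[p]} (hζ : Irrat p ζ) :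
    pt h.frame ζ ∈ affinoid a b (Submodule.span ℤ_[p] {wp, e, wm}) ↔ ‖ζ‖ ≤ 1 ∧ 1 ≤ rho p ζ := by
  constructor
  · rintro ⟨-, hz⟩
    by_contra hcon
    apply hz
    rcases lt_or_ge 1 ‖ζ‖ with h1 | h1
    · exact ⟨wp, primitive_wp h.frame, by rw [h.frame.quad_wp, norm_zero]; exact one_pos,
        congMod_max_wp h h1⟩
    · have h2 : ‖ζ - ι (nearest p ζ)‖ < 1 := by
        by_contra h2
        exact hcon ⟨h1, not_lt.1 h2⟩
      have h3 := (norm_le_one_of_near (h1.trans_lt one_lt_p) h2).1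
      exact ⟨ptVec a b wp e wm (nearest p ζ), primitive_ptVec h h3,
        by rw [h.frame.quadForm_ptVec, norm_zero]; exact one_pos, congMod_max_ptVec h h1 h3 h2⟩
  · rintro ⟨h1, h2⟩
    refine ⟨pt_mem_halfPlane h.frame hζ, ?_⟩
    rintro ⟨v, hv, -, hcong⟩
    rw [isPrimitiveIn_iff h.frame, mem_lattice_iff h.frame] at hv
    rw [congMod_max_iff h.frame] at hcong
    obtain ⟨c, k1, k2, k3⟩ := hcong
    obtain ⟨⟨m1, m2, m3⟩, hprim⟩ := hv
    rcases m3.lt_or_eq with m | m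
    · exact hprim (coords_lt_of_coordM_lt h h1 k1 k2 k3 m)
    · set δ := coordM a b wp e wm v
      set β := coordE a b wp e wm v
      have hδ : δ ≠ 0 := by rw [← norm_pos_iff, m]; exact one_pos
      have := rho_le ζ (β / δ)
      have e1 : ζ - ι (β / δ) = (ι δ)⁻¹ * ((c * ζ - ι β) - (c - ι δ) * ζ) := by
        have : ι δ ≠ 0 := (map_ne_zero _).2 hδ
        rw [map_div₀]; field_simp; ring
      rw [e1, norm_mul, norm_inv, norm_iota, m, inv_one, one_mul] at this
      have h4 : ‖(c * ζ - ι β) - (c - ι δ) * ζ‖ < 1 := by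
        refine (norm_sub_le_max' _ _).trans_lt (max_lt k2 ?_)
        rw [norm_mul]
        exact mul_lt_one_of_nonneg_of_lt_one_left (norm_nonneg _) k3 h1
      linarith

theorem relIndex_inf_eq (h : IsFrame a b wp e wm) :
    (Submodule.span ℤ_[p] {wp, e, wm} ⊓ Submodule.span ℤ_[p] {(p : ℚ_[p]) • wp, e,
      (p : ℚ_[p])⁻¹ • wm}).toAddSubgroup.relIndex
        (Submodule.span ℤ_[p] {wp, e, wm}).toAddSubgroup = p := by
  have hp0 : (p : ℚ_[p]) ≠ 0 := by exact_mod_cast (Fact.out : p.Prime).ne_zero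
  have hp := p_pos (p := p)
  have hex : ∀ v : (Submodule.span ℤ_[p] {wp, e, wm}).toAddSubgroup,
      ∃ x : ℤ_[p], (x : ℚ_[p]) = coordP a b wp e wm v :=
    fun v => ⟨⟨_, ((mem_lattice_iff h v).1 v.2).1⟩, rfl⟩
  choose co hco using hex
  let f : (Submodule.span ℤ_[p] {wp, e, wm}).toAddSubgroup →+ ZMod p :=
    { toFun := fun v => PadicInt.toZMod (co v)
      map_zero' := by
        have : co 0 = 0 := by
          apply Subtype.ext
          rw [hco]
          change coordP a b wp e wm 0 = 0
          rw [coordP, pairing_comm, pairing_zero_left, zero_div]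
        rw [this, map_zero]
      map_add' := fun v w => by
        have : co (v + w) = co v + co w := by
          apply Subtype.ext
          rw [hco, PadicInt.coe_add, hco, hco]
          exact coordP_add _ _
        rw [this, map_add] }
  have hmem : ∀ v : Vec ℚ_[p], v ∈ Submodule.span ℤ_[p] {(p : ℚ_[p]) • wp, e, (p : ℚ_[p])⁻¹ • wm} ↔
      ‖coordP a b wp e wm v‖ ≤ (p : ℝ)⁻¹ ∧ ‖coordE a b wp e wm v‖ ≤ 1 ∧
        ‖coordM a b wp e wm v‖ ≤ p := by
    intro v
    have h' := (h.shift 0 hp0).1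
    simp only [mul_zero, zero_smul, add_zero] at h'
    have e1 : ptVec a b wp e wm 0 = wm := by simp [ptVec]
    rw [e1] at h'
    have e2 : pairing a b ((p : ℚ_[p]) • wp) ((p : ℚ_[p])⁻¹ • wm) = pairing a b wp wm := by
      rw [pairing_smul_left, pairing_smul_right, mul_inv_cancel_left₀ hp0]
    rw [mem_lattice_iff h', coordP, coordE, coordM, e2, pairing_smul_left, pairing_smul_left,
      mul_div_assoc, mul_div_assoc, norm_mul, norm_mul, norm_inv, Padic.norm_p, inv_inv]
    change (p : ℝ) * ‖coordP a b wp e wm v‖ ≤ 1 ∧ ‖coordE a b wp e wm v‖ ≤ 1 ∧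
      (p : ℝ)⁻¹ * ‖coordM a b wp e wm v‖ ≤ 1 ↔ _
    rw [← le_div_iff₀' hp, one_div, inv_mul_le_iff₀ hp, mul_one]
  have hker : (Submodule.span ℤ_[p] {wp, e, wm} ⊓ Submodule.span ℤ_[p] {(p : ℚ_[p]) • wp, e,
      (p : ℚ_[p])⁻¹ • wm}).toAddSubgroup.addSubgroupOf
        (Submodule.span ℤ_[p] {wp, e, wm}).toAddSubgroup = f.ker := by
    ext ⟨v, hv⟩
    rw [AddSubgroup.mem_addSubgroupOf, AddMonoidHom.mem_ker]
    change (v ∈ Submodule.span ℤ_[p] {wp, e, wm} ∧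
      v ∈ Submodule.span ℤ_[p] {(p : ℚ_[p]) • wp, e, (p : ℚ_[p])⁻¹ • wm}) ↔
      PadicInt.toZMod (co ⟨v, hv⟩) = 0
    rw [← RingHom.mem_ker, PadicInt.ker_toZMod, IsLocalRing.mem_maximalIdeal,
      PadicInt.mem_nonunits, hmem, PadicInt.norm_def, hco]
    obtain ⟨h1, h2, h3⟩ := (mem_lattice_iff h v).1 hv
    constructor
    · rintro ⟨-, h4, -⟩
      exact h4.trans_lt (inv_lt_one_of_one_lt₀ one_lt_p)
    · intro h4
      exact ⟨hv, norm_le_p_inv h4, h2, h3.trans (one_lt_p (p := p)).le⟩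
  rw [AddSubgroup.relIndex, hker, AddSubgroup.index_ker]
  have hsurj : f.range = ⊤ := by
    rw [AddMonoidHom.range_eq_top]
    intro x
    obtain ⟨y, rfl⟩ := ZMod.ringHom_surjective (PadicInt.toZMod (p := p)) x
    have hy : (y : ℚ_[p]) • wp ∈ Submodule.span ℤ_[p] {wp, e, wm} :=
      Submodule.smul_mem _ y (mem_span_wp h)
    refine ⟨⟨_, hy⟩, ?_⟩
    have : co ⟨_, hy⟩ = y := by
      apply Subtype.ext
      rw [hco, coordP_smul, (coord_wp h).1, mul_one]
    change PadicInt.toZMod (co ⟨_, hy⟩) = _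
    rw [this]
  rw [hsurj]
  simp

theorem IsFrame.swap (h : IsFrame a b wp e wm) : IsFrame a b wm e wp := by
  refine ⟨h.quad_wm, h.quad_wp, h.pair_wm_e, h.pair_wp_e, ?_, h.quad_e_ne⟩
  rw [pairing_comm]; exact h.pair_ne

theorem isNeighbour_scale (h : IsFrame a b wp e wm) :
    IsNeighbour (Submodule.span ℤ_[p] {wp, e, wm}) (Submodule.span ℤ_[p] {(p : ℚ_[p]) • wp, e,
      (p : ℚ_[p])⁻¹ • wm}) := by
  have hp0 : (p : ℚ_[p]) ≠ 0 := by exact_mod_cast (Fact.out : p.Prime).ne_zero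
  refine ⟨relIndex_inf_eq h, ?_⟩
  have h' := (h.shift 0 hp0).1
  simp only [mul_zero, zero_smul, add_zero] at h'
  have e1 : ptVec a b wp e wm 0 = wm := by simp [ptVec]
  rw [e1] at h'
  have := relIndex_inf_eq h'.swap
  rw [smul_inv_smul₀ hp0, inv_smul_smul₀ hp0] at this
  have e2 : ∀ x y z : Vec ℚ_[p], ({x, y, z} : Set (Vec ℚ_[p])) = {z, y, x} := by
    intro x y z; ext w; simp; tauto
  rw [e2 _ e wp, e2 _ e (_ • wp), inf_comm] at this
  exact this

theorem span_integral_shift {x y d : ℚ_[p]} (hx : ‖x‖ ≤ 1) (hy : ‖y‖ ≤ 1) (hd : ‖d‖ ≤ 1) :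
    Submodule.span ℤ_[p] {wp, e + x • wp, y • wp + d • e + wm} =
      Submodule.span ℤ_[p] {wp, e, wm} := by
  have hs : ∀ (N : Submodule ℤ_[p] (Vec ℚ_[p])) (c : ℚ_[p]) (_ : ‖c‖ ≤ 1) (v : Vec ℚ_[p]),
      v ∈ N → c • v ∈ N := fun N c hc v hv => N.smul_mem (⟨c, hc⟩ : ℤ_[p]) hv
  have sub : ∀ v ∈ ({wp, e, wm} : Set (Vec ℚ_[p])), v ∈ Submodule.span ℤ_[p] {wp, e, wm} :=
    fun v hv => Submodule.subset_span hv
  have sub' : ∀ v ∈ ({wp, e + x • wp, y • wp + d • e + wm} : Set (Vec ℚ_[p])),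
      v ∈ Submodule.span ℤ_[p] {wp, e + x • wp, y • wp + d • e + wm} :=
    fun v hv => Submodule.subset_span hv
  apply le_antisymm <;> rw [Submodule.span_le]
  · rintro v (rfl | rfl | rfl)
    · exact sub _ (by simp)
    · exact Submodule.add_mem _ (sub _ (by simp)) (hs _ _ hx _ (sub _ (by simp)))
    · exact Submodule.add_mem _ (Submodule.add_mem _ (hs _ _ hy _ (sub _ (by simp)))
        (hs _ _ hd _ (sub _ (by simp)))) (sub _ (by simp))
  · have he : e ∈ Submodule.span ℤ_[p] {wp, e + x • wp, y • wp + d • e + wm} := by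
      have := Submodule.sub_mem _ (sub' (e + x • wp) (by simp)) (hs _ _ hx _ (sub' wp (by simp)))
      rwa [add_sub_cancel_right] at this
    rintro v (rfl | rfl | rfl)
    · exact sub' _ (by simp)
    · exact he
    · have := Submodule.sub_mem _ (sub' (y • wp + d • e + v) (by simp))
        (Submodule.add_mem _ (hs _ _ hy _ (sub' wp (by simp))) (hs _ _ hd _ he))
      rwa [add_sub_cancel_left] at this

theorem span_shift_one (hp2 : p ≠ 2) (h : IsUnitFrame a b wp e wm) {c : ℚ_[p]} (hc : ‖c‖ ≤ 1) :
    Submodule.span ℤ_[p] {wp, e + (2 * kap a b wp e wm * c) • wp, ptVec a b wp e wm c} =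
      Submodule.span ℤ_[p] {wp, e, wm} := by
  rw [ptVec, one_smul]
  apply span_integral_shift
  · rw [norm_mul, norm_mul, norm_two_eq hp2, h.norm_kap]; simpa using hc
  · rw [norm_mul, h.norm_kap, one_mul, norm_pow]; exact pow_le_one₀ (norm_nonneg _) hc
  · exact hc

end Reduction

section WideOpens

variable {a b : ℚ} {p : ℕ} [Fact p.Prime] {wp e wm : Vec ℚ_[p]}

local notation "ι" => algebraMap ℚ_[p] ℂ_[p]

theorem p_smul_eq (v : Vec ℚ_[p]) : (p : ℤ_[p]) • v = (p : ℚ_[p]) • v := by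
  rw [← algebraMap_smul ℚ_[p] (p : ℤ_[p]) v, map_natCast]

theorem norm_lt_p_of_not_congMod (h : IsUnitFrame a b wp e wm) {ζ : ℂ_[p]} {v : Vec ℚ_[p]}
    (hv : IsPrimitiveIn (Submodule.span ℤ_[p] {wp, e, wm}) v)
    (h1 : CongMod (maxIdeal p) (Submodule.span ℤ_[p] {wp, e, wm}) (pt h.frame ζ) v)
    (h2 : ¬ CongMod (pIdeal p) (Submodule.span ℤ_[p] {wp, e, wm}) (pt h.frame ζ) v) :
    ‖ζ‖ < p := by
  by_contra hlt
  rw [not_lt] at hlt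
  apply h2
  have hp := p_pos (p := p)
  rw [isPrimitiveIn_iff h.frame, mem_lattice_iff h.frame] at hv
  rw [congMod_max_iff h.frame] at h1
  rw [congMod_p_iff h.frame]
  obtain ⟨c, k1, k2, k3⟩ := h1
  obtain ⟨⟨m1, m2, m3⟩, hprim⟩ := hv
  set α := coordP a b wp e wm v
  set β := coordE a b wp e wm v
  set δ := coordM a b wp e wm v
  have hκ : ‖ι (kap a b wp e wm)‖ = 1 := by rw [norm_iota, h.norm_kap]
  have hκ0 : ι (kap a b wp e wm) ≠ 0 := (map_ne_zero _).2 h.frame.kap_ne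
  have hζ0 : ζ ≠ 0 := by rintro rfl; rw [norm_zero] at hlt; linarith
  have hζp : 0 < ‖ζ‖ := norm_pos_iff.2 hζ0
  have hinv : ‖ζ‖⁻¹ ≤ (p : ℝ)⁻¹ := inv_anti₀ hp hlt
  have hpinv : (p : ℝ)⁻¹ < 1 := inv_lt_one_of_one_lt₀ one_lt_p
  -- the vectors `x / ζ` and `x / ζ ^ 2` are small when `x` is integral
  have sm : ∀ x : ℂ_[p], ‖x‖ ≤ 1 → ‖x * ζ⁻¹‖ ≤ (p : ℝ)⁻¹ ∧ ‖x * ζ⁻¹ * ζ⁻¹‖ ≤ (p : ℝ)⁻¹ := by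
    intro x hx
    have e1 : ‖x * ζ⁻¹‖ ≤ (p : ℝ)⁻¹ := by
      rw [norm_mul, norm_inv]
      exact (mul_le_of_le_one_left (inv_nonneg.2 hζp.le) hx).trans hinv
    refine ⟨e1, ?_⟩
    rw [norm_mul, norm_inv]
    exact (mul_le_of_le_one_right (norm_nonneg _) (hinv.trans hpinv.le)).trans e1
  have red : ∀ (x : ℂ_[p]) (y : ℚ_[p]), ‖x‖ ≤ (p : ℝ)⁻¹ → ‖x - ι y‖ < 1 → ‖y‖ ≤ (p : ℝ)⁻¹ := by
    intro x y hx hxy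
    apply norm_le_p_inv
    have := norm_sub_lt_of_lt (x := ι y) (y := x) (z := 0) (by rwa [norm_sub_rev])
      (by rw [sub_zero]; exact hx.trans_lt hpinv)
    rwa [sub_zero, norm_iota] at this
  have hc : ‖c * (ι (kap a b wp e wm) * ζ ^ 2)‖ ≤ 1 := by
    have := norm_sub_le_of_le (x := c * (ι (kap a b wp e wm) * ζ ^ 2)) (y := ι α) (z := 0) k1.le
      (by rwa [sub_zero, norm_iota])
    rwa [sub_zero] at this
  have hc' : ‖c * ζ * ζ‖ ≤ 1 := by
    rw [norm_mul, norm_mul, hκ, one_mul, ← norm_mul] at hc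
    rwa [mul_assoc, ← pow_two]
  obtain ⟨s1, s2⟩ := sm _ hc'
  rw [mul_inv_cancel_right₀ hζ0] at s1 s2
  rw [mul_inv_cancel_right₀ hζ0] at s2
  have hβ := red _ _ s1 k2
  have hδ := red _ _ s2 k3
  obtain ⟨t1, t2⟩ := sm ((ι (kap a b wp e wm))⁻¹ * ι α)
    (by rw [norm_mul, norm_inv, hκ, inv_one, one_mul, norm_iota]; exact m1)
  refine ⟨(ι (kap a b wp e wm))⁻¹ * ι α * ζ⁻¹ * ζ⁻¹, ?_, ?_, ?_⟩
  · have : (ι (kap a b wp e wm))⁻¹ * ι α * ζ⁻¹ * ζ⁻¹ * (ι (kap a b wp e wm) * ζ ^ 2) - ι α = 0 := by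
      field_simp; ring
    rw [this, norm_zero]; positivity
  · rw [inv_mul_cancel_right₀ hζ0]
    exact (norm_sub_le_max' _ _).trans (max_le t1 (by rwa [norm_iota]))
  · exact (norm_sub_le_max' _ _).trans (max_le t2 (by rwa [norm_iota]))

theorem lt_rho_of_not_congMod (h : IsUnitFrame a b wp e wm) {ζ : ℂ_[p]} {v : Vec ℚ_[p]}
    (hζ : ‖ζ‖ < p) (hv : IsPrimitiveIn (Submodule.span ℤ_[p] {wp, e, wm}) v)
    (h1 : CongMod (maxIdeal p) (Submodule.span ℤ_[p] {wp, e, wm}) (pt h.frame ζ) v)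
    (h2 : ¬ CongMod (pIdeal p) (Submodule.span ℤ_[p] {wp, e, wm}) (pt h.frame ζ) v) :
    (p : ℝ)⁻¹ < rho p ζ := by
  by_contra hlt
  rw [not_lt] at hlt
  apply h2
  have hp := p_pos (p := p)
  have hpinv : (p : ℝ)⁻¹ < 1 := inv_lt_one_of_one_lt₀ one_lt_p
  have hn : ‖ζ - ι (nearest p ζ)‖ ≤ (p : ℝ)⁻¹ := hlt
  set n := nearest p ζ
  obtain ⟨hn1, hζ1⟩ := norm_le_one_of_near hζ (hn.trans_lt hpinv)
  rw [isPrimitiveIn_iff h.frame, mem_lattice_iff h.frame] at hv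
  rw [congMod_max_iff h.frame] at h1
  rw [congMod_p_iff h.frame]
  obtain ⟨c, k1, k2, k3⟩ := h1
  obtain ⟨⟨m1, m2, m3⟩, hprim⟩ := hv
  have hm : ¬ ‖coordM a b wp e wm v‖ < 1 := fun m =>
    hprim (coords_lt_of_coordM_lt h hζ1 k1 k2 k3 m)
  set α := coordP a b wp e wm v
  set β := coordE a b wp e wm v
  set δ := coordM a b wp e wm v
  set κ := kap a b wp e wm with hκd
  have hκ : ‖ι κ‖ = 1 := by rw [norm_iota, h.norm_kap]
  have hδ1 : ‖ι δ‖ ≤ 1 := by rwa [norm_iota]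
  have hζ2 : ‖ι κ * ζ ^ 2‖ ≤ 1 := by
    rw [norm_mul, hκ, one_mul, norm_pow]; exact pow_le_one₀ (norm_nonneg _) hζ1
  -- a congruence modulo the maximal ideal between rational numbers is one modulo `p`
  have up : ∀ (X : ℂ_[p]) (x y : ℚ_[p]), ‖X‖ ≤ 1 → ‖X - ι x‖ ≤ (p : ℝ)⁻¹ → ‖c * X - ι y‖ < 1 →
      ‖ι δ * X - ι y‖ ≤ (p : ℝ)⁻¹ := by
    intro X x y hX hx hy
    have e1 : ‖ι δ * X - ι (δ * x)‖ ≤ (p : ℝ)⁻¹ := by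
      rw [map_mul, ← mul_sub, norm_mul]
      exact (mul_le_of_le_one_left (norm_nonneg _) hδ1).trans hx
    have e2 : ‖ι (δ * x) - ι y‖ < 1 := by
      refine norm_sub_lt_of_lt (y := ι δ * X) ?_ ?_
      · rw [norm_sub_rev]; exact e1.trans_lt hpinv
      · refine norm_sub_lt_of_lt (y := c * X) ?_ hy
        rw [← sub_mul, norm_mul, norm_sub_rev]
        exact mul_lt_one_of_nonneg_of_lt_one_left (norm_nonneg _) k3 hX
    refine norm_sub_le_of_le e1 ?_
    rw [← map_sub, norm_iota]
    apply norm_le_p_inv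
    rwa [← norm_iota (p := p), map_sub]
  refine ⟨ι δ, up _ (κ * n ^ 2) _ hζ2 ?_ k1, up _ n _ hζ1 hn k2, by rw [sub_self, norm_zero]; positivity⟩
  have e1 : ι κ * ζ ^ 2 - ι (κ * n ^ 2) = ι κ * ((ζ - ι n) * (ζ + ι n)) := by
    rw [map_mul, map_pow]; ring
  rw [e1, norm_mul, hκ, one_mul, norm_mul]
  refine (mul_le_of_le_one_right (norm_nonneg _) ?_).trans hn
  exact (IsUltrametricDist.norm_add_le_max _ _).trans (max_le hζ1 (by rwa [norm_iota]))

theorem not_congMod_p_wp (h : IsUnitFrame a b wp e wm) {ζ : ℂ_[p]} (hζ : ‖ζ‖ < p) :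
    ¬ CongMod (pIdeal p) (Submodule.span ℤ_[p] {wp, e, wm}) (pt h.frame ζ) wp := by
  obtain ⟨h1, h2, h3⟩ := coord_wp h.frame
  have hp := p_pos (p := p)
  rw [congMod_p_iff h.frame, h1, h2, h3]
  rintro ⟨c, k1, k2, -⟩
  rw [map_zero, sub_zero] at k2
  rw [map_one] at k1
  have h4 : ‖c * (ι (kap a b wp e wm) * ζ ^ 2)‖ = 1 := by
    have := norm_eq_of_norm_sub_lt (x := 1) (y := c * (ι (kap a b wp e wm) * ζ ^ 2)) (by
      rw [norm_sub_rev, norm_one]; exact k1.trans_lt (inv_lt_one_of_one_lt₀ one_lt_p))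
    rwa [norm_one] at this
  rw [norm_mul, norm_mul, norm_iota, h.norm_kap, one_mul, pow_two, norm_mul, ← mul_assoc,
    ← norm_mul] at h4
  have h5 : ‖c * ζ‖ * ‖ζ‖ < (p : ℝ)⁻¹ * p := by
    rcases (norm_nonneg (c * ζ)).eq_or_lt with h0 | h0
    · rw [← h0, zero_mul]; positivity
    · exact mul_lt_mul' k2 hζ (norm_nonneg _) (by positivity)
  rw [inv_mul_cancel₀ hp.ne', h4] at h5
  exact lt_irrefl _ h5

theorem not_congMod_p_ptVec (h : IsUnitFrame a b wp e wm) {ζ : ℂ_[p]} (hζ1 : ‖ζ‖ ≤ 1)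
    {c : ℚ_[p]} (hζ : (p : ℝ)⁻¹ < ‖ζ - ι c‖) :
    ¬ CongMod (pIdeal p) (Submodule.span ℤ_[p] {wp, e, wm}) (pt h.frame ζ)
      (ptVec a b wp e wm c) := by
  obtain ⟨h1, h2, h3⟩ := coord_ptVec h.frame c
  rw [congMod_p_iff h.frame, h1, h2, h3, map_one]
  rintro ⟨d, -, k2, k3⟩
  have e1 : ζ - ι c = (d * ζ - ι c) - (d - 1) * ζ := by ring
  have : ‖ζ - ι c‖ ≤ (p : ℝ)⁻¹ := by
    rw [e1]
    refine (norm_sub_le_max' _ _).trans (max_le k2 ?_)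
    rw [norm_mul]
    exact (mul_le_of_le_one_right (norm_nonneg _) hζ1).trans k3
  linarith

theorem mem_wideOpen_iff (hp2 : p ≠ 2) (h : IsUnitFrame a b wp e wm) {ζ : ℂ_[p]}
    (hζ : Irrat p ζ) :
    pt h.frame ζ ∈ wideOpen a b (Submodule.span ℤ_[p] {wp, e, wm}) ↔
      ‖ζ‖ < p ∧ (p : ℝ)⁻¹ < rho p ζ := by
  have hp := p_pos (p := p)
  have hp0 : (p : ℚ_[p]) ≠ 0 := by exact_mod_cast (Fact.out : p.Prime).ne_zero
  have hpinv : (p : ℝ)⁻¹ < 1 := inv_lt_one_of_one_lt₀ one_lt_p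
  constructor
  · rintro (hA | ⟨L', -, -, -, v, hv, -, -, h1, h2⟩)
    · obtain ⟨h1, h2⟩ := (mem_affinoid_iff h hζ).1 hA
      exact ⟨h1.trans_lt one_lt_p, hpinv.trans_le h2⟩
    · have h3 := norm_lt_p_of_not_congMod h hv h1 h2
      exact ⟨h3, lt_rho_of_not_congMod h h3 hv h1 h2⟩
  · rintro ⟨h1, h2⟩
    by_cases hA : ‖ζ‖ ≤ 1 ∧ 1 ≤ rho p ζ
    · exact Or.inl ((mem_affinoid_iff h hζ).2 hA)
    right
    rcases lt_or_ge 1 ‖ζ‖ with hζ1 | hζ1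
    · have hs := h.shift 0 (inv_ne_zero hp0)
      have hn := isNeighbour_scale h.frame.swap
      have e0 : ptVec a b wp e wm 0 = wm := by simp [ptVec]
      rw [mul_zero, zero_smul, add_zero, e0, inv_inv] at hs
      have e2 : ∀ x y z : Vec ℚ_[p], ({x, y, z} : Set (Vec ℚ_[p])) = {z, y, x} := by
        intro x y z; ext w; simp; tauto
      rw [e2 wm e wp, e2 (_ • wm) e (_ • wp)] at hn
      refine ⟨_, hs.isUnimodular hp2, hn, pt_mem_halfPlane h.frame hζ, wp, primitive_wp h.frame,
        ?_, by rw [h.frame.quad_wp, norm_zero]; exact one_pos, congMod_max_wp h hζ1,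
        not_congMod_p_wp h h1⟩
      have := Submodule.smul_mem _ (p : ℤ_[p]) (mem_span_wp hs.frame)
      rwa [p_smul_eq, smul_inv_smul₀ hp0] at this
    · have h3 : ‖ζ - ι (nearest p ζ)‖ < 1 := by
        by_contra h3
        exact hA ⟨hζ1, not_lt.1 h3⟩
      have h4 : (p : ℝ)⁻¹ < ‖ζ - ι (nearest p ζ)‖ := h2
      set n := nearest p ζ
      obtain ⟨hn1, -⟩ := norm_le_one_of_near h1 h3
      have hs := h.shift n hp0
      have hn := isNeighbour_scale (h.frame.shift n one_ne_zero).1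
      rw [one_smul, inv_one, one_smul, span_shift_one hp2 h hn1] at hn
      refine ⟨_, hs.isUnimodular hp2, hn, pt_mem_halfPlane h.frame hζ, _, primitive_ptVec h hn1,
        ?_, by rw [h.frame.quadForm_ptVec, norm_zero]; exact one_pos,
        congMod_max_ptVec h hζ1 hn1 h3, not_congMod_p_ptVec h hζ1 h4⟩
      have := Submodule.smul_mem _ (p : ℤ_[p]) (mem_span_wm hs.frame)
      rwa [p_smul_eq, smul_inv_smul₀ hp0] at this

end WideOpens

section BallLattices

variable {a b : ℚ} {p : ℕ} [Fact p.Prime] {wp e wm : Vec ℚ_[p]}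

local notation "ι" => algebraMap ℚ_[p] ℂ_[p]

/-- The unimodular lattice corresponding to the ball with centre `c` and radius `p ^ (-r)`. -/
def ballLattice (a b : ℚ) (wp e wm : Vec ℚ_[p]) (c : ℚ_[p]) (r : ℤ) :
    Submodule ℤ_[p] (Vec ℚ_[p]) :=
  Submodule.span ℤ_[p] {(p : ℚ_[p]) ^ r • wp, e + (2 * kap a b wp e wm * c) • wp,
    ((p : ℚ_[p]) ^ r)⁻¹ • ptVec a b wp e wm c}

theorem pQ_ne_zero : (p : ℚ_[p]) ≠ 0 := by exact_mod_cast (Fact.out : p.Prime).ne_zero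

theorem norm_p_zpow (r : ℤ) : ‖(p : ℚ_[p]) ^ r‖ = (p : ℝ) ^ (-r) := by
  rw [norm_zpow, Padic.norm_p, inv_zpow, zpow_neg]

theorem IsUnitFrame.ball (h : IsUnitFrame a b wp e wm) (c : ℚ_[p]) (r : ℤ) :
    IsUnitFrame a b ((p : ℚ_[p]) ^ r • wp) (e + (2 * kap a b wp e wm * c) • wp)
      (((p : ℚ_[p]) ^ r)⁻¹ • ptVec a b wp e wm c) :=
  h.shift c (zpow_ne_zero _ pQ_ne_zero)

theorem isUnimodular_ball (hp2 : p ≠ 2) (h : IsUnitFrame a b wp e wm) (c : ℚ_[p]) (r : ℤ) :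
    IsUnimodular a b (ballLattice a b wp e wm c r) := (h.ball c r).isUnimodular hp2

theorem ballLattice_zero : ballLattice a b wp e wm 0 0 = Submodule.span ℤ_[p] {wp, e, wm} := by
  simp [ballLattice, ptVec]

theorem isNeighbour_ball (h : IsUnitFrame a b wp e wm) (c : ℚ_[p]) (r : ℤ) :
    IsNeighbour (ballLattice a b wp e wm c r) (ballLattice a b wp e wm c (r + 1)) := by
  have := isNeighbour_scale (h.ball c r).frame
  rwa [smul_smul, smul_smul, ← mul_inv, ← zpow_one_add₀ pQ_ne_zero, add_comm 1 r] at this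

theorem ballLattice_eq (hp2 : p ≠ 2) (h : IsUnitFrame a b wp e wm) {c : ℚ_[p]} {r : ℤ}
    (hc : ‖c‖ ≤ (p : ℝ) ^ (-r)) :
    ballLattice a b wp e wm c r = ballLattice a b wp e wm 0 r := by
  have hq0 : (p : ℚ_[p]) ^ r ≠ 0 := zpow_ne_zero _ pQ_ne_zero
  set q := (p : ℚ_[p]) ^ r with hq
  have hd : ‖c / q‖ ≤ 1 := by
    rw [norm_div, hq, norm_p_zpow, div_le_one (p_zpow_pos _)]; exact hc
  have h1 := span_integral_shift (p := p) (wp := q • wp) (e := e) (wm := q⁻¹ • wm)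
    (x := 2 * kap a b wp e wm * (c / q)) (y := kap a b wp e wm * (c / q) ^ 2) (d := c / q)
    (by rw [norm_mul, norm_mul, norm_two_eq hp2, h.norm_kap]; simpa using hd)
    (by rw [norm_mul, h.norm_kap, one_mul, norm_pow]; exact pow_le_one₀ (norm_nonneg _) hd) hd
  have e0 : ballLattice a b wp e wm 0 r = Submodule.span ℤ_[p] {q • wp, e, q⁻¹ • wm} := by
    simp [ballLattice, ptVec, hq]
  rw [e0, ← h1, ballLattice, ← hq]
  have e1 : (2 * kap a b wp e wm * (c / q)) • q • wp = (2 * kap a b wp e wm * c) • wp := by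
    rw [smul_smul]; congr 1; field_simp
  have e2 : (kap a b wp e wm * (c / q) ^ 2) • q • wp + (c / q) • e + q⁻¹ • wm =
      q⁻¹ • ptVec a b wp e wm c := by
    rw [ptVec, smul_add, smul_add, smul_smul, smul_smul, smul_smul, smul_smul, mul_one]
    congr 3
    · field_simp
    · field_simp
  rw [e1, e2]

theorem even_iff_of_succ {g : ℤ → Prop} (hg : ∀ r, g (r + 1) ↔ ¬ g r) {r₀ : ℤ}
    (h₀ : g r₀ ↔ Even r₀) (r : ℤ) : g r ↔ Even r := by
  refine Int.inductionOn' (motive := fun r => g r ↔ Even r) r r₀ h₀ (fun k _ ih => ?_)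
    fun k _ ih => ?_
  · rw [hg, ih, Int.even_add_one]
  · have := hg (k - 1)
    rw [sub_add_cancel, ih] at this
    rw [Int.even_sub_one]
    tauto

/-- The parity of a vertex is the parity of the level of the corresponding ball. -/
theorem par_ball (hp2 : p ≠ 2) (h : IsUnitFrame a b wp e wm)
    {par : Submodule ℤ_[p] (Vec ℚ_[p]) → Prop} (hpar : IsParity a b par)
    (h₀ : par (Submodule.span ℤ_[p] {wp, e, wm})) (c : ℚ_[p]) (r : ℤ) :
    par (ballLattice a b wp e wm c r) ↔ Even r := by
  have succ : ∀ c r, par (ballLattice a b wp e wm c (r + 1)) ↔ ¬ par (ballLattice a b wp e wm c r) :=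
    fun c r => hpar _ _ (isUnimodular_ball hp2 h c r) (isUnimodular_ball hp2 h c _)
      (isNeighbour_ball h c r)
  have zero : ∀ r, par (ballLattice a b wp e wm 0 r) ↔ Even r :=
    even_iff_of_succ (g := fun r => par (ballLattice a b wp e wm 0 r)) (succ 0) (r₀ := 0) (by rw [ballLattice_zero]; simpa using h₀)
  obtain ⟨r₀, hr₀⟩ : ∃ r₀ : ℤ, ‖c‖ ≤ (p : ℝ) ^ (-r₀) := by
    by_cases hc : c = 0
    · exact ⟨0, by simp [hc]⟩
    · obtain ⟨n, hn⟩ := norm_zpow_of_ne hc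
      exact ⟨-n, by rw [neg_neg, hn]⟩
  exact even_iff_of_succ (g := fun r => par (ballLattice a b wp e wm c r)) (succ c) (r₀ := r₀) (by rw [ballLattice_eq hp2 h hr₀]; exact zero r₀) r

theorem pt_shift (h : IsUnitFrame a b wp e wm) (c : ℚ_[p]) (r : ℤ) (ζ : ℂ_[p]) :
    pt h.frame ζ = pt (h.ball c r).frame (ι ((p : ℚ_[p]) ^ r)⁻¹ * (ζ + ι (-c))) := by
  have hq0 : (p : ℚ_[p]) ^ r ≠ 0 := zpow_ne_zero _ pQ_ne_zero
  rw [pt, pt, Projectivization.mk_eq_mk_iff']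
  generalize (p : ℚ_[p]) ^ r = q at *
  have hq1 : ι q ≠ 0 := (map_ne_zero _).2 hq0
  have := (h.frame.toCp.shift (ι c) hq1).2.2.2 (ι q⁻¹ * (ζ + ι (-c)))
  refine ⟨ι q, ?_⟩
  have e2 : ι (2 * kap a b wp e wm * c) = 2 * ι (kap a b wp e wm) * ι c := by
    rw [map_mul, map_mul, map_ofNat]
  rw [toCp_add, toCp_smul, toCp_smul, toCp_smul, e2, map_inv₀ ι q, ← ptVec_toCp]
  rw [kap_toCp, map_inv₀ ι q] at this
  rw [this, smul_inv_smul₀ hq1, map_neg]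
  congr 1
  field_simp
  ring

theorem mem_affinoid_ball (h : IsUnitFrame a b wp e wm) {ζ : ℂ_[p]} (hζ : Irrat p ζ) (c : ℚ_[p])
    (r : ℤ) : pt h.frame ζ ∈ affinoid a b (ballLattice a b wp e wm c r) ↔
      ‖ζ - ι c‖ ≤ (p : ℝ) ^ (-r) ∧ (p : ℝ) ^ (-r) ≤ rho p ζ := by
  have hq0 : (p : ℚ_[p]) ^ r ≠ 0 := zpow_ne_zero _ pQ_ne_zero
  rw [pt_shift h c r, ballLattice,
    mem_affinoid_iff (h.ball c r) (irrat_mul (irrat_add hζ _) (inv_ne_zero hq0)),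
    rho_mul _ (inv_ne_zero hq0), rho_add, norm_mul, norm_iota, norm_inv, norm_p_zpow,
    map_neg, ← sub_eq_add_neg, inv_mul_le_iff₀ (p_zpow_pos _), mul_one, ← div_eq_inv_mul,
    one_le_div (p_zpow_pos _)]

theorem mem_wideOpen_ball (hp2 : p ≠ 2) (h : IsUnitFrame a b wp e wm) {ζ : ℂ_[p]}
    (hζ : Irrat p ζ) (c : ℚ_[p]) (r : ℤ) :
    pt h.frame ζ ∈ wideOpen a b (ballLattice a b wp e wm c r) ↔
      ‖ζ - ι c‖ < (p : ℝ) ^ (1 - r) ∧ (p : ℝ) ^ (-r - 1) < rho p ζ := by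
  have hq0 : (p : ℚ_[p]) ^ r ≠ 0 := zpow_ne_zero _ pQ_ne_zero
  have hp := p_pos (p := p)
  rw [pt_shift h c r, ballLattice,
    mem_wideOpen_iff hp2 (h.ball c r) (irrat_mul (irrat_add hζ _) (inv_ne_zero hq0)),
    rho_mul _ (inv_ne_zero hq0), rho_add, norm_mul, norm_iota, norm_inv, norm_p_zpow,
    map_neg, ← sub_eq_add_neg, inv_mul_lt_iff₀ (p_zpow_pos _), ← div_eq_inv_mul,
    lt_div_iff₀ (p_zpow_pos _), ← zpow_neg_one, ← zpow_add₀ hp.ne', ← zpow_add_one₀ hp.ne']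
  rw [show -r + 1 = 1 - r by ring, show (-1 : ℤ) + -r = -r - 1 by ring]

/-- The parts of the partition of the upper half plane attached to one of the two parities are
wide opens and affinoids. -/
theorem lab_eq_iff_mem (hp2 : p ≠ 2) (h : IsUnitFrame a b wp e wm) {ζ₀ : ℂ_[p]}
    (hζ₀ : Irrat p ζ₀) (s : ℤ) :
    (Even (lev p s ζ₀ + s) ∧ ∀ ζ, Irrat p ζ → (lab p s ζ = lab p s ζ₀ ↔
      pt h.frame ζ ∈ wideOpen a b (ballLattice a b wp e wm (nearest p ζ₀) (lev p s ζ₀)))) ∨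
    (¬ Even (lev p s ζ₀ + s) ∧ ∀ ζ, Irrat p ζ → (lab p s ζ = lab p s ζ₀ ↔
      pt h.frame ζ ∈ affinoid a b (ballLattice a b wp e wm (nearest p ζ₀) (lev p s ζ₀)))) := by
  have hr := isLev_lev s hζ₀
  have hn := nearest_mem s hζ₀
  set r := lev p s ζ₀ with hrdef
  set c := nearest p ζ₀ with hcdef
  have lab₀ := lab_eq_of_mem hr hn
  by_cases he : Even (r + s)
  · refine Or.inl ⟨he, fun ζ hζ => ?_⟩
    rw [mem_wideOpen_ball hp2 h hζ]
    constructor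
    · intro hl
      obtain ⟨h0, h1⟩ := (lab_eq_iff hζ hζ₀).1 hl
      rw [h0] at h1
      refine ⟨norm_sub_lt_of_lt h1 hn, ?_⟩
      have := isLev_lev s hζ
      rw [h0] at this
      exact this.bounds.1
    · rintro ⟨h1, h2⟩
      rw [lab₀]
      exact lab_eq_of_mem (Or.inl ⟨he, h2, (rho_le ζ c).trans_lt h1⟩) h1
  · refine Or.inr ⟨he, fun ζ hζ => ?_⟩
    rw [mem_affinoid_ball h hζ]
    constructor
    · intro hl
      obtain ⟨h0, h1⟩ := (lab_eq_iff hζ hζ₀).1 hl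
      rw [h0] at h1
      have h2 := isLev_lev s hζ
      rw [h0] at h2
      have h3 : rho p ζ = (p : ℝ) ^ (-r) := by
        rcases h2 with ⟨h2, -⟩ | ⟨-, h2⟩
        · exact (he h2).elim
        · exact h2
      refine ⟨?_, h3.ge⟩
      have h4 : ‖ζ - ι (nearest p ζ)‖ ≤ (p : ℝ) ^ (-r) := h3.le
      refine norm_sub_le_of_le h4 ?_
      rw [← map_sub, norm_iota]
      apply norm_le_zpow_of_lt
      rw [← norm_iota, map_sub]
      refine norm_sub_lt_of_lt (y := ζ) ?_ ?_
      · rw [norm_sub_rev]; refine h4.trans_lt (p_zpow_lt.2 (by omega))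
      · rw [show -r + 1 = 1 - r by ring]; exact norm_sub_lt_of_lt h1 hn
    · rintro ⟨h1, h2⟩
      rw [lab₀]
      refine lab_eq_of_mem (Or.inr ⟨he, le_antisymm ((rho_le ζ c).trans h1) h2⟩) ?_
      exact h1.trans_lt (p_zpow_lt.2 (by omega))

/-- The parameter of a point of the conic. -/
def zcoord (h : IsFrame a b wp e wm) : Pt p → ℂ_[p] := Function.invFun (pt h)

theorem zcoord_pt (h : IsFrame a b wp e wm) (ζ : ℂ_[p]) : zcoord h (pt h ζ) = ζ :=
  Function.leftInverse_invFun (pt_injective h) ζ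

theorem pt_zcoord (h : IsFrame a b wp e wm) {z : Pt p} (hz : z ∈ halfPlane a b p) :
    pt h (zcoord h z) = z ∧ Irrat p (zcoord h z) := by
  obtain ⟨ζ, hζ, rfl⟩ := (mem_halfPlane_iff h z).1 hz
  rw [zcoord_pt]; exact ⟨rfl, hζ⟩

variable (a b) in
/-- Strong degree `0` in an even (`s = 0`) or in an odd (`s = 1`) sense. -/
def IsStrongZero (par : Submodule ℤ_[p] (Vec ℚ_[p]) → Prop) (s : ℤ) (𝒟 : Pt p →₀ ℤ) : Prop :=
  (∀ z ∈ 𝒟.support, z ∈ halfPlane a b p) ∧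
    ∀ L, IsUnimodular a b L →
      ((par L ↔ Even s) → degOn (wideOpen a b L) 𝒟 = 0) ∧
      (¬ (par L ↔ Even s) → degOn (affinoid a b L) 𝒟 = 0)

theorem IsStrongZeroEven.isStrongZero {par : Submodule ℤ_[p] (Vec ℚ_[p]) → Prop}
    {𝒟 : Pt p →₀ ℤ} (h : IsStrongZeroEven a b par 𝒟) : IsStrongZero a b par 0 𝒟 := by
  refine ⟨h.1, fun L hL => ?_⟩
  simpa using h.2 L hL

theorem IsStrongZeroOdd.isStrongZero {par : Submodule ℤ_[p] (Vec ℚ_[p]) → Prop}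
    {𝒟 : Pt p →₀ ℤ} (h : IsStrongZeroOdd a b par 𝒟) : IsStrongZero a b par 1 𝒟 := by
  refine ⟨h.1, fun L hL => ?_⟩
  simpa using h.2 L hL

open Classical in
theorem degOn_eq_sum (U : Set (Pt p)) (𝒟 : Pt p →₀ ℤ) :
    degOn U 𝒟 = ∑ z ∈ 𝒟.support with z ∈ U, 𝒟 z := by
  rw [degOn, Finsupp.sum, Finset.sum_filter]

open Classical in
/-- Divisors of strong degree `0` have degree `0` on each part of the partition. -/
theorem IsStrongZero.sum_lab_eq_zero (hp2 : p ≠ 2) (h : IsUnitFrame a b wp e wm)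
    {par : Submodule ℤ_[p] (Vec ℚ_[p]) → Prop} (hpar : IsParity a b par)
    (h₀ : par (Submodule.span ℤ_[p] {wp, e, wm})) {s : ℤ} {𝒟 : Pt p →₀ ℤ}
    (h𝒟 : IsStrongZero a b par s 𝒟) {ζ₀ : ℂ_[p]} (hζ₀ : Irrat p ζ₀) :
    ∑ z ∈ 𝒟.support with lab p s (zcoord h.frame z) = lab p s ζ₀, 𝒟 z = 0 := by
  have key : ∀ U : Set (Pt p), (∀ ζ, Irrat p ζ → (lab p s ζ = lab p s ζ₀ ↔ pt h.frame ζ ∈ U)) →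
      degOn U 𝒟 = 0 →
      ∑ z ∈ 𝒟.support with lab p s (zcoord h.frame z) = lab p s ζ₀, 𝒟 z = 0 := by
    intro U hU h0
    rw [← h0, degOn_eq_sum]
    refine Finset.sum_congr (Finset.filter_congr fun z hz => ?_) fun _ _ => rfl
    obtain ⟨h1, h2⟩ := pt_zcoord h.frame (h𝒟.1 z hz)
    rw [hU _ h2, h1]
  have hU := isUnimodular_ball hp2 h (nearest p ζ₀) (lev p s ζ₀)
  have hpb := par_ball hp2 h hpar h₀ (nearest p ζ₀) (lev p s ζ₀)
  rcases lab_eq_iff_mem hp2 h hζ₀ s with ⟨he, hl⟩ | ⟨he, hl⟩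
  · exact key _ hl ((h𝒟.2 _ hU).1 (by rw [hpb]; exact Int.even_add.1 he))
  · exact key _ hl ((h𝒟.2 _ hU).2 (by rw [hpb]; exact fun h' => he (Int.even_add.2 h')))

end BallLattices

/-! ### Conjugation and the frame of a hyperbolic element -/

section Conjugation

variable {a b : ℚ} {K : Type*} [CommRing K] [Algebra ℚ K]

theorem toQuat_conj_smul (x : (Quat a b K)ˣ) (v : Vec K) : toQuat a b (conj x • v) =
    (x : Quat a b K) * toQuat a b v * ((x⁻¹ : (Quat a b K)ˣ) : Quat a b K) := toQuat_conj x v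

theorem quadForm_conj (x : (Quat a b K)ˣ) (v : Vec K) :
    quadForm a b (conj x • v) = quadForm a b v := by
  rw [quadForm, toQuat_conj_smul, nrd_mul, nrd_mul, mul_right_comm, ← nrd_mul, Units.mul_inv,
    nrd_one, one_mul]
  rfl

theorem pairing_conj (x : (Quat a b K)ˣ) (v w : Vec K) :
    pairing a b (conj x • v) (conj x • w) = pairing a b v w := by
  rw [pairing, ← smul_add, quadForm_conj, quadForm_conj, quadForm_conj]
  rfl

theorem toQuat_mul_self (v : Vec K) :
    toQuat a b v * toQuat a b v = algebraMap K (Quat a b K) (-quadForm a b v) := by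
  ext <;> simp [quadForm, nrd, toQuat] <;> ring

theorem toQuat_add (v w : Vec K) : toQuat a b (v + w) = toQuat a b v + toQuat a b w := by
  ext <;> simp [toQuat]

theorem toQuat_smul (c : K) (v : Vec K) : toQuat a b (c • v) = c • toQuat a b v := by
  ext <;> simp [toQuat]

theorem toQuat_anticomm (v w : Vec K) : toQuat a b v * toQuat a b w + toQuat a b w * toQuat a b v =
    algebraMap K (Quat a b K) (-pairing a b v w) := by
  ext <;> simp [pairing, quadForm, nrd, toQuat] <;> ring

end Conjugation

section Hyperbolic

variable {a b : ℚ} {p : ℕ} [Fact p.Prime] {wp e wm : Vec ℚ_[p]}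

theorem IsHyperbolicFrame.smul_eq {par : Submodule ℤ_[p] (Vec ℚ_[p]) → Prop} {γ : (Quat a b ℚ)ˣ}
    {ϖ : ℚ_[p]} {t : ℕ} {L₀ : Submodule ℤ_[p] (Vec ℚ_[p])}
    (h : IsHyperbolicFrame par γ ϖ t L₀ wp e wm) :
    conjRat ℚ_[p] γ • wp = ϖ • wp ∧ conjRat ℚ_[p] γ • e = e ∧
      conjRat ℚ_[p] γ • wm = ϖ⁻¹ • wm := by
  have key : ∀ (μ : ℚ_[p]) (v : Vec ℚ_[p]), eigenPart γ μ L₀ = Submodule.span ℤ_[p] {v} →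
      conjRat ℚ_[p] γ • v = μ • v := by
    intro μ v hv
    have : v ∈ eigenPart γ μ L₀ := by rw [hv]; exact Submodule.mem_span_singleton_self v
    exact Module.End.mem_eigenspace_iff.1 this.2
  exact ⟨key _ _ h.span_wp, by simpa using key _ _ h.span_e, key _ _ h.span_wm⟩

theorem IsHyperbolicFrame.lattice_eq {par : Submodule ℤ_[p] (Vec ℚ_[p]) → Prop}
    {γ : (Quat a b ℚ)ˣ} {ϖ : ℚ_[p]} {t : ℕ} {L₀ : Submodule ℤ_[p] (Vec ℚ_[p])}
    (h : IsHyperbolicFrame par γ ϖ t L₀ wp e wm) : L₀ = Submodule.span ℤ_[p] {wp, e, wm} := by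
  conv_lhs => rw [h.depth_zero, h.span_wp, h.span_e, h.span_wm]
  rw [← Submodule.span_union, ← Submodule.span_union]
  congr 1
  ext x; simp; tauto

theorem IsHyperbolicFrame.ne_zero {par : Submodule ℤ_[p] (Vec ℚ_[p]) → Prop}
    {γ : (Quat a b ℚ)ˣ} {ϖ : ℚ_[p]} {t : ℕ} {L₀ : Submodule ℤ_[p] (Vec ℚ_[p])}
    (h : IsHyperbolicFrame par γ ϖ t L₀ wp e wm) : wp ≠ 0 ∧ e ≠ 0 ∧ wm ≠ 0 := by
  have hs : (⊤ : Submodule ℚ_[p] (Vec ℚ_[p])) ≤ Submodule.span ℚ_[p] (Set.range ![wp, e, wm]) := by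
    rw [← h.unimodular.2.1, Submodule.span_le, h.lattice_eq]
    intro x hx
    have : Submodule.span ℤ_[p] {wp, e, wm} ≤
        (Submodule.span ℚ_[p] (Set.range ![wp, e, wm])).restrictScalars ℤ_[p] := by
      rw [Submodule.span_le]
      rintro y (rfl | rfl | rfl)
      · exact Submodule.subset_span ⟨0, rfl⟩
      · exact Submodule.subset_span ⟨1, rfl⟩
      · exact Submodule.subset_span ⟨2, rfl⟩
    exact this hx
  have hli := linearIndependent_of_top_le_span_of_card_eq_finrank hs (by simp)
  exact ⟨hli.ne_zero 0, hli.ne_zero 1, hli.ne_zero 2⟩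

/-- The eigenvectors of a hyperbolic element form a frame. -/
theorem IsHyperbolicFrame.isUnitFrame (hp2 : p ≠ 2) {par : Submodule ℤ_[p] (Vec ℚ_[p]) → Prop}
    {γ : (Quat a b ℚ)ˣ} {ϖ : ℚ_[p]} {t : ℕ} {L₀ : Submodule ℤ_[p] (Vec ℚ_[p])}
    (h : IsHyperbolicFrame par γ ϖ t L₀ wp e wm) : IsUnitFrame a b wp e wm := by
  obtain ⟨h1, h2, h3⟩ := h.smul_eq
  obtain ⟨n1, n2, n3⟩ := h.ne_zero
  have hp := p_pos (p := p)
  have hϖ : 1 < ‖ϖ‖ := by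
    rw [h.norm_eq]; exact one_lt_pow₀ one_lt_p (by have := h.t_pos; omega)
  have hϖ0 : ϖ ≠ 0 := by rintro rfl; rw [norm_zero] at hϖ; linarith
  have hϖ1 : ϖ ≠ 1 := by rintro rfl; rw [norm_one] at hϖ; exact lt_irrefl _ hϖ
  have hϖ2 : ϖ ^ 2 ≠ 1 := by
    intro h0
    have := congrArg norm h0
    rw [norm_pow, norm_one] at this
    exact (one_lt_pow₀ hϖ two_ne_zero).ne' this
  have q1 : quadForm a b wp = 0 := by
    have := quadForm_conj (Units.map (baseChange (a := a) (b := b) ℚ_[p]).toMonoidHom γ) wp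
    change quadForm a b (conjRat ℚ_[p] γ • wp) = _ at this
    rw [h1, quadForm_smul] at this
    by_contra h0
    exact hϖ2 (mul_right_cancel₀ h0 (by rw [this, one_mul]))
  have q3 : quadForm a b wm = 0 := by
    have := quadForm_conj (Units.map (baseChange (a := a) (b := b) ℚ_[p]).toMonoidHom γ) wm
    change quadForm a b (conjRat ℚ_[p] γ • wm) = _ at this
    rw [h3, quadForm_smul] at this
    by_contra h0
    have h4 : (ϖ⁻¹) ^ 2 = 1 := mul_right_cancel₀ h0 (by rw [this, one_mul])
    rw [inv_pow, inv_eq_one] at h4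
    exact hϖ2 h4
  have pe : ∀ v w : Vec ℚ_[p], pairing a b (conjRat ℚ_[p] γ • v) (conjRat ℚ_[p] γ • w) =
      pairing a b v w :=
    pairing_conj (Units.map (baseChange (a := a) (b := b) ℚ_[p]).toMonoidHom γ)
  have e1 : pairing a b wp e = 0 := by
    have := pe wp e
    rw [h1, h2, pairing_smul_left] at this
    by_contra h0
    exact hϖ1 (mul_right_cancel₀ h0 (by rw [this, one_mul]))
  have e3 : pairing a b wm e = 0 := by
    have := pe wm e
    rw [h3, h2, pairing_smul_left] at this
    by_contra h0
    exact hϖ1 (inv_eq_one.1 (mul_right_cancel₀ h0 (by rw [this, one_mul])))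
  have hL := h.lattice_eq
  have m1 : wp ∈ L₀ := by rw [hL]; exact Submodule.subset_span (by simp)
  have m2 : e ∈ L₀ := by rw [hL]; exact Submodule.subset_span (by simp)
  have m3 : wm ∈ L₀ := by rw [hL]; exact Submodule.subset_span (by simp)
  have int : ∀ v ∈ L₀, ∀ w ∈ L₀, ‖pairing a b v w‖ ≤ 1 := fun v hv =>
    (h.unimodular.2.2 v).1 hv
  -- a generator of an eigenspace of the lattice is not divisible by `p` in the lattice
  have prim : ∀ (μ : ℚ_[p]) (v : Vec ℚ_[p]), v ≠ 0 →
      eigenPart γ μ L₀ = Submodule.span ℤ_[p] {v} → conjRat ℚ_[p] γ • v = μ • v →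
      (p : ℚ_[p])⁻¹ • v ∉ L₀ := by
    intro μ v hv hspan hγ hmem
    have hp0 : (p : ℚ_[p]) ≠ 0 := pQ_ne_zero
    have : (p : ℚ_[p])⁻¹ • v ∈ eigenPart γ μ L₀ := by
      refine ⟨hmem, ?_⟩
      change _ ∈ Module.End.eigenspace (conjRat ℚ_[p] γ).val μ
      refine Submodule.smul_mem _ _ (Module.End.mem_eigenspace_iff.2 hγ)
    rw [hspan, Submodule.mem_span_singleton] at this
    obtain ⟨c, hc⟩ := this
    change (c : ℚ_[p]) • v = _ at hc
    have h5 : (c : ℚ_[p]) = (p : ℚ_[p])⁻¹ := smul_left_injective _ hv hc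
    have h6 := c.2
    rw [h5, norm_inv, Padic.norm_p, inv_inv] at h6
    exact absurd h6 (not_le.2 one_lt_p)
  have gen : ∀ v : Vec ℚ_[p], (∀ w ∈ L₀, ‖pairing a b v w‖ < 1) → (p : ℚ_[p])⁻¹ • v ∈ L₀ := by
    intro v hv
    rw [h.unimodular.2.2]
    intro w hw
    rw [pairing_smul_left, norm_mul, norm_inv, Padic.norm_p, inv_inv, ← le_div_iff₀' hp, one_div]
    exact norm_le_p_inv (hv w hw)
  have dec : ∀ w ∈ L₀, ∃ x y z : ℤ_[p],
      w = (x : ℚ_[p]) • wp + (y : ℚ_[p]) • e + (z : ℚ_[p]) • wm := by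
    intro w hw
    rw [hL, Submodule.mem_span_triple] at hw
    obtain ⟨x, y, z, rfl⟩ := hw
    exact ⟨x, y, z, rfl⟩
  have u1 : ‖pairing a b wp wm‖ = 1 := by
    refine le_antisymm (int _ m1 _ m3) (not_lt.1 fun hlt => ?_)
    refine prim _ _ n1 h.span_wp h1 (gen _ fun w hw => ?_)
    obtain ⟨x, y, z, rfl⟩ := dec w hw
    rw [pairing_add_right, pairing_add_right, pairing_smul_right, pairing_smul_right,
      pairing_smul_right, pairing_self, q1, e1, mul_zero, mul_zero, mul_zero, add_zero, zero_add,
      norm_mul, mul_comm]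
    exact mul_lt_one_of_nonneg_of_lt_one_left (norm_nonneg _) hlt z.2
  have u2 : ‖quadForm a b e‖ = 1 := by
    have h5 : ‖pairing a b e e‖ = ‖quadForm a b e‖ := by
      rw [pairing_self, norm_mul, norm_two_eq hp2, one_mul]
    rw [← h5]
    refine le_antisymm (int _ m2 _ m2) (not_lt.1 fun hlt => ?_)
    refine prim _ _ n2 h.span_e (by rw [h2, one_smul]) (gen _ fun w hw => ?_)
    obtain ⟨x, y, z, rfl⟩ := dec w hw
    rw [pairing_add_right, pairing_add_right, pairing_smul_right, pairing_smul_right,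
      pairing_smul_right, pairing_comm e wp, pairing_comm e wm, e1, e3, mul_zero, mul_zero,
      add_zero, zero_add, norm_mul, mul_comm]
    exact mul_lt_one_of_nonneg_of_lt_one_left (norm_nonneg _) hlt y.2
  refine ⟨⟨q1, q3, e1, e3, ?_, ?_⟩, u1, u2⟩
  · rw [← norm_pos_iff, u1]; exact one_pos
  · rw [← norm_pos_iff, u2]; exact one_pos

end Hyperbolic

/-! ### Kernels of nilpotent matrices -/

section Kernel

variable {a b : ℚ} {p : ℕ} [Fact p.Prime] {wp e wm : Vec ℚ_[p]}
  (σ : Quat a b ℚ_[p] ≃ₐ[ℚ_[p]] Matrix (Fin 2) (Fin 2) ℚ_[p])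

local notation "ι" => algebraMap ℚ_[p] ℂ_[p]

theorem quat_decomp {K : Type*} [CommRing K] [Algebra ℚ K] (q : Quat a b K) :
    q = algebraMap K (Quat a b K) q.re + q.imI • toQuat a b (Pi.single 0 1) +
      q.imJ • toQuat a b (Pi.single 1 1) + q.imK • toQuat a b (Pi.single 2 1) := by
  ext <;> simp [toQuat]

theorem split_mul_map (x y : Quat a b ℚ_[p]) :
    (σ x).map ι * (σ y).map ι = (σ (x * y)).map ι := by
  rw [map_mul, Matrix.map_mul]

/-- The extension of the splitting to `ℂ_p`, on the standard generators. -/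
def splitBasis : QuaternionAlgebra.Basis (Matrix (Fin 2) (Fin 2) ℂ_[p])
    (algebraMap ℚ ℂ_[p] a) 0 (algebraMap ℚ ℂ_[p] b) where
  i := (σ (toQuat a b (Pi.single 0 1))).map ι
  j := (σ (toQuat a b (Pi.single 1 1))).map ι
  k := (σ (toQuat a b (Pi.single 2 1))).map ι
  i_mul_i := by
    rw [split_mul_map, toQuat_mul_self, ← iota_rat (p := p) a]
    have : -quadForm a b (Pi.single 0 1 : Vec ℚ_[p]) = algebraMap ℚ ℚ_[p] a := by
      rw [quadForm_eq]; simp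
    rw [this, AlgEquiv.commutes, zero_smul, add_zero]
    generalize algebraMap ℚ ℚ_[p] a = c
    ext i j
    fin_cases i <;> fin_cases j <;> simp [Matrix.algebraMap_matrix_apply]
  j_mul_j := by
    rw [split_mul_map, toQuat_mul_self, ← iota_rat (p := p) b]
    have : -quadForm a b (Pi.single 1 1 : Vec ℚ_[p]) = algebraMap ℚ ℚ_[p] b := by
      rw [quadForm_eq]; simp
    rw [this, AlgEquiv.commutes]
    generalize algebraMap ℚ ℚ_[p] b = c
    ext i j
    fin_cases i <;> fin_cases j <;> simp [Matrix.algebraMap_matrix_apply]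
  i_mul_j := by
    rw [split_mul_map]
    congr 2
    ext <;> simp [toQuat]
  j_mul_i := by
    rw [split_mul_map, zero_smul, zero_sub]
    have : toQuat a b (Pi.single 1 1 : Vec ℚ_[p]) * toQuat a b (Pi.single 0 1) =
        -toQuat a b (Pi.single 2 1) := by
      ext <;> simp [toQuat]
    rw [this, map_neg]
    ext i j; simp

/-- The extension of the splitting to `ℂ_p`. -/
def splitC : Quat a b ℂ_[p] →ₐ[ℂ_[p]] Matrix (Fin 2) (Fin 2) ℂ_[p] := (splitBasis σ).liftHom

theorem splitC_toQuat (x : Vec ℂ_[p]) : splitC σ (toQuat a b x) = matrixOf σ x := by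
  simp [splitC, QuaternionAlgebra.Basis.lift, matrixOf, Fin.sum_univ_three, toQuat, splitBasis]

theorem splitC_of_map (q : Quat a b ℚ_[p]) :
    splitC σ ⟨ι q.re, ι q.imI, ι q.imJ, ι q.imK⟩ = (σ q).map ι := by
  conv_rhs => rw [quat_decomp q, map_add, map_add, map_add, map_smul, map_smul, map_smul,
    AlgEquiv.commutes]
  ext i j
  fin_cases i <;> fin_cases j <;>
    simp [splitC, QuaternionAlgebra.Basis.lift, splitBasis, Matrix.algebraMap_matrix_apply] <;>
    simp only [Algebra.smul_def]

theorem matrixOf_toCp (v : Vec ℚ_[p]) : matrixOf σ (toCp p v) = (σ (toQuat a b v)).map ι := by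
  rw [← splitC_toQuat, ← splitC_of_map]
  congr 1
  ext <;> simp [toQuat, toCp]

theorem splitC_baseChange (q : Quat a b ℚ) :
    splitC σ (baseChange ℂ_[p] q) = (σ (baseChange ℚ_[p] q)).map ι := by
  rw [← splitC_of_map]
  congr 1
  ext <;> simp [baseChange]

end Kernel

section KernelFrame

variable {a b : ℚ} {p : ℕ} [Fact p.Prime] {wp e wm : Vec ℚ_[p]}
  (σ : Quat a b ℚ_[p] ≃ₐ[ℚ_[p]] Matrix (Fin 2) (Fin 2) ℚ_[p])

local notation "ι" => algebraMap ℚ_[p] ℂ_[p]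

theorem matrixOf_add (x y : Vec ℂ_[p]) : matrixOf σ (x + y) = matrixOf σ x + matrixOf σ y := by
  rw [← splitC_toQuat, toQuat_add, map_add, splitC_toQuat, splitC_toQuat]

theorem matrixOf_smul (c : ℂ_[p]) (x : Vec ℂ_[p]) : matrixOf σ (c • x) = c • matrixOf σ x := by
  rw [← splitC_toQuat, toQuat_smul, map_smul, splitC_toQuat]

theorem matrixOf_mul_self (x : Vec ℂ_[p]) :
    matrixOf σ x * matrixOf σ x = algebraMap ℂ_[p] _ (-quadForm a b x) := by
  rw [← splitC_toQuat, ← map_mul, toQuat_mul_self, AlgHom.commutes]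

theorem matrixOf_anticomm (x y : Vec ℂ_[p]) :
    matrixOf σ x * matrixOf σ y + matrixOf σ y * matrixOf σ x =
      algebraMap ℂ_[p] _ (-pairing a b x y) := by
  rw [← splitC_toQuat, ← splitC_toQuat, ← map_mul, ← map_mul, ← map_add, toQuat_anticomm,
    AlgHom.commutes]

/-- The vector `A + ζ B`. -/
def kerVec (A B : Fin 2 → ℚ_[p]) (ζ : ℂ_[p]) : Fin 2 → ℂ_[p] := fun i => ι (A i) + ζ * ι (B i)

theorem kerVec_det (A B : Fin 2 → ℚ_[p]) (ζ ζ' : ℂ_[p]) :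
    kerVec A B ζ 0 * kerVec A B ζ' 1 - kerVec A B ζ 1 * kerVec A B ζ' 0 =
      (ζ' - ζ) * ι (A 0 * B 1 - A 1 * B 0) := by
  simp only [kerVec, map_sub, map_mul]; ring

variable (wp e wm) in
/-- The vectors `A` and `B` are such that `A + ζ B` spans the kernel of the nilpotent matrix
with parameter `ζ`. -/
structure IsKerFrame (A B : Fin 2 → ℚ_[p]) : Prop where
  det_ne : A 0 * B 1 - A 1 * B 0 ≠ 0
  ker : ∀ ζ, (matrixOf σ (ptVec a b (toCp p wp) (toCp p e) (toCp p wm) ζ)).mulVec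
    (kerVec A B ζ) = 0
  wp_ne : ∀ ζ, (matrixOf σ (toCp p wp)).mulVec (kerVec A B ζ) ≠ 0

theorem exists_isKerFrame (h : IsFrame a b wp e wm) : ∃ A B, IsKerFrame wp e wm σ A B := by
  set N := σ (toQuat a b wp) with hN
  set E := σ (toQuat a b e) with hE
  set M := σ (toQuat a b wm) with hM
  have hNN : N * N = 0 := by rw [hN, ← map_mul, toQuat_mul_self, h.quad_wp]; simp
  have hEE : E * E = algebraMap ℚ_[p] _ (-quadForm a b e) := by
    rw [hE, ← map_mul, toQuat_mul_self, AlgEquiv.commutes]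
  have hNE : N * E + E * N = 0 := by
    rw [hN, hE, ← map_mul, ← map_mul, ← map_add, toQuat_anticomm, h.pair_wp_e]; simp
  have hNM : N * M + M * N = algebraMap ℚ_[p] _ (-pairing a b wp wm) := by
    rw [hN, hM, ← map_mul, ← map_mul, ← map_add, toQuat_anticomm, AlgEquiv.commutes]
  have hdet : N.det = 0 := by
    have := congrArg Matrix.det hNN
    rw [Matrix.det_mul, Matrix.det_zero] at this
    · exact mul_self_eq_zero.1 this
  obtain ⟨u, hu0, hu⟩ := Matrix.exists_mulVec_eq_zero_iff.2 hdet
  have hsc : ∀ (c : ℚ_[p]) (v : Fin 2 → ℚ_[p]),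
      (algebraMap ℚ_[p] (Matrix (Fin 2) (Fin 2) ℚ_[p]) c).mulVec v = c • v := by
    intro c v
    rw [Algebra.algebraMap_eq_smul_one, Matrix.smul_mulVec, Matrix.one_mulVec]
  set A := M.mulVec u with hA
  set B := E.mulVec u with hB
  have hNB : N.mulVec B = 0 := by
    have := congrArg (fun X => X.mulVec u) hNE
    simp only [Matrix.add_mulVec, ← Matrix.mulVec_mulVec, hu, Matrix.mulVec_zero, add_zero,
      Matrix.zero_mulVec] at this
    exact this
  have hNA : N.mulVec A = -pairing a b wp wm • u := by
    have := congrArg (fun X => X.mulVec u) hNM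
    simp only [Matrix.add_mulVec, ← Matrix.mulVec_mulVec, hu, Matrix.mulVec_zero, add_zero,
      hsc] at this
    exact this
  have hEB : E.mulVec B = -quadForm a b e • u := by
    have := congrArg (fun X => X.mulVec u) hEE
    simp only [← Matrix.mulVec_mulVec, hsc] at this
    exact this
  have hB0 : B ≠ 0 := by
    intro h0
    rw [h0, Matrix.mulVec_zero] at hEB
    exact smul_ne_zero (neg_ne_zero.2 h.quad_e_ne) hu0 hEB.symm
  have hmapv : ∀ (X : Matrix (Fin 2) (Fin 2) ℚ_[p]) (v : Fin 2 → ℚ_[p]),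
      (X.map ι).mulVec (fun i => ι (v i)) = fun i => ι (X.mulVec v i) := by
    intro X v; ext i; rw [RingHom.map_mulVec]; rfl
  have hU : ∀ ζ, kerVec A B ζ =
      (matrixOf σ (ptVec a b (toCp p wp) (toCp p e) (toCp p wm) ζ)).mulVec (fun i => ι (u i)) := by
    intro ζ
    rw [ptVec, matrixOf_add, matrixOf_add, matrixOf_smul, matrixOf_smul, matrixOf_smul,
      matrixOf_toCp, matrixOf_toCp, matrixOf_toCp, ← hN, ← hE, ← hM, Matrix.add_mulVec,
      Matrix.add_mulVec, Matrix.smul_mulVec, Matrix.smul_mulVec, Matrix.smul_mulVec, hmapv, hmapv,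
      hmapv, hu, ← hA, ← hB]
    ext i
    simp [kerVec, add_comm]
  refine ⟨A, B, ?_, ?_, ?_⟩
  · intro h0
    -- the determinant vanishes only if `A` and `B` are proportional
    have hpr : ∃ c : ℚ_[p], A = c • B := by
      by_cases hb : B 0 = 0
      · have hb1 : B 1 ≠ 0 := by
          intro hb1; apply hB0; ext i; fin_cases i <;> simp [hb, hb1]
        refine ⟨A 1 / B 1, ?_⟩
        ext i; fin_cases i
        · simp [hb] at h0 ⊢; tauto
        · simp [hb1]
      · refine ⟨A 0 / B 0, ?_⟩
        ext i; fin_cases i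
        · simp [hb]
        · simp; field_simp; linear_combination -h0
    obtain ⟨c, hc⟩ := hpr
    rw [hc, Matrix.mulVec_smul, hNB, smul_zero] at hNA
    exact smul_ne_zero (neg_ne_zero.2 h.pair_ne) hu0 hNA.symm
  · intro ζ
    rw [hU, Matrix.mulVec_mulVec, matrixOf_mul_self, h.toCp.quadForm_ptVec]
    simp
  · intro ζ h0
    have e1 : kerVec A B ζ = (fun i => ι (A i)) + ζ • fun i => ι (B i) := rfl
    rw [e1, matrixOf_toCp, ← hN, Matrix.mulVec_add, Matrix.mulVec_smul, hmapv, hmapv, hNB, hNA]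
      at h0
    apply smul_ne_zero (neg_ne_zero.2 h.pair_ne) hu0
    ext i
    have := congrFun h0 i
    simpa using this

theorem kerVec_ne_zero {A B : Fin 2 → ℚ_[p]} (hAB : IsKerFrame wp e wm σ A B) (ζ : ℂ_[p]) :
    kerVec A B ζ ≠ 0 := by
  intro h0
  apply hAB.wp_ne ζ
  rw [h0, Matrix.mulVec_zero]

/-- The kernel of a nonzero nilpotent matrix is one-dimensional. -/
theorem eq_smul_of_mulVec_eq_zero {F : Type*} [Field F] {X : Matrix (Fin 2) (Fin 2) F} (hX : X ≠ 0)
    {u v : Fin 2 → F} (hu : X.mulVec u = 0) (hv : X.mulVec v = 0) (hv0 : v ≠ 0) :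
    ∃ c : F, u = c • v := by
  have h1 := fun i => congrFun hu i
  have h2 := fun i => congrFun hv i
  simp only [Matrix.mulVec, dotProduct, Fin.sum_univ_two, Pi.zero_apply] at h1 h2
  have hdet : u 0 * v 1 - u 1 * v 0 = 0 := by
    by_contra hd
    apply hX
    ext i j
    have e0 : X i 0 * (u 0 * v 1 - u 1 * v 0) = 0 := by
      linear_combination v 1 * h1 i - u 1 * h2 i
    have e1 : X i 1 * (u 0 * v 1 - u 1 * v 0) = 0 := by
      linear_combination -v 0 * h1 i + u 0 * h2 i
    fin_cases j
    · simpa [hd] using e0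
    · simpa [hd] using e1
  by_cases hb : v 0 = 0
  · have hb1 : v 1 ≠ 0 := by
      intro hb1; apply hv0; ext i; fin_cases i <;> simp [hb, hb1]
    refine ⟨u 1 / v 1, ?_⟩
    ext i; fin_cases i
    · simp [hb, hb1] at hdet ⊢; tauto
    · simp [hb1]
  · refine ⟨u 0 / v 0, ?_⟩
    ext i; fin_cases i
    · simp [hb]
    · simp; field_simp; linear_combination -hdet

theorem matrixOf_ptVec_ne_zero (h : IsFrame a b wp e wm) (ζ : ℂ_[p]) :
    matrixOf σ (ptVec a b (toCp p wp) (toCp p e) (toCp p wm) ζ) ≠ 0 := by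
  intro h0
  have := matrixOf_anticomm σ (toCp p wp) (ptVec a b (toCp p wp) (toCp p e) (toCp p wm) ζ)
  rw [h0, mul_zero, zero_mul, add_zero, ptVec, h.toCp.pair_wp, one_mul,
    eq_comm, FaithfulSMul.algebraMap_eq_zero_iff, neg_eq_zero] at this
  exact h.toCp.pair_ne this

/-- The homogeneous coordinates of the point with parameter `ζ`. -/
theorem kerCoord_pt (h : IsFrame a b wp e wm) {A B : Fin 2 → ℚ_[p]}
    (hAB : IsKerFrame wp e wm σ A B) (ζ : ℂ_[p]) :
    ∃ c : ℂ_[p], c ≠ 0 ∧ kerCoord σ (pt h ζ) = c • kerVec A B ζ := by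
  have hex : ∃ u : Fin 2 → ℂ_[p], u ≠ 0 ∧
      ∀ x ∈ (pt h ζ).submodule, (matrixOf σ x).mulVec u = 0 := by
    refine ⟨kerVec A B ζ, kerVec_ne_zero σ hAB ζ, fun x hx => ?_⟩
    obtain ⟨c, rfl⟩ := (mem_pt h ζ x).1 hx
    rw [matrixOf_smul, Matrix.smul_mulVec, hAB.ker, smul_zero]
  rw [kerCoord, dif_pos hex]
  obtain ⟨h1, h2⟩ := hex.choose_spec
  have h3 := h2 _ ((mem_pt h ζ _).2 ⟨1, one_smul _ _⟩)
  obtain ⟨c, hc⟩ := eq_smul_of_mulVec_eq_zero (matrixOf_ptVec_ne_zero σ h ζ) h3 (hAB.ker ζ)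
    (kerVec_ne_zero σ hAB ζ)
  refine ⟨c, ?_, hc⟩
  rintro rfl
  rw [zero_smul] at hc
  exact h1 hc

/-- A vector all of whose multiples kill `A + ζ B` represents the point `ζ`. -/
theorem mk_eq_pt (h : IsFrame a b wp e wm) {A B : Fin 2 → ℚ_[p]}
    (hAB : IsKerFrame wp e wm σ A B) {x : Vec ℂ_[p]} (hx0 : x ≠ 0) (hx : quadForm a b x = 0)
    {ζ : ℂ_[p]} (hk : (matrixOf σ x).mulVec (kerVec A B ζ) = 0) :
    Projectivization.mk ℂ_[p] x hx0 = pt h ζ := by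
  by_cases h0 : coordM a b (toCp p wp) (toCp p e) (toCp p wm) x = 0
  · have h1 := h.toCp.eq_smul_wp hx h0
    have hc : coordP a b (toCp p wp) (toCp p e) (toCp p wm) x ≠ 0 := by
      intro hc
      rw [hc, zero_smul] at h1
      exact hx0 h1
    rw [h1, matrixOf_smul, Matrix.smul_mulVec] at hk
    exact (hAB.wp_ne ζ ((smul_eq_zero.1 hk).resolve_left hc)).elim
  · have h1 := h.toCp.eq_smul_ptVec hx h0
    set c := coordM a b (toCp p wp) (toCp p e) (toCp p wm) x
    set ζ' := coordE a b (toCp p wp) (toCp p e) (toCp p wm) x / c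
    rw [h1, matrixOf_smul, Matrix.smul_mulVec] at hk
    have hk' := (smul_eq_zero.1 hk).resolve_left h0
    obtain ⟨d, hd⟩ := eq_smul_of_mulVec_eq_zero (matrixOf_ptVec_ne_zero σ h ζ') hk' (hAB.ker ζ')
      (kerVec_ne_zero σ hAB ζ')
    have e1 := kerVec_det A B ζ ζ'
    rw [hd] at e1
    have e2 : (ζ' - ζ) * ι (A 0 * B 1 - A 1 * B 0) = 0 := by
      rw [← e1]; simp only [Pi.smul_apply, smul_eq_mul]; ring
    have e3 : ζ' = ζ :=
      sub_eq_zero.1 ((mul_eq_zero.1 e2).resolve_right ((map_ne_zero _).2 hAB.det_ne))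
    rw [pt, Projectivization.mk_eq_mk_iff', ← e3]
    exact ⟨c, h1.symm⟩

theorem det_split (x : Quat a b ℚ_[p]) : (σ x).det = nrd x := by
  have h1 : x * x = (2 * x.re) • x - algebraMap ℚ_[p] _ (nrd x) := by
    ext <;> simp [nrd] <;> ring
  have h2 := congrArg σ h1
  rw [map_mul, map_sub, map_smul, AlgEquiv.commutes] at h2
  generalize hX : σ x = X at *
  have e00 := congrFun (congrFun h2 0) 0
  have e01 := congrFun (congrFun h2 0) 1
  have e10 := congrFun (congrFun h2 1) 0
  have e11 := congrFun (congrFun h2 1) 1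
  simp [Matrix.mul_apply, Fin.sum_univ_two, Matrix.algebraMap_matrix_apply] at e00 e01 e10 e11
  rw [Matrix.det_fin_two]
  by_cases hs : X 0 1 = 0 ∧ X 1 0 = 0 ∧ X 0 0 = X 1 1
  · obtain ⟨s1, s2, s3⟩ := hs
    have : σ x = σ (algebraMap ℚ_[p] _ (X 0 0)) := by
      rw [hX, AlgEquiv.commutes]
      ext i j
      fin_cases i <;> fin_cases j <;> simp [s1, s2, s3, Matrix.algebraMap_matrix_apply]
    have h3 := σ.injective this
    rw [s1, ← s3, h3]
    simp [nrd]
  · have ht : 2 * x.re = X 0 0 + X 1 1 := by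
      by_contra ht
      apply hs
      have hne : 2 * x.re - (X 0 0 + X 1 1) ≠ 0 := sub_ne_zero.2 ht
      refine ⟨?_, ?_, ?_⟩
      · apply mul_left_cancel₀ hne; linear_combination -e01
      · apply mul_left_cancel₀ hne; linear_combination -e10
      · apply mul_left_cancel₀ hne; linear_combination e11 - e00
    linear_combination -e00 - X 0 0 * ht

/-- The matrix of the action on the parameters. -/
def actMat (A B : Fin 2 → ℚ_[p]) (x : Quat a b ℚ_[p]) : Matrix (Fin 2) (Fin 2) ℚ_[p] :=
  (!![B 0, A 0; B 1, A 1])⁻¹ * σ x * !![B 0, A 0; B 1, A 1]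

theorem actMat_spec {A B : Fin 2 → ℚ_[p]} (hAB : A 0 * B 1 - A 1 * B 0 ≠ 0)
    (x : Quat a b ℚ_[p]) :
    (actMat σ A B x).det = nrd x ∧
    ∀ ζ : ℂ_[p], ((σ x).map ι).mulVec (kerVec A B ζ) = fun i =>
      (ι (actMat σ A B x 0 0) * ζ + ι (actMat σ A B x 0 1)) * ι (B i) +
        (ι (actMat σ A B x 1 0) * ζ + ι (actMat σ A B x 1 1)) * ι (A i) := by
  set P : Matrix (Fin 2) (Fin 2) ℚ_[p] := !![B 0, A 0; B 1, A 1] with hP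
  have hdet : IsUnit P.det := by
    rw [hP, Matrix.det_fin_two_of, isUnit_iff_ne_zero]
    intro h0; apply hAB; linear_combination -h0
  have hPm : P * actMat σ A B x = σ x * P := by
    rw [actMat, ← hP, mul_assoc, Matrix.mul_nonsing_inv_cancel_left _ _ hdet]
  refine ⟨?_, fun ζ => ?_⟩
  · have h1 := congrArg Matrix.det hPm
    rw [Matrix.det_mul, Matrix.det_mul, det_split, mul_comm] at h1
    exact mul_right_cancel₀ hdet.ne_zero h1
  · generalize actMat σ A B x = m at *
    generalize σ x = X at *
    have e : ∀ i j, (P * m) i j = (X * P) i j := fun i j => by rw [hPm]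
    simp only [hP, Matrix.mul_apply, Fin.sum_univ_two] at e
    ext i
    have e0 := congrArg ι (e i 0)
    have e1 := congrArg ι (e i 1)
    fin_cases i <;> simp [kerVec, Matrix.mulVec, dotProduct, Fin.sum_univ_two] at e0 e1 ⊢ <;>
      linear_combination -ζ * e0 - e1

/-- Elements of reduced norm one act on the parameters by Möbius transformations. -/
theorem smul_pt (h : IsFrame a b wp e wm) {A B : Fin 2 → ℚ_[p]}
    (hAB : IsKerFrame wp e wm σ A B) {g : (Quat a b ℚ)ˣ} (hg : nrd (g : Quat a b ℚ) = 1) :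
    (actMat σ A B (baseChange ℚ_[p] g) 0 0 * actMat σ A B (baseChange ℚ_[p] g) 1 1 -
      actMat σ A B (baseChange ℚ_[p] g) 0 1 * actMat σ A B (baseChange ℚ_[p] g) 1 0 = 1) ∧
    ∀ ζ : ℂ_[p], Irrat p ζ → conjRat ℂ_[p] g • pt h ζ =
      pt h (mob (actMat σ A B (baseChange ℚ_[p] g) 0 0) (actMat σ A B (baseChange ℚ_[p] g) 0 1)
        (actMat σ A B (baseChange ℚ_[p] g) 1 0) (actMat σ A B (baseChange ℚ_[p] g) 1 1) ζ) := by
  obtain ⟨h1, h2⟩ := actMat_spec σ hAB.det_ne (baseChange ℚ_[p] (g : Quat a b ℚ))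
  have hn : nrd (baseChange ℚ_[p] (g : Quat a b ℚ)) = 1 := by
    have : nrd (baseChange ℚ_[p] (g : Quat a b ℚ)) = algebraMap ℚ ℚ_[p] (nrd (g : Quat a b ℚ)) := by
      simp [nrd, baseChange]
    rw [this, hg, map_one]
  rw [hn, Matrix.det_fin_two] at h1
  refine ⟨h1, fun ζ hζ => ?_⟩
  generalize hm : actMat σ A B (baseChange ℚ_[p] (g : Quat a b ℚ)) = m at *
  have hd := mob_denom_ne h1 hζ
  set x := ptVec a b (toCp p wp) (toCp p e) (toCp p wm) ζ with hx
  set G : (Quat a b ℂ_[p])ˣ := Units.map (baseChange (a := a) (b := b) ℂ_[p]).toMonoidHom g with hG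
  have hy : quadForm a b (conj G • x) = 0 := by rw [quadForm_conj, hx, h.toCp.quadForm_ptVec]
  refine mk_eq_pt σ h hAB (x := conj G • x) ((smul_ne_zero_iff_ne _).2 (h.toCp.ptVec_ne_zero ζ)) hy ?_
  have hU : (ι (m 1 0) * ζ + ι (m 1 1)) • kerVec A B (mob (m 0 0) (m 0 1) (m 1 0) (m 1 1) ζ) =
      (splitC σ (G : Quat a b ℂ_[p])).mulVec (kerVec A B ζ) := by
    have : splitC σ (G : Quat a b ℂ_[p]) = (σ (baseChange ℚ_[p] (g : Quat a b ℚ))).map ι :=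
      splitC_baseChange σ _
    rw [this, h2]
    ext i
    simp only [Pi.smul_apply, smul_eq_mul, kerVec, mob]
    generalize ι (m 1 0) * ζ + ι (m 1 1) = j at *
    field_simp
    ring
  have hz : (ι (m 1 0) * ζ + ι (m 1 1)) • (matrixOf σ (conj G • x)).mulVec
      (kerVec A B (mob (m 0 0) (m 0 1) (m 1 0) (m 1 1) ζ)) = 0 := by
    rw [← Matrix.mulVec_smul, hU, ← splitC_toQuat, toQuat_conj_smul, map_mul, map_mul,
      Matrix.mulVec_mulVec, mul_assoc, mul_assoc, ← map_mul, Units.inv_mul, map_one, mul_one,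
      ← Matrix.mulVec_mulVec, splitC_toQuat, hx, hAB.ker, Matrix.mulVec_zero]
  exact (smul_eq_zero.1 hz).resolve_left hd

end KernelFrame

section GroupAction

variable {a b : ℚ} {p : ℕ} [Fact p.Prime] {wp e wm : Vec ℚ_[p]}

local notation "ι" => algebraMap ℚ_[p] ℂ_[p]

theorem conjRat_map {K K' : Type*} [CommRing K] [CommRing K'] [Algebra ℚ K] [Algebra ℚ K']
    (f : K →+* K') (g : (Quat a b ℚ)ˣ) (v : Vec K) :
    (conjRat K' g • (fun i => f (v i)) : Vec K') = fun i => f ((conjRat K g • v : Vec K) i) := by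
  have hf : ∀ x : ℚ, f (algebraMap ℚ K x) = algebraMap ℚ K' x := fun x => f.map_rat_algebraMap x
  change imag (baseChange K' (g : Quat a b ℚ) * toQuat a b (fun i => f (v i)) *
    baseChange K' ((g⁻¹ : (Quat a b ℚ)ˣ) : Quat a b ℚ)) = fun i => f (imag (baseChange K (g : Quat a b ℚ) *
      toQuat a b v * baseChange K ((g⁻¹ : (Quat a b ℚ)ˣ) : Quat a b ℚ)) i)
  generalize (g : Quat a b ℚ) = x
  generalize ((g⁻¹ : (Quat a b ℚ)ˣ) : Quat a b ℚ) = y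
  funext i
  fin_cases i <;>
    simp [imag, baseChange, toQuat, -eq_ratCast, hf]

theorem conjRat_toCp (g : (Quat a b ℚ)ˣ) (v : Vec ℚ_[p]) :
    conjRat ℂ_[p] g • toCp p v = toCp p (conjRat ℚ_[p] g • v) := conjRat_map ι g v

theorem conjRat_toQp (g : (Quat a b ℚ)ˣ) (v : Vec ℚ) :
    conjRat ℚ_[p] g • toQp p v = toQp p (conjRat ℚ g • v) :=
  conjRat_map (algebraMap ℚ ℚ_[p]) g v

theorem glSmul_add {K : Type*} [CommRing K] (g : LinearMap.GeneralLinearGroup K (Vec K))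
    (x y : Vec K) : g • (x + y) = g • x + g • y := smul_add _ _ _

theorem glSmul_smul {K : Type*} [CommRing K] (g : LinearMap.GeneralLinearGroup K (Vec K))
    (c : K) (x : Vec K) : g • (c • x) = c • g • x := map_smul g.val c x

/-- The action of a hyperbolic element on the parameters. -/
theorem hyperbolic_smul_pt (h : IsFrame a b wp e wm) {γ : (Quat a b ℚ)ˣ} {ϖ : ℚ_[p]} (hϖ : ϖ ≠ 0)
    (h1 : conjRat ℚ_[p] γ • wp = ϖ • wp) (h2 : conjRat ℚ_[p] γ • e = e)
    (h3 : conjRat ℚ_[p] γ • wm = ϖ⁻¹ • wm) (ζ : ℂ_[p]) :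
    conjRat ℂ_[p] γ • pt h ζ = pt h (ι ϖ * ζ) := by
  have hϖ' : ι ϖ ≠ 0 := (map_ne_zero _).2 hϖ
  rw [pt, Projectivization.smul_mk, pt, Projectivization.mk_eq_mk_iff']
  refine ⟨(ι ϖ)⁻¹, ?_⟩
  rw [ptVec, ptVec, glSmul_add, glSmul_add, glSmul_smul, glSmul_smul, glSmul_smul, conjRat_toCp,
    conjRat_toCp, conjRat_toCp, h1, h2, h3, toCp_smul, toCp_smul, map_inv₀]
  ext i
  simp only [Pi.add_apply, Pi.smul_apply, smul_eq_mul]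
  generalize ι ϖ = w at *
  field_simp

variable {R : Subalgebra (ZInv p) (Quat a b ℚ)}

theorem inv_smul_mem_of_mem_smul (g : (Quat a b ℚ)ˣ) (z : Pt p) (x : Vec ℂ_[p])
    (hx : x ∈ (conjRat ℂ_[p] g • z).submodule) : conjRat ℂ_[p] g⁻¹ • x ∈ z.submodule := by
  rw [← z.mk_rep, Projectivization.smul_mk, Projectivization.submodule_mk,
    Submodule.mem_span_singleton] at hx
  obtain ⟨c, rfl⟩ := hx
  rw [glSmul_smul, smul_smul, ← map_mul, inv_mul_cancel, map_one, one_smul]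
  apply Submodule.smul_mem
  rw [Projectivization.submodule_eq]
  exact Submodule.mem_span_singleton_self _

theorem smul_mem_halfPlane (g : (Quat a b ℚ)ˣ) {z : Pt p} (hz : z ∈ halfPlane a b p) :
    conjRat ℂ_[p] g • z ∈ halfPlane a b p := by
  obtain ⟨h1, h2⟩ := hz
  refine ⟨fun x hx => ?_, ?_⟩
  · rw [← h1 _ (inv_smul_mem_of_mem_smul g z x hx)]
    exact (quadForm_conj (Units.map (baseChange (a := a) (b := b) ℂ_[p]).toMonoidHom g⁻¹) x).symm
  · rintro ⟨v, hv, hx⟩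
    refine h2 ⟨conjRat ℚ_[p] g⁻¹ • v, (smul_ne_zero_iff_ne _).2 hv, ?_⟩
    rw [← conjRat_toCp]
    exact inv_smul_mem_of_mem_smul g z _ hx

theorem exists_gammaBar {K : Type*} [CommRing K] [Algebra ℚ K] (α : GammaBar R K) :
    ∃ g ∈ normOne R, conjRat K g = (α : LinearMap.GeneralLinearGroup K (Vec K)) := α.2

theorem gammaBar_smul_mem (α : GammaBar R ℂ_[p]) {z : Pt p} (hz : z ∈ halfPlane a b p) :
    α • z ∈ halfPlane a b p := by
  obtain ⟨g, -, hg⟩ := exists_gammaBar α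
  change (α : LinearMap.GeneralLinearGroup ℂ_[p] (Vec ℂ_[p])) • z ∈ _
  rw [← hg]
  exact smul_mem_halfPlane g hz

variable (σ : Quat a b ℚ_[p] ≃ₐ[ℚ_[p]] Matrix (Fin 2) (Fin 2) ℚ_[p])

include σ in
theorem gammaBar_mob (h : IsFrame a b wp e wm) (α : GammaBar R ℂ_[p]) :
    ∃ A B C D : ℚ_[p], A * D - B * C = 1 ∧
      ∀ z ∈ halfPlane a b p, zcoord h (α • z) = mob A B C D (zcoord h z) := by
  obtain ⟨A, B, hAB⟩ := exists_isKerFrame σ h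
  obtain ⟨g, hgR, hg⟩ := exists_gammaBar α
  obtain ⟨h1, h2⟩ := smul_pt σ h hAB hgR.2.2
  refine ⟨_, _, _, _, h1, fun z hz => ?_⟩
  obtain ⟨hz1, hz2⟩ := pt_zcoord h hz
  have h3 := h2 _ hz2
  rw [hz1] at h3
  change zcoord h ((α : LinearMap.GeneralLinearGroup ℂ_[p] (Vec ℂ_[p])) • z) = _
  rw [← hg, h3, zcoord_pt]

include σ in
theorem lab_smul (h : IsFrame a b wp e wm) (α : GammaBar R ℂ_[p]) {s : ℤ} {z z' : Pt p}
    (hz : z ∈ halfPlane a b p) (hz' : z' ∈ halfPlane a b p) :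
    lab p s (zcoord h (α • z)) = lab p s (zcoord h (α • z')) ↔
      lab p s (zcoord h z) = lab p s (zcoord h z') := by
  have one : ∀ (α : GammaBar R ℂ_[p]) {z z' : Pt p}, z ∈ halfPlane a b p → z' ∈ halfPlane a b p →
      lab p s (zcoord h z) = lab p s (zcoord h z') →
      lab p s (zcoord h (α • z)) = lab p s (zcoord h (α • z')) := by
    intro α z z' hz hz' hl
    obtain ⟨A, B, C, D, h1, h2⟩ := gammaBar_mob σ h α
    rw [h2 _ hz, h2 _ hz']
    exact lab_mob h1 (pt_zcoord h hz).2 (pt_zcoord h hz').2 hl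
  refine ⟨fun hl => ?_, one α hz hz'⟩
  have := one α⁻¹ (gammaBar_smul_mem α hz) (gammaBar_smul_mem α hz') hl
  rwa [inv_smul_smul, inv_smul_smul] at this

include σ in
open Classical in
theorem IsStrongZero.sum_lab_smul_eq_zero (hp2 : p ≠ 2) (h : IsUnitFrame a b wp e wm)
    {par : Submodule ℤ_[p] (Vec ℚ_[p]) → Prop} (hpar : IsParity a b par)
    (h₀ : par (Submodule.span ℤ_[p] {wp, e, wm})) {s : ℤ} {𝒟 : Pt p →₀ ℤ}
    (h𝒟 : IsStrongZero a b par s 𝒟) (α : GammaBar R ℂ_[p]) (P : ℤ × Set ℚ_[p]) :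
    ∑ z ∈ 𝒟.support with lab p s (zcoord h.frame (α • z)) = P, 𝒟 z = 0 := by
  by_cases hex : ∃ z₀ ∈ 𝒟.support, lab p s (zcoord h.frame (α • z₀)) = P
  · obtain ⟨z₀, hz₀, rfl⟩ := hex
    rw [← h𝒟.sum_lab_eq_zero hp2 h hpar h₀ (pt_zcoord h.frame (h𝒟.1 _ hz₀)).2]
    refine Finset.sum_congr (Finset.filter_congr fun z hz => ?_) fun _ _ => rfl
    exact lab_smul σ h.frame α (h𝒟.1 _ hz) (h𝒟.1 _ hz₀)
  · refine Finset.sum_eq_zero fun z hz => ?_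
    obtain ⟨hz1, hz2⟩ := Finset.mem_filter.1 hz
    exact (hex ⟨z, hz1, hz2⟩).elim

open Classical in
theorem IsStrongZero.sum_eq_zero (hp2 : p ≠ 2) (h : IsUnitFrame a b wp e wm)
    {par : Submodule ℤ_[p] (Vec ℚ_[p]) → Prop} (hpar : IsParity a b par)
    (h₀ : par (Submodule.span ℤ_[p] {wp, e, wm})) {s : ℤ} {𝒟 : Pt p →₀ ℤ}
    (h𝒟 : IsStrongZero a b par s 𝒟) : ∑ z ∈ 𝒟.support, 𝒟 z = 0 := by
  rw [← Finset.sum_fiberwise_of_maps_to (g := fun z => lab p s (zcoord h.frame z))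
    (t := 𝒟.support.image fun z => lab p s (zcoord h.frame z))
    fun z hz => Finset.mem_image_of_mem _ hz]
  refine Finset.sum_eq_zero fun P hP => ?_
  obtain ⟨z₀, hz₀, rfl⟩ := Finset.mem_image.1 hP
  exact h𝒟.sum_lab_eq_zero hp2 h hpar h₀ (pt_zcoord h.frame (h𝒟.1 _ hz₀)).2

theorem ratFun_single_sub (h : IsFrame a b wp e wm) {A B : Fin 2 → ℚ_[p]}
    (hAB : IsKerFrame wp e wm σ A B) {η η' : ℂ_[p]} (hη : η' ≠ η) :
    ∃ c : ℂ_[p], c ≠ 0 ∧ ∀ ζ, ζ ≠ η → ζ ≠ η' →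
      ratFun σ (Finsupp.single (pt h η') 1 - Finsupp.single (pt h η) 1) (pt h ζ) =
        c * twoPoint η η' ζ := by
  classical
  obtain ⟨c, hc, hk⟩ := kerCoord_pt σ h hAB η
  obtain ⟨c', hc', hk'⟩ := kerCoord_pt σ h hAB η'
  have hd : ι (A 0 * B 1 - A 1 * B 0) ≠ 0 := (map_ne_zero _).2 hAB.det_ne
  refine ⟨c' / c, div_ne_zero hc' hc, fun ζ h1 h2 => ?_⟩
  obtain ⟨d, hd0, hkd⟩ := kerCoord_pt σ h hAB ζ
  have hne : pt h η' ≠ pt h η := fun h0 => hη (pt_injective h h0)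
  have hval : ∀ x u, kerCoord σ (pt h ζ) 0 * (x • kerVec A B u) 1 -
      kerCoord σ (pt h ζ) 1 * (x • kerVec A B u) 0 =
      d * x * ((u - ζ) * ι (A 0 * B 1 - A 1 * B 0)) := by
    intro x u
    rw [hkd, ← kerVec_det]
    simp only [Pi.smul_apply, smul_eq_mul]; ring
  rw [ratFun, Finsupp.prod_of_support_subset (s := {pt h η', pt h η}) _ ?_ _ (by simp),
    Finset.prod_pair hne]
  · simp only [Finsupp.coe_sub, Pi.sub_apply, Finsupp.single_eq_same]
    rw [Finsupp.single_eq_of_ne hne, Finsupp.single_eq_of_ne hne.symm, sub_zero, zero_sub, zpow_one,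
      zpow_neg_one, hk, hk', hval, hval, twoPoint]
    rw [← sub_ne_zero] at h1 h2
    have h1' : η - ζ ≠ 0 := by rw [← neg_sub]; exact neg_ne_zero.2 h1
    generalize ι (A 0 * B 1 - A 1 * B 0) = D at *
    field_simp
    ring
  · intro x hx
    have := Finsupp.support_sub hx
    rw [Finset.mem_union] at this
    rcases this with h0 | h0 <;> have := Finsupp.support_single_subset h0 <;> simp at this ⊢ <;> tauto

/-- The factors of the infinite product in coordinates. -/
theorem thetaFactor_eq (h : IsFrame a b wp e wm) {𝒟 : Pt p →₀ ℤ}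
    (h𝒟 : ∀ z ∈ 𝒟.support, z ∈ halfPlane a b p) (hdeg : ∑ z ∈ 𝒟.support, 𝒟 z = 0)
    {γ : (Quat a b ℚ)ˣ} {η : Pt p} {η' : ℂ_[p]} (hη : IsBasePoint R 𝒟 η)
    (hγ : conjRat ℂ_[p] γ • η = pt h η') (hne : η' ≠ zcoord h η)
    (α : GammaBar R ℂ_[p]) (hη' : ∀ z ∈ 𝒟.support, zcoord h (α • z) ≠ η') :
    thetaFactor R σ 𝒟 η γ α =
      ∏ z ∈ 𝒟.support, twoPoint (zcoord h η) η' (zcoord h (α • z)) ^ 𝒟 z := by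
  obtain ⟨A, B, hAB⟩ := exists_isKerFrame σ h
  obtain ⟨c, hc, hfun⟩ := ratFun_single_sub σ h hAB hne
  obtain ⟨hη1, hη2⟩ := pt_zcoord h hη.1
  rw [thetaFactor, weilSymbol, Finsupp.prod_mapDomain_index_inj (MulAction.injective α), hγ,
    Finsupp.prod]
  rw [hη1] at hfun
  have : ∀ z ∈ 𝒟.support, ratFun σ (Finsupp.single (pt h η') 1 - Finsupp.single η 1) (α • z) ^ 𝒟 z =
      c ^ 𝒟 z * twoPoint (zcoord h η) η' (zcoord h (α • z)) ^ 𝒟 z := by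
    intro z hz
    obtain ⟨hz1, hz2⟩ := pt_zcoord h (gammaBar_smul_mem α (h𝒟 z hz))
    rw [← mul_zpow, ← hfun _ ?_ (hη' z hz), hz1]
    intro h0
    apply hη.2 α z hz
    rw [← hz1, h0, hη1]
  rw [Finset.prod_congr rfl this, Finset.prod_mul_distrib, ← zpow_sum_of_ne _ _ hc, hdeg, zpow_zero,
    one_mul]

end GroupAction

/-! ### Finiteness of bounded sets of rational vectors -/

section Bounded

variable {p : ℕ} [Fact p.Prime]

theorem mem_zInv_iff (q : ℚ) : q ∈ ZInv p ↔ ∃ (k : ℕ) (n : ℤ), q * (p : ℚ) ^ k = n := by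
  have hp0 : (p : ℚ) ≠ 0 := by exact_mod_cast (Fact.out : p.Prime).ne_zero
  constructor
  · intro hq
    induction hq using Algebra.adjoin_induction with
    | mem x hx =>
      rw [Set.mem_singleton_iff.1 hx]
      exact ⟨1, 1, by simp [hp0]⟩
    | algebraMap r => exact ⟨0, r, by simp⟩
    | add x y _ _ h1 h2 =>
      obtain ⟨k, n, h1⟩ := h1
      obtain ⟨l, m, h2⟩ := h2
      refine ⟨k + l, n * p ^ l + m * p ^ k, ?_⟩
      push_cast
      rw [pow_add, ← h1, ← h2]; ring
    | mul x y _ _ h1 h2 =>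
      obtain ⟨k, n, h1⟩ := h1
      obtain ⟨l, m, h2⟩ := h2
      refine ⟨k + l, n * m, ?_⟩
      push_cast
      rw [pow_add, ← h1, ← h2]; ring
  · rintro ⟨k, n, h⟩
    have e : q = algebraMap ℤ ℚ n * ((p : ℚ)⁻¹) ^ k := by
      rw [eq_intCast, ← h, inv_pow, mul_inv_cancel_right₀ (pow_ne_zero k hp0)]
    rw [e]
    exact (ZInv p).mul_mem ((ZInv p).algebraMap_mem n)
      ((ZInv p).pow_mem (Algebra.subset_adjoin rfl) k)

theorem intCast_mem_zInv (n : ℤ) : (n : ℚ) ∈ ZInv p := (mem_zInv_iff _).2 ⟨0, n, by simp⟩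

theorem zInv_integral {q : ℚ} (hq : q ∈ ZInv p) {c : ℕ} (h : ‖(q : ℚ_[p])‖ ≤ (p : ℝ) ^ c) :
    ∃ n : ℤ, q * (p : ℚ) ^ c = n := by
  have hp0 : (p : ℚ) ≠ 0 := by exact_mod_cast (Fact.out : p.Prime).ne_zero
  have hp := p_pos (p := p)
  obtain ⟨k, n, hk⟩ := (mem_zInv_iff q).1 hq
  rcases le_total k c with hkc | hkc
  · refine ⟨n * p ^ (c - k), ?_⟩
    push_cast
    rw [← hk, mul_assoc, ← pow_add, Nat.add_sub_cancel' hkc]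
  · have h1 : ‖((n : ℤ) : ℚ_[p])‖ ≤ (p : ℝ) ^ (-((k - c : ℕ) : ℤ)) := by
      have e1 : ((n : ℤ) : ℚ_[p]) = (q : ℚ_[p]) * (p : ℚ_[p]) ^ k := by exact_mod_cast hk.symm
      rw [e1, norm_mul, norm_pow, Padic.norm_p, inv_pow, zpow_neg, zpow_natCast]
      calc ‖(q : ℚ_[p])‖ * ((p : ℝ) ^ k)⁻¹ ≤ (p : ℝ) ^ c * ((p : ℝ) ^ k)⁻¹ := by gcongr
        _ = ((p : ℝ) ^ (k - c))⁻¹ := by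
          conv_lhs => rw [← Nat.add_sub_cancel' hkc, pow_add]
          field_simp
    obtain ⟨m, hm⟩ := (Padic.norm_int_le_pow_iff_dvd n (k - c)).1 h1
    refine ⟨m, ?_⟩
    have h2 : q * (p : ℚ) ^ c * (p : ℚ) ^ (k - c) = m * (p : ℚ) ^ (k - c) := by
      rw [mul_assoc, ← pow_add, Nat.add_sub_cancel' hkc, hk, hm]; push_cast; ring
    exact mul_right_cancel₀ (pow_ne_zero _ hp0) h2

/-- A set of rational numbers with bounded denominators away from `p` and bounded real and
`p`-adic absolute values is finite. -/
theorem finite_bounded_rat (N : ℤ) (hN : N ≠ 0) (C : ℝ) :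
    {q : ℚ | (N : ℚ) * q ∈ ZInv p ∧ |(q : ℝ)| ≤ C ∧ ‖(q : ℚ_[p])‖ ≤ C}.Finite := by
  have hp0 : (p : ℚ) ≠ 0 := by exact_mod_cast (Fact.out : p.Prime).ne_zero
  obtain ⟨c, hc⟩ := pow_unbounded_of_one_lt C (one_lt_p (p := p))
  set T : ℝ := |(N : ℝ)| * C * (p : ℝ) ^ c with hT
  refine ((Set.finite_Icc (-⌈T⌉) ⌈T⌉).image fun n : ℤ => (n : ℚ) / ((p : ℚ) ^ c * N)).subset ?_
  rintro q ⟨h1, h2, h3⟩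
  have h4 : ‖(((N : ℚ) * q : ℚ) : ℚ_[p])‖ ≤ (p : ℝ) ^ c := by
    push_cast
    rw [norm_mul]
    exact (mul_le_of_le_one_left (norm_nonneg _) (Padic.norm_int_le_one N)).trans
      (h3.trans hc.le)
  obtain ⟨n, hn⟩ := zInv_integral h1 h4
  have hN' : (N : ℚ) ≠ 0 := by exact_mod_cast hN
  refine ⟨n, ?_, ?_⟩
  · have h5 : |(n : ℝ)| ≤ T := by
      have e : (n : ℝ) = (N : ℝ) * q * (p : ℝ) ^ c := by exact_mod_cast hn.symm
      rw [e, abs_mul, abs_mul, hT, abs_of_nonneg (pow_nonneg (p_pos (p := p)).le c)]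
      have := p_pos (p := p)
      gcongr
    obtain ⟨h6, h7⟩ := abs_le.1 h5
    have h8 := Int.le_ceil T
    constructor
    · have : (-(⌈T⌉ : ℝ)) ≤ n := by linarith
      exact_mod_cast this
    · have : (n : ℝ) ≤ ⌈T⌉ := by linarith
      exact_mod_cast this
  · change (n : ℚ) / ((p : ℚ) ^ c * N) = q
    rw [← hn]; field_simp

theorem finite_bounded_vec {T : Type*} [Finite T] (N : ℤ) (hN : N ≠ 0) (C : ℝ) :
    {v : T → ℚ | ∀ i, (N : ℚ) * v i ∈ ZInv p ∧ |(v i : ℝ)| ≤ C ∧ ‖(v i : ℚ_[p])‖ ≤ C}.Finite := by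
  have := Set.Finite.pi (t := fun _ : T => {q : ℚ | (N : ℚ) * q ∈ ZInv p ∧ |(q : ℝ)| ≤ C ∧
    ‖(q : ℚ_[p])‖ ≤ C}) fun _ => finite_bounded_rat N hN C
  refine this.subset fun v hv i _ => hv i

/-- The quotient of `ℤ[1/p]` by a nonzero integer is finite. -/
theorem exists_zInv_class (K : ℕ) (hK : K ≠ 0) :
    ∃ (M : ℕ) (_ : M ≠ 0) (f : ZInv p → ZMod M), ∀ x y, f x = f y →
      ∃ z ∈ ZInv p, (x : ℚ) - y = K * z := by
  have hp0 : (p : ℚ) ≠ 0 := by exact_mod_cast (Fact.out : p.Prime).ne_zero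
  obtain ⟨e, M, hM, hKM⟩ := Nat.exists_eq_pow_mul_and_not_dvd hK p (Fact.out : p.Prime).ne_one
  have hM0 : M ≠ 0 := by rintro rfl; simp at hM
  have hcop : IsUnit (p : ZMod M) := by
    rw [ZMod.isUnit_iff_coprime]
    exact (Nat.Prime.coprime_iff_not_dvd Fact.out).2 hM
  have hex : ∀ x : ZInv p, ∃ (k : ℕ) (n : ℤ), (x : ℚ) * (p : ℚ) ^ k = n := fun x =>
    (mem_zInv_iff _).1 x.2
  choose k n hkn using hex
  refine ⟨M, hM0, fun x => (n x : ZMod M) * (((hcop.unit⁻¹ : (ZMod M)ˣ) : ZMod M)) ^ k x, ?_⟩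
  intro x y hxy
  have h1 : ((n x * p ^ k y - n y * p ^ k x : ℤ) : ZMod M) = 0 := by
    have hu : (p : ZMod M) * ((hcop.unit⁻¹ : (ZMod M)ˣ) : ZMod M) = 1 := hcop.mul_val_inv
    have hu' : ∀ k : ℕ, (p : ZMod M) ^ k * ((hcop.unit⁻¹ : (ZMod M)ˣ) : ZMod M) ^ k = 1 := by
      intro k; rw [← mul_pow, hu, one_pow]
    generalize ((hcop.unit⁻¹ : (ZMod M)ˣ) : ZMod M) = u at *
    push_cast
    have := congrArg (fun t => t * ((p : ZMod M) ^ k x * (p : ZMod M) ^ k y)) hxy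
    simp only at this
    linear_combination this - (n x : ZMod M) * (p : ZMod M) ^ k y * hu' (k x) +
      (n y : ZMod M) * (p : ZMod M) ^ k x * hu' (k y)
  rw [ZMod.intCast_zmod_eq_zero_iff_dvd] at h1 <;> try exact ⟨hM0⟩
  obtain ⟨d, hd⟩ := h1
  refine ⟨d / (p : ℚ) ^ (e + k x + k y), (mem_zInv_iff _).2 ⟨e + k x + k y, d, ?_⟩, ?_⟩
  · field_simp
  · have h2 : (n x : ℚ) * (p : ℚ) ^ k y - n y * (p : ℚ) ^ k x = M * d := by exact_mod_cast hd
    rw [← hkn, ← hkn] at h2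
    rw [hKM]
    push_cast
    rw [pow_add, pow_add]
    field_simp
    linear_combination h2

end Bounded

/-! ### Definite quaternion algebras and orders -/

section Orders

variable {a b : ℚ} {p : ℕ} [Fact p.Prime]

theorem neg_of_isDivision (h : IsDivision a b ℝ) : a < 0 ∧ b < 0 := by
  have key : ∀ x y : Quat a b ℝ, x ≠ 0 → y ≠ 0 → x * y ≠ 0 := by
    intro x y hx hy h0
    apply hy
    rwa [(h x hx).mul_right_eq_zero] at h0
  constructor
  · by_contra ha
    rw [not_lt] at ha
    have ha' : (0 : ℝ) ≤ a := by exact_mod_cast ha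
    refine key ⟨Real.sqrt a, 1, 0, 0⟩ ⟨Real.sqrt a, -1, 0, 0⟩ ?_ ?_ ?_
    · intro h0; have := congrArg QuaternionAlgebra.imI h0; simp at this
    · intro h0; have := congrArg QuaternionAlgebra.imI h0; simp at this
    · ext <;> simp [Real.mul_self_sqrt ha']
  · by_contra ha
    rw [not_lt] at ha
    have ha' : (0 : ℝ) ≤ b := by exact_mod_cast ha
    refine key ⟨Real.sqrt b, 0, 1, 0⟩ ⟨Real.sqrt b, 0, -1, 0⟩ ?_ ?_ ?_
    · intro h0; have := congrArg QuaternionAlgebra.imJ h0; simp at this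
    · intro h0; have := congrArg QuaternionAlgebra.imJ h0; simp at this
    · ext <;> simp [Real.mul_self_sqrt ha']

/-- The coordinates of a quaternion. -/
def coords {K : Type*} [CommRing K] [Algebra ℚ K] (x : Quat a b K) : Fin 4 → K :=
  ![x.re, x.imI, x.imJ, x.imK]

theorem coords_injective {K : Type*} [CommRing K] [Algebra ℚ K] :
    Function.Injective (coords : Quat a b K → Fin 4 → K) := by
  intro x y h
  ext
  exacts [congrFun h 0, congrFun h 1, congrFun h 2, congrFun h 3]

theorem nrd_eq {K : Type*} [CommRing K] [Algebra ℚ K] (x : Quat a b K) : nrd x =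
    x.re ^ 2 - algebraMap ℚ K a * x.imI ^ 2 - algebraMap ℚ K b * x.imJ ^ 2 +
      algebraMap ℚ K a * algebraMap ℚ K b * x.imK ^ 2 := by
  simp [nrd]; ring

theorem exists_coords_le (hinf : IsDivision a b ℝ) : ∃ c : ℚ, 0 < c ∧ ∀ (x : Quat a b ℚ) (i : Fin 4),
    c * coords x i ^ 2 ≤ nrd x := by
  obtain ⟨ha, hb⟩ := neg_of_isDivision hinf
  have hab : 0 < a * b := mul_pos_of_neg_of_neg ha hb
  refine ⟨min (min 1 (-a)) (min (-b) (a * b)), by simp [ha, hb, hab], fun x i => ?_⟩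
  have h1 : min (min 1 (-a)) (min (-b) (a * b)) ≤ 1 := by simp
  have h2 : min (min 1 (-a)) (min (-b) (a * b)) ≤ -a := by simp
  have h3 : min (min 1 (-a)) (min (-b) (a * b)) ≤ -b := by simp
  have h4 : min (min 1 (-a)) (min (-b) (a * b)) ≤ a * b := by simp
  generalize min (min 1 (-a)) (min (-b) (a * b)) = c at *
  rw [nrd_eq]
  simp only [Algebra.algebraMap_self, RingHom.id_apply]
  have p0 := sq_nonneg x.re
  have p1 := mul_nonneg (neg_nonneg.2 ha.le) (sq_nonneg x.imI)
  have p2 := mul_nonneg (neg_nonneg.2 hb.le) (sq_nonneg x.imJ)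
  have p3 := mul_nonneg hab.le (sq_nonneg x.imK)
  fin_cases i
  · have := mul_le_mul_of_nonneg_right h1 (sq_nonneg x.re); change c * x.re ^ 2 ≤ _; linarith
  · have := mul_le_mul_of_nonneg_right h2 (sq_nonneg x.imI); change c * x.imI ^ 2 ≤ _; linarith
  · have := mul_le_mul_of_nonneg_right h3 (sq_nonneg x.imJ); change c * x.imJ ^ 2 ≤ _; linarith
  · have := mul_le_mul_of_nonneg_right h4 (sq_nonneg x.imK); change c * x.imK ^ 2 ≤ _; linarith

theorem exists_abs_coords_le (hinf : IsDivision a b ℝ) (D : ℚ) : ∃ C : ℝ, ∀ x : Quat a b ℚ,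
    nrd x ≤ D → ∀ i, |((coords x i : ℚ) : ℝ)| ≤ C := by
  obtain ⟨c, hc, h⟩ := exists_coords_le hinf
  refine ⟨((1 + D / c : ℚ) : ℝ), fun x hx i => ?_⟩
  have h1 : coords x i ^ 2 ≤ D / c := by
    rw [le_div_iff₀' hc]; exact (h x i).trans hx
  have h2 : |coords x i| ≤ 1 + D / c := by
    rw [abs_le]; constructor <;> nlinarith [sq_nonneg (coords x i - 1), sq_nonneg (coords x i + 1)]
  exact_mod_cast h2

theorem nrd_ne_zero (hinf : IsDivision a b ℝ) {x : Quat a b ℚ} (hx : x ≠ 0) : nrd x ≠ 0 := by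
  intro h0
  obtain ⟨c, hc, h⟩ := exists_coords_le hinf
  apply hx
  apply coords_injective
  funext i
  have := h x i
  rw [h0] at this
  have h2 : coords x i ^ 2 ≤ 0 := by
    by_contra h3
    rw [not_le] at h3
    have := mul_pos hc h3
    linarith
  have h3 : coords x i = 0 := pow_eq_zero_iff two_ne_zero |>.1 (le_antisymm h2 (sq_nonneg _))
  rw [h3]
  fin_cases i <;> rfl

variable {R : Subalgebra (ZInv p) (Quat a b ℚ)} {M : ℕ}

theorem zInv_smul_coords (c : ZInv p) (x : Quat a b ℚ) (i : Fin 4) :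
    coords (c • x) i = c * coords x i := by
  fin_cases i <;> rfl

theorem exists_common_denom {T : Finset ℚ} : ∃ m : ℤ, m ≠ 0 ∧ ∀ q ∈ T, ∃ n : ℤ, m * q = n := by
  refine ⟨∏ q ∈ T, (q.den : ℤ), Finset.prod_ne_zero_iff.2 fun q _ => by exact_mod_cast q.den_nz,
    fun q hq => ?_⟩
  rw [← Finset.mul_prod_erase _ _ hq]
  refine ⟨q.num * ∏ x ∈ T.erase q, (x.den : ℤ), ?_⟩
  push_cast
  have := Rat.den_mul_eq_num q
  linear_combination (∏ x ∈ T.erase q, (x.den : ℚ)) * this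

theorem IsOrder.exists_denom (hR : IsOrder R) : ∃ m : ℤ, m ≠ 0 ∧ ∀ x ∈ R, ∀ i,
    (m : ℚ) * coords x i ∈ ZInv p := by
  obtain ⟨T, hT⟩ := hR.1
  obtain ⟨m, hm, h⟩ := exists_common_denom (T := (T ×ˢ (Finset.univ : Finset (Fin 4))).image
    fun q : Quat a b ℚ × Fin 4 => coords q.1 q.2)
  refine ⟨m, hm, fun x hx => ?_⟩
  have hx' : x ∈ Submodule.span (ZInv p) (T : Set (Quat a b ℚ)) := by rw [hT]; exact hx
  clear hx
  induction hx' using Submodule.span_induction with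
  | mem x hx =>
    intro i
    obtain ⟨n, hn⟩ := h (coords x i) (Finset.mem_image.2 ⟨(x, i), by simpa using hx, rfl⟩)
    rw [hn]; exact intCast_mem_zInv n
  | zero =>
    intro i
    have : coords (0 : Quat a b ℚ) i = 0 := by fin_cases i <;> rfl
    rw [this, mul_zero]; exact (ZInv p).zero_mem
  | add x y _ _ h1 h2 =>
    intro i
    have : coords (x + y) i = coords x i + coords y i := by fin_cases i <;> rfl
    rw [this, mul_add]
    exact (ZInv p).add_mem (h1 i) (h2 i)
  | smul c x _ h1 =>
    intro i
    rw [zInv_smul_coords, mul_left_comm]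
    exact (ZInv p).mul_mem c.2 (h1 i)

theorem IsOrder.exists_int_smul_mem (hR : IsOrder R) (w : Quat a b ℚ) :
    ∃ n : ℤ, n ≠ 0 ∧ (n : ℚ) • w ∈ R := by
  have hint : ∀ (n : ℤ) (x : Quat a b ℚ), x ∈ R → (n : ℚ) • x ∈ R := by
    intro n x hx
    exact R.smul_mem hx (⟨(n : ℚ), intCast_mem_zInv n⟩ : ZInv p)
  have hw : w ∈ Submodule.span ℚ (R : Set (Quat a b ℚ)) := by rw [hR.2]; trivial
  induction hw using Submodule.span_induction with
  | mem x hx => exact ⟨1, one_ne_zero, by simpa using hx⟩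
  | zero => exact ⟨1, one_ne_zero, by simp [R.zero_mem]⟩
  | add x y _ _ h1 h2 =>
    obtain ⟨n, hn, h1⟩ := h1
    obtain ⟨m, hm, h2⟩ := h2
    refine ⟨n * m, mul_ne_zero hn hm, ?_⟩
    rw [smul_add]
    refine R.add_mem ?_ ?_
    · have := hint m _ h1
      rwa [smul_smul, mul_comm, ← Int.cast_mul] at this
    · have := hint n _ h2
      rwa [smul_smul, ← Int.cast_mul] at this
  | smul q x _ h1 =>
    obtain ⟨n, hn, h1⟩ := h1
    refine ⟨n * q.den, mul_ne_zero hn (by exact_mod_cast q.den_nz), ?_⟩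
    have := hint q.num _ h1
    rw [smul_smul] at this ⊢
    convert this using 2
    push_cast
    linear_combination (n : ℚ) * Rat.den_mul_eq_num q

theorem IsEichlerOrder.exists_denom (hR : IsEichlerOrder R M) : ∃ m : ℤ, m ≠ 0 ∧ ∀ x ∈ R, ∀ i,
    (m : ℚ) * coords x i ∈ ZInv p := by
  obtain ⟨O₁, O₂, h1, -, hRe, -⟩ := hR
  obtain ⟨m, hm, h⟩ := h1.1.exists_denom
  refine ⟨m, hm, fun x hx => h x ?_⟩
  rw [hRe] at hx
  exact hx.1

/-- An Eichler order contains all the quaternions with coordinates in a nonzero ideal. -/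
theorem IsEichlerOrder.exists_mem (hR : IsEichlerOrder R M) (hM : M ≠ 0) : ∃ n : ℤ, n ≠ 0 ∧
    ∀ x : Quat a b ℚ, (∀ i, ∃ c ∈ ZInv p, coords x i = n * c) → x ∈ R := by
  obtain ⟨O₁, O₂, h1, -, hRe, hind⟩ := hR
  have hone : ∀ w : Quat a b ℚ, ∃ n : ℤ, n ≠ 0 ∧ (n : ℚ) • w ∈ R := by
    intro w
    obtain ⟨n, hn, hw⟩ := h1.1.exists_int_smul_mem w
    obtain ⟨m, hm, -, hmw⟩ := AddSubgroup.exists_nsmul_mem_of_relIndex_ne_zero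
      (hind.trans_ne hM) (a := (n : ℚ) • w) hw
    refine ⟨m * n, mul_ne_zero (by exact_mod_cast hm.ne') hn, ?_⟩
    have : (((m * n : ℤ) : ℚ)) • w = m • ((n : ℚ) • w) := by
      rw [← Nat.cast_smul_eq_nsmul ℚ, smul_smul]; push_cast; rfl
    rw [this]
    exact hmw.1
  choose n hn h using hone
  refine ⟨n ⟨1, 0, 0, 0⟩ * n ⟨0, 1, 0, 0⟩ * n ⟨0, 0, 1, 0⟩ * n ⟨0, 0, 0, 1⟩,
    by simp [hn], fun x hx => ?_⟩
  choose c hc hxc using hx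
  have h0 := h ⟨1, 0, 0, 0⟩
  have h1 := h ⟨0, 1, 0, 0⟩
  have h2 := h ⟨0, 0, 1, 0⟩
  have h3 := h ⟨0, 0, 0, 1⟩
  generalize n ⟨1, 0, 0, 0⟩ = n0 at *
  generalize n ⟨0, 1, 0, 0⟩ = n1 at *
  generalize n ⟨0, 0, 1, 0⟩ = n2 at *
  generalize n ⟨0, 0, 0, 1⟩ = n3 at *
  have hsm : ∀ (d : ℤ) (i : Fin 4), (d : ℚ) * c i ∈ ZInv p := fun d i =>
    (ZInv p).mul_mem (intCast_mem_zInv d) (hc i)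
  have s : ∀ (q : ℚ) (_ : q ∈ ZInv p) (w : Quat a b ℚ), w ∈ R → q • w ∈ R := fun q hq w hw =>
    R.smul_mem hw (⟨q, hq⟩ : ZInv p)
  have key := R.add_mem (R.add_mem (R.add_mem (s _ (hsm (n1 * n2 * n3) 0) _ h0)
    (s _ (hsm (n0 * n2 * n3) 1) _ h1)) (s _ (hsm (n0 * n1 * n3) 2) _ h2))
    (s _ (hsm (n0 * n1 * n2) 3) _ h3)
  convert key using 1
  have e0 := hxc 0
  have e1 := hxc 1
  have e2 := hxc 2
  have e3 := hxc 3
  change x.re = _ at e0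
  change x.imI = _ at e1
  change x.imJ = _ at e2
  change x.imK = _ at e3
  push_cast at *
  ext
  · simp [e0]; ring
  · simp [e1]; ring
  · simp [e2]; ring
  · simp [e3]; ring

/-- A set of quaternions with bounded denominators away from `p`, bounded reduced norm and bounded
`p`-adic coordinates is finite. -/
theorem finite_bounded_quat (hinf : IsDivision a b ℝ) (N : ℤ) (hN : N ≠ 0) (D : ℚ) (C : ℝ) :
    {x : Quat a b ℚ | nrd x ≤ D ∧ ∀ i, (N : ℚ) * coords x i ∈ ZInv p ∧
      ‖((coords x i : ℚ) : ℚ_[p])‖ ≤ C}.Finite := by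
  obtain ⟨C', hC'⟩ := exists_abs_coords_le hinf D
  refine ((finite_bounded_vec (p := p) (T := Fin 4) N hN (max C C')).preimage
    (f := coords) coords_injective.injOn).subset ?_
  rintro x ⟨h1, h2⟩ i
  exact ⟨(h2 i).1, (hC' x h1 i).trans (le_max_right _ _), (h2 i).2.trans (le_max_left _ _)⟩

end Orders

/-! ### Functions with compact support on the adeles -/

section Adeles

variable {p : ℕ} [Fact p.Prime]

/-- The finite adeles away from `p` which are integral outside of the primes up to `n` and have
absolute values at most `n` at these primes. -/
def boundedAdele (p n : ℕ) [Fact p.Prime] : Set (AdeleAway p) :=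
  {x | ∀ l : PrimesAway p, ‖x l‖ ≤ if n < (l : ℕ) then (1 : ℝ) else n}

theorem isOpen_boundedAdele (n : ℕ) : IsOpen (boundedAdele p n) := by
  have hop : ∀ (l : PrimesAway p) (r : ℝ), r ≠ 0 → IsOpen {x : ℚ_[(l : ℕ)] | ‖x‖ ≤ r} := by
    intro l r hr
    have := IsUltrametricDist.isOpen_closedBall (0 : ℚ_[(l : ℕ)]) hr
    convert this using 1
    ext x; simp
  have h1 : IsOpen {x : AdeleAway p | ∀ l : PrimesAway p, n < (l : ℕ) →
      x.1 l ∈ (PadicInt.subring (l : ℕ) : Set _)} :=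
    RestrictedProduct.isOpen_forall_imp_mem (p := fun l : PrimesAway p => n < (l : ℕ))
      fun l => hop l 1 one_ne_zero
  have hfin : {l : PrimesAway p | (l : ℕ) ≤ n}.Finite :=
    Set.Finite.of_finite_image (f := fun l : PrimesAway p => (l : ℕ))
      ((Set.finite_Iic n).subset (by rintro _ ⟨l, hl, rfl⟩; exact hl))
      (fun _ _ _ _ h => Subtype.ext h)
  have h2 : IsOpen (⋂ l ∈ {l : PrimesAway p | (l : ℕ) ≤ n},
      {x : AdeleAway p | ‖x l‖ ≤ n}) := by
    refine hfin.isOpen_biInter fun l hl => ?_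
    rcases Nat.eq_zero_or_pos n with rfl | hn
    · exact absurd hl (by simpa using l.2.1.ne_zero)
    · exact (hop l n (by exact_mod_cast hn.ne')).preimage (show Continuous fun x : AdeleAway p => x l from RestrictedProduct.continuous_eval l)
  convert h1.inter h2 using 1
  ext x
  simp only [boundedAdele, Set.mem_inter_iff, Set.mem_iInter, Set.mem_ofPred_eq]
  constructor
  · intro h
    refine ⟨fun l hl => ?_, fun l hl => ?_⟩
    · have := h l; rw [if_pos hl] at this; exact this
    · have := h l; rwa [if_neg (not_lt.2 hl)] at this
  · rintro ⟨h1, h2⟩ l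
    split_ifs with hl
    · exact h1 l hl
    · exact h2 l (not_lt.1 hl)

theorem boundedAdele_mono {n m : ℕ} (h : n ≤ m) : boundedAdele p n ⊆ boundedAdele p m := by
  intro x hx l
  refine (hx l).trans ?_
  have hl : (1 : ℝ) ≤ (l : ℕ) := by exact_mod_cast l.2.1.one_lt.le
  have hnm : (n : ℝ) ≤ m := by exact_mod_cast h
  split_ifs with h1 h2 h2
  · exact le_rfl
  · have : ((l : ℕ) : ℝ) ≤ m := by exact_mod_cast not_lt.1 h2
    linarith
  · omega
  · exact hnm

theorem exists_mem_boundedAdele (x : AdeleAway p) : ∃ n, x ∈ boundedAdele p n := by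
  have hfin : {l : PrimesAway p | ¬ ‖x l‖ ≤ 1}.Finite := x.2
  obtain ⟨n, hn⟩ := (hfin.image fun l : PrimesAway p => max ((l : ℕ) : ℝ) ‖x l‖).bddAbove
  obtain ⟨m, hm⟩ := exists_nat_ge n
  refine ⟨m, fun l => ?_⟩
  by_cases hl : ‖x l‖ ≤ 1
  · split_ifs with h
    · exact hl
    · have h1 : 1 ≤ m := l.2.1.one_lt.le.trans (not_lt.1 h)
      have h2 : (1 : ℝ) ≤ m := by exact_mod_cast h1
      exact hl.trans h2
  · have h3 : max ((l : ℕ) : ℝ) ‖x l‖ ≤ m := (hn ⟨l, hl, rfl⟩).trans hm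
    rw [if_neg]
    · exact (le_max_right _ _).trans h3
    · rw [not_lt]
      exact_mod_cast (le_max_left _ _).trans h3

theorem not_dvd_den {l : ℕ} [Fact l.Prime] {q : ℚ} (h : ‖(q : ℚ_[l])‖ ≤ 1) : ¬ l ∣ q.den := by
  intro hd
  have h1 : (q : ℚ_[l]) * (q.den : ℚ_[l]) = (q.num : ℚ_[l]) := by exact_mod_cast Rat.mul_den_eq_num q
  have h2 := (Padic.norm_natCast_lt_one_iff (p := l) (n := q.den)).2 hd
  have h3 : ‖(q.num : ℚ_[l])‖ < 1 := by
    rw [← h1, norm_mul]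
    exact mul_lt_one_of_nonneg_of_lt_one_right h (norm_nonneg _) h2
  have h4 := (Padic.norm_intCast_lt_one_iff (p := l)).1 h3
  have h5 : l ∣ q.num.natAbs := Int.natCast_dvd.1 h4
  exact (Fact.out : l.Prime).one_lt.ne' (Nat.eq_one_of_dvd_coprimes q.reduced h5 hd)

theorem mem_zInv_of_norm_le {q : ℚ} (h : ∀ l : PrimesAway p, ‖(q : ℚ_[(l : ℕ)])‖ ≤ 1) :
    q ∈ ZInv p := by
  obtain ⟨k, h1⟩ : ∃ k, q.den = p ^ k := by
    refine ⟨q.den.primeFactorsList.length, ?_⟩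
    refine Nat.eq_prime_pow_of_unique_prime_dvd q.den_nz fun {l} hl hd => ?_
    by_contra hne
    have : Fact l.Prime := ⟨hl⟩
    exact not_dvd_den (h ⟨l, hl, hne⟩) hd
  refine (mem_zInv_iff q).2 ⟨k, q.num, ?_⟩
  rw [← Rat.mul_den_eq_num q, h1]
  push_cast
  rfl

/-- The rational vectors in the support of a function with compact support on the adeles have
bounded denominators. -/
theorem exists_denom_of_compactSupport {Φ : Vec (AdeleAway p) → ℤ} (hΦ : HasCompactSupport Φ) :
    ∃ N : ℤ, N ≠ 0 ∧ ∀ v : Vec ℚ, ratVal Φ v ≠ 0 → ∀ i, (N : ℚ) * v i ∈ ZInv p := by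
  obtain ⟨n, hn⟩ := hΦ.elim_directed_cover
    (fun n => {v : Vec (AdeleAway p) | ∀ i, v i ∈ boundedAdele p n})
    (fun n => by
      have : {v : Vec (AdeleAway p) | ∀ i, v i ∈ boundedAdele p n} =
        ⋂ i, (fun v : Vec (AdeleAway p) => v i) ⁻¹' boundedAdele p n := by ext; simp
      rw [this]
      exact isOpen_iInter_of_finite fun i =>
        (isOpen_boundedAdele n).preimage (continuous_apply i))
    (by
      intro v _
      choose m hm using fun i => exists_mem_boundedAdele (v i)
      rw [Set.mem_iUnion]
      exact ⟨max (max (m 0) (m 1)) (m 2), fun i => boundedAdele_mono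
        (by fin_cases i <;> simp) (hm i)⟩)
    (by
      intro n m
      exact ⟨max n m, fun v hv i => boundedAdele_mono (le_max_left _ _) (hv i),
        fun v hv i => boundedAdele_mono (le_max_right _ _) (hv i)⟩)
  refine ⟨(n.factorial : ℤ) ^ n, pow_ne_zero _ (by exact_mod_cast n.factorial_ne_zero),
    fun v hv i => ?_⟩
  have hmem := hn (subset_tsupport Φ hv) i
  refine mem_zInv_of_norm_le fun l => ?_
  have h1 : ‖((v i : ℚ) : ℚ_[(l : ℕ)])‖ ≤ if n < (l : ℕ) then (1 : ℝ) else n := hmem l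
  push_cast
  rw [norm_mul, norm_pow]
  have h2 : ‖(n.factorial : ℚ_[(l : ℕ)])‖ ≤ 1 := by
    exact_mod_cast Padic.norm_int_le_one (p := (l : ℕ)) (n.factorial : ℤ)
  split_ifs at h1 with hl
  · exact mul_le_one₀ (pow_le_one₀ (norm_nonneg _) h2) (norm_nonneg _) h1
  · have h3 : ‖(n.factorial : ℚ_[(l : ℕ)])‖ ≤ ((l : ℕ) : ℝ)⁻¹ := by
      apply norm_le_p_inv
      rw [Padic.norm_natCast_lt_one_iff]
      exact (Nat.Prime.dvd_factorial l.2.1).2 (not_lt.1 hl)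
    have hl0 : (0 : ℝ) < (l : ℕ) := by exact_mod_cast l.2.1.pos
    have h4 : (n : ℝ) ≤ ((l : ℕ) : ℝ) ^ n := by
      exact_mod_cast (Nat.lt_pow_self l.2.1.one_lt).le
    calc ‖(n.factorial : ℚ_[(l : ℕ)])‖ ^ n * ‖((v i : ℚ) : ℚ_[(l : ℕ)])‖
        ≤ (((l : ℕ) : ℝ)⁻¹) ^ n * n := by gcongr
      _ ≤ (((l : ℕ) : ℝ)⁻¹) ^ n * ((l : ℕ) : ℝ) ^ n := by gcongr
      _ = 1 := by rw [← mul_pow, inv_mul_cancel₀ hl0.ne', one_pow]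

end Adeles

/-! ### Discreteness of the action and finiteness of orbits -/

section Discrete

variable {a b : ℚ} {p : ℕ} [Fact p.Prime] {wp e wm : Vec ℚ_[p]}
  (σ : Quat a b ℚ_[p] ≃ₐ[ℚ_[p]] Matrix (Fin 2) (Fin 2) ℚ_[p])

theorem exists_actEquiv {A B : Fin 2 → ℚ_[p]} (hAB : A 0 * B 1 - A 1 * B 0 ≠ 0) :
    ∃ ψ : Quat a b ℚ_[p] ≃ₐ[ℚ_[p]] Matrix (Fin 2) (Fin 2) ℚ_[p], ∀ x, ψ x = actMat σ A B x := by
  set P : Matrix (Fin 2) (Fin 2) ℚ_[p] := !![B 0, A 0; B 1, A 1] with hP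
  have hdet : IsUnit P.det := by
    rw [hP, Matrix.det_fin_two_of, isUnit_iff_ne_zero]
    intro h0; apply hAB; linear_combination -h0
  set u : (Matrix (Fin 2) (Fin 2) ℚ_[p])ˣ := ⟨P⁻¹, P, Matrix.nonsing_inv_mul _ hdet,
    Matrix.mul_nonsing_inv _ hdet⟩
  exact ⟨σ.trans (MulSemiringAction.toAlgEquiv ℚ_[p] _ (ConjAct.toConjAct u)), fun x => rfl⟩

theorem coords_add {K : Type*} [CommRing K] [Algebra ℚ K] (x y : Quat a b K) (i : Fin 4) :
    coords (x + y) i = coords x i + coords y i := by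
  fin_cases i <;> rfl

theorem coords_smul {K : Type*} [CommRing K] [Algebra ℚ K] (c : K) (x : Quat a b K) (i : Fin 4) :
    coords (c • x) i = c * coords x i := by
  fin_cases i <;> rfl

theorem matrix_decomp {F : Type*} [CommRing F] (X : Matrix (Fin 2) (Fin 2) F) :
    X = X 0 0 • !![1, 0; 0, 0] + X 0 1 • !![0, 1; 0, 0] + X 1 0 • !![0, 0; 1, 0] +
      X 1 1 • !![0, 0; 0, 1] := by
  ext i j; fin_cases i <;> fin_cases j <;> simp

theorem exists_coords_bound : ∃ C : ℝ, 0 ≤ C ∧ ∀ (x : Quat a b ℚ_[p]) (T : ℝ),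
    (∀ j k, ‖σ x j k‖ ≤ T) → ∀ i, ‖coords x i‖ ≤ C * T := by
  set B : Fin 4 → Quat a b ℚ_[p] := ![σ.symm !![1, 0; 0, 0], σ.symm !![0, 1; 0, 0],
    σ.symm !![0, 0; 1, 0], σ.symm !![0, 0; 0, 1]] with hB
  refine ⟨∑ i, ∑ j, ‖coords (B j) i‖, by positivity, fun x T hT i => ?_⟩
  have hT0 : 0 ≤ T := (norm_nonneg _).trans (hT 0 0)
  have hx : x = σ x 0 0 • B 0 + σ x 0 1 • B 1 + σ x 1 0 • B 2 + σ x 1 1 • B 3 := by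
    apply σ.injective
    conv_lhs => rw [matrix_decomp (σ x)]
    simp [hB]
  have h1 : ‖coords x i‖ ≤ (∑ j, ‖coords (B j) i‖) * T := by
    conv_lhs => rw [hx]
    simp only [coords_add, coords_smul, Fin.sum_univ_four]
    have e : ∀ j k (q : ℚ_[p]), ‖σ x j k * q‖ ≤ ‖q‖ * T := fun j k q => by
      rw [norm_mul, mul_comm]; gcongr; exact hT j k
    refine (norm_add_le _ _).trans ?_
    have h2 := norm_add_le (σ x 0 0 * coords (B 0) i + σ x 0 1 * coords (B 1) i)
      (σ x 1 0 * coords (B 2) i)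
    have h3 := norm_add_le (σ x 0 0 * coords (B 0) i) (σ x 0 1 * coords (B 1) i)
    linarith [e 0 0 (coords (B 0) i), e 0 1 (coords (B 1) i), e 1 0 (coords (B 2) i),
      e 1 1 (coords (B 3) i)]
  refine h1.trans ?_
  refine mul_le_mul_of_nonneg_right ?_ hT0
  exact Finset.single_le_sum (f := fun i => ∑ j, ‖coords (B j) i‖)
    (fun _ _ => by positivity) (Finset.mem_univ i)

theorem coords_baseChange (x : Quat a b ℚ) (i : Fin 4) :
    coords (baseChange ℚ_[p] x) i = ((coords x i : ℚ) : ℚ_[p]) := by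
  fin_cases i <;> simp [coords, baseChange]

variable {R : Subalgebra (ZInv p) (Quat a b ℚ)} {M : ℕ}

theorem Bdd.mono {C C' : ℝ} (hC : C ≤ C') {ζ : ℂ_[p]} (hζ : Irrat p ζ) (h : Bdd p C ζ) :
    Bdd p C' ζ := by
  have h1 : 0 < C := ((rho_pos hζ).trans_le (rho_le_norm ζ)).trans_le h.1
  exact ⟨h.1.trans hC, (inv_anti₀ h1 hC).trans h.2⟩

include σ in
theorem finite_bdd_smul (hinf : IsDivision a b ℝ) (hR : IsEichlerOrder R M)
    (h : IsFrame a b wp e wm) {z : Pt p} (hz : z ∈ halfPlane a b p) (C : ℝ) :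
    {α : GammaBar R ℂ_[p] | Bdd p C (zcoord h (α • z))}.Finite := by
  obtain ⟨A, B, hAB⟩ := exists_isKerFrame σ h
  obtain ⟨ψ, hψ⟩ := exists_actEquiv σ hAB.det_ne
  obtain ⟨C₁, hC₁, hb⟩ := exists_coords_bound ψ
  obtain ⟨m, hm, hden⟩ := hR.exists_denom
  obtain ⟨hz1, hz2⟩ := pt_zcoord h hz
  obtain ⟨M₀, hM₀⟩ := exists_bdd hz2
  set C₂ := max 1 (max C M₀) with hC₂
  choose g hg hgα using fun α : GammaBar R ℂ_[p] => exists_gammaBar α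
  have hfin := finite_bounded_quat (p := p) hinf m hm 1 (C₁ * C₂ ^ 3)
  refine (hfin.preimage (f := fun α => (g α : Quat a b ℚ)) ?_).subset ?_
  · intro α _ β _ hαβ
    apply Subtype.ext
    rw [← hgα α, ← hgα β, Units.ext hαβ]
  · intro α hα
    obtain ⟨h1, h2⟩ := smul_pt σ h hAB (hg α).2.2
    have h3 : zcoord h (α • z) = mob (actMat σ A B (baseChange ℚ_[p] (g α)) 0 0)
        (actMat σ A B (baseChange ℚ_[p] (g α)) 0 1) (actMat σ A B (baseChange ℚ_[p] (g α)) 1 0)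
        (actMat σ A B (baseChange ℚ_[p] (g α)) 1 1) (zcoord h z) := by
      have h3 := h2 _ hz2
      rw [hz1] at h3
      change zcoord h ((α : LinearMap.GeneralLinearGroup ℂ_[p] (Vec ℂ_[p])) • z) = _
      rw [← hgα, h3, zcoord_pt]
    have hb1 : Bdd p C₂ (zcoord h (α • z)) := Bdd.mono ((le_max_left _ _).trans (le_max_right _ _))
      (pt_zcoord h (gammaBar_smul_mem α hz)).2 hα
    rw [h3] at hb1
    have h4 := norm_le_of_bdd_mob h1 (le_max_left _ _)
      (hM₀ C₂ ((le_max_right _ _).trans (le_max_right _ _))) hb1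
    refine ⟨(hg α).2.2.le, fun i => ⟨hden _ (hg α).1 i, ?_⟩⟩
    rw [← coords_baseChange]
    refine hb _ _ (fun j k => ?_) i
    rw [hψ]
    fin_cases j <;> fin_cases k
    exacts [h4.1, h4.2.1, h4.2.2.1, h4.2.2.2]

theorem norm_le_of_toZModPow_eq {k : ℕ} {x y : ℤ_[p]}
    (h : PadicInt.toZModPow k x = PadicInt.toZModPow k y) : ‖x - y‖ ≤ (p : ℝ) ^ (-k : ℤ) := by
  rw [PadicInt.norm_le_pow_iff_mem_span_pow, ← PadicInt.ker_toZModPow, RingHom.mem_ker, map_sub, h,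
    sub_self]

/-- A form of Minkowski's theorem. -/
theorem exists_small_vec (k : ℕ) (w : Fin 4 → Fin 4 → ℤ_[p]) {c : ℚ_[p]} (hc : ‖c‖ ≤ (p : ℝ) ^ k) :
    ∃ y : Fin 4 → ℤ, y ≠ 0 ∧ (∀ i, |y i| ≤ p ^ k) ∧
      (∀ j ∈ ({0, 2} : Finset (Fin 4)), ‖((∑ i, (y i : ℤ_[p]) * w j i : ℤ_[p]) : ℚ_[p])‖ ≤ (p : ℝ) ^ (-k : ℤ) ∧
        ‖((∑ i, (y i : ℤ_[p]) * w (j + 1) i : ℤ_[p]) : ℚ_[p]) +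
          c * ((∑ i, (y i : ℤ_[p]) * w j i : ℤ_[p]) : ℚ_[p])‖ ≤ (p : ℝ) ^ (-k : ℤ)) := by
  have hp := p_pos (p := p)
  set F : Fin 4 → (Fin 4 → Fin (p ^ k + 1)) → ℤ_[p] := fun j y =>
    ∑ i, ((y i : ℕ) : ℤ_[p]) * w j i with hF
  set r : Fin 4 → (Fin 4 → Fin (p ^ k + 1)) → ℤ_[p] := fun j y =>
    ((PadicInt.toZModPow k (F j y)).val : ℤ_[p]) with hr
  have hpk : NeZero (p ^ k) := ⟨pow_ne_zero _ (Fact.out : p.Prime).ne_zero⟩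
  have hrF : ∀ j y, ‖F j y - r j y‖ ≤ (p : ℝ) ^ (-k : ℤ) := fun j y => by
    apply norm_le_of_toZModPow_eq
    rw [hr]
    simp
  have hint : ∀ j y, ‖c * ((F j y - r j y : ℤ_[p]) : ℚ_[p])‖ ≤ 1 := fun j y => by
    rw [norm_mul]
    calc _ ≤ (p : ℝ) ^ k * (p : ℝ) ^ (-k : ℤ) := by
          gcongr
          exact hrF j y
      _ = 1 := by rw [zpow_neg, zpow_natCast, mul_inv_cancel₀ (by positivity)]
  set d : Fin 4 → (Fin 4 → Fin (p ^ k + 1)) → ℤ_[p] := fun j y => ⟨_, hint j y⟩ with hd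
  obtain ⟨y, y', hne, hy⟩ := Fintype.exists_ne_map_eq_of_card_lt
    (fun y : Fin 4 → Fin (p ^ k + 1) => (![PadicInt.toZModPow k (F 0 y),
      PadicInt.toZModPow k (F 1 y + d 0 y), PadicInt.toZModPow k (F 2 y),
      PadicInt.toZModPow k (F 3 y + d 2 y)] : Fin 4 → ZMod (p ^ k)))
    (by
      simp only [Fintype.card_fun, Fintype.card_fin, ZMod.card]
      exact Nat.pow_lt_pow_left (Nat.lt_succ_self _) (by norm_num))
  have hsub : ∀ j, (∑ i, ((((y i : ℕ) : ℤ) - ((y' i : ℕ) : ℤ) : ℤ) : ℤ_[p]) * w j i) =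
      F j y - F j y' := fun j => by
    rw [hF]
    simp only
    rw [← Finset.sum_sub_distrib]
    refine Finset.sum_congr rfl fun i _ => ?_
    push_cast; ring
  have key : ∀ j j' : Fin 4, PadicInt.toZModPow k (F j y) = PadicInt.toZModPow k (F j y') →
      PadicInt.toZModPow k (F j' y + d j y) = PadicInt.toZModPow k (F j' y' + d j y') →
      ‖((F j y - F j y' : ℤ_[p]) : ℚ_[p])‖ ≤ (p : ℝ) ^ (-k : ℤ) ∧
      ‖((F j' y - F j' y' : ℤ_[p]) : ℚ_[p]) + c * ((F j y - F j y' : ℤ_[p]) : ℚ_[p])‖ ≤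
        (p : ℝ) ^ (-k : ℤ) := by
    intro j j' h1 h2
    refine ⟨norm_le_of_toZModPow_eq h1, ?_⟩
    have h3 := norm_le_of_toZModPow_eq h2
    have h4 : r j y = r j y' := by rw [hr]; simp only; rw [h1]
    have h5 : ((F j' y - F j' y' : ℤ_[p]) : ℚ_[p]) + c * ((F j y - F j y' : ℤ_[p]) : ℚ_[p]) =
        ((F j' y + d j y - (F j' y' + d j y') : ℤ_[p]) : ℚ_[p]) := by
      have hdc : ∀ y, ((d j y : ℤ_[p]) : ℚ_[p]) = c * ((F j y - r j y : ℤ_[p]) : ℚ_[p]) :=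
        fun _ => rfl
      rw [PadicInt.coe_sub (F j' y + d j y), PadicInt.coe_add, PadicInt.coe_add, hdc, hdc, h4]
      push_cast
      ring
    rw [h5]
    exact h3
  refine ⟨fun i => ((y i : ℕ) : ℤ) - ((y' i : ℕ) : ℤ), ?_, fun i => ?_, ?_⟩
  · intro h0
    apply hne
    funext i
    have := congrFun h0 i
    apply Fin.ext
    simp only [Pi.zero_apply] at this
    omega
  · have h1 := (y i).2
    have h2 := (y' i).2
    have h3 : ((p : ℤ)) ^ k = ((p ^ k : ℕ) : ℤ) := by push_cast; rfl
    rw [h3, abs_le]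
    dsimp only
    constructor <;> omega
  · intro j hj
    rw [hsub, hsub]
    simp only [Finset.mem_insert, Finset.mem_singleton] at hj
    rcases hj with rfl | rfl
    · exact key 0 1 (congrFun hy 0) (congrFun hy 1)
    · exact key 2 3 (congrFun hy 2) (congrFun hy 3)

end Discrete

section Orbits

variable {a b : ℚ} {p : ℕ} [Fact p.Prime] {wp e wm : Vec ℚ_[p]}
  (ψ : Quat a b ℚ_[p] ≃ₐ[ℚ_[p]] Matrix (Fin 2) (Fin 2) ℚ_[p])
  {R : Subalgebra (ZInv p) (Quat a b ℚ)} {M : ℕ}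

theorem quat_coords_decomp (x : Quat a b ℚ_[p]) : x = coords x 0 • (⟨1, 0, 0, 0⟩ : Quat a b ℚ_[p]) +
    coords x 1 • (⟨0, 1, 0, 0⟩ : Quat a b ℚ_[p]) + coords x 2 • (⟨0, 0, 1, 0⟩ : Quat a b ℚ_[p]) +
      coords x 3 • (⟨0, 0, 0, 1⟩ : Quat a b ℚ_[p]) := by
  ext <;> simp [coords]

theorem coords_mul_mem {x y : Quat a b ℚ} {m n : ℤ} (hx : ∀ i, (m : ℚ) * coords x i ∈ ZInv p)
    (hy : ∀ i, (n : ℚ) * coords y i ∈ ZInv p) (i : Fin 4) :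
    ((m * n * (a.den * b.den) : ℤ) : ℚ) * coords (x * y) i ∈ ZInv p := by
  have hA : ((a.den : ℤ) : ℚ) ∈ ZInv p := intCast_mem_zInv _
  have hB : ((b.den : ℤ) : ℚ) ∈ ZInv p := intCast_mem_zInv _
  have hA' : (a.num : ℚ) ∈ ZInv p := intCast_mem_zInv _
  have hB' : (b.num : ℚ) ∈ ZInv p := intCast_mem_zInv _
  have ea : (a.den : ℚ) * a = a.num := Rat.den_mul_eq_num a
  have eb : (b.den : ℚ) * b = b.num := Rat.den_mul_eq_num b
  push_cast at *
  have x0 := hx 0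
  have x1 := hx 1
  have x2 := hx 2
  have x3 := hx 3
  have y0 := hy 0
  have y1 := hy 1
  have y2 := hy 2
  have y3 := hy 3
  change (m : ℚ) * x.re ∈ _ at x0
  change (m : ℚ) * x.imI ∈ _ at x1
  change (m : ℚ) * x.imJ ∈ _ at x2
  change (m : ℚ) * x.imK ∈ _ at x3
  change (n : ℚ) * y.re ∈ _ at y0
  change (n : ℚ) * y.imI ∈ _ at y1
  change (n : ℚ) * y.imJ ∈ _ at y2
  change (n : ℚ) * y.imK ∈ _ at y3
  have hm : ∀ {u v : ℚ}, u ∈ ZInv p → v ∈ ZInv p → u * v ∈ ZInv p := fun h h' =>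
    (ZInv p).mul_mem h h'
  have ha : ∀ {u v : ℚ}, u ∈ ZInv p → v ∈ ZInv p → u + v ∈ ZInv p := fun h h' =>
    (ZInv p).add_mem h h'
  have hs : ∀ {u v : ℚ}, u ∈ ZInv p → v ∈ ZInv p → u - v ∈ ZInv p := fun h h' =>
    (ZInv p).sub_mem h h'
  have hAB := hm hA hB
  have haB := hm hA' hB
  have hAb := hm hA hB'
  have hab := hm hA' hB'
  fin_cases i
  · convert hs (ha (ha (hm hAB (hm x0 y0)) (hm haB (hm x1 y1))) (hm hAb (hm x2 y2)))
      (hm hab (hm x3 y3)) using 1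
    simp [coords]
    linear_combination (m * n : ℚ) * (b.den * (x.imI * y.imI) * ea + a.den * (x.imJ * y.imJ) * eb -
      x.imK * y.imK * (b.den * b * ea + a.num * eb))
  · convert ha (hs (ha (hm hAB (hm x0 y1)) (hm hAB (hm x1 y0))) (hm hAb (hm x2 y3)))
      (hm hAb (hm x3 y2)) using 1
    simp [coords]
    linear_combination (m * n : ℚ) * (a.den * (x.imK * y.imJ - x.imJ * y.imK)) * eb
  · convert hs (ha (ha (hm hAB (hm x0 y2)) (hm haB (hm x1 y3))) (hm hAB (hm x2 y0)))
      (hm haB (hm x3 y1)) using 1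
    simp [coords]
    linear_combination (m * n : ℚ) * (b.den * (x.imI * y.imK - x.imK * y.imI)) * ea
  · convert ha (hs (ha (hm hAB (hm x0 y3)) (hm hAB (hm x1 y2))) (hm hAB (hm x2 y1)))
      (hm hAB (hm x3 y0)) using 1
    simp [coords]; ring

theorem exists_small_quat {n : ℤ} (hn : n ≠ 0) : ∃ C : ℝ, 0 ≤ C ∧ ∃ C' : ℚ, ∀ c : ℚ_[p],
    ∃ x : Quat a b ℚ, x ≠ 0 ∧ (∀ i, ∃ z ∈ ZInv p, coords x i = n * z) ∧ |nrd x| ≤ C' ∧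
      ∀ j, ‖ψ (baseChange ℚ_[p] x) j 0‖ ≤ C ∧
        ‖ψ (baseChange ℚ_[p] x) j 1 + c * ψ (baseChange ℚ_[p] x) j 0‖ ≤ C := by
  have hp := p_pos (p := p)
  have hp0 : (p : ℚ) ≠ 0 := by exact_mod_cast (Fact.out : p.Prime).ne_zero
  set B : Fin 4 → Quat a b ℚ_[p] := ![⟨1, 0, 0, 0⟩, ⟨0, 1, 0, 0⟩, ⟨0, 0, 1, 0⟩, ⟨0, 0, 0, 1⟩] with hB
  obtain ⟨s, hs⟩ := pow_unbounded_of_one_lt (∑ i, ∑ j, ∑ k, ‖ψ (B i) j k‖) (one_lt_p (p := p))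
  have hint : ∀ i j k, ‖(p : ℚ_[p]) ^ s * ψ (B i) j k‖ ≤ 1 := fun i j k => by
    have h1 : ‖ψ (B i) j k‖ ≤ (p : ℝ) ^ s := by
      refine le_trans ?_ hs.le
      refine le_trans ?_ (Finset.single_le_sum (f := fun i => ∑ j, ∑ k, ‖ψ (B i) j k‖)
        (fun _ _ => by positivity) (Finset.mem_univ i))
      refine le_trans ?_ (Finset.single_le_sum (f := fun j => ∑ k, ‖ψ (B i) j k‖)
        (fun _ _ => by positivity) (Finset.mem_univ j))
      exact Finset.single_le_sum (f := fun k => ‖ψ (B i) j k‖)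
        (fun _ _ => by positivity) (Finset.mem_univ k)
    rw [norm_mul, norm_pow, Padic.norm_p]
    calc _ ≤ ((p : ℝ)⁻¹) ^ s * (p : ℝ) ^ s := by gcongr
      _ = 1 := by rw [← mul_pow, inv_mul_cancel₀ hp.ne', one_pow]
  set w : Fin 4 → Fin 4 → ℤ_[p] := ![fun i => ⟨_, hint i 0 0⟩, fun i => ⟨_, hint i 0 1⟩,
    fun i => ⟨_, hint i 1 0⟩, fun i => ⟨_, hint i 1 1⟩] with hw
  refine ⟨(p : ℝ) ^ s, by positivity, n ^ 2 * (1 + |a| + |b| + |a * b|), fun c => ?_⟩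
  obtain ⟨k, hk⟩ := pow_unbounded_of_one_lt ‖c‖ (one_lt_p (p := p))
  obtain ⟨y, hy0, hy1, hy2⟩ := exists_small_vec k w hk.le
  set x : Quat a b ℚ := ⟨n * (y 0 / p ^ k), n * (y 1 / p ^ k), n * (y 2 / p ^ k),
    n * (y 3 / p ^ k)⟩ with hx
  have hxc : ∀ i, coords x i = n * (y i / p ^ k) := fun i => by fin_cases i <;> rfl
  have hpk : (p : ℚ) ^ k ≠ 0 := pow_ne_zero _ hp0
  have hnq : (n : ℚ) ≠ 0 := by exact_mod_cast hn
  have hψ : ∀ j l : Fin 2, ∀ m : Fin 4, (∀ i, (w m i : ℚ_[p]) = (p : ℚ_[p]) ^ s * ψ (B i) j l) →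
      ψ (baseChange ℚ_[p] x) j l = n / ((p : ℚ_[p]) ^ k * (p : ℚ_[p]) ^ s) *
        ((∑ i, (y i : ℤ_[p]) * w m i : ℤ_[p]) : ℚ_[p]) := by
    intro j l m hm
    have hpq : (p : ℚ_[p]) ≠ 0 := pQ_ne_zero
    have e : ψ (baseChange ℚ_[p] x) = ((coords x 0 : ℚ) : ℚ_[p]) • ψ (B 0) +
        ((coords x 1 : ℚ) : ℚ_[p]) • ψ (B 1) + ((coords x 2 : ℚ) : ℚ_[p]) • ψ (B 2) +
          ((coords x 3 : ℚ) : ℚ_[p]) • ψ (B 3) := by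
      conv_lhs => rw [quat_coords_decomp (baseChange ℚ_[p] x)]
      simp only [map_add, map_smul, coords_baseChange]
      rfl
    rw [e]
    simp only [Matrix.add_apply, Matrix.smul_apply, hxc, Fin.sum_univ_four, PadicInt.coe_add,
      PadicInt.coe_mul, PadicInt.coe_intCast, hm, smul_eq_mul]
    push_cast
    field_simp
  have hnn : ‖(n : ℚ_[p]) / ((p : ℚ_[p]) ^ k * (p : ℚ_[p]) ^ s)‖ * (p : ℝ) ^ (-k : ℤ) ≤
      (p : ℝ) ^ s := by
    rw [norm_div, norm_mul, norm_pow, norm_pow, Padic.norm_p, zpow_neg, zpow_natCast]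
    have := Padic.norm_int_le_one (p := p) n
    calc _ ≤ 1 / (((p : ℝ)⁻¹) ^ k * ((p : ℝ)⁻¹) ^ s) * ((p : ℝ) ^ k)⁻¹ := by gcongr
      _ = _ := by
        rw [inv_pow, inv_pow]
        field_simp
  have hfin : ∀ q : ℚ_[p], ‖q‖ ≤ (p : ℝ) ^ (-k : ℤ) →
      ‖(n : ℚ_[p]) / ((p : ℚ_[p]) ^ k * (p : ℚ_[p]) ^ s) * q‖ ≤ (p : ℝ) ^ s := by
    intro q hq
    rw [norm_mul]
    exact (mul_le_mul_of_nonneg_left hq (norm_nonneg _)).trans hnn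
  refine ⟨x, ?_, fun i => ⟨y i / p ^ k, ?_, hxc i⟩, ?_, ?_⟩
  · intro h0
    apply hy0
    funext i
    have h1 := hxc i
    rw [h0] at h1
    have h2 : coords (0 : Quat a b ℚ) i = 0 := by fin_cases i <;> rfl
    rw [h2, eq_comm, mul_eq_zero, div_eq_zero_iff] at h1
    have : (y i : ℚ) = 0 := by tauto
    exact_mod_cast this
  · exact (mem_zInv_iff _).2 ⟨k, y i, div_mul_cancel₀ _ hpk⟩
  · have hb : ∀ i, (coords x i) ^ 2 ≤ n ^ 2 := fun i => by
      rw [hxc, mul_pow]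
      have h1 : ((y i : ℚ) / p ^ k) ^ 2 ≤ 1 := by
        rw [div_pow, div_le_one (by positivity), sq_le_sq, abs_of_nonneg (by positivity : (0 : ℚ) ≤ p ^ k)]
        exact_mod_cast hy1 i
      nlinarith [sq_nonneg (n : ℚ)]
    have h0 : x.re ^ 2 ≤ n ^ 2 := hb 0
    have h1 : x.imI ^ 2 ≤ n ^ 2 := hb 1
    have h2 : x.imJ ^ 2 ≤ n ^ 2 := hb 2
    have h3 : x.imK ^ 2 ≤ n ^ 2 := hb 3
    rw [nrd_eq]
    simp only [eq_ratCast, Rat.cast_id]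
    have t1 : |x.re ^ 2 - a * x.imI ^ 2 - b * x.imJ ^ 2 + a * b * x.imK ^ 2| ≤
        x.re ^ 2 + |a| * x.imI ^ 2 + |b| * x.imJ ^ 2 + |a * b| * x.imK ^ 2 := by
      rw [abs_le]
      have e1 := neg_abs_le a
      have e2 := le_abs_self a
      have e3 := neg_abs_le b
      have e4 := le_abs_self b
      have e5 := neg_abs_le (a * b)
      have e6 := le_abs_self (a * b)
      constructor <;> nlinarith [sq_nonneg x.re, sq_nonneg x.imI, sq_nonneg x.imJ, sq_nonneg x.imK]
    have g1 := mul_le_mul_of_nonneg_left h1 (abs_nonneg a)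
    have g2 := mul_le_mul_of_nonneg_left h2 (abs_nonneg b)
    have g3 := mul_le_mul_of_nonneg_left h3 (abs_nonneg (a * b))
    linarith
  · intro j
    fin_cases j
    · have h1 := hy2 0 (by simp)
      have e0 := hψ 0 0 0 fun i => rfl
      have e1 := hψ 0 1 1 fun i => rfl
      simp only [Fin.zero_eta]
      rw [e1, e0]
      refine ⟨hfin _ h1.1, ?_⟩
      convert hfin _ h1.2 using 2
      simp only [zero_add]
      ring
    · have h1 := hy2 2 (by simp)
      have e0 := hψ 1 0 2 fun i => rfl
      have e1 := hψ 1 1 3 fun i => rfl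
      simp only [Fin.mk_one]
      rw [e1, e0]
      refine ⟨hfin _ h1.1, ?_⟩
      convert hfin _ h1.2 using 2
      have : (2 : Fin 4) + 1 = 3 := rfl
      rw [this]
      ring

end Orbits

section FiniteOrbits

variable {a b : ℚ} {p : ℕ} [Fact p.Prime] {wp e wm : Vec ℚ_[p]}
  (ψ : Quat a b ℚ_[p] ≃ₐ[ℚ_[p]] Matrix (Fin 2) (Fin 2) ℚ_[p])
  {R : Subalgebra (ZInv p) (Quat a b ℚ)} {M : ℕ}

theorem mul_star_eq {K : Type*} [CommRing K] [Algebra ℚ K] (x : Quat a b K) :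
    x * star x = algebraMap K _ (nrd x) := by
  ext <;> simp [nrd] <;> ring

theorem mul_star_eq_smul (x : Quat a b ℚ) : x * star x = nrd x • (1 : Quat a b ℚ) := by
  ext <;> simp [nrd] <;> ring

theorem star_mul_eq_smul (x : Quat a b ℚ) : star x * x = nrd x • (1 : Quat a b ℚ) := by
  ext <;> simp [nrd] <;> ring

theorem nrd_star {K : Type*} [CommRing K] [Algebra ℚ K] (x : Quat a b K) :
    nrd (star x) = nrd x := by
  rw [nrd_eq, nrd_eq]; simp

theorem coords_star_mem {x : Quat a b ℚ} {n : ℚ} (h : ∀ i, ∃ z ∈ ZInv p, coords x i = n * z)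
    (i : Fin 4) : ∃ z ∈ ZInv p, coords (star x) i = n * z := by
  obtain ⟨z, hz, h'⟩ := h i
  fin_cases i
  · exact ⟨z, hz, by rw [← h']; simp [coords]⟩
  · exact ⟨-z, (ZInv p).neg_mem hz, by rw [mul_neg, ← h']; simp [coords]⟩
  · exact ⟨-z, (ZInv p).neg_mem hz, by rw [mul_neg, ← h']; simp [coords]⟩
  · exact ⟨-z, (ZInv p).neg_mem hz, by rw [mul_neg, ← h']; simp [coords]⟩

theorem split_star (x : Quat a b ℚ_[p]) (hx : nrd x ≠ 0) : ψ (star x) = (ψ x).adjugate := by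
  have h1 : ψ x * ψ (star x) = ψ x * (ψ x).adjugate := by
    rw [← map_mul, mul_star_eq, AlgEquiv.commutes, Matrix.mul_adjugate, det_split,
      Algebra.algebraMap_eq_smul_one]
  have h2 : IsUnit (ψ x).det := by rw [det_split]; exact hx.isUnit
  have := congrArg (fun Y => (ψ x)⁻¹ * Y) h1
  simpa only [Matrix.nonsing_inv_mul_cancel_left _ _ h2] using this

theorem nrd_baseChange (x : Quat a b ℚ) : nrd (baseChange ℚ_[p] x) = ((nrd x : ℚ) : ℚ_[p]) := by
  rw [nrd_eq, nrd_eq]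
  simp [baseChange]

/-- Conjugating by the upper triangular unipotent matrix that makes a traceless matrix
antidiagonal. -/
theorem norm_conj_le {X Y : Matrix (Fin 2) (Fin 2) ℚ_[p]} (htr : X 1 1 = -X 0 0)
    (ht : X 1 0 ≠ 0) {C T : ℝ} (hT : ‖X 1 0‖ ≤ T) (hdet : ‖X.det‖ ≤ T * ‖X 1 0‖)
    (hC : ∀ j, ‖Y j 0‖ ≤ C ∧ ‖Y j 1 + X 0 0 / X 1 0 * Y j 0‖ ≤ C) (j k : Fin 2) :
    ‖(Y * X * Y.adjugate) j k‖ ≤ C ^ 2 * T := by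
  set c := X 0 0 / X 1 0 with hc
  set s := -X.det / X 1 0 with hs
  have hC0 : 0 ≤ C := (norm_nonneg _).trans (hC 0).1
  have hsT : ‖s‖ ≤ T := by
    rw [hs, norm_div, norm_neg, div_le_iff₀ (norm_pos_iff.2 ht)]; exact hdet
  have e1 : X 0 0 = c * X 1 0 := by rw [hc, div_mul_cancel₀ _ ht]
  have e2 : X 0 1 = s - c ^ 2 * X 1 0 := by
    rw [hs, hc, Matrix.det_fin_two, htr]; field_simp; ring
  have key : ∀ j k l m : ℚ_[p], ‖j‖ ≤ C → ‖k‖ ≤ C → ‖l‖ ≤ C → ‖m‖ ≤ C →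
      ‖j * k * X 1 0 - l * m * s‖ ≤ C ^ 2 * T := by
    intro j k l m hj hk hl hm
    have hT0 : 0 ≤ T := (norm_nonneg _).trans hT
    refine (norm_sub_le_max' _ _).trans (max_le ?_ ?_)
    · rw [norm_mul, norm_mul, sq]; gcongr
    · rw [norm_mul, norm_mul, sq]; gcongr
  have h0 := hC 0
  have h1 := hC 1
  fin_cases j <;> fin_cases k
  · convert key _ _ _ _ h0.2 h1.2 h0.1 h1.1 using 2
    simp [Matrix.mul_apply, Fin.sum_univ_two, Matrix.adjugate_fin_two, htr, e1, e2]; ring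
  · have h2 := key _ _ _ _ h0.2 h0.2 h0.1 h0.1
    rw [← norm_neg] at h2
    refine le_of_eq_of_le (congrArg norm ?_) h2
    simp [Matrix.mul_apply, Fin.sum_univ_two, Matrix.adjugate_fin_two, htr, e1, e2]; ring
  · convert key _ _ _ _ h1.2 h1.2 h1.1 h1.1 using 2
    simp [Matrix.mul_apply, Fin.sum_univ_two, Matrix.adjugate_fin_two, htr, e1, e2]; ring
  · have h2 := key _ _ _ _ h0.2 h1.2 h0.1 h1.1
    rw [← norm_neg] at h2
    refine le_of_eq_of_le (congrArg norm ?_) h2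
    simp [Matrix.mul_apply, Fin.sum_univ_two, Matrix.adjugate_fin_two, htr, e1, e2]; ring

theorem baseChange_toQuat (v : Vec ℚ) :
    baseChange ℚ_[p] (toQuat a b v) = toQuat a b (toQp p v) := by
  ext <;> simp [baseChange, toQuat, toQp]

theorem split_toQuat_trace (v : Vec ℚ_[p]) : ψ (toQuat a b v) 1 1 = -ψ (toQuat a b v) 0 0 := by
  have h1 : toQuat a b v * toQuat a b v = algebraMap _ _ (-quadForm a b v) := toQuat_mul_self v
  have h2 : star (toQuat a b v) = -toQuat a b v := by ext <;> simp [toQuat]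
  by_cases h0 : quadForm a b v = 0
  · have hX : ψ (toQuat a b v) * ψ (toQuat a b v) = 0 := by
      rw [← map_mul, h1, h0]; simp
    have hd : (ψ (toQuat a b v)).det = 0 := by rw [det_split]; exact h0
    generalize ψ (toQuat a b v) = X at *
    have e := fun i j => congrFun (congrFun hX i) j
    simp only [Matrix.mul_apply, Fin.sum_univ_two, Matrix.zero_apply] at e
    rw [Matrix.det_fin_two] at hd
    have : (X 0 0 + X 1 1) ^ 2 = 0 := by linear_combination e 0 0 + e 1 1 + 2 * hd
    linear_combination pow_eq_zero_iff two_ne_zero |>.1 this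
  · have h3 := split_star ψ (toQuat a b v) h0
    rw [h2, map_neg] at h3
    have := congrFun (congrFun h3 1) 1
    rw [Matrix.adjugate_fin_two] at this
    simp at this
    linear_combination -this

theorem exists_multiple (S : Set ℚ) (hS : S.Finite) (h0 : ∀ q ∈ S, q ≠ 0) :
    ∃ K : ℕ, K ≠ 0 ∧ ∀ q ∈ S, ∃ n : ℤ, (K : ℚ) * q⁻¹ = n := by
  refine ⟨∏ q ∈ hS.toFinset, q.num.natAbs, ?_, fun q hq => ?_⟩
  · refine Finset.prod_ne_zero_iff.2 fun q hq => ?_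
    have := h0 q (hS.mem_toFinset.1 hq)
    simpa using this
  · rw [← Finset.mul_prod_erase _ _ (hS.mem_toFinset.2 hq)]
    have hn : (q.num : ℚ) ≠ 0 := by exact_mod_cast Rat.num_ne_zero.2 (h0 q hq)
    have e : q⁻¹ = q.den / q.num := by
      conv_lhs => rw [← Rat.num_div_den q, inv_div]
    have e2 : ((q.num.natAbs : ℕ) : ℚ) = |(q.num : ℚ)| := by
      rw [← Int.cast_natCast, Int.natCast_natAbs]; push_cast; rfl
    rcases abs_choice (q.num : ℚ) with h | h
    · refine ⟨(q.den : ℤ) * ∏ x ∈ hS.toFinset.erase q, (x.num.natAbs : ℤ), ?_⟩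
      push_cast
      rw [e, e2, h]
      simp only [Nat.cast_natAbs, Int.cast_abs]
      field_simp
    · refine ⟨-((q.den : ℤ) * ∏ x ∈ hS.toFinset.erase q, (x.num.natAbs : ℤ)), ?_⟩
      push_cast
      rw [e, e2, h]
      simp only [Nat.cast_natAbs, Int.cast_abs]
      field_simp

theorem inv_smul_mul_inv_smul {A : Type*} [Ring A] [Algebra ℚ A] {m : ℚ} (hm : m ≠ 0)
    {x y z w : A} (h : y * z = m • 1) (h' : x * w = m • 1) :
    m⁻¹ • (x * y) * (m⁻¹ • (z * w)) = 1 := by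
  rw [smul_mul_smul_comm, mul_assoc, ← mul_assoc y, h, smul_one_mul, mul_smul_comm, h', smul_smul,
    smul_smul, show m⁻¹ * m⁻¹ * m * m = (m⁻¹ * m) * (m⁻¹ * m) by ring, inv_mul_cancel₀ hm, one_mul,
    one_smul]

/-- Two vectors with the same image under the conjugation `v ↦ x v x̄` for congruent quaternions
`x` of the same reduced norm are equivalent. -/
theorem exists_normOne_smul {n : ℤ} (hRn : ∀ x : Quat a b ℚ,
      (∀ i, ∃ c ∈ ZInv p, coords x i = n * c) → x ∈ R) {x x' : Quat a b ℚ}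
    (hx : ∀ i, ∃ c ∈ ZInv p, coords x i = n * c) (hx' : ∀ i, ∃ c ∈ ZInv p, coords x' i = n * c)
    (hxn : nrd x ≠ 0) (hn : nrd x = nrd x')
    (hcong : ∀ i, ∃ c ∈ ZInv p, (nrd x)⁻¹ * (coords x i - coords x' i) = n * c) {v v' : Vec ℚ}
    (hv : x * toQuat a b v * star x = x' * toQuat a b v' * star x') :
    ∃ g ∈ normOne R, conjRat ℚ g • v = v' := by
  set m := nrd x with hm
  have hdm : ∀ i, coords (m⁻¹ • (x - x')) i = m⁻¹ * (coords x i - coords x' i) := fun i => by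
    rw [coords_smul]; fin_cases i <;> rfl
  have hdm' : ∀ i, ∃ c ∈ ZInv p, coords (m⁻¹ • (x' - x)) i = n * c := fun i => by
    obtain ⟨c, hc, h⟩ := hcong i
    refine ⟨-c, (ZInv p).neg_mem hc, ?_⟩
    have : coords (m⁻¹ • (x' - x)) i = m⁻¹ * (coords x' i - coords x i) := by
      rw [coords_smul]; fin_cases i <;> rfl
    rw [this]; linear_combination -h
  have hxx' : star x' * x' = m • (1 : Quat a b ℚ) := by rw [star_mul_eq_smul, ← hn]
  have hxx : star x * x = m • (1 : Quat a b ℚ) := by rw [star_mul_eq_smul]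
  have hxs : x * star x = m • (1 : Quat a b ℚ) := by rw [mul_star_eq_smul]
  have hxs' : x' * star x' = m • (1 : Quat a b ℚ) := by rw [mul_star_eq_smul, ← hn]
  have hmm : m⁻¹ * m = 1 := inv_mul_cancel₀ hxn
  have e1 : m⁻¹ • (star x' * x) * (m⁻¹ • (star x * x')) = 1 :=
    inv_smul_mul_inv_smul hxn hxs hxx'
  have e2 : m⁻¹ • (star x * x') * (m⁻¹ • (star x' * x)) = 1 :=
    inv_smul_mul_inv_smul hxn hxs' hxx
  have m1 : m⁻¹ • (star x' * x) ∈ R := by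
    have : m⁻¹ • (star x' * x) = 1 + star x' * (m⁻¹ • (x - x')) := by
      rw [mul_smul_comm, mul_sub, hxx', smul_sub, smul_smul, hmm]
      simp
    rw [this]
    exact R.add_mem R.one_mem (R.mul_mem (hRn _ (coords_star_mem hx'))
      (hRn _ fun i => by rw [hdm]; exact hcong i))
  have m2 : m⁻¹ • (star x * x') ∈ R := by
    have : m⁻¹ • (star x * x') = 1 + star x * (m⁻¹ • (x' - x)) := by
      rw [mul_smul_comm, mul_sub, hxx, smul_sub, smul_smul, hmm]
      simp
    rw [this]
    exact R.add_mem R.one_mem (R.mul_mem (hRn _ (coords_star_mem hx)) (hRn _ hdm'))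
  have hnr : nrd (m⁻¹ • (star x' * x)) = 1 := by
    have : ∀ (c : ℚ) (y : Quat a b ℚ), nrd (c • y) = c ^ 2 * nrd y := fun c y => by
      rw [nrd_eq, nrd_eq]; simp; ring
    rw [this, nrd_mul, nrd_star, ← hn, ← hm]
    field_simp
  refine ⟨⟨_, _, e1, e2⟩, ⟨m1, m2, hnr⟩, ?_⟩
  have inj : ∀ u w : Vec ℚ, toQuat a b u = toQuat a b w → u = w := fun u w h => by
    rw [← imag_toQuat (a := a) (b := b) u, h, imag_toQuat]
  apply inj
  have e3 := toQuat_conj_smul (K := ℚ) (Units.map (baseChange (a := a) (b := b) ℚ : Quat a b ℚ →* Quat a b ℚ)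
    ⟨_, _, e1, e2⟩) v
  have hbc : ∀ y : Quat a b ℚ, baseChange ℚ y = y := fun y => by ext <;> simp [baseChange]
  refine e3.trans ?_
  change baseChange ℚ (m⁻¹ • (star x' * x)) * toQuat a b v * baseChange ℚ (m⁻¹ • (star x * x')) = _
  rw [hbc, hbc, smul_mul_assoc, smul_mul_smul_comm]
  rw [show star x' * x * toQuat a b v * (star x * x') = star x' * (x * toQuat a b v * star x) * x' by
    simp only [mul_assoc], hv]
  rw [show star x' * (x' * toQuat a b v' * star x') * x' =
    (star x' * x') * toQuat a b v' * (star x' * x') by simp only [mul_assoc], hxx']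
  rw [smul_one_mul, mul_smul_comm, mul_one, smul_smul, smul_smul]
  rw [show m⁻¹ * m⁻¹ * m * m = (m⁻¹ * m) * (m⁻¹ * m) by ring, hmm, one_mul, one_smul]

variable (p) in
theorem finite_small_nrd {n : ℤ} {C : ℝ} {C' : ℚ} (hψ : 0 ≤ C) :
    {q : ℚ | ∃ x : Quat a b ℚ, (∀ i, ∃ z ∈ ZInv p, coords x i = n * z) ∧ |nrd x| ≤ C' ∧
      ‖(nrd (baseChange ℚ_[p] x))‖ ≤ C ∧ nrd x = q}.Finite := by
  have hden : (1 * 1 * (a.den * b.den) : ℤ) ≠ 0 := by simp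
  refine (finite_bounded_rat (p := p) _ hden (max C (C' : ℝ))).subset ?_
  rintro q ⟨x, h1, h2, h3, rfl⟩
  have hx : ∀ i, ((1 : ℤ) : ℚ) * coords x i ∈ ZInv p := fun i => by
    obtain ⟨z, hz, h⟩ := h1 i
    rw [h]
    simpa using (ZInv p).mul_mem (intCast_mem_zInv n) hz
  have hx' : ∀ i, ((1 : ℤ) : ℚ) * coords (star x) i ∈ ZInv p := fun i => by
    obtain ⟨z, hz, h⟩ := coords_star_mem h1 i
    rw [h]
    simpa using (ZInv p).mul_mem (intCast_mem_zInv n) hz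
  refine ⟨coords_mul_mem hx hx' 0, ?_, ?_⟩
  · refine le_trans ?_ (le_max_right _ _)
    exact_mod_cast h2
  · refine le_trans ?_ (le_max_left _ _)
    rwa [nrd_baseChange] at h3

theorem finite_orbits (hinf : IsDivision a b ℝ) (hR : IsEichlerOrder R M) (hM : M ≠ 0) {N : ℤ}
    (hN : N ≠ 0) {D : ℚ} {T : ℝ} (hT : 0 < T) :
    ((Quotient.mk (MulAction.orbitRel (GammaBar R ℚ) (Vec ℚ))) '' {v : Vec ℚ |
      quadForm a b v = D ∧ (∀ i, (N : ℚ) * v i ∈ ZInv p) ∧ T⁻¹ ≤ ‖ψ (toQuat a b (toQp p v)) 1 0‖ ∧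
        ‖ψ (toQuat a b (toQp p v)) 1 0‖ ≤ T}).Finite := by
  obtain ⟨n, hn, hRn⟩ := hR.exists_mem hM
  obtain ⟨C, hC, C', hx⟩ := exists_small_quat ψ (n := n) hn
  set S : Set (Vec ℚ) := {v : Vec ℚ |
      quadForm a b v = D ∧ (∀ i, (N : ℚ) * v i ∈ ZInv p) ∧ T⁻¹ ≤ ‖ψ (toQuat a b (toQp p v)) 1 0‖ ∧
        ‖ψ (toQuat a b (toQp p v)) 1 0‖ ≤ T} with hS
  choose x hx0 hxn hxC' hxC using fun v : Vec ℚ =>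
    hx (ψ (toQuat a b (toQp p v)) 0 0 / ψ (toQuat a b (toQp p v)) 1 0)
  choose z hz hxz using hxn
  have hdet : ∀ v, ‖nrd (baseChange ℚ_[p] (x v))‖ ≤ C ^ 2 := fun v => by
    rw [← det_split ψ, Matrix.det_fin_two]
    have h0 := hxC v 0
    have h1 := hxC v 1
    generalize ψ (toQuat a b (toQp p v)) 0 0 / ψ (toQuat a b (toQp p v)) 1 0 = c at h0 h1
    rw [show ∀ k q r s : ℚ_[p], k * s - q * r = k * (s + c * r) - (q + c * k) * r by intros; ring]
    refine (norm_sub_le_max' _ _).trans (max_le ?_ ?_)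
    · rw [norm_mul, sq]; gcongr; exacts [h0.1, h1.2]
    · rw [norm_mul, sq]; gcongr; exacts [h0.2, h1.1]
  have hfin1 := finite_small_nrd p (a := a) (b := b) (n := n) (C := C ^ 2) (C' := C') (by positivity)
  obtain ⟨K, hK, hKm⟩ := exists_multiple ({q : ℚ | ∃ x : Quat a b ℚ, (∀ i, ∃ z ∈ ZInv p,
    coords x i = n * z) ∧ |nrd x| ≤ C' ∧
      ‖(nrd (baseChange ℚ_[p] x))‖ ≤ C ^ 2 ∧ nrd x = q} \ {0}) (hfin1.subset Set.sdiff_subset)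
    (fun q hq => hq.2)
  obtain ⟨m, hm, f, hf⟩ := exists_zInv_class (p := p) K hK
  have : NeZero m := ⟨hm⟩
  obtain ⟨C₁, hC₁, hb⟩ := exists_coords_bound ψ
  have hmem : ∀ v, nrd (x v) ∈ {q : ℚ | ∃ x : Quat a b ℚ, (∀ i, ∃ z ∈ ZInv p,
    coords x i = n * z) ∧ |nrd x| ≤ C' ∧
      ‖(nrd (baseChange ℚ_[p] x))‖ ≤ C ^ 2 ∧ nrd x = q} := fun v =>
    ⟨x v, fun i => ⟨z v i, hz v i, hxz v i⟩, hxC' v, hdet v, rfl⟩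
  have hnz : ∀ v, nrd (x v) ≠ 0 := fun v => nrd_ne_zero hinf (hx0 v)
  set W := {y : Quat a b ℚ | nrd y ≤ C' ^ 2 * |D| ∧ ∀ i,
    (((1 * N * (a.den * b.den)) * 1 * (a.den * b.den) : ℤ) : ℚ) * coords y i ∈ ZInv p ∧
      ‖((coords y i : ℚ) : ℚ_[p])‖ ≤ C₁ * (C ^ 2 * max T (‖(D : ℚ_[p])‖ * T))} with hW
  have hfin2 : W.Finite := finite_bounded_quat hinf _ (by simpa using hN) _ _
  set F : Vec ℚ → (ℚ × (Fin 4 → ZMod m)) × Quat a b ℚ := fun v =>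
    ((nrd (x v), fun i => f ⟨z v i, hz v i⟩), x v * toQuat a b v * star (x v)) with hF
  have hFW : ∀ v ∈ S, x v * toQuat a b v * star (x v) ∈ W := by
    rintro v ⟨h1, h2, h3, h4⟩
    have hx1 : ∀ i, ((1 : ℤ) : ℚ) * coords (x v) i ∈ ZInv p := fun i => by
      rw [hxz]
      simpa using (ZInv p).mul_mem (intCast_mem_zInv n) (hz v i)
    have hx2 : ∀ i, ((1 : ℤ) : ℚ) * coords (star (x v)) i ∈ ZInv p := fun i => by
      obtain ⟨y, hy, h⟩ := coords_star_mem (fun i => ⟨z v i, hz v i, hxz v i⟩) i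
      rw [h]
      simpa using (ZInv p).mul_mem (intCast_mem_zInv n) hy
    have hv : ∀ i, (N : ℚ) * coords (toQuat a b v) i ∈ ZInv p := fun i => by
      fin_cases i
      · change (N : ℚ) * 0 ∈ _
        rw [mul_zero]; exact (ZInv p).zero_mem
      exacts [h2 0, h2 1, h2 2]
    refine ⟨?_, fun i => ⟨coords_mul_mem (coords_mul_mem hx1 hv) hx2 i, ?_⟩⟩
    · rw [nrd_mul, nrd_mul, nrd_star]
      change nrd (x v) * quadForm a b v * nrd (x v) ≤ _
      rw [h1]
      calc nrd (x v) * D * nrd (x v) ≤ |nrd (x v) * D * nrd (x v)| := le_abs_self _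
        _ = |nrd (x v)| ^ 2 * |D| := by rw [abs_mul, abs_mul]; ring
        _ ≤ _ := by
          have := hxC' v
          gcongr
    · rw [← coords_baseChange]
      refine hb _ _ (fun j k => ?_) i
      have hstar : baseChange ℚ_[p] (star (x v)) = star (baseChange ℚ_[p] (x v)) := by
        ext <;> simp [baseChange]
      rw [map_mul, map_mul, map_mul, map_mul, hstar, split_star ψ _ (by
        rw [nrd_baseChange]; exact_mod_cast hnz v), baseChange_toQuat]
      have h5 : 0 < ‖ψ (toQuat a b (toQp p v)) 1 0‖ := (inv_pos.2 hT).trans_le h3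
      refine norm_conj_le (split_toQuat_trace ψ _) (norm_pos_iff.1 h5) (h4.trans (le_max_left _ _))
        ?_ (hxC v) j k
      rw [det_split, ← baseChange_toQuat, nrd_baseChange]
      change ‖((quadForm a b v : ℚ) : ℚ_[p])‖ ≤ _
      rw [h1, baseChange_toQuat]
      calc ‖(D : ℚ_[p])‖ = ‖(D : ℚ_[p])‖ * T * T⁻¹ := by field_simp
        _ ≤ _ := by
          refine mul_le_mul (le_max_right _ _) h3 (inv_nonneg.2 hT.le) ?_
          exact hT.le.trans (le_max_left _ _)
  have hfin3 : (F '' S).Finite := by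
    refine ((hfin1.prod (Set.finite_univ (α := Fin 4 → ZMod m))).prod hfin2).subset ?_
    rintro _ ⟨v, hv, rfl⟩
    exact ⟨⟨hmem v, trivial⟩, hFW v hv⟩
  have horb : ∀ v ∈ S, ∀ v' ∈ S, F v = F v' →
      (Quotient.mk (MulAction.orbitRel (GammaBar R ℚ) (Vec ℚ)) v) = Quotient.mk _ v' := by
    intro v _ v' _ hvv
    have e1 : nrd (x v) = nrd (x v') := congrArg (fun y => y.1.1) hvv
    have e2 : x v * toQuat a b v * star (x v) = x v' * toQuat a b v' * star (x v') :=
      congrArg (fun y => y.2) hvv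
    have e3 : ∀ i, f ⟨z v i, hz v i⟩ = f ⟨z v' i, hz v' i⟩ := fun i =>
      congrFun (congrArg (fun y => y.1.2) hvv) i
    obtain ⟨g, hg, hgv⟩ := exists_normOne_smul hRn (fun i => ⟨z v i, hz v i, hxz v i⟩)
      (fun i => ⟨z v' i, hz v' i, hxz v' i⟩) (hnz v) e1 (fun i => by
        obtain ⟨y, hy, h⟩ := hf _ _ (e3 i)
        obtain ⟨l, hl⟩ := hKm (nrd (x v)) ⟨hmem v, hnz v⟩
        refine ⟨l * y, (ZInv p).mul_mem (intCast_mem_zInv l) hy, ?_⟩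
        simp only at h
        rw [hxz, hxz, ← mul_sub, h, ← hl]
        ring) e2
    refine (Quotient.sound ?_ : _ = _).symm
    exact ⟨⟨conjRat ℚ g, Subgroup.mem_map_of_mem _ hg⟩, hgv⟩
  classical
  have : Finite (F '' S) := hfin3
  refine (Set.finite_range (fun y : F '' S => Quotient.mk (MulAction.orbitRel (GammaBar R ℚ) (Vec ℚ))
    (Classical.choose y.2))).subset ?_
  rintro _ ⟨v, hv, rfl⟩
  refine ⟨⟨F v, v, hv, rfl⟩, ?_⟩
  have h1 := Classical.choose_spec (⟨v, hv, rfl⟩ : F v ∈ F '' S)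
  exact horb _ h1.1 _ hv h1.2

end FiniteOrbits

/-! ### Theta values as products over labels -/

section ThetaValue

variable {a b : ℚ} {p : ℕ} [Fact p.Prime] {wp e wm : Vec ℚ_[p]}
  {R : Subalgebra (ZInv p) (Quat a b ℚ)} {M : ℕ}

local notation "ι" => algebraMap ℚ_[p] ℂ_[p]

variable (R) in
/-- The total multiplicity of the point with parameter `ζ` in the translates of a divisor. -/
def transMult (h : IsFrame a b wp e wm) (𝒟 : Pt p →₀ ℤ) (ζ : ℂ_[p]) : ℤ :=
  orbitMult (fun (α : GammaBar R ℂ_[p]) z => zcoord h (α • z)) 𝒟 ζ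

theorem zcoord_hyperbolic (h : IsFrame a b wp e wm) {γ : (Quat a b ℚ)ˣ} (hγ : γ ∈ normOne R)
    {ϖ : ℚ_[p]} (hϖ : ϖ ≠ 0)
    (h1 : conjRat ℚ_[p] γ • wp = ϖ • wp) (h2 : conjRat ℚ_[p] γ • e = e)
    (h3 : conjRat ℚ_[p] γ • wm = ϖ⁻¹ • wm) {z : Pt p} (hz : z ∈ halfPlane a b p) :
    zcoord h ((⟨conjRat ℂ_[p] γ, Subgroup.mem_map_of_mem _ hγ⟩ : GammaBar R ℂ_[p]) • z) =
      ι ϖ * zcoord h z := by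
  change zcoord h (conjRat ℂ_[p] γ • z) = _
  conv_lhs => rw [← (pt_zcoord h hz).1, hyperbolic_smul_pt h hϖ h1 h2 h3, zcoord_pt]

theorem transMult_hyperbolic (h : IsFrame a b wp e wm) {γ : (Quat a b ℚ)ˣ} (hγ : γ ∈ normOne R)
    {ϖ : ℚ_[p]} (hϖ : ϖ ≠ 0)
    (h1 : conjRat ℚ_[p] γ • wp = ϖ • wp) (h2 : conjRat ℚ_[p] γ • e = e)
    (h3 : conjRat ℚ_[p] γ • wm = ϖ⁻¹ • wm) {𝒟 : Pt p →₀ ℤ}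
    (h𝒟 : ∀ z ∈ 𝒟.support, z ∈ halfPlane a b p) (ζ : ℂ_[p]) :
    transMult R h 𝒟 (ι ϖ * ζ) = transMult R h 𝒟 ζ := by
  classical
  set g : GammaBar R ℂ_[p] := ⟨conjRat ℂ_[p] γ, Subgroup.mem_map_of_mem _ hγ⟩ with hg
  rw [transMult, transMult, orbitMult, orbitMult, ← finsum_comp_equiv (Equiv.mulLeft g)]
  refine finsum_congr fun α => Finset.sum_congr (Finset.filter_congr fun z hz => ?_) fun _ _ => rfl
  rw [Equiv.coe_mulLeft, mul_smul, hg,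
    zcoord_hyperbolic h hγ hϖ h1 h2 h3 (gammaBar_smul_mem α (h𝒟 z hz))]
  exact mul_right_inj' ((map_ne_zero _).2 hϖ)

theorem thetaValue_hasProd
    (σ : Quat a b ℚ_[p] ≃ₐ[ℚ_[p]] Matrix (Fin 2) (Fin 2) ℚ_[p]) (hp2 : p ≠ 2)
    (hinf : IsDivision a b ℝ) (hR : IsEichlerOrder R M)
    {par : Submodule ℤ_[p] (Vec ℚ_[p]) → Prop} (hpar : IsParity a b par)
    {γ : (Quat a b ℚ)ˣ} (hγ : γ ∈ normOne R) {ϖ : ℚ_[p]} {t : ℕ}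
    {L₀ : Submodule ℤ_[p] (Vec ℚ_[p])} (hf : IsHyperbolicFrame par γ ϖ t L₀ wp e wm)
    (h : IsFrame a b wp e wm) {s : ℤ} {𝒟 : Pt p →₀ ℤ} (h𝒟 : IsStrongZero a b par s 𝒟)
    {η : Pt p} (hη : IsBasePoint R 𝒟 η) :
    Multipliable (thetaFactor R σ 𝒟 η γ) ∧
    HasProd (fun P : FundLabel p t => ∏ᶠ ζ ∈ part (F := ℂ_[p]) p s P.1, ζ ^ (-transMult R h 𝒟 ζ))
      (thetaValue R σ 𝒟 η γ) ∧
    ∀ P, ∃ Z : Finset ℂ_[p], (∀ ζ ∈ Z, ζ ∈ part p s P) ∧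
      (∀ ζ ∈ part p s P, ζ ∉ Z → transMult R h 𝒟 ζ = 0) ∧ ∑ ζ ∈ Z, transMult R h 𝒟 ζ = 0 := by
  classical
  have hu := hf.isUnitFrame hp2
  obtain ⟨h1, h2, h3⟩ := hf.smul_eq
  have h0 : par (Submodule.span ℤ_[p] {wp, e, wm}) := by rw [← hf.lattice_eq]; exact hf.even
  have hϖ := ne_zero_of_norm hf.norm_eq
  set act := fun (α : GammaBar R ℂ_[p]) z => zcoord h (α • z) with hact
  have hirr : ∀ α, ∀ y ∈ 𝒟.support, Irrat p (act α y) := fun α y hy =>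
    (pt_zcoord h (gammaBar_smul_mem α (h𝒟.1 y hy))).2
  have hfin : ∀ C : ℝ, {α | ∃ y ∈ 𝒟.support, Bdd p C (act α y)}.Finite := fun C => by
    have : {α | ∃ y ∈ 𝒟.support, Bdd p C (act α y)} =
        ⋃ y ∈ (𝒟.support : Set (Pt p)), {α : GammaBar R ℂ_[p] | Bdd p C (zcoord h (α • y))} := by
      ext α; simp [hact]
    rw [this]
    exact 𝒟.support.finite_toSet.biUnion fun y hy => finite_bdd_smul σ hinf hR h (h𝒟.1 y hy) C
  have hdeg : ∀ α P, ∑ y ∈ 𝒟.support with lab p s (act α y) = P, 𝒟 y = 0 := fun α P =>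
    h𝒟.sum_lab_smul_eq_zero σ hp2 hu hpar h0 α P
  obtain ⟨hη1, hη2⟩ := pt_zcoord h hη.1
  have hηne : ∀ α, ∀ y ∈ 𝒟.support, act α y ≠ zcoord h η := fun α y hy he => by
    apply hη.2 α y hy
    rw [← hη1, ← he, (pt_zcoord h (gammaBar_smul_mem α (h𝒟.1 y hy))).1]
  set g : GammaBar R ℂ_[p] := ⟨conjRat ℂ_[p] γ, Subgroup.mem_map_of_mem _ hγ⟩ with hg
  have hηne' : ∀ α, ∀ y ∈ 𝒟.support, act α y ≠ ι ϖ * zcoord h η := fun α y hy he => by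
    apply hηne (g⁻¹ * α) y hy
    apply mul_left_cancel₀ ((map_ne_zero ι).2 hϖ)
    rw [← he, hact]
    simp only
    rw [← zcoord_hyperbolic h hγ hϖ h1 h2 h3 (gammaBar_smul_mem _ (h𝒟.1 y hy)), ← hg, ← mul_smul,
      mul_inv_cancel_left]
  obtain ⟨J, hJ1, hJ2⟩ := exists_hasProd_theta hirr hfin s hdeg hη2
    (irrat_mul hη2 hϖ) fun α y hy => ⟨hηne α y hy, hηne' α y hy⟩
  have hne1 : ι ϖ * zcoord h η ≠ zcoord h η := by
    intro he
    have e1 : ι ϖ = 1 := mul_right_cancel₀ hη2.ne_zero (by rw [he, one_mul])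
    have e2 := hf.norm_eq
    rw [← map_one ι] at e1
    rw [(algebraMap ℚ_[p] ℂ_[p]).injective e1, norm_one] at e2
    exact (one_lt_pow₀ (one_lt_p (p := p)) (by have := hf.t_pos; omega)).ne e2
  have hγη : conjRat ℂ_[p] γ • η = pt h (ι ϖ * zcoord h η) := by
    conv_lhs => rw [← hη1]
    exact hyperbolic_smul_pt h hϖ h1 h2 h3 _
  have hfac : thetaFactor R σ 𝒟 η γ = fun α => ∏ y ∈ 𝒟.support,
      twoPoint (zcoord h η) (ι ϖ * zcoord h η) (act α y) ^ 𝒟 y := by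
    funext α
    exact thetaFactor_eq σ h h𝒟.1 (h𝒟.sum_eq_zero hp2 hu hpar h0) hη hγη hne1 α
      fun z hz => hηne' α z hz
  have hZ : ∀ P, ∃ Z : Finset ℂ_[p], (∀ ζ ∈ Z, ζ ∈ part p s P) ∧
      (∀ ζ ∈ part p s P, ζ ∉ Z → transMult R h 𝒟 ζ = 0) ∧ ∑ ζ ∈ Z, transMult R h 𝒟 ζ = 0 := by
    intro P
    obtain ⟨A, Z, -, h4, -, h5, h6, -⟩ := exists_orbitMult_part hirr hfin s hdeg P
    exact ⟨Z, h4, h5, h6⟩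
  have hn := transMult_hyperbolic h hγ hϖ h1 h2 h3 h𝒟.1
  have hη0 : transMult R h 𝒟 (zcoord h η) = 0 := by
    rw [transMult, orbitMult]
    refine finsum_eq_zero_of_forall_eq_zero fun α => Finset.sum_eq_zero fun y hy => ?_
    obtain ⟨hy1, hy2⟩ := Finset.mem_filter.1 hy
    exact (hηne α y hy1 hy2).elim
  have hηk : ∀ k : ℤ, transMult R h 𝒟 (ι (ϖ ^ k) * zcoord h η) = 0 := by
    intro k
    induction k with
    | zero => simpa using hη0
    | succ k ih => rw [add_comm, zpow_add₀ hϖ, map_mul, mul_assoc, zpow_one, hn, ih]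
    | pred k ih =>
      rw [← hn, ← mul_assoc, ← map_mul, mul_comm ϖ, ← zpow_add_one₀ hϖ, sub_add_cancel, ih]
  have hJ3 := hasProd_fundLabel hf.norm_eq hf.t_pos hη2 s (transMult R h 𝒟) hn hηk hZ hJ2
  rw [← hfac] at hJ1
  refine ⟨hJ1.multipliable, ?_, hZ⟩
  rw [thetaValue, hJ1.tprod_eq]
  exact hJ3

end ThetaValue

/-! ### Vectors of fixed length -/

section Lengths

variable {a b : ℚ} {p : ℕ} [Fact p.Prime] {wp e wm : Vec ℚ_[p]}
  {R : Subalgebra (ZInv p) (Quat a b ℚ)} {M : ℕ}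

local notation "ι" => algebraMap ℚ_[p] ℂ_[p]

/-- A splitting for which the coordinate `coordM` becomes the lower left entry. -/
theorem exists_lower_left (σ : Quat a b ℚ_[p] ≃ₐ[ℚ_[p]] Matrix (Fin 2) (Fin 2) ℚ_[p])
    (h : IsFrame a b wp e wm) (hwp : wp ≠ 0) :
    ∃ (ψ : Quat a b ℚ_[p] ≃ₐ[ℚ_[p]] Matrix (Fin 2) (Fin 2) ℚ_[p]) (c : ℚ_[p]), c ≠ 0 ∧
      ∀ v, ψ (toQuat a b v) 1 0 = coordM a b wp e wm v * c := by
  obtain ⟨ψ, hψ⟩ : ∃ ψ : Quat a b ℚ_[p] ≃ₐ[ℚ_[p]] Matrix (Fin 2) (Fin 2) ℚ_[p],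
      ψ (toQuat a b wp) = !![0, 1; 0, 0] := by
    set N := σ (toQuat a b wp) with hN
    have hNN : N * N = 0 := by rw [hN, ← map_mul, toQuat_mul_self, h.quad_wp]; simp
    have hN0 : N ≠ 0 := by
      rw [hN, Ne, map_eq_zero_iff _ σ.injective]
      intro h0
      apply hwp
      rw [← imag_toQuat (a := a) (b := b) wp, h0]
      funext i; fin_cases i <;> simp [imag]
    have htr := split_toQuat_trace σ wp
    rw [← hN] at htr
    have e00 := congrFun (congrFun hNN 0) 0
    rw [Matrix.mul_apply, Fin.sum_univ_two, Matrix.zero_apply] at e00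
    have key : ∀ A : Fin 2 → ℚ_[p], A 0 * N.mulVec A 1 - A 1 * N.mulVec A 0 ≠ 0 →
        ∃ ψ : Quat a b ℚ_[p] ≃ₐ[ℚ_[p]] Matrix (Fin 2) (Fin 2) ℚ_[p],
          ψ (toQuat a b wp) = !![0, 1; 0, 0] := by
      intro A hA
      obtain ⟨ψ, hψ⟩ := exists_actEquiv σ (A := A) (B := N.mulVec A) hA
      refine ⟨ψ, ?_⟩
      rw [hψ, actMat, ← hN]
      set P : Matrix (Fin 2) (Fin 2) ℚ_[p] := !![N.mulVec A 0, A 0; N.mulVec A 1, A 1] with hP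
      have hdet : IsUnit P.det := by
        rw [hP, Matrix.det_fin_two_of, isUnit_iff_ne_zero]
        intro h0; apply hA; linear_combination -h0
      have hNP : N * P = P * !![0, 1; 0, 0] := by
        rw [hP]
        ext i j
        fin_cases i <;> fin_cases j <;>
          simp [Matrix.mul_apply, Fin.sum_univ_two, Matrix.mulVec, dotProduct, htr] <;>
          first
            | linear_combination A 0 * e00
            | linear_combination A 1 * e00
      rw [mul_assoc, hNP, Matrix.nonsing_inv_mul_cancel_left _ _ hdet]
    by_cases hz : N 1 0 = 0
    · have h00 : N 0 0 = 0 := by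
        rw [hz, mul_zero, add_zero] at e00
        exact mul_self_eq_zero.1 e00
      refine key ![0, 1] ?_
      intro h0
      apply hN0
      simp [Matrix.mulVec, dotProduct, Fin.sum_univ_two] at h0
      ext i j
      fin_cases i <;> fin_cases j <;> simp [hz, h00, htr, h0]
    · refine key ![1, 0] ?_
      simpa [Matrix.mulVec, dotProduct, Fin.sum_univ_two] using hz
  have he : ψ (toQuat a b e) 1 0 = 0 := by
    have h1 : ψ (toQuat a b wp) * ψ (toQuat a b e) + ψ (toQuat a b e) * ψ (toQuat a b wp) = 0 := by
      rw [← map_mul, ← map_mul, ← map_add, toQuat_anticomm, h.pair_wp_e]; simp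
    rw [hψ] at h1
    have := congrFun (congrFun h1 0) 0
    rw [Matrix.add_apply, Matrix.mul_apply, Matrix.mul_apply, Fin.sum_univ_two,
      Fin.sum_univ_two] at this
    simpa using this
  have hv : ∀ v, ψ (toQuat a b v) 1 0 = coordM a b wp e wm v * ψ (toQuat a b wm) 1 0 := by
    intro v
    conv_lhs => rw [h.decomp v]
    simp only [toQuat_add, toQuat_smul, map_add, map_smul, Matrix.add_apply, Matrix.smul_apply, hψ,
      he, smul_eq_mul]
    simp
  refine ⟨ψ, _, ?_, hv⟩
  intro h0
  have h1 : ∀ q, ψ q 1 0 = 0 := by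
    intro q
    have h2 : q = algebraMap ℚ_[p] _ q.re + toQuat a b (imag q) := by
      ext <;> simp [toQuat, imag]
    rw [h2, map_add, AlgEquiv.commutes, Matrix.add_apply, hv, h0]
    simp [Matrix.algebraMap_matrix_apply]
  have h2 := h1 (ψ.symm !![0, 0; 1, 0])
  rw [AlgEquiv.apply_symm_apply] at h2
  simp at h2

theorem ratVal_smul {Φ : Vec (AdeleAway p) → ℤ}
    (hΦ : ∀ u : (Quat a b (AdeleAway p))ˣ, (u : Quat a b (AdeleAway p)) ∈ orderHat R →
      ((u⁻¹ : (Quat a b (AdeleAway p))ˣ) : Quat a b (AdeleAway p)) ∈ orderHat R →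
      ∀ v, Φ (conj u • v) = Φ v) {g : (Quat a b ℚ)ˣ} (hg : g ∈ normOne R) (v : Vec ℚ) :
    ratVal Φ (conjRat ℚ g • v) = ratVal Φ v := by
  refine (congrArg Φ (conjRat_map (algebraMap ℚ (AdeleAway p)) g v).symm).trans
    (hΦ (Units.map (baseChange (a := a) (b := b) (AdeleAway p) :
      Quat a b ℚ →* Quat a b (AdeleAway p)) g) (Submodule.subset_span ⟨_, hg.1, rfl⟩)
      (Submodule.subset_span ⟨_, hg.2.1, rfl⟩) _)

theorem ratVal_smul_p {Φ : Vec (AdeleAway p) → ℤ}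
    (hΦ : ∀ v : Vec ℚ, ratVal Φ ((p : ℚ) • v) = ratVal Φ v) (n : ℕ) (v : Vec ℚ) :
    ratVal Φ ((p : ℚ) ^ n • v) = ratVal Φ v := by
  induction n with
  | zero => simp
  | succ n ih => rw [pow_succ', mul_smul, hΦ, ih]

theorem toQuat_injective {K : Type*} [CommRing K] [Algebra ℚ K] :
    Function.Injective (toQuat a b : Vec K → Quat a b K) := fun u w h => by
  rw [← imag_toQuat (a := a) (b := b) u, h, imag_toQuat]

theorem norm_toQp_le (h : IsFrame a b wp e wm) : ∃ C : ℝ, 0 ≤ C ∧ ∀ (v : Vec ℚ_[p]) (T : ℝ),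
    ‖coordP a b wp e wm v‖ ≤ T → ‖coordE a b wp e wm v‖ ≤ T → ‖coordM a b wp e wm v‖ ≤ T →
      ∀ i, ‖v i‖ ≤ C * T := by
  refine ⟨‖wp‖ + ‖e‖ + ‖wm‖, by positivity, fun v T h1 h2 h3 i => ?_⟩
  rw [h.decomp v]
  have e1 := norm_le_pi_norm wp i
  have e2 := norm_le_pi_norm e i
  have e3 := norm_le_pi_norm wm i
  have hT := (norm_nonneg _).trans h1
  simp only [Pi.add_apply, Pi.smul_apply, smul_eq_mul]
  calc _ ≤ ‖coordP a b wp e wm v * wp i‖ + ‖coordE a b wp e wm v * e i‖ +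
        ‖coordM a b wp e wm v * wm i‖ := norm_add₃_le
    _ ≤ T * ‖wp‖ + T * ‖e‖ + T * ‖wm‖ := by
      rw [norm_mul, norm_mul, norm_mul]
      gcongr
    _ = _ := by ring

/-- The vectors of fixed length in the support of a function with compact support and with bounded
`p`-adic coordinates. -/
theorem finite_length (hinf : IsDivision a b ℝ) (h : IsFrame a b wp e wm)
    {Φ : Vec (AdeleAway p) → ℤ} (hΦ : HasCompactSupport Φ) (D : ℚ) (T : ℝ) :
    {v : Vec ℚ | quadForm a b v = D ∧ ratVal Φ v ≠ 0 ∧ ‖coordP a b wp e wm (toQp p v)‖ ≤ T ∧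
      ‖coordE a b wp e wm (toQp p v)‖ ≤ T ∧ ‖coordM a b wp e wm (toQp p v)‖ ≤ T}.Finite := by
  obtain ⟨N, hN, hden⟩ := exists_denom_of_compactSupport hΦ
  obtain ⟨C, hC, hb⟩ := norm_toQp_le h
  refine ((finite_bounded_quat (p := p) hinf N hN D (max 0 (C * T))).preimage
    (f := toQuat a b) toQuat_injective.injOn).subset ?_
  rintro v ⟨h1, h2, h3, h4, h5⟩
  refine ⟨h1.le, fun i => ?_⟩
  have hv := hb (toQp p v) T h3 h4 h5
  have hv' : ∀ j, ‖((v j : ℚ) : ℚ_[p])‖ ≤ C * T := fun j => hv j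
  fin_cases i
  · change (N : ℚ) * 0 ∈ _ ∧ ‖((0 : ℚ) : ℚ_[p])‖ ≤ _
    simp [(ZInv p).zero_mem]
  · exact ⟨hden v h2 0, (hv' 0).trans (le_max_right _ _)⟩
  · exact ⟨hden v h2 1, (hv' 1).trans (le_max_right _ _)⟩
  · exact ⟨hden v h2 2, (hv' 2).trans (le_max_right _ _)⟩

theorem coord_hyperbolic (h : IsFrame a b wp e wm) {γ : (Quat a b ℚ)ˣ}
    {ϖ : ℚ_[p]} (hϖ : ϖ ≠ 0)
    (h1 : conjRat ℚ_[p] γ • wp = ϖ • wp) (h2 : conjRat ℚ_[p] γ • e = e)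
    (h3 : conjRat ℚ_[p] γ • wm = ϖ⁻¹ • wm) (v : Vec ℚ) :
    coordP a b wp e wm (toQp p (conjRat ℚ γ • v)) = ϖ * coordP a b wp e wm (toQp p v) ∧
    coordE a b wp e wm (toQp p (conjRat ℚ γ • v)) = coordE a b wp e wm (toQp p v) ∧
    coordM a b wp e wm (toQp p (conjRat ℚ γ • v)) = ϖ⁻¹ * coordM a b wp e wm (toQp p v) := by
  have key : toQp p (conjRat ℚ γ • v) = (ϖ * coordP a b wp e wm (toQp p v)) • wp +
      coordE a b wp e wm (toQp p v) • e + (ϖ⁻¹ * coordM a b wp e wm (toQp p v)) • wm := by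
    rw [← conjRat_toQp]
    conv_lhs => rw [h.decomp (toQp p v)]
    rw [glSmul_add, glSmul_add, glSmul_smul, glSmul_smul, glSmul_smul, h1, h2, h3, smul_smul,
      smul_smul, mul_comm _ ϖ, mul_comm _ ϖ⁻¹]
  rw [key]
  exact ⟨h.coordP_comb _ _ _, h.coordE_comb _ _ _, h.coordM_comb _ _ _⟩

end Lengths

/-! ### Points orthogonal to a vector -/

section Orthogonal

variable {a b : ℚ} {p : ℕ} [Fact p.Prime] {wp e wm : Vec ℚ_[p]}
  {R : Subalgebra (ZInv p) (Quat a b ℚ)} {M : ℕ}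

local notation "ι" => algebraMap ℚ_[p] ℂ_[p]

variable (a b) in
/-- The point `z` is orthogonal to `v`. -/
def Orth (z : Pt p) (v : Vec ℚ) : Prop :=
  ∀ x ∈ z.submodule, pairing a b x (toCp p (toQp p v)) = 0

theorem orth_smul (g : (Quat a b ℚ)ˣ) (z : Pt p) (v : Vec ℚ) :
    Orth a b (conjRat ℂ_[p] g • z) (conjRat ℚ g • v) ↔ Orth a b z v := by
  have key : ∀ (g : (Quat a b ℚ)ˣ) (z : Pt p) (v : Vec ℚ), Orth a b z v →
      Orth a b (conjRat ℂ_[p] g • z) (conjRat ℚ g • v) := by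
    intro g z v h x hx
    have h1 := h _ (inv_smul_mem_of_mem_smul g z x hx)
    rw [← conjRat_toQp, ← conjRat_toCp]
    have h2 := pairing_conj (Units.map (baseChange (a := a) (b := b) ℂ_[p]).toMonoidHom g)
      ((conjRat ℂ_[p] g⁻¹ • x : Vec ℂ_[p])) (toCp p (toQp p v))
    rw [h1] at h2
    rw [← h2]
    congr 1
    change x = conjRat ℂ_[p] g • (conjRat ℂ_[p] g⁻¹ • x)
    rw [smul_smul, ← map_mul, mul_inv_cancel, map_one, one_smul]
  refine ⟨fun h => ?_, key g z v⟩
  have := key g⁻¹ _ _ h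
  rwa [smul_smul, smul_smul, ← map_mul, ← map_mul, inv_mul_cancel, map_one, map_one, one_smul,
    one_smul] at this

theorem orth_iff_pairing (h : IsFrame a b wp e wm) (ζ : ℂ_[p]) (v : Vec ℚ) :
    Orth a b (pt h ζ) v ↔ ι (pairing a b wp wm) * ι (coordP a b wp e wm (toQp p v)) +
      2 * ι (quadForm a b e) * ι (coordE a b wp e wm (toQp p v)) * ζ -
        ι (quadForm a b e) * ι (coordM a b wp e wm (toQp p v)) * ζ ^ 2 = 0 := by
  have h1 := h.toCp.pairing_ptVec ζ (toCp p (toQp p v))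
  rw [pairing_toCp, coordP_toCp, quadForm_toCp, coordE_toCp, coordM_toCp] at h1
  rw [← h1, Orth]
  constructor
  · intro h2
    exact h2 _ ((mem_pt h ζ _).2 ⟨1, one_smul _ _⟩)
  · intro h2 x hx
    obtain ⟨c, rfl⟩ := (mem_pt h ζ _).1 hx
    rw [pairing_smul_left, h2, mul_zero]

theorem quadForm_toQp (v : Vec ℚ) : quadForm a b (toQp p v) = ((quadForm a b v : ℚ) : ℚ_[p]) := by
  rw [quadForm, ← baseChange_toQuat, nrd_baseChange]
  rfl

/-- The rational number `D` is not of the form `Q(e) q ^ 2` over `ℚ_p`. -/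
def NotLength (a b : ℚ) (p : ℕ) [Fact p.Prime] (e : Vec ℚ_[p]) (D : ℚ) : Prop :=
  ∀ q : ℚ_[p], quadForm a b e * q ^ 2 ≠ D

theorem coordM_ne_zero (h : IsFrame a b wp e wm) {D : ℚ} (hD : NotLength a b p e D) {v : Vec ℚ}
    (hv : quadForm a b v = D) : coordM a b wp e wm (toQp p v) ≠ 0 := by
  intro h0
  have h1 := h.quadForm_eq_coord (toQp p v)
  rw [h0, quadForm_toQp, hv] at h1
  apply hD (coordE a b wp e wm (toQp p v))
  rw [h1]; ring

/-- The points orthogonal to a vector of length `D = Q(e) θ ^ 2`. -/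
theorem orth_iff (h : IsFrame a b wp e wm) {D : ℚ} (hD : NotLength a b p e D) {θ : ℂ_[p]}
    (hθ : ι (quadForm a b e) * θ ^ 2 = ι (D : ℚ_[p])) {v : Vec ℚ} (hv : quadForm a b v = D)
    (ζ : ℂ_[p]) : Orth a b (pt h ζ) v ↔
      ζ = (ι (coordE a b wp e wm (toQp p v)) + θ) / ι (coordM a b wp e wm (toQp p v)) ∨
      ζ = (ι (coordE a b wp e wm (toQp p v)) - θ) / ι (coordM a b wp e wm (toQp p v)) := by
  have hM : ι (coordM a b wp e wm (toQp p v)) ≠ 0 := (map_ne_zero _).2 (coordM_ne_zero h hD hv)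
  have hε : ι (quadForm a b e) ≠ 0 := (map_ne_zero _).2 h.quad_e_ne
  have h1 := congrArg ι (h.quadForm_eq_coord (toQp p v))
  rw [quadForm_toQp, hv, ← hθ] at h1
  simp only [map_add, map_mul, map_pow] at h1
  rw [orth_iff_pairing, eq_div_iff hM, eq_div_iff hM]
  generalize ι (coordE a b wp e wm (toQp p v)) = E at *
  generalize ι (coordM a b wp e wm (toQp p v)) = m at *
  generalize ι (coordP a b wp e wm (toQp p v)) = P at *
  rw [← mul_right_inj' hM, mul_zero]
  have h2 : m * (ι (pairing a b wp wm) * P + 2 * ι (quadForm a b e) * E * ζ -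
      ι (quadForm a b e) * m * ζ ^ 2) =
      -ι (quadForm a b e) * ((ζ * m - (E + θ)) * (ζ * m - (E - θ))) := by
    linear_combination -h1
  rw [h2, mul_eq_zero, mul_eq_zero, sub_eq_zero, sub_eq_zero]
  simp [hε]

theorem irrat_theta {D : ℚ} (hD : NotLength a b p e D) {θ : ℂ_[p]}
    (hθ : ι (quadForm a b e) * θ ^ 2 = ι (D : ℚ_[p])) : Irrat p θ := by
  rintro q rfl
  apply hD q
  apply (algebraMap ℚ_[p] ℂ_[p]).injective
  rw [← hθ]; simp

theorem theta_neg {D : ℚ} {θ : ℂ_[p]} (hθ : ι (quadForm a b e) * θ ^ 2 = ι (D : ℚ_[p])) :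
    ι (quadForm a b e) * (-θ) ^ 2 = ι (D : ℚ_[p]) := by rw [neg_sq, hθ]

theorem irrat_root (h : IsFrame a b wp e wm) {D : ℚ} (hD : NotLength a b p e D) {θ : ℂ_[p]}
    (hθ : ι (quadForm a b e) * θ ^ 2 = ι (D : ℚ_[p])) {v : Vec ℚ} (hv : quadForm a b v = D) :
    Irrat p ((ι (coordE a b wp e wm (toQp p v)) + θ) / ι (coordM a b wp e wm (toQp p v))) := by
  have h1 := irrat_mul (irrat_add (irrat_theta hD hθ) (coordE a b wp e wm (toQp p v)))
    (inv_ne_zero (coordM_ne_zero h hD hv))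
  rwa [map_inv₀, add_comm, inv_mul_eq_div] at h1

variable (a b p) in
theorem exists_theta_of_discSet (h : IsFrame a b wp e wm) {D : ℤ} (hD : D ∈ discSet a b p) :
    NotLength a b p e D ∧ ∃ θ : ℂ_[p], ι (quadForm a b e) * θ ^ 2 = ι ((D : ℚ) : ℚ_[p]) := by
  obtain ⟨v, hv0, hv, hΔ⟩ := hD
  obtain ⟨z, hz, hzv⟩ : ∃ z : Pt p, z ∈ halfPlane a b p ∧ Orth a b z v := by
    by_contra hcon
    apply hΔ
    rw [pointDivisor]
    refine finsum_mem_eq_zero_of_forall_eq_zero fun z hz => ?_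
    exact (hcon ⟨z, hz⟩).elim
  obtain ⟨ζ, hζ, rfl⟩ := (mem_halfPlane_iff h z).1 hz
  have h1 := (h.quadForm_eq_coord (toQp p v)).symm
  rw [quadForm_toQp, hv] at h1
  have hεp := h.quad_e_ne
  have hε : ι (quadForm a b e) ≠ 0 := (map_ne_zero _).2 hεp
  rw [orth_iff_pairing] at hzv
  have hu := h.pair_ne
  have h3 := h.decomp (toQp p v)
  have h1' := congrArg ι h1
  simp only [map_add, map_mul, map_pow] at h1'
  have hθ : ι (quadForm a b e) * (ι (coordE a b wp e wm (toQp p v)) -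
      ι (coordM a b wp e wm (toQp p v)) * ζ) ^ 2 = ι ((D : ℚ) : ℚ_[p]) := by
    linear_combination h1' - ι (coordM a b wp e wm (toQp p v)) * hzv
  refine ⟨fun q hq => ?_, _, hθ⟩
  generalize hE : coordE a b wp e wm (toQp p v) = E at *
  generalize hm : coordM a b wp e wm (toQp p v) = m at *
  generalize hP : coordP a b wp e wm (toQp p v) = P at *
  rw [← hq, map_mul, map_pow] at hθ
  have h4 := mul_left_cancel₀ hε hθ
  by_cases hm0 : m = 0
  · rw [hm0] at hzv h1
    rw [map_zero] at hzv
    by_cases hE0 : E = 0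
    · rw [hE0] at hzv
      have : P = 0 := by
        have h5 : ι (pairing a b wp wm) * ι P = 0 := by linear_combination hzv - 2 * ι (quadForm a b e) * ζ * (map_zero ι)
        rw [← map_mul, map_eq_zero] at h5
        exact (mul_eq_zero.1 h5).resolve_left hu
      apply hv0
      rw [hE0, hm0, this, zero_smul, zero_smul, zero_smul, add_zero, add_zero] at h3
      funext i
      have h6 : ((v i : ℚ) : ℚ_[p]) = 0 := congrFun h3 i
      exact_mod_cast h6
    · apply hζ (-(pairing a b wp wm * P) / (2 * quadForm a b e * E))
      have h2 : (2 : ℂ_[p]) ≠ 0 := two_ne_zero_of_rat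
      have hE' : ι E ≠ 0 := (map_ne_zero _).2 hE0
      rw [map_div₀, map_neg, map_mul, map_mul, map_mul, map_ofNat, div_eq_iff (by
        exact mul_ne_zero (mul_ne_zero h2 hε) hE')]
      linear_combination -hzv
  · have hm' : ι m ≠ 0 := (map_ne_zero _).2 hm0
    have h5 : (ι E - ι m * ζ - ι q) * (ι E - ι m * ζ + ι q) = 0 := by linear_combination h4
    rcases mul_eq_zero.1 h5 with h6 | h6
    · apply hζ ((E - q) / m)
      rw [map_div₀, map_sub, div_eq_iff hm']
      linear_combination h6
    · apply hζ ((E + q) / m)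
      rw [map_div₀, map_add, div_eq_iff hm']
      linear_combination h6

/-- Finitely many vectors of fixed length in the support of `Φ` are orthogonal to a given point. -/
theorem finite_orth (hinf : IsDivision a b ℝ) (h : IsFrame a b wp e wm)
    {Φ : Vec (AdeleAway p) → ℤ} (hΦ : HasCompactSupport Φ) {D : ℚ} (hD : NotLength a b p e D)
    {θ : ℂ_[p]} (hθ : ι (quadForm a b e) * θ ^ 2 = ι (D : ℚ_[p])) {ζ : ℂ_[p]} (hζ : Irrat p ζ) :
    {v : Vec ℚ | quadForm a b v = D ∧ ratVal Φ v ≠ 0 ∧ Orth a b (pt h ζ) v}.Finite := by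
  set T1 := ‖θ‖ / rho p ζ with hT1
  set T2 := ‖θ‖ + T1 * ‖ζ‖ with hT2
  set T3 := (‖(2 * quadForm a b e : ℚ_[p])‖ * T2 * ‖ζ‖ + ‖quadForm a b e‖ * T1 * ‖ζ‖ ^ 2) /
    ‖pairing a b wp wm‖ with hT3
  have hr := rho_pos hζ
  have hu : 0 < ‖pairing a b wp wm‖ := norm_pos_iff.2 h.pair_ne
  refine (finite_length hinf h hΦ D (max T1 (max T2 T3))).subset ?_
  rintro v ⟨h1, h2, h3⟩
  have hM := coordM_ne_zero h hD h1
  have hM' : ι (coordM a b wp e wm (toQp p v)) ≠ 0 := (map_ne_zero _).2 hM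
  have h4 : ‖ζ * ι (coordM a b wp e wm (toQp p v)) - ι (coordE a b wp e wm (toQp p v))‖ = ‖θ‖ := by
    rcases (orth_iff h hD hθ h1 ζ).1 h3 with h5 | h5
    · rw [h5, div_mul_cancel₀ _ hM']; congr 1; ring
    · rw [h5, div_mul_cancel₀ _ hM', ← norm_neg]; congr 1; ring
  have hm : ‖coordM a b wp e wm (toQp p v)‖ ≤ T1 := by
    rw [hT1, le_div_iff₀ hr, ← h4]
    have h5 := rho_le ζ (coordE a b wp e wm (toQp p v) / coordM a b wp e wm (toQp p v))
    calc _ ≤ ‖coordM a b wp e wm (toQp p v)‖ * ‖ζ - ι (coordE a b wp e wm (toQp p v) /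
          coordM a b wp e wm (toQp p v))‖ := by gcongr
      _ = _ := by
        rw [← norm_iota (p := p), ← norm_mul]
        congr 1
        rw [map_div₀]
        field_simp
  have hE : ‖coordE a b wp e wm (toQp p v)‖ ≤ T2 := by
    rw [← norm_iota (p := p)]
    have h5 : ι (coordE a b wp e wm (toQp p v)) = ζ * ι (coordM a b wp e wm (toQp p v)) -
      (ζ * ι (coordM a b wp e wm (toQp p v)) - ι (coordE a b wp e wm (toQp p v))) := by ring
    rw [h5]
    refine (norm_sub_le _ _).trans ?_
    rw [h4, norm_mul, norm_iota, hT2, add_comm, mul_comm]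
    gcongr
  have hP : ‖coordP a b wp e wm (toQp p v)‖ ≤ T3 := by
    rw [hT3, le_div_iff₀ hu]
    rw [orth_iff_pairing] at h3
    have h5 : ι (coordP a b wp e wm (toQp p v)) * ι (pairing a b wp wm) =
        -ι (2 * quadForm a b e) * ι (coordE a b wp e wm (toQp p v)) * ζ +
        ι (quadForm a b e) * ι (coordM a b wp e wm (toQp p v)) * ζ ^ 2 := by
      rw [map_mul, map_ofNat]
      linear_combination h3
    rw [← norm_iota (p := p), ← norm_iota (p := p) (pairing a b wp wm), ← norm_mul, h5]
    refine (norm_add_le _ _).trans ?_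
    rw [norm_mul, norm_mul, norm_neg, norm_mul, norm_mul, norm_pow, norm_iota, norm_iota, norm_iota,
      norm_iota]
    gcongr
  exact ⟨h1, h2, hP.trans ((le_max_right _ _).trans (le_max_right _ _)),
    hE.trans ((le_max_left _ _).trans (le_max_right _ _)), hm.trans (le_max_left _ _)⟩

end Orthogonal

/-! ### Multiplicities in Heegner divisors -/

section Counting

open MulAction

theorem card_smul_eq {G X : Type*} [Group G] [MulAction G X] (x y : X) (hy : y ∈ orbit G x) :
    {α : G | α • x = y}.ncard = Nat.card (stabilizer G x) := by
  obtain ⟨β, rfl⟩ := hy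
  have : {α : G | α • x = β • x} = (fun α => β * α) '' (stabilizer G x : Set G) := by
    ext α
    simp only [Set.mem_ofPred_eq, Set.mem_image, SetLike.mem_coe, mem_stabilizer_iff]
    constructor
    · intro h
      exact ⟨β⁻¹ * α, by rw [mul_smul, h, inv_smul_smul], mul_inv_cancel_left _ _⟩
    · rintro ⟨γ, hγ, rfl⟩
      rw [mul_smul, hγ]
  rw [this, Set.ncard_image_of_injective _ (mul_right_injective β)]
  rfl

theorem finite_smul_eq {G X : Type*} [Group G] [MulAction G X] (x y : X)
    (hfin : (stabilizer G x : Set G).Finite) : {α : G | α • x = y}.Finite := by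
  by_cases hy : y ∈ orbit G x
  · obtain ⟨β, rfl⟩ := hy
    refine (hfin.image fun α => β * α).subset ?_
    intro α hα
    exact ⟨β⁻¹ * α, by
      change (β⁻¹ * α) • x = x
      rw [mul_smul]
      exact (inv_smul_eq_iff).2 hα, mul_inv_cancel_left _ _⟩
  · convert Set.finite_empty
    rw [Set.eq_empty_iff_forall_notMem]
    intro α hα
    exact hy ⟨α, hα⟩

theorem finsum_smul_eq {G X : Type*} [Group G] [MulAction G X] (x : X)
    (hfin : (stabilizer G x : Set G).Finite) (φ : X → ℚ) (T : Finset X)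
    (h1 : ∀ y ∈ T, y ∈ orbit G x) (h2 : ∀ y ∈ orbit G x, φ y ≠ 0 → y ∈ T) :
    ∑ᶠ α : G, φ (α • x) = (Nat.card (stabilizer G x) : ℚ) * ∑ y ∈ T, φ y := by
  classical
  have hA : {α : G | α • x ∈ T}.Finite := by
    have : {α : G | α • x ∈ T} = ⋃ y ∈ (T : Set X), {α : G | α • x = y} := by ext; simp
    rw [this]
    exact T.finite_toSet.biUnion fun y _ => finite_smul_eq x y hfin
  rw [finsum_eq_sum_of_support_subset (s := hA.toFinset) _ (fun α hα => by
    simpa using h2 _ ⟨α, rfl⟩ hα), ← Finset.sum_fiberwise_of_maps_to (t := T)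
      (g := fun α => α • x) (fun α hα => by simpa using hα), Finset.mul_sum]
  refine Finset.sum_congr rfl fun y hy => ?_
  rw [Finset.sum_congr rfl (g := fun _ => φ y) fun α hα => by rw [(Finset.mem_filter.1 hα).2],
    Finset.sum_const, nsmul_eq_mul]
  congr 2
  rw [← card_smul_eq x y (h1 y hy), ← Set.ncard_coe_finset]
  congr 1
  ext α
  simp only [Finset.coe_filter, Set.Finite.mem_toFinset, Set.mem_ofPred_eq]
  exact ⟨fun h => h.2, fun h => ⟨by rw [h]; exact hy, h⟩⟩

end Counting

section Heegner

variable {a b : ℚ} {p : ℕ} [Fact p.Prime] {wp e wm : Vec ℚ_[p]}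
  {R : Subalgebra (ZInv p) (Quat a b ℚ)} {M : ℕ}

local notation "ι" => algebraMap ℚ_[p] ℂ_[p]

theorem conjRat_eq_iff {K : Type*} [Field K] [Algebra ℚ K] (g g' : (Quat a b ℚ)ˣ) :
    conjRat K g = conjRat K g' ↔ conjRat ℚ g = conjRat ℚ g' := by
  have hinj : Function.Injective (algebraMap ℚ K) := (algebraMap ℚ K).injective
  have ext_iff : ∀ {K : Type _} [CommRing K] (u w : LinearMap.GeneralLinearGroup K (Vec K)),
      (∀ v : Vec K, u • v = w • v) → u = w := fun u w h => Units.ext (LinearMap.ext h)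
  constructor
  · intro h
    apply ext_iff
    intro v
    have h1 := conjRat_map (algebraMap ℚ K) g v
    rw [h, conjRat_map (algebraMap ℚ K) g' v] at h1
    funext i
    exact (hinj (congrFun h1 i)).symm
  · intro h
    apply Units.ext
    apply LinearMap.pi_ext'
    intro i
    apply LinearMap.ext_ring
    have h1 := conjRat_map (algebraMap ℚ K) g (Pi.single i 1)
    have h2 := conjRat_map (algebraMap ℚ K) g' (Pi.single i 1)
    rw [h, ← h2] at h1
    have h3 : (fun j => algebraMap ℚ K ((Pi.single i 1 : Vec ℚ) j)) = Pi.single i 1 := by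
      funext j
      by_cases hj : j = i
      · subst hj; simp
      · simp [hj]
    rw [h3] at h1
    exact h1

variable (R p) in
theorem exists_gammaEquiv : ∃ ε : GammaBar R ℚ ≃ GammaBar R ℂ_[p],
    ∀ α : GammaBar R ℚ, ∃ g ∈ normOne R,
    conjRat ℚ g = (α : LinearMap.GeneralLinearGroup ℚ (Vec ℚ)) ∧
      conjRat ℂ_[p] g = (ε α : LinearMap.GeneralLinearGroup ℂ_[p] (Vec ℂ_[p])) := by
  choose g hg hgα using fun α : GammaBar R ℚ => exists_gammaBar α
  set f : GammaBar R ℚ → GammaBar R ℂ_[p] := fun α =>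
    ⟨conjRat ℂ_[p] (g α), Subgroup.mem_map_of_mem _ (hg α)⟩ with hf
  have hbij : Function.Bijective f := by
    constructor
    · intro α β hαβ
      have h1 : conjRat ℂ_[p] (g α) = conjRat ℂ_[p] (g β) := congrArg Subtype.val hαβ
      apply Subtype.ext
      rw [← hgα α, ← hgα β, (conjRat_eq_iff _ _).1 h1]
    · intro β
      obtain ⟨g₀, hg₀, hβ⟩ := exists_gammaBar β
      refine ⟨⟨conjRat ℚ g₀, Subgroup.mem_map_of_mem _ hg₀⟩, Subtype.ext ?_⟩
      rw [← hβ]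
      exact (conjRat_eq_iff _ _).2 (hgα _)
  exact ⟨Equiv.ofBijective f hbij, fun α : GammaBar R ℚ => ⟨g α, hg α, hgα α, rfl⟩⟩

theorem stabilizer_finite (σ : Quat a b ℚ_[p] ≃ₐ[ℚ_[p]] Matrix (Fin 2) (Fin 2) ℚ_[p])
    (hinf : IsDivision a b ℝ) (hR : IsEichlerOrder R M) (h : IsFrame a b wp e wm) {z : Pt p}
    (hz : z ∈ halfPlane a b p) :
    (MulAction.stabilizer (GammaBar R ℂ_[p]) z : Set (GammaBar R ℂ_[p])).Finite := by
  obtain ⟨C, hC⟩ := exists_bdd (pt_zcoord h hz).2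
  refine (finite_bdd_smul σ hinf hR h hz C).subset fun α hα => ?_
  change Bdd p C (zcoord h (α • z))
  rw [show α • z = z from hα]
  exact hC C le_rfl

theorem pushforward_apply (𝒟 : Pt p →₀ ℤ) (q : QuotPt R) [DecidableEq (QuotPt R)] :
    pushforward R 𝒟 q = ∑ y ∈ 𝒟.support with (Quotient.mk _ y : QuotPt R) = q, (𝒟 y : ℚ) := by
  rw [pushforward, Finsupp.mapDomain, Finsupp.sum_apply, Finsupp.sum_mapRange_index (by simp),
    Finsupp.sum, Finset.sum_filter]
  refine Finset.sum_congr rfl fun y _ => ?_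
  rw [Finsupp.single_apply]

theorem finsum_smul_pushforward {z : Pt p}
    (hfin : (MulAction.stabilizer (GammaBar R ℂ_[p]) z : Set (GammaBar R ℂ_[p])).Finite)
    (𝒟 : Pt p →₀ ℤ) : ∑ᶠ α : GammaBar R ℂ_[p], (𝒟 (α • z) : ℚ) =
      (Nat.card (MulAction.stabilizer (GammaBar R ℂ_[p]) z) : ℚ) *
        pushforward R 𝒟 (Quotient.mk _ z : QuotPt R) := by
  classical
  rw [pushforward_apply]
  refine finsum_smul_eq z hfin (fun y => (𝒟 y : ℚ)) _ ?_ ?_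
  · intro y hy
    exact Quotient.exact (Finset.mem_filter.1 hy).2
  · intro y hy h0
    refine Finset.mem_filter.2 ⟨?_, Quotient.sound hy⟩
    rw [Finsupp.mem_support_iff]
    exact_mod_cast h0

theorem transMult_eq_finsum (h : IsFrame a b wp e wm) {𝒟 : Pt p →₀ ℤ}
    (h𝒟 : ∀ z ∈ 𝒟.support, z ∈ halfPlane a b p) (ζ : ℂ_[p]) :
    transMult R h 𝒟 ζ = ∑ᶠ α : GammaBar R ℂ_[p], 𝒟 (α • pt h ζ) := by
  classical
  rw [transMult, orbitMult, ← finsum_comp_equiv (Equiv.inv (GammaBar R ℂ_[p]))]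
  refine finsum_congr fun α => ?_
  rw [Finset.sum_filter]
  have key : ∀ y ∈ 𝒟.support, zcoord h ((Equiv.inv (GammaBar R ℂ_[p])) α • y) = ζ ↔ y = α • pt h ζ := by
    intro y hy
    have h1 := (pt_zcoord h (gammaBar_smul_mem α⁻¹ (h𝒟 y hy))).1
    change zcoord h (α⁻¹ • y) = ζ ↔ _
    rw [← inv_smul_eq_iff]
    constructor
    · intro h2; rw [← h1, h2]
    · intro h2; rw [h2, zcoord_pt]
  rw [Finset.sum_congr rfl fun y hy => by rw [if_congr (key y hy) rfl rfl], Finset.sum_ite_eq']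
  by_cases hm : α • pt h ζ ∈ 𝒟.support
  · rw [if_pos hm]
  · rw [if_neg hm, Finsupp.notMem_support_iff.1 hm]

theorem pointDivisor_apply (h : IsFrame a b wp e wm) {D : ℚ} (hD : NotLength a b p e D) {θ : ℂ_[p]}
    (hθ : ι (quadForm a b e) * θ ^ 2 = ι (D : ℚ_[p])) {v : Vec ℚ} (hv : quadForm a b v = D)
    {z : Pt p} (hz : z ∈ halfPlane a b p) [Decidable (Orth a b z v)] :
    pointDivisor a b p v z = if Orth a b z v then 1 else 0 := by
  classical
  have hfin : {z : Pt p | z ∈ halfPlane a b p ∧ Orth a b z v}.Finite := by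
    refine (Set.toFinite {pt h ((ι (coordE a b wp e wm (toQp p v)) + θ) / ι (coordM a b wp e wm (toQp p v))),
      pt h ((ι (coordE a b wp e wm (toQp p v)) - θ) / ι (coordM a b wp e wm (toQp p v)))}).subset ?_
    rintro z ⟨h1, h2⟩
    obtain ⟨ζ, hζ, rfl⟩ := (mem_halfPlane_iff h z).1 h1
    rcases (orth_iff h hD hθ hv ζ).1 h2 with h3 | h3 <;> rw [← h3] <;> simp
  have h1 : pointDivisor a b p v = ∑ z ∈ hfin.toFinset, Finsupp.single z 1 :=
    finsum_mem_eq_finite_toFinset_sum _ hfin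
  rw [h1, Finsupp.finsetSum_apply]
  simp only [Finsupp.single_apply]
  rw [Finset.sum_ite_eq']
  simp only [Set.Finite.mem_toFinset, Set.mem_ofPred_eq, hz, true_and]

theorem zpow_smul_eq_of {K : Type*} [Field K] {g : LinearMap.GeneralLinearGroup K (Vec K)} {c : K}
    (hc : c ≠ 0) {w : Vec K} (h : g • w = c • w) (k : ℤ) : g ^ k • w = c ^ k • w := by
  have h' : g⁻¹ • w = c⁻¹ • w := by
    rw [inv_smul_eq_iff, glSmul_smul, h, smul_smul, inv_mul_cancel₀ hc, one_smul]
  induction k with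
  | zero => simp
  | succ k ih => rw [zpow_add_one, mul_smul, h, glSmul_smul, ih, smul_smul, zpow_add_one₀ hc, mul_comm]
  | pred k ih => rw [zpow_sub_one, mul_smul, h', glSmul_smul, ih, smul_smul, zpow_sub_one₀ hc, mul_comm]

theorem hyperbolic_zpow {γ : (Quat a b ℚ)ˣ} {ϖ : ℚ_[p]} (hϖ : ϖ ≠ 0)
    (h1 : conjRat ℚ_[p] γ • wp = ϖ • wp) (h2 : conjRat ℚ_[p] γ • e = e)
    (h3 : conjRat ℚ_[p] γ • wm = ϖ⁻¹ • wm) (k : ℤ) :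
    conjRat ℚ_[p] (γ ^ k) • wp = ϖ ^ k • wp ∧ conjRat ℚ_[p] (γ ^ k) • e = e ∧
      conjRat ℚ_[p] (γ ^ k) • wm = (ϖ ^ k)⁻¹ • wm := by
  rw [map_zpow]
  refine ⟨zpow_smul_eq_of hϖ h1 k, ?_, ?_⟩
  · have := zpow_smul_eq_of one_ne_zero (by rw [h2, one_smul]) k (w := e) (g := conjRat ℚ_[p] γ)
    rwa [one_zpow, one_smul] at this
  · rw [← inv_zpow]
    exact zpow_smul_eq_of (inv_ne_zero hϖ) h3 k

/-- The group has finitely many orbits on the vectors of fixed length in the support of `Φ`. -/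
theorem finite_orbits_length
    (σ : Quat a b ℚ_[p] ≃ₐ[ℚ_[p]] Matrix (Fin 2) (Fin 2) ℚ_[p])
    (hinf : IsDivision a b ℝ) (hR : IsEichlerOrder R M) (hM : M ≠ 0)
    {par : Submodule ℤ_[p] (Vec ℚ_[p]) → Prop}
    {γ : (Quat a b ℚ)ˣ} (hγ : γ ∈ normOne R) {ϖ : ℚ_[p]} {t : ℕ}
    {L₀ : Submodule ℤ_[p] (Vec ℚ_[p])} (hf : IsHyperbolicFrame par γ ϖ t L₀ wp e wm)
    (h : IsFrame a b wp e wm) {Φ : Vec (AdeleAway p) → ℤ} (hΦ : IsConvenient R par Φ) {D : ℚ}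
    (hD : NotLength a b p e D) :
    ((Quotient.mk (MulAction.orbitRel (GammaBar R ℚ) (Vec ℚ))) '' {v : Vec ℚ |
      quadForm a b v = D ∧ ratVal Φ v ≠ 0}).Finite := by
  obtain ⟨N, hN, hden⟩ := exists_denom_of_compactSupport hΦ.compactSupport
  obtain ⟨ψ, c, hc, hψ⟩ := exists_lower_left σ h hf.ne_zero.1
  have hc' : 0 < ‖c‖ := norm_pos_iff.2 hc
  have hϖ := ne_zero_of_norm hf.norm_eq
  obtain ⟨h1, h2, h3⟩ := hf.smul_eq
  set T := max ((p : ℝ) ^ (2 * t) * ‖c‖) ‖c‖⁻¹ with hT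
  have hT0 : 0 < T := (inv_pos.2 hc').trans_le (le_max_right _ _)
  refine (finite_orbits ψ hinf hR hM hN (D := D) hT0).subset ?_
  rintro _ ⟨v, ⟨hv1, hv2⟩, rfl⟩
  have hm := norm_pos_iff.2 (coordM_ne_zero h hD hv1)
  have hϖ1 : 1 < ‖ϖ‖ := by
    rw [hf.norm_eq]; exact one_lt_pow₀ one_lt_p (by have := hf.t_pos; omega)
  obtain ⟨k, hk1, hk2⟩ := exists_mem_Ico_zpow hm hϖ1
  have hγk : γ ^ k ∈ normOne R := Subgroup.zpow_mem _ hγ k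
  obtain ⟨g1, g2, g3⟩ := hyperbolic_zpow hϖ h1 h2 h3 k
  obtain ⟨-, -, e3⟩ := coord_hyperbolic h (zpow_ne_zero k hϖ) g1 g2 g3 v
  have hϖk : 0 < ‖ϖ‖ ^ k := zpow_pos (norm_pos_iff.2 hϖ) k
  have hn : ‖coordM a b wp e wm (toQp p (conjRat ℚ (γ ^ k) • v))‖ =
      ‖coordM a b wp e wm (toQp p v)‖ / ‖ϖ‖ ^ k := by
    rw [e3, norm_mul, norm_inv, norm_zpow, inv_mul_eq_div]
  refine ⟨conjRat ℚ (γ ^ k) • v, ⟨?_, fun i => hden _ ?_ i, ?_, ?_⟩, ?_⟩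
  · rw [← hv1]
    exact quadForm_conj (Units.map (baseChange (a := a) (b := b) ℚ).toMonoidHom (γ ^ k)) v
  · rwa [ratVal_smul hΦ.unitInvariant hγk]
  · rw [hψ, norm_mul, hn]
    calc T⁻¹ ≤ (‖c‖⁻¹)⁻¹ := inv_anti₀ (inv_pos.2 hc') (le_max_right _ _)
      _ = 1 * ‖c‖ := by rw [inv_inv, one_mul]
      _ ≤ _ := by
        gcongr
        rwa [one_le_div hϖk]
  · rw [hψ, norm_mul, hn]
    refine le_trans ?_ (le_max_left _ _)
    rw [← hf.norm_eq]
    gcongr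
    rw [div_le_iff₀ hϖk]
    rw [zpow_add_one₀ (norm_ne_zero_iff.2 hϖ), mul_comm] at hk2
    exact hk2.le
  · exact Quotient.sound ⟨⟨conjRat ℚ (γ ^ k), Subgroup.mem_map_of_mem _ hγk⟩, rfl⟩

end Heegner

section HeegnerSum

variable {a b : ℚ} {p : ℕ} [Fact p.Prime] {wp e wm : Vec ℚ_[p]}
  {R : Subalgebra (ZInv p) (Quat a b ℚ)} {M : ℕ}

local notation "ι" => algebraMap ℚ_[p] ℂ_[p]

theorem gammaBar_rat (β : GammaBar R ℚ) : ∃ g ∈ normOne R, conjRat ℚ g = β.1 := β.2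

theorem quadForm_gammaBar (β : GammaBar R ℚ) (v : Vec ℚ) :
    quadForm a b (β • v) = quadForm a b v := by
  obtain ⟨g, hg, hβ⟩ := gammaBar_rat β
  change quadForm a b (β.1 • v) = _
  rw [← hβ]
  exact quadForm_conj (Units.map (baseChange (a := a) (b := b) ℚ).toMonoidHom g) v

theorem stabilizer_vec_finite (σ : Quat a b ℚ_[p] ≃ₐ[ℚ_[p]] Matrix (Fin 2) (Fin 2) ℚ_[p])
    (hinf : IsDivision a b ℝ) (hR : IsEichlerOrder R M) (h : IsFrame a b wp e wm) {D : ℚ}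
    (hD : NotLength a b p e D) {θ : ℂ_[p]} (hθ : ι (quadForm a b e) * θ ^ 2 = ι (D : ℚ_[p]))
    {v : Vec ℚ} (hv : quadForm a b v = D) :
    (MulAction.stabilizer (GammaBar R ℚ) v : Set (GammaBar R ℚ)).Finite := by
  obtain ⟨ε, hε⟩ := exists_gammaEquiv p R
  set z₁ := pt h ((ι (coordE a b wp e wm (toQp p v)) + θ) / ι (coordM a b wp e wm (toQp p v)))
    with hz₁
  set z₂ := pt h ((ι (coordE a b wp e wm (toQp p v)) - θ) / ι (coordM a b wp e wm (toQp p v)))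
    with hz₂
  have hz : z₁ ∈ halfPlane a b p := pt_mem_halfPlane h (irrat_root h hD hθ hv)
  have hs := stabilizer_finite σ hinf hR h hz
  refine (((finite_smul_eq z₁ z₁ hs).union (finite_smul_eq z₁ z₂ hs)).preimage
    ε.injective.injOn).subset fun α hα => ?_
  obtain ⟨g, hg, h1, h2⟩ := hε α
  have hα' : conjRat ℚ g • v = v := by rw [h1]; exact hα
  have h3 : Orth a b (conjRat ℂ_[p] g • z₁) v := by
    have h5 := (orth_smul g z₁ v).2 ((orth_iff h hD hθ hv _).2 (Or.inl rfl))
    rwa [hα'] at h5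
  have h4 : conjRat ℂ_[p] g • z₁ ∈ halfPlane a b p := by
    rw [h2]; exact gammaBar_smul_mem (ε α) hz
  obtain ⟨ζ, hζ, h5⟩ := (mem_halfPlane_iff h _).1 h4
  rw [← h5] at h3
  rw [h2] at h5
  rcases (orth_iff h hD hθ hv ζ).1 h3 with h6 | h6
  · left
    change (ε α).1 • z₁ = z₁
    rw [← h5, h6]
  · right
    change (ε α).1 • z₁ = z₂
    rw [← h5, h6]

/-- The multiplicities of the translates of a divisor that represents the Heegner divisor. -/
theorem transMult_eq_sum (σ : Quat a b ℚ_[p] ≃ₐ[ℚ_[p]] Matrix (Fin 2) (Fin 2) ℚ_[p])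
    (hinf : IsDivision a b ℝ) (hR : IsEichlerOrder R M) (hM : M ≠ 0)
    {par : Submodule ℤ_[p] (Vec ℚ_[p]) → Prop}
    {γ : (Quat a b ℚ)ˣ} (hγ : γ ∈ normOne R) {ϖ : ℚ_[p]} {t : ℕ}
    {L₀ : Submodule ℤ_[p] (Vec ℚ_[p])} (hf : IsHyperbolicFrame par γ ϖ t L₀ wp e wm)
    (h : IsFrame a b wp e wm) {Φ : Vec (AdeleAway p) → ℤ} (hΦ : IsConvenient R par Φ) {D : ℤ}
    (hD : NotLength a b p e D) {θ : ℂ_[p]}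
    (hθ : ι (quadForm a b e) * θ ^ 2 = ι ((D : ℚ) : ℚ_[p]))
    {𝒟 : Pt p →₀ ℤ} (h𝒟 : ∀ z ∈ 𝒟.support, z ∈ halfPlane a b p)
    (hpush : pushforward R 𝒟 = heegnerDivisor R Φ D) {ζ : ℂ_[p]} (hζ : Irrat p ζ) :
    transMult R h 𝒟 ζ =
      ∑ v ∈ (finite_orth hinf h hΦ.compactSupport hD hθ hζ).toFinset, ratVal Φ v := by
  classical
  set Y := (finite_orth hinf h hΦ.compactSupport hD hθ hζ).toFinset with hY
  set z := pt h ζ with hz'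
  have hz : z ∈ halfPlane a b p := pt_mem_halfPlane h hζ
  have hO := finite_orbits_length σ hinf hR hM hγ hf h hΦ hD
  set O := hO.toFinset with hOdef
  obtain ⟨ε, hε⟩ := exists_gammaEquiv p R
  have hmY : ∀ v, v ∈ Y ↔ quadForm a b v = (D : ℚ) ∧ ratVal Φ v ≠ 0 ∧ Orth a b z v := by
    intro v; rw [hY, Set.Finite.mem_toFinset]; rfl
  have hΦo : ∀ (β : GammaBar R ℚ) (v : Vec ℚ), ratVal Φ (β • v) = ratVal Φ v := by
    intro β v
    obtain ⟨g, hg, hβ⟩ := gammaBar_rat β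
    change ratVal Φ (β.1 • v) = _
    rw [← hβ]
    exact ratVal_smul hΦ.unitInvariant hg v
  have hrel : ∀ v : Vec ℚ, ∀ o : MulAction.orbitRel.Quotient (GammaBar R ℚ) (Vec ℚ),
      v ∈ MulAction.orbit (GammaBar R ℚ) o.out ↔ Quotient.mk _ v = o := by
    intro v o
    constructor
    · intro hv
      rw [← Quotient.out_eq o]
      exact Quotient.sound hv
    · intro hv
      have : (Quotient.mk _ v : MulAction.orbitRel.Quotient (GammaBar R ℚ) (Vec ℚ)) =
        Quotient.mk _ o.out := by rw [hv, Quotient.out_eq]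
      exact Quotient.exact this
  set n : ℚ := (Nat.card (MulAction.stabilizer (GammaBar R ℂ_[p]) z) : ℚ) with hn
  have hstab := stabilizer_finite σ hinf hR h hz
  have e1 : ((transMult R h 𝒟 ζ : ℤ) : ℚ) =
      n * heegnerDivisor R Φ D (Quotient.mk _ z : QuotPt R) := by
    rw [transMult_eq_finsum h h𝒟, ← hpush, ← finsum_smul_pushforward hstab]
    exact AddMonoidHom.map_finsum_of_injective (Int.castAddHom ℚ) Int.cast_injective _
  set F := fun o : MulAction.orbitRel.Quotient (GammaBar R ℚ) (Vec ℚ) =>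
    if quadForm a b o.out = (D : ℚ) then
      ((Nat.card (MulAction.stabilizer (GammaBar R ℚ) o.out) : ℚ)⁻¹ * (ratVal Φ o.out : ℚ)) •
        pushforward R (pointDivisor a b p o.out)
    else 0 with hF
  have e2 : heegnerDivisor R Φ D = ∑ o ∈ O, F o := by
    rw [heegnerDivisor]
    refine (finsum_congr fun o => ?_).trans (finsum_eq_sum_of_support_subset F ?_)
    · rw [hF]
    · intro o ho
      rw [Function.mem_support] at ho
      rw [hOdef, Set.Finite.coe_toFinset]
      by_cases hq : quadForm a b o.out = (D : ℚ)
      · refine ⟨o.out, ⟨hq, fun h0 => ho ?_⟩, Quotient.out_eq o⟩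
        rw [hF]
        simp [h0]
      · exact (ho (if_neg hq)).elim
  have e3 : ∀ o ∈ O, n * F o (Quotient.mk _ z : QuotPt R) =
      ((∑ v ∈ Y with Quotient.mk _ v = o, ratVal Φ v : ℤ) : ℚ) := by
    intro o ho
    rw [hOdef, Set.Finite.mem_toFinset] at ho
    obtain ⟨w, ⟨hw1, hw2⟩, hwo⟩ := ho
    obtain ⟨β, hβ⟩ := (hrel w o).2 hwo
    have hq : quadForm a b o.out = (D : ℚ) := by
      rw [← hw1, ← hβ]; exact (quadForm_gammaBar β _).symm
    have hφ : ratVal Φ o.out ≠ 0 := by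
      rw [← hβ] at hw2; rwa [← hΦo β]
    have hs := stabilizer_vec_finite σ hinf hR h hD hθ hq
    have hcard : (Nat.card (MulAction.stabilizer (GammaBar R ℚ) o.out) : ℚ) ≠ 0 := by
      have : Finite (MulAction.stabilizer (GammaBar R ℚ) o.out) := hs.to_subtype
      exact_mod_cast Nat.card_pos.ne'
    have s1 : n * pushforward R (pointDivisor a b p o.out) (Quotient.mk _ z : QuotPt R) =
        ∑ᶠ α : GammaBar R ℚ, (if Orth a b z (α • o.out) then (1 : ℚ) else 0) := by
      rw [hn, ← finsum_smul_pushforward hstab,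
        ← finsum_comp_equiv ((Equiv.inv (GammaBar R ℚ)).trans ε)]
      refine finsum_congr fun α => ?_
      obtain ⟨g, hg, h1, h2⟩ := hε α⁻¹
      have hmem : (ε α⁻¹) • z ∈ halfPlane a b p := gammaBar_smul_mem (ε α⁻¹) hz
      have h3 : Orth a b ((ε α⁻¹) • z) o.out ↔ Orth a b z (α • o.out) := by
        rw [← orth_smul g z (α • o.out), h1, h2]
        change _ ↔ Orth a b ((ε α⁻¹) • z) (α⁻¹ • α • o.out)
        rw [inv_smul_smul]
      change ((pointDivisor a b p o.out ((ε α⁻¹) • z) : ℤ) : ℚ) = _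
      rw [pointDivisor_apply h hD hθ hq hmem]
      simp only [h3]
      split_ifs <;> simp
    have s2 := finsum_smul_eq o.out hs (fun y => if Orth a b z y then (1 : ℚ) else 0)
      {v ∈ Y | Quotient.mk _ v = o} (fun y hy => (hrel y o).2 (Finset.mem_filter.1 hy).2) (by
        intro y hy h0
        have hy' := (hrel y o).1 hy
        obtain ⟨β, rfl⟩ := hy
        refine Finset.mem_filter.2 ⟨(hmY _).2 ⟨?_, ?_, ?_⟩, hy'⟩
        · rw [← hq]; exact quadForm_gammaBar β _
        · change ratVal Φ (β • o.out) ≠ 0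
          rwa [hΦo]
        · by_contra hcon
          exact h0 (if_neg hcon))
    rw [hF]
    simp only [if_pos hq]
    rw [Finsupp.smul_apply, smul_eq_mul, mul_left_comm, s1, s2, Int.cast_sum, mul_right_comm,
      ← mul_assoc, inv_mul_cancel₀ hcard, one_mul, mul_comm, Finset.mul_sum]
    refine Finset.sum_congr rfl fun y hy => ?_
    obtain ⟨hy1, hy2⟩ := Finset.mem_filter.1 hy
    rw [if_pos ((hmY y).1 hy1).2.2, mul_one]
    obtain ⟨β, rfl⟩ := (hrel y o).2 hy2
    exact congrArg _ (hΦo β _).symm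
  have e4 : ((transMult R h 𝒟 ζ : ℤ) : ℚ) = ((∑ v ∈ Y, ratVal Φ v : ℤ) : ℚ) := by
    rw [e1, e2, Finsupp.finsetSum_apply, Finset.mul_sum, Finset.sum_congr rfl e3,
      ← Int.cast_sum, Finset.sum_fiberwise_of_maps_to]
    intro v hv
    obtain ⟨h1, h2, -⟩ := (hmY v).1 hv
    rw [hOdef, Set.Finite.mem_toFinset]
    exact ⟨v, ⟨h1, h2⟩, rfl⟩
  exact_mod_cast e4

end HeegnerSum

/-! ### The parts containing the roots of a vector -/

section Roots

variable {a b : ℚ} {p : ℕ} [Fact p.Prime] {wp e wm : Vec ℚ_[p]}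

local notation "ι" => algebraMap ℚ_[p] ℂ_[p]

theorem exists_sq_eq (hp2 : p ≠ 2) {x : ℚ_[p]} (hx : ‖x - 1‖ < 1) : ∃ y, y ^ 2 = x := by
  have h1 : ‖x‖ ≤ 1 := by
    rw [show x = (x - 1) + 1 by ring]
    exact (IsUltrametricDist.norm_add_le_max _ _).trans (max_le hx.le norm_one.le)
  obtain ⟨x, rfl⟩ : ∃ x' : ℤ_[p], (x' : ℚ_[p]) = x := ⟨⟨x, h1⟩, rfl⟩
  obtain ⟨z, hz, -⟩ := hensels_lemma (p := p) (R := ℤ_[p]) (a := 1)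
    (F := Polynomial.X ^ 2 - Polynomial.C x) (by
      have h2 : ‖(2 : ℤ_[p])‖ = 1 := norm_two_eq hp2
      have h3 : ‖(1 : ℤ_[p]) - x‖ < 1 := by rw [norm_sub_rev]; exact hx
      simp [one_add_one_eq_two, h2, h3])
  refine ⟨z, ?_⟩
  simp only [map_sub, map_pow, Polynomial.aeval_X, Polynomial.aeval_C, sub_eq_zero] at hz
  exact congrArg Subtype.val hz

variable (a b wp e wm) in
/-- A frame of a unimodular lattice together with a class of vectors of length
`D = Q(e) θ ^ 2`, with `θ` not in `ℚ_p`. -/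
structure IsLengthData (Φ : Vec (AdeleAway p) → ℤ) (D : ℚ) (θ : ℂ_[p]) : Prop where
  ne_two : p ≠ 2
  unit : IsUnitFrame a b wp e wm
  notLength : NotLength a b p e D
  theta : ι (quadForm a b e) * θ ^ 2 = ι (D : ℚ_[p])
  finite : ∀ T : ℝ, {v : Vec ℚ | quadForm a b v = D ∧ ratVal Φ v ≠ 0 ∧
    ‖coordP a b wp e wm (toQp p v)‖ ≤ T ∧ ‖coordE a b wp e wm (toQp p v)‖ ≤ T ∧
    ‖coordM a b wp e wm (toQp p v)‖ ≤ T}.Finite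

local notation "cP" => fun v => coordP a b wp e wm (toQp p v)
local notation "cE" => fun v => coordE a b wp e wm (toQp p v)
local notation "cM" => fun v => coordM a b wp e wm (toQp p v)

variable (a b) in
/-- The vectors of length `D` in the support of `Φ`. -/
def lengthSet (Φ : Vec (AdeleAway p) → ℤ) (D : ℚ) : Set (Vec ℚ) :=
  {v | quadForm a b v = D ∧ ratVal Φ v ≠ 0}

variable (a b wp e wm) in
/-- A point of the upper half plane orthogonal to `v`. -/
def vecRoot (θ : ℂ_[p]) (v : Vec ℚ) : ℂ_[p] := (ι (cE v) + θ) / ι (cM v)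

namespace IsLengthData

variable {Φ : Vec (AdeleAway p) → ℤ} {D : ℚ} {θ : ℂ_[p]}
  (H : IsLengthData a b wp e wm Φ D θ)
include H

theorem neg : IsLengthData a b wp e wm Φ D (-θ) :=
  ⟨H.ne_two, H.unit, H.notLength, theta_neg H.theta, H.finite⟩

theorem theta_irrat : Irrat p θ := irrat_theta H.notLength H.theta

theorem theta_ne : θ ≠ 0 := fun h0 => H.theta_irrat 0 (by rw [map_zero, h0])

theorem norm_theta_sq : ‖θ‖ ^ 2 = ‖(D : ℚ_[p])‖ := by
  have h1 := congrArg norm H.theta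
  rwa [norm_mul, norm_iota, norm_iota, H.unit.norm_e, one_mul, norm_pow] at h1

theorem norm_theta_sub (q : ℚ_[p]) : ‖θ - ι q‖ = max ‖θ‖ ‖q‖ := by
  by_cases hq : ‖θ‖ = ‖q‖
  · refine le_antisymm (by
      rw [sub_eq_add_neg]
      exact (IsUltrametricDist.norm_add_le_max _ _).trans_eq (by rw [norm_neg, norm_iota])) ?_
    rw [← hq, max_self]
    by_contra hcon
    rw [not_le] at hcon
    have hθ := norm_pos_iff.2 H.theta_ne
    have hq0 : q ≠ 0 := norm_pos_iff.1 (hq ▸ hθ)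
    have hι : ι q ≠ 0 := (map_ne_zero _).2 hq0
    have hε := H.unit.frame.quad_e_ne
    obtain ⟨y, hy⟩ := exists_sq_eq H.ne_two (x := (D : ℚ_[p]) / (quadForm a b e * q ^ 2)) (by
      rw [← norm_iota]
      have : ι ((D : ℚ_[p]) / (quadForm a b e * q ^ 2) - 1) =
          (θ - ι q) * (θ + ι q) / ι q ^ 2 := by
        rw [map_sub, map_div₀, ← H.theta, map_mul, map_pow, map_one]
        have : ι (quadForm a b e) ≠ 0 := (map_ne_zero _).2 hε
        field_simp
        ring
      rw [this, norm_div, norm_mul, norm_pow, norm_iota, ← hq, div_lt_one (by positivity)]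
      have h2 : ‖θ + ι q‖ ≤ ‖θ‖ := (IsUltrametricDist.norm_add_le_max _ _).trans_eq (by
        rw [norm_iota, hq, max_self])
      nlinarith [norm_nonneg (θ + ι q), norm_nonneg (θ - ι q)])
    refine H.notLength (y * q) ?_
    rw [mul_pow, hy]
    field_simp
  · rw [sub_eq_add_neg, IsUltrametricDist.norm_add_eq_max_of_norm_ne_norm (by
      rwa [norm_neg, norm_iota]), norm_neg, norm_iota]

theorem rho_theta : rho p θ = ‖θ‖ :=
  rho_eq_of (fun q => by rw [H.norm_theta_sub]; exact le_max_left _ _) 0 (by simp)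

theorem coordM_ne {v : Vec ℚ} (hv : v ∈ lengthSet a b Φ D) : cM v ≠ 0 :=
  coordM_ne_zero H.unit.frame H.notLength hv.1

theorem coord_eq {v : Vec ℚ} (hv : v ∈ lengthSet a b Φ D) :
    cP v * cM v * pairing a b wp wm = D - cE v ^ 2 * quadForm a b e := by
  have h1 := H.unit.frame.quadForm_eq_coord (toQp p v)
  rw [quadForm_toQp, hv.1] at h1
  rw [h1]
  ring

theorem norm_coord_mul {v : Vec ℚ} (hv : v ∈ lengthSet a b Φ D) :
    ‖cP v‖ * ‖cM v‖ = max ‖(D : ℚ_[p])‖ (‖cE v‖ ^ 2) := by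
  have h1 := congrArg norm (H.coord_eq hv)
  rw [norm_mul, norm_mul, H.unit.norm_pair, mul_one] at h1
  have h2 : ι ((D : ℚ_[p]) - cE v ^ 2 * quadForm a b e) =
      ι (quadForm a b e) * ((θ - ι (cE v)) * (θ - ι (-cE v))) := by
    rw [map_sub, ← H.theta]
    simp only [map_mul, map_pow, map_neg]
    ring
  rw [h1, ← norm_iota, h2, norm_mul, norm_mul, H.norm_theta_sub, H.norm_theta_sub, norm_neg,
    norm_iota, H.unit.norm_e, one_mul, ← H.norm_theta_sq]
  rcases le_total ‖θ‖ ‖cE v‖ with h3 | h3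
  · rw [max_eq_right h3, max_eq_right (pow_le_pow_left₀ (norm_nonneg _) h3 2), sq]
  · rw [max_eq_left h3, max_eq_left (pow_le_pow_left₀ (norm_nonneg _) h3 2), sq]

theorem coordP_ne {v : Vec ℚ} (hv : v ∈ lengthSet a b Φ D) : cP v ≠ 0 := by
  intro h0
  have h1 := H.norm_coord_mul hv
  rw [h0, norm_zero, zero_mul, ← H.norm_theta_sq] at h1
  have h2 := norm_pos_iff.2 H.theta_ne
  have h3 : 0 < ‖θ‖ ^ 2 := by positivity
  exact absurd (h1.symm ▸ le_max_left (‖θ‖ ^ 2) (‖cE v‖ ^ 2)) (not_le.2 h3)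

theorem finite_of_bounds {c T : ℝ} (hc : 0 < c) :
    {v ∈ lengthSet a b Φ D | c ≤ ‖cM v‖ ∧ ‖cM v‖ ≤ T ∧ ‖cE v‖ ≤ T}.Finite := by
  refine (H.finite (max T (max ‖(D : ℚ_[p])‖ (T ^ 2) / c))).subset ?_
  rintro v ⟨hv, h1, h2, h3⟩
  refine ⟨hv.1, hv.2, le_max_of_le_right ?_, le_max_of_le_left h3, le_max_of_le_left h2⟩
  have h4 := norm_pos_iff.2 (H.coordM_ne hv)
  rw [le_div_iff₀ hc]
  calc ‖cP v‖ * c ≤ ‖cP v‖ * ‖cM v‖ := by gcongr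
    _ = _ := H.norm_coord_mul hv
    _ ≤ _ := max_le_max le_rfl (pow_le_pow_left₀ (norm_nonneg _) h3 2)

theorem root_irrat {v : Vec ℚ} (hv : v ∈ lengthSet a b Φ D) : Irrat p (vecRoot a b wp e wm θ v) :=
  irrat_root H.unit.frame H.notLength H.theta hv.1

theorem root_eq {v : Vec ℚ} (hv : v ∈ lengthSet a b Φ D) :
    vecRoot a b wp e wm θ v = ι (cM v)⁻¹ * θ + ι (cE v / cM v) := by
  have := H.coordM_ne hv
  rw [vecRoot, map_inv₀, map_div₀]
  ring

theorem rho_root {v : Vec ℚ} (hv : v ∈ lengthSet a b Φ D) :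
    rho p (vecRoot a b wp e wm θ v) = ‖θ‖ / ‖cM v‖ := by
  rw [H.root_eq hv, rho_add, rho_mul _ (inv_ne_zero (H.coordM_ne hv)), H.rho_theta, norm_inv,
    inv_mul_eq_div]

theorem norm_root_sub {v : Vec ℚ} (hv : v ∈ lengthSet a b Φ D) :
    ‖vecRoot a b wp e wm θ v - ι (cE v / cM v)‖ = ‖θ‖ / ‖cM v‖ := by
  rw [H.root_eq hv, add_sub_cancel_right, norm_mul, norm_iota, norm_inv, inv_mul_eq_div]

theorem isLev_root (s : ℤ) {v : Vec ℚ} (hv : v ∈ lengthSet a b Φ D) :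
    IsLev p s (‖θ‖ / ‖cM v‖) (lev p s (vecRoot a b wp e wm θ v)) := by
  rw [← H.rho_root hv]
  exact isLev_lev s (H.root_irrat hv)

theorem lab_root {s r : ℤ} {v : Vec ℚ} (hv : v ∈ lengthSet a b Φ D)
    (hr : IsLev p s (‖θ‖ / ‖cM v‖) r) : lab p s (vecRoot a b wp e wm θ v) =
      (r, {c : ℚ_[p] | ‖cE v / cM v - c‖ < (p : ℝ) ^ (1 - r)}) := by
  refine lab_eq_of_mem (by rwa [H.rho_root hv]) ?_
  rw [H.norm_root_sub hv]
  exact hr.bounds.2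

theorem lab_root_neg (s : ℤ) {v : Vec ℚ} (hv : v ∈ lengthSet a b Φ D) :
    lab p s (vecRoot a b wp e wm (-θ) v) = lab p s (vecRoot a b wp e wm θ v) := by
  have h1 := H.isLev_root s hv
  rw [H.lab_root hv h1, H.neg.lab_root hv (by rwa [norm_neg])]

theorem root_ne_root_neg {v : Vec ℚ} (hv : v ∈ lengthSet a b Φ D) :
    vecRoot a b wp e wm θ v ≠ vecRoot a b wp e wm (-θ) v := by
  have h1 : ι (cM v) ≠ 0 := (map_ne_zero _).2 (H.coordM_ne hv)
  rw [vecRoot, vecRoot, Ne, div_left_inj' h1, add_right_inj, eq_neg_iff_add_eq_zero, ← two_mul]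
  exact mul_ne_zero two_ne_zero H.theta_ne

theorem root_mul {v : Vec ℚ} (hv : v ∈ lengthSet a b Φ D) :
    vecRoot a b wp e wm θ v * vecRoot a b wp e wm (-θ) v =
      ι (-(pairing a b wp wm / quadForm a b e)) * (ι (cM v / cP v))⁻¹ := by
  have h1 : ι (cM v) ≠ 0 := (map_ne_zero _).2 (H.coordM_ne hv)
  have h2 : ι (cP v) ≠ 0 := (map_ne_zero _).2 (H.coordP_ne hv)
  have h3 : ι (quadForm a b e) ≠ 0 := (map_ne_zero _).2 H.unit.frame.quad_e_ne
  have h4 := congrArg ι (H.coord_eq hv)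
  rw [map_sub, ← H.theta] at h4
  simp only [map_mul, map_pow] at h4
  rw [vecRoot, vecRoot, map_neg, map_div₀, map_div₀]
  field_simp
  linear_combination h4

/-- The part of the product belonging to a given part of the partition. -/
theorem prod_part {m : ℂ_[p] → ℤ} (hm : ∀ ζ, Irrat p ζ → ∀ Y : Finset (Vec ℚ), (∀ v, v ∈ Y ↔
      v ∈ lengthSet a b Φ D ∧ (ζ = vecRoot a b wp e wm θ v ∨ ζ = vecRoot a b wp e wm (-θ) v)) →
      m ζ = ∑ v ∈ Y, ratVal Φ v) {s : ℤ} {P : ℤ × Set ℚ_[p]}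
    (hZ : ∃ Z : Finset ℂ_[p], (∀ ζ ∈ Z, ζ ∈ part p s P) ∧
      (∀ ζ ∈ part p s P, ζ ∉ Z → m ζ = 0) ∧ ∑ ζ ∈ Z, m ζ = 0)
    {X : Finset (Vec ℚ)} (hX : ∀ v, v ∈ X ↔ v ∈ lengthSet a b Φ D ∧
      lab p s (vecRoot a b wp e wm θ v) = P) :
    ∑ v ∈ X, ratVal Φ v = 0 ∧
    ∏ᶠ ζ ∈ part p s P, ζ ^ (-m ζ) = ∏ v ∈ X, ι (cM v / cP v) ^ ratVal Φ v := by
  classical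
  set r₁ := vecRoot a b wp e wm θ with hr₁
  set r₂ := vecRoot a b wp e wm (-θ) with hr₂
  set Z' := X.image r₁ ∪ X.image r₂ with hZ'
  have hL : ∀ v ∈ X, v ∈ lengthSet a b Φ D := fun v hv => ((hX v).1 hv).1
  have hp1 : ∀ v ∈ X, r₁ v ∈ Z' := fun v hv =>
    Finset.mem_union_left _ (Finset.mem_image_of_mem _ hv)
  have hp2 : ∀ v ∈ X, r₂ v ∈ Z' := fun v hv =>
    Finset.mem_union_right _ (Finset.mem_image_of_mem _ hv)
  have hZp : ∀ ζ ∈ Z', ζ ∈ part (F := ℂ_[p]) p s P := by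
    intro ζ hζ
    rcases Finset.mem_union.1 hζ with h1 | h1
    · obtain ⟨v, hv, rfl⟩ := Finset.mem_image.1 h1
      exact ⟨H.root_irrat (hL v hv), ((hX v).1 hv).2⟩
    · obtain ⟨v, hv, rfl⟩ := Finset.mem_image.1 h1
      exact ⟨H.neg.root_irrat (hL v hv), (H.lab_root_neg s (hL v hv)).trans ((hX v).1 hv).2⟩
  have hmX : ∀ ζ ∈ part (F := ℂ_[p]) p s P, m ζ = ∑ v ∈ X,
      ((if ζ = r₁ v then ratVal Φ v else 0) + if ζ = r₂ v then ratVal Φ v else 0) := by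
    intro ζ hζ
    rw [hm ζ hζ.1 {v ∈ X | ζ = r₁ v ∨ ζ = r₂ v}, Finset.sum_filter]
    · refine Finset.sum_congr rfl fun v hv => ?_
      have := H.root_ne_root_neg (hL v hv)
      by_cases h1 : ζ = r₁ v
      · have h2 : ζ ≠ r₂ v := by rw [h1]; exact this
        rw [if_pos (Or.inl h1), if_pos h1, if_neg h2, add_zero]
      · by_cases h2 : ζ = r₂ v
        · rw [if_pos (Or.inr h2), if_neg h1, if_pos h2, zero_add]
        · rw [if_neg (by tauto), if_neg h1, if_neg h2, add_zero]
    · intro v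
      rw [Finset.mem_filter, hX]
      refine ⟨fun h => ⟨h.1.1, h.2⟩, fun h => ⟨⟨h.1, ?_⟩, h.2⟩⟩
      rcases h.2 with h2 | h2
      · rw [← h2]; exact hζ.2
      · rw [← H.lab_root_neg s h.1, ← hζ.2, h2]
  have hm0 : ∀ ζ ∈ part (F := ℂ_[p]) p s P, ζ ∉ Z' → m ζ = 0 := by
    intro ζ hζ h0
    rw [hmX ζ hζ]
    refine Finset.sum_eq_zero fun v hv => ?_
    rw [if_neg (by rintro rfl; exact h0 (hp1 v hv)), if_neg (by rintro rfl; exact h0 (hp2 v hv)),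
      add_zero]
  have hsum : ∑ v ∈ X, ratVal Φ v = 0 := by
    obtain ⟨Z, hZ1, hZ2, hZ3⟩ := hZ
    have h1 : ∑ ζ ∈ Z', m ζ = 0 := by
      rw [← hZ3, Finset.sum_subset (Finset.subset_union_left : Z' ⊆ Z' ∪ Z),
        Finset.sum_subset (Finset.subset_union_right : Z ⊆ Z' ∪ Z)]
      · intro ζ hζ h0
        exact hZ2 ζ (hZp ζ ((Finset.mem_union.1 hζ).resolve_right h0)) h0
      · intro ζ hζ h0
        exact hm0 ζ (hZ1 ζ ((Finset.mem_union.1 hζ).resolve_left h0)) h0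
    rw [Finset.sum_congr rfl fun ζ hζ => hmX ζ (hZp ζ hζ), Finset.sum_comm] at h1
    rw [Finset.sum_congr rfl (g := fun v => 2 * ratVal Φ v) fun v hv => by
      rw [Finset.sum_add_distrib, Finset.sum_ite_eq', Finset.sum_ite_eq', if_pos (hp1 v hv),
        if_pos (hp2 v hv), two_mul], ← Finset.mul_sum] at h1
    omega
  refine ⟨hsum, ?_⟩
  rw [finprod_mem_eq_prod_of_inter_mulSupport_eq (t := Z')]
  · have h1 : ∀ ζ ∈ Z', ζ ^ (-m ζ) = ∏ v ∈ X, ((if ζ = r₁ v then ζ ^ (-ratVal Φ v) else 1) *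
        if ζ = r₂ v then ζ ^ (-ratVal Φ v) else 1) := by
      intro ζ hζ
      have hζ0 : ζ ≠ 0 := fun h0 => (hZp ζ hζ).1 0 (by rw [map_zero, h0])
      rw [hmX ζ (hZp ζ hζ), ← Finset.sum_neg_distrib, zpow_sum_of_ne _ _ hζ0]
      refine Finset.prod_congr rfl fun v hv => ?_
      rw [neg_add, zpow_add₀ hζ0]
      split_ifs <;> simp
    rw [Finset.prod_congr rfl h1, Finset.prod_comm]
    have h2 : ∀ v ∈ X, (∏ ζ ∈ Z', ((if ζ = r₁ v then ζ ^ (-ratVal Φ v) else 1) *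
        if ζ = r₂ v then ζ ^ (-ratVal Φ v) else 1)) =
        ι (-(pairing a b wp wm / quadForm a b e)) ^ (-ratVal Φ v) *
          ι (cM v / cP v) ^ ratVal Φ v := by
      intro v hv
      rw [Finset.prod_mul_distrib, Finset.prod_ite_eq', Finset.prod_ite_eq', if_pos (hp1 v hv),
        if_pos (hp2 v hv), ← mul_zpow, H.root_mul (hL v hv), mul_zpow, inv_zpow', neg_neg]
    have hc : ι (-(pairing a b wp wm / quadForm a b e)) ≠ 0 := (map_ne_zero _).2
      (neg_ne_zero.2 (div_ne_zero H.unit.frame.pair_ne H.unit.frame.quad_e_ne))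
    rw [Finset.prod_congr rfl h2, Finset.prod_mul_distrib, ← zpow_sum_of_ne _ _ hc,
      Finset.sum_neg_distrib, hsum, neg_zero, zpow_zero, one_mul]
  · ext ζ
    simp only [Set.mem_inter_iff, Finset.mem_coe, Function.mem_mulSupport]
    constructor
    · rintro ⟨h1, h2⟩
      refine ⟨?_, h2⟩
      by_contra h0
      rw [hm0 ζ h1 h0] at h2
      simp at h2
    · rintro ⟨h1, h2⟩
      exact ⟨hZp ζ h1, h2⟩

end IsLengthData

end Roots

section Window

variable {a b : ℚ} {p : ℕ} [Fact p.Prime] {wp e wm : Vec ℚ_[p]}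

local notation "ι" => algebraMap ℚ_[p] ℂ_[p]
local notation "cP" => fun v => coordP a b wp e wm (toQp p v)
local notation "cE" => fun v => coordE a b wp e wm (toQp p v)
local notation "cM" => fun v => coordM a b wp e wm (toQp p v)
local notation "root" => vecRoot a b wp e wm

variable (a b wp e wm) in
/-- The vectors whose roots belong to a part of level between `0` and `2 t` and of bounded
depth. -/
def window (Φ : Vec (AdeleAway p) → ℤ) (D : ℚ) (θ : ℂ_[p]) (t : ℕ) (s : ℤ) (n : ℕ) :
    Set (Vec ℚ) :=
  {v ∈ lengthSet a b Φ D | (0 ≤ lev p s (root θ v) ∧ lev p s (root θ v) < 2 * t) ∧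
    ‖cE v / cM v‖ ≤ (p : ℝ) ^ (n - lev p s (root θ v))}

namespace IsLengthData

variable {Φ : Vec (AdeleAway p) → ℤ} {D : ℚ} {θ : ℂ_[p]}
  (H : IsLengthData a b wp e wm Φ D θ)
include H

theorem finite_lev (s ℓ : ℤ) (T : ℝ) : {v ∈ lengthSet a b Φ D |
    lev p s (root θ v) = ℓ ∧ ‖cE v / cM v‖ ≤ T}.Finite := by
  have hθ := norm_pos_iff.2 H.theta_ne
  have hpos := fun n : ℤ => p_zpow_pos (p := p) n
  set B := ‖θ‖ * (p : ℝ) ^ (ℓ + 1) with hB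
  refine (H.finite_of_bounds (c := ‖θ‖ * (p : ℝ) ^ (ℓ - 1)) (T := max B (T * B))
    (mul_pos hθ (hpos _))).subset ?_
  rintro v ⟨hv, h1, h2⟩
  have hM := norm_pos_iff.2 (H.coordM_ne hv)
  have h3 := (H.isLev_root s hv).bounds
  rw [h1, lt_div_iff₀ hM, div_lt_iff₀ hM] at h3
  have e1 : (p : ℝ) ^ (-ℓ - 1) * (p : ℝ) ^ (ℓ + 1) = 1 := by
    rw [← zpow_add₀ p_pos.ne']; simp
  have e2 : (p : ℝ) ^ (1 - ℓ) * (p : ℝ) ^ (ℓ - 1) = 1 := by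
    rw [← zpow_add₀ p_pos.ne']; simp
  have h4 : ‖cM v‖ ≤ B := by
    calc ‖cM v‖ = ((p : ℝ) ^ (-ℓ - 1) * ‖cM v‖) * (p : ℝ) ^ (ℓ + 1) := by
          rw [mul_right_comm, e1, one_mul]
      _ ≤ B := mul_le_mul_of_nonneg_right h3.1.le (hpos _).le
  refine ⟨hv, ?_, le_max_of_le_left h4, le_max_of_le_right ?_⟩
  · calc ‖θ‖ * (p : ℝ) ^ (ℓ - 1) ≤ ((p : ℝ) ^ (1 - ℓ) * ‖cM v‖) * (p : ℝ) ^ (ℓ - 1) :=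
          mul_le_mul_of_nonneg_right h3.2.le (hpos _).le
      _ = ‖cM v‖ := by rw [mul_right_comm, e2, one_mul]
  · rw [norm_div, div_le_iff₀ hM] at h2
    exact h2.trans (mul_le_mul_of_nonneg_left h4
      (nonneg_of_mul_nonneg_left ((norm_nonneg _).trans h2) hM))

theorem finite_window (t : ℕ) (s : ℤ) (n : ℕ) : (window a b wp e wm Φ D θ t s n).Finite := by
  refine ((Finset.Ico (0 : ℤ) (2 * t)).finite_toSet.biUnion fun ℓ _ =>
    H.finite_lev s ℓ ((p : ℝ) ^ (n - ℓ))).subset ?_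
  rintro v ⟨hv, h1, h2⟩
  simp only [Set.mem_iUnion]
  exact ⟨_, Finset.mem_coe.2 (Finset.mem_Ico.2 h1), hv, rfl, h2⟩

theorem lab_congr {s : ℤ} {v w : Vec ℚ} (hv : v ∈ lengthSet a b Φ D) (hw : w ∈ lengthSet a b Φ D)
    (h : lab p s (root θ v) = lab p s (root θ w)) :
    lev p s (root θ v) = lev p s (root θ w) ∧
      ‖cE v / cM v - cE w / cM w‖ ≤ (p : ℝ) ^ (-lev p s (root θ w)) := by
  have h1 : lev p s (root θ v) = lev p s (root θ w) := congrArg Prod.fst h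
  refine ⟨h1, norm_le_zpow_of_lt ?_⟩
  rw [H.lab_root hv (H.isLev_root s hv), H.lab_root hw (H.isLev_root s hw)] at h
  have h2 : cE w / cM w ∈ {c : ℚ_[p] | ‖cE v / cM v - c‖ <
      (p : ℝ) ^ (1 - lev p s (root θ v))} := by
    refine (Set.ext_iff.1 (congrArg Prod.snd h) _).2 ?_
    change ‖_‖ < _
    rw [sub_self, norm_zero]
    exact p_zpow_pos _
  rw [← h1, neg_add_eq_sub]
  exact h2

theorem depth_congr {s : ℤ} {v w : Vec ℚ} (hv : v ∈ lengthSet a b Φ D)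
    (hw : w ∈ lengthSet a b Φ D) (h : lab p s (root θ v) = lab p s (root θ w)) {n : ℕ}
    (hn : ‖cE w / cM w‖ ≤ (p : ℝ) ^ (n - lev p s (root θ w))) :
    ‖cE v / cM v‖ ≤ (p : ℝ) ^ (n - lev p s (root θ v)) := by
  obtain ⟨h1, h2⟩ := H.lab_congr hv hw h
  rw [h1, show cE v / cM v = (cE v / cM v - cE w / cM w) + cE w / cM w by ring]
  refine (IsUltrametricDist.norm_add_le_max _ _).trans (max_le (h2.trans ?_) hn)
  rw [p_zpow_le]
  omega

theorem sum_saturated {s : ℤ} (hP : ∀ (P : ℤ × Set ℚ_[p]) (X : Finset (Vec ℚ)), (∀ v, v ∈ X ↔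
      v ∈ lengthSet a b Φ D ∧ lab p s (root θ v) = P) → ∑ v ∈ X, ratVal Φ v = 0)
    (A : Finset (Vec ℚ)) (hA : ∀ v ∈ A, v ∈ lengthSet a b Φ D)
    (hsat : ∀ v ∈ lengthSet a b Φ D, ∀ w ∈ A,
      lab p s (root θ v) = lab p s (root θ w) → v ∈ A) :
    ∑ v ∈ A, ratVal Φ v = 0 := by
  classical
  rw [← Finset.sum_fiberwise_of_maps_to (t := A.image fun v => lab p s (root θ v))
    (g := fun v => lab p s (root θ v)) (fun v hv => Finset.mem_image_of_mem _ hv)]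
  refine Finset.sum_eq_zero fun P hP' => ?_
  obtain ⟨w, hw, rfl⟩ := Finset.mem_image.1 hP'
  refine hP (lab p s (root θ w)) _ fun v => ?_
  rw [Finset.mem_filter]
  exact ⟨fun h => ⟨hA v h.1, h.2⟩, fun h => ⟨hsat v h.1 w hw h.2, h.2⟩⟩

theorem tendsto_window {s : ℤ} {t : ℕ} {g : ℤ × Set ℚ_[p] → ℂ_[p]} {J : ℂ_[p]}
    (hJ : HasProd (fun P : FundLabel p t => g P.1) J)
    (hg : ∀ (P : ℤ × Set ℚ_[p]) (X : Finset (Vec ℚ)), (∀ v, v ∈ X ↔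
      v ∈ lengthSet a b Φ D ∧ lab p s (root θ v) = P) →
      g P = ∏ v ∈ X, ι (cM v / cP v) ^ ratVal Φ v) :
    Tendsto (fun n : ℕ => ι (∏ᶠ v ∈ window a b wp e wm Φ D θ t s n, (cM v / cP v) ^ ratVal Φ v))
      atTop (𝓝 J) := by
  classical
  set W := fun n => (H.finite_window t s n).toFinset with hW
  have hmW : ∀ n v, v ∈ W n ↔ v ∈ window a b wp e wm Φ D θ t s n := fun n v => by
    rw [hW, Set.Finite.mem_toFinset]
  set A : ℕ → Finset (FundLabel p t) := fun n =>
    ((W n).image fun v => lab p s (root θ v)).subtype _ with hA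
  have hAg : ∀ n, ∏ P ∈ A n, g P.1 =
      ι (∏ᶠ v ∈ window a b wp e wm Φ D θ t s n, (cM v / cP v) ^ ratVal Φ v) := by
    intro n
    rw [finprod_mem_eq_finite_toFinset_prod _ (H.finite_window t s n), map_prod]
    change _ = ∏ v ∈ W n, _
    rw [hA]
    simp only
    rw [Finset.prod_subtype_of_mem (fun P => g P), ← Finset.prod_fiberwise_of_maps_to
      (t := (W n).image fun v => lab p s (root θ v)) (g := fun v => lab p s (root θ v))
      (s := W n) (fun v hv => Finset.mem_image_of_mem _ hv)]
    · refine Finset.prod_congr rfl fun P hP => ?_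
      obtain ⟨w, hw, rfl⟩ := Finset.mem_image.1 hP
      rw [hg _ {v ∈ W n | lab p s (root θ v) = lab p s (root θ w)}]
      · exact Finset.prod_congr rfl fun v _ => (map_zpow₀ ι _ _).symm
      · intro v
        rw [Finset.mem_filter, hmW]
        refine ⟨fun h => ⟨h.1.1, h.2⟩, fun h => ⟨⟨h.1, ?_, ?_⟩, h.2⟩⟩
        · rw [(H.lab_congr h.1 ((hmW n w).1 hw).1 h.2).1]
          exact ((hmW n w).1 hw).2.1
        · exact H.depth_congr h.1 ((hmW n w).1 hw).1 h.2 ((hmW n w).1 hw).2.2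
    · intro P hP
      obtain ⟨w, hw, rfl⟩ := Finset.mem_image.1 hP
      exact ((hmW n w).1 hw).2.1
  rw [tendsto_def]
  intro U hU
  obtain ⟨S, hS⟩ := mem_atTop_sets.1 (hJ hU)
  have hev : ∀ᶠ n in atTop, ∀ P ∈ S, g P.1 ≠ 1 → P ∈ A n := by
    rw [eventually_all_finset]
    intro P _
    rcases Set.eq_empty_or_nonempty {v ∈ lengthSet a b Φ D | lab p s (root θ v) = P.1} with h | h
    · refine Eventually.of_forall fun n hP => (hP ?_).elim
      rw [hg P.1 ∅, Finset.prod_empty]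
      intro v
      simp only [Finset.notMem_empty, false_iff]
      exact Set.eq_empty_iff_forall_notMem.1 h v
    · obtain ⟨w, hw, hP⟩ := h
      filter_upwards [(tendsto_pow_atTop_atTop_of_one_lt (one_lt_p (p := p))).eventually_ge_atTop
        (‖cE w / cM w‖ * (p : ℝ) ^ lev p s (root θ w))] with n hn _
      rw [hA, Finset.mem_subtype, Finset.mem_image]
      refine ⟨w, (hmW n w).2 ⟨hw, ?_, ?_⟩, hP⟩
      · have := P.2
        rwa [← hP] at this
      · rw [zpow_sub₀ p_pos.ne', le_div_iff₀ (p_zpow_pos _), zpow_natCast]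
        exact hn
  filter_upwards [hev] with n hn
  have h1 := hS (A n ∪ S) Finset.subset_union_right
  change ∏ P ∈ A n ∪ S, g P.1 ∈ U at h1
  rw [← Finset.prod_subset (Finset.subset_union_left : A n ⊆ A n ∪ S)] at h1
  · change ι _ ∈ U
    rwa [← hAg]
  · intro P hP h0
    by_contra hcon
    exact h0 (hn P ((Finset.mem_union.1 hP).resolve_left h0) hcon)

end IsLengthData

end Window

/-! ### Products over fundamental domains -/

section Periodic

theorem prod_range_add_of_periodic {A : Type*} [CommMonoid A] {f : ℤ → A} {k : ℕ}
    (hf : ∀ z, f (z + k) = f z) (x : ℤ) :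
    ∏ j ∈ Finset.range k, f (x + j) = ∏ j ∈ Finset.range k, f j := by
  have step : ∀ x : ℤ, ∏ j ∈ Finset.range k, f (x + 1 + j) = ∏ j ∈ Finset.range k, f (x + j) := by
    intro x
    cases k with
    | zero => rfl
    | succ k =>
      rw [Finset.prod_range_succ, Finset.prod_range_succ', ← hf (x + (0 : ℕ))]
      congr 1
      · exact Finset.prod_congr rfl fun j _ => congrArg f (by push_cast; ring)
      · exact congrArg f (by push_cast; ring)
  have key : ∀ x : ℤ, ∏ j ∈ Finset.range k, f (x + j) = ∏ j ∈ Finset.range k, f (0 + j) := by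
    intro x
    induction x with
    | zero => rfl
    | succ n ih => rw [step, ih]
    | pred n ih => rw [← ih, ← step (-n - 1), sub_add_cancel]
  rw [key x]
  simp

variable {Y Λ A : Type*} [CommMonoid A] {r : Y → ℤ} {l : Y → Λ} {F : Y → A} {k : ℕ}

theorem finprod_level (hfin : ∀ ρ δ, {y | r y = ρ ∧ l y = δ}.Finite) (I : Finset Λ) (x : Λ → ℤ) :
    {y | r y = x (l y) ∧ l y ∈ I}.Finite ∧ ∏ᶠ y ∈ {y | r y = x (l y) ∧ l y ∈ I}, F y =
      ∏ δ ∈ I, ∏ᶠ y ∈ {y | r y = x δ ∧ l y = δ}, F y := by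
  have h1 : {y | r y = x (l y) ∧ l y ∈ I} = ⋃ δ ∈ (I : Set Λ), {y | r y = x δ ∧ l y = δ} := by
    ext y
    simp only [Set.mem_ofPred_eq, Set.mem_iUnion, Finset.mem_coe, exists_prop]
    constructor
    · rintro ⟨h1, h2⟩
      exact ⟨_, h2, h1, rfl⟩
    · rintro ⟨_, h2, h1, rfl⟩
      exact ⟨h1, h2⟩
  rw [h1, finprod_mem_biUnion _ I.finite_toSet fun δ _ => hfin (x δ) δ, finprod_mem_coe_finset]
  · exact ⟨I.finite_toSet.biUnion fun δ _ => hfin (x δ) δ, rfl⟩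
  · intro δ _ δ' _ hne
    exact Set.disjoint_left.2 fun y h2 h3 => hne (h2.2.symm.trans h3.2)

theorem finprod_fundamental (hfin : ∀ ρ δ, {y | r y = ρ ∧ l y = δ}.Finite)
    (hper : ∀ ρ δ, ∏ᶠ y ∈ {y | r y = ρ + k ∧ l y = δ}, F y = ∏ᶠ y ∈ {y | r y = ρ ∧ l y = δ}, F y)
    (I : Finset Λ) (x : Λ → ℤ) :
    ∏ j ∈ Finset.range k, ∏ᶠ y ∈ {y | r y = x (l y) + j ∧ l y ∈ I}, F y =
      ∏ᶠ y ∈ {y | (0 ≤ r y ∧ r y < k) ∧ l y ∈ I}, F y := by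
  have h1 : {y | (0 ≤ r y ∧ r y < k) ∧ l y ∈ I} =
      ⋃ j ∈ (Finset.range k : Set ℕ), {y | r y = j ∧ l y ∈ I} := by
    ext y
    simp only [Set.mem_ofPred_eq, Set.mem_iUnion, Finset.mem_coe, exists_prop, Finset.mem_range]
    constructor
    · rintro ⟨⟨h1, h2⟩, h3⟩
      exact ⟨(r y).toNat, by omega, by omega, h3⟩
    · rintro ⟨j, hj, h1, h2⟩
      exact ⟨by omega, h2⟩
  rw [h1, finprod_mem_biUnion (t := fun j : ℕ => {y | r y = j ∧ l y ∈ I}) _ (Finset.finite_toSet _)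
    fun j _ => (finprod_level (F := F) hfin I fun _ => (j : ℤ)).1, finprod_mem_coe_finset]
  · rw [Finset.prod_congr rfl fun (j : ℕ) _ => (finprod_level hfin I fun δ => x δ + j).2,
      Finset.prod_congr (s₁ := Finset.range k) rfl
        fun (j : ℕ) _ => (finprod_level hfin I fun _ => (j : ℤ)).2, Finset.prod_comm,
      Finset.prod_comm (s := Finset.range k)]
    refine Finset.prod_congr rfl fun δ _ => ?_
    exact prod_range_add_of_periodic (f := fun ρ => ∏ᶠ y ∈ {y | r y = ρ ∧ l y = δ}, F y)
      (fun ρ => hper ρ δ) (x δ)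
  · intro j _ j' _ hne
    exact Set.disjoint_left.2 fun y h2 h3 => hne (by
      have := h2.1.symm.trans h3.1
      exact_mod_cast this)

theorem finprod_periodic {K : Type*} [NormedField K] [IsUltrametricDist K] {f : Y → K} {Ψ : Y → ℤ} {c : K} (T : Y ≃ Y)
    (hT : ∀ y, Ψ (T y) = Ψ y ∧ r (T y) = r y - k ∧ l (T y) = l y) (hf : ∀ y, f (T y) = c * f y)
    (hc : c ≠ 0) (hfin : ∀ ρ δ, {y | r y = ρ ∧ l y = δ}.Finite)
    (h : c = 1 ∨ ∀ ρ δ, ∑ᶠ y ∈ {y | r y = ρ ∧ l y = δ}, Ψ y = 0) (ρ : ℤ) (δ : Λ) :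
    ∏ᶠ y ∈ {y | r y = ρ + k ∧ l y = δ}, f y ^ Ψ y =
      ∏ᶠ y ∈ {y | r y = ρ ∧ l y = δ}, f y ^ Ψ y := by
  have h1 : ∏ᶠ y ∈ {y | r y = ρ + k ∧ l y = δ}, c ^ Ψ y * f y ^ Ψ y =
      ∏ᶠ y ∈ {y | r y = ρ ∧ l y = δ}, f y ^ Ψ y := by
    refine finprod_mem_eq_of_bijOn T ⟨?_, T.injective.injOn, ?_⟩ ?_
    · rintro y ⟨h1, h2⟩
      obtain ⟨-, h3, h4⟩ := hT y
      exact ⟨by omega, h4.trans h2⟩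
    · rintro y ⟨h1, h2⟩
      obtain ⟨-, h3, h4⟩ := hT (T.symm y)
      rw [T.apply_symm_apply] at h3 h4
      exact ⟨T.symm y, ⟨by omega, h4.symm.trans h2⟩, T.apply_symm_apply y⟩
    · intro y _
      rw [hf, (hT y).1, mul_zpow]
  rw [← h1, finprod_mem_mul_distrib (hfin _ _)]
  rcases h with rfl | h
  · simp
  · rw [finprod_mem_eq_finite_toFinset_prod (fun y => c ^ Ψ y) (hfin (ρ + k) δ),
      ← zpow_sum_of_ne _ _ hc, ← finsum_mem_eq_finite_toFinset_sum Ψ (hfin (ρ + k) δ), h,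
      zpow_zero, one_mul]

end Periodic

section Levels

variable {a b : ℚ} {p : ℕ} [Fact p.Prime] {wp e wm : Vec ℚ_[p]}

local notation "cP" v:max => coordP a b wp e wm (toQp p v)
local notation "cE" v:max => coordE a b wp e wm (toQp p v)
local notation "cM" v:max => coordM a b wp e wm (toQp p v)
local notation "root" => vecRoot a b wp e wm

variable (a b) in
/-- Pairs consisting of a vector of length `D` in the support of `Φ` and an index. -/
abbrev LevelIdx (Φ : Vec (AdeleAway p) → ℤ) (D : ℚ) (o : ℕ) : Type := lengthSet a b Φ D × Fin (o + 1)

variable {Φ : Vec (AdeleAway p) → ℤ} {D : ℚ} {o : ℕ}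

variable (wp e wm) in
/-- The level. -/
def idxLevel (y : LevelIdx a b Φ D o) : ℤ := -(cM y.1.1).valuation + y.2

variable (wp e wm) in
/-- The depth. -/
def idxDepth (y : LevelIdx a b Φ D o) : ℕ := sInf {n : ℕ | ‖cE y.1.1‖ ≤ (p : ℝ) ^ ((n : ℤ) - y.2)}

variable (wp e wm) in
/-- The index seen from the other end of the axis. -/
def idxFlip (y : LevelIdx a b Φ D o) : Fin (o + 1) :=
  if ‖cE y.1.1‖ < 1 then Fin.rev y.2 else y.2

theorem idxDepth_le_iff (y : LevelIdx a b Φ D o) (n : ℕ) :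
    idxDepth wp e wm y ≤ n ↔ ‖cE y.1.1‖ ≤ (p : ℝ) ^ ((n : ℤ) - y.2) := by
  have hne : {n : ℕ | ‖cE y.1.1‖ ≤ (p : ℝ) ^ ((n : ℤ) - y.2)}.Nonempty := by
    obtain ⟨n, hn⟩ := pow_unbounded_of_one_lt
      (‖cE y.1.1‖ * (p : ℝ) ^ (y.2 : ℕ)) (one_lt_p (p := p))
    refine ⟨n, ?_⟩
    rw [Set.mem_ofPred_eq, zpow_sub₀ p_pos.ne', zpow_natCast, zpow_natCast, le_div_iff₀ (pow_pos p_pos _)]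
    exact hn.le
  constructor
  · intro h
    have h1 : ‖cE y.1.1‖ ≤ (p : ℝ) ^ ((idxDepth wp e wm y : ℤ) - y.2) := Nat.sInf_mem hne
    exact h1.trans (p_zpow_le.2 (by omega))
  · intro h
    exact Nat.sInf_le h

theorem idxFlip_val (y : LevelIdx a b Φ D o) :
    (‖cE y.1.1‖ < 1 → ((idxFlip wp e wm y : ℕ) : ℤ) = o - y.2) ∧
      (1 ≤ ‖cE y.1.1‖ → idxFlip wp e wm y = y.2) := by
  constructor
  · intro h
    rw [idxFlip, if_pos h, Fin.val_rev]
    omega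
  · intro h
    rw [idxFlip, if_neg (not_lt.2 h)]

theorem idxFlip_idxFlip (v : lengthSet a b Φ D) (i : Fin (o + 1)) :
    idxFlip wp e wm (v, idxFlip wp e wm (v, i)) = i := by
  rw [idxFlip, idxFlip]
  split_ifs <;> simp

theorem depth_eq_zero (ho : o ≤ 1) (y : LevelIdx a b Φ D o) (h : ‖cE y.1.1‖ < 1) :
    idxDepth wp e wm y = 0 := by
  rw [← Nat.le_zero, idxDepth_le_iff]
  refine (norm_le_p_inv h).trans ?_
  rw [← zpow_neg_one, p_zpow_le]
  omega

theorem norm_coordE_eq (y : LevelIdx a b Φ D o) (h : 1 ≤ ‖cE y.1.1‖) :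
    ‖cE y.1.1‖ = (p : ℝ) ^ ((idxDepth wp e wm y : ℤ) - y.2) := by
  obtain ⟨n, hn⟩ := norm_zpow_of_ne (p := p) (b := cE y.1.1)
    (norm_pos_iff.1 (zero_lt_one.trans_le h))
  have h0 : 0 ≤ n := by
    rw [hn, ← zpow_zero (p : ℝ), p_zpow_le] at h
    exact h
  have h1 := (idxDepth_le_iff (wp := wp) (e := e) (wm := wm) y _).1 le_rfl
  have h2 := (idxDepth_le_iff (wp := wp) (e := e) (wm := wm) y (n + y.2).toNat).2 (by
    rw [hn, p_zpow_le]; omega)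
  rw [hn, p_zpow_le] at h1
  rw [hn]
  congr 1
  omega

namespace IsLengthData

variable {θ : ℂ_[p]} (H : IsLengthData a b wp e wm Φ D θ) (ho : o ≤ 1)
  (hD : ‖(D : ℚ_[p])‖ = (p : ℝ) ^ (-(o : ℤ)))
include H

theorem norm_coordM_eq (y : LevelIdx a b Φ D o) :
    ‖cM y.1.1‖ = (p : ℝ) ^ (idxLevel wp e wm y - y.2) := by
  rw [Padic.norm_eq_zpow_neg_valuation (H.coordM_ne y.1.2), idxLevel, add_sub_cancel_right]

include ho hD in
theorem norm_coordP_eq (y : LevelIdx a b Φ D o) : ‖cP y.1.1‖ =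
    (p : ℝ) ^ (2 * (idxDepth wp e wm y : ℤ) - idxLevel wp e wm y - idxFlip wp e wm y) := by
  have h1 := H.norm_coord_mul y.1.2
  simp only at h1
  rw [H.norm_coordM_eq y, hD, ← eq_div_iff (p_zpow_pos _).ne'] at h1
  rw [h1]
  obtain ⟨f1, f2⟩ := idxFlip_val (wp := wp) (e := e) (wm := wm) y
  rcases lt_or_ge ‖cE y.1.1‖ 1 with h | h
  · rw [depth_eq_zero ho y h, f1 h, max_eq_left, ← zpow_sub₀ p_pos.ne']
    · congr 1; push_cast; ring
    · calc ‖cE y.1.1‖ ^ 2 ≤ ((p : ℝ) ^ (-1 : ℤ)) ^ 2 := by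
            gcongr
            rw [zpow_neg_one]
            exact norm_le_p_inv h
        _ = (p : ℝ) ^ (-2 : ℤ) := by rw [← zpow_natCast, ← zpow_mul]; rfl
        _ ≤ _ := p_zpow_le.2 (by omega)
  · rw [f2 h, max_eq_right, norm_coordE_eq y h, ← zpow_natCast, ← zpow_mul,
      ← zpow_sub₀ p_pos.ne']
    · congr 1; push_cast; ring
    · refine le_trans ?_ (one_le_pow₀ h)
      rw [← zpow_zero (p : ℝ), p_zpow_le]
      omega

theorem depth_le_iff_window (y : LevelIdx a b Φ D o) (n : ℕ) : idxDepth wp e wm y ≤ n ↔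
    ‖cE y.1.1 / cM y.1.1‖ ≤ (p : ℝ) ^ ((n : ℤ) - idxLevel wp e wm y) := by
  rw [idxDepth_le_iff, norm_div, H.norm_coordM_eq, div_le_iff₀ (p_zpow_pos _),
    ← zpow_add₀ p_pos.ne', sub_add_sub_cancel]

include ho hD in
theorem lev_eq_idxLevel {s : ℤ} (y : LevelIdx a b Φ D o)
    (hs : Even (idxLevel wp e wm y + s) ∨ o = 0) :
    lev p s (root θ y.1.1) = idxLevel wp e wm y := by
  refine lev_eq ?_
  rw [H.rho_root y.1.2]
  simp only
  have h1 := H.norm_theta_sq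
  rw [hD] at h1
  rw [H.norm_coordM_eq y]
  have hlt := y.2.2
  obtain rfl | rfl : o = 0 ∨ o = 1 := by omega
  · have h2 : ‖θ‖ = 1 := by
      rw [Nat.cast_zero, neg_zero, zpow_zero] at h1
      exact (pow_eq_one_iff_of_nonneg (norm_nonneg _) two_ne_zero).1 h1
    have h3 : ((y.2 : ℕ) : ℤ) = 0 := by omega
    rw [h2, h3, sub_zero, one_div, ← zpow_neg]
    by_cases he : Even (idxLevel wp e wm y + s)
    · exact Or.inl ⟨he, p_zpow_lt.2 (by omega), p_zpow_lt.2 (by omega)⟩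
    · exact Or.inr ⟨he, rfl⟩
  · have he := hs.resolve_right one_ne_zero
    have hθ := norm_pos_iff.2 H.theta_ne
    have hp := one_lt_p (p := p)
    have e1 : (p : ℝ) ^ (-((1 : ℕ) : ℤ)) = (p : ℝ)⁻¹ := by simp
    rw [e1] at h1
    have h2 : ‖θ‖ < 1 := by
      by_contra hcon
      have : 1 ≤ ‖θ‖ ^ 2 := one_le_pow₀ (not_lt.1 hcon)
      rw [h1] at this
      exact absurd (inv_lt_one_of_one_lt₀ hp) (not_lt.2 this)
    have h3 : (p : ℝ)⁻¹ < ‖θ‖ := by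
      rw [← h1, sq]
      nlinarith
    refine Or.inl ⟨he, ?_, ?_⟩
    · rw [lt_div_iff₀ (p_zpow_pos _), ← zpow_add₀ p_pos.ne']
      refine lt_of_le_of_lt ?_ h3
      rw [← zpow_neg_one, p_zpow_le]
      omega
    · rw [div_lt_iff₀ (p_zpow_pos _), ← zpow_add₀ p_pos.ne']
      refine h2.trans_le ?_
      rw [← zpow_zero (p : ℝ), p_zpow_le]
      omega

omit H in
include ho in
theorem _root_.HeegnerTheta.exists_idx (s : ℤ) (v : lengthSet a b Φ D) :
    ∃ i : Fin (o + 1), Even (idxLevel wp e wm (v, i) + s) ∨ o = 0 := by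
  obtain rfl | rfl : o = 0 ∨ o = 1 := by omega
  · exact ⟨0, Or.inr rfl⟩
  · by_cases h : Even (-(cM v.1).valuation + s)
    · refine ⟨0, Or.inl ?_⟩
      simpa [idxLevel] using h
    · refine ⟨1, Or.inl ?_⟩
      have h1 : idxLevel wp e wm (v, (1 : Fin 2)) + s = (-(cM v.1).valuation + s) + 1 := by
        simp [idxLevel]; ring
      rw [h1, Int.even_add_one]
      exact h

omit H in
theorem _root_.HeegnerTheta.idx_ext {y y' : LevelIdx a b Φ D o} (h : y.1.1 = y'.1.1)
    (hr : idxLevel wp e wm y = idxLevel wp e wm y') : y = y' := by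
  have h1 : y.1 = y'.1 := Subtype.ext h
  refine Prod.ext h1 (Fin.ext ?_)
  rw [idxLevel, idxLevel, h1] at hr
  omega

include ho hD in
theorem finite_idx (ρ : ℤ) (δ : ℕ) :
    {y : LevelIdx a b Φ D o | idxLevel wp e wm y = ρ ∧ idxDepth wp e wm y = δ}.Finite := by
  refine (((H.finite_lev ρ ρ ((p : ℝ) ^ (δ - ρ))).preimage
    Subtype.val_injective.injOn).prod Set.finite_univ).subset ?_
  rintro y ⟨h1, h2⟩
  refine ⟨⟨y.1.2, ?_, ?_⟩, Set.mem_univ _⟩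
  · rw [H.lev_eq_idxLevel ho hD y (Or.inl (by rw [h1]; exact ⟨ρ, rfl⟩)), h1]
  · have := (H.depth_le_iff_window y δ).1 h2.le
    rwa [h1] at this

include ho hD in
theorem sum_idx {ρ s : ℤ} (hs : Even (ρ + s) ∨ o = 0) (hP : ∀ (P : ℤ × Set ℚ_[p])
      (X : Finset (Vec ℚ)), (∀ v, v ∈ X ↔ v ∈ lengthSet a b Φ D ∧ lab p s (root θ v) = P) →
      ∑ v ∈ X, ratVal Φ v = 0) (δ : ℕ) :
    ∑ᶠ y ∈ {y : LevelIdx a b Φ D o | idxLevel wp e wm y = ρ ∧ idxDepth wp e wm y = δ},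
      ratVal Φ y.1.1 = 0 := by
  classical
  have hfin := H.finite_idx ho hD ρ δ
  rw [finsum_mem_eq_finite_toFinset_sum _ hfin, ← Finset.sum_image
    (s := hfin.toFinset) (g := fun y : LevelIdx a b Φ D o => y.1.1) (f := ratVal Φ)]
  · refine H.sum_saturated hP _ ?_ ?_
    · intro v hv
      obtain ⟨y, -, rfl⟩ := Finset.mem_image.1 hv
      exact y.1.2
    · intro v hv w hw hvw
      obtain ⟨y, hy, rfl⟩ := Finset.mem_image.1 hw
      obtain ⟨h1, h2⟩ := hfin.mem_toFinset.1 hy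
      have e1 := H.lev_eq_idxLevel ho hD (s := s) y (by rwa [h1])
      obtain ⟨i, hi⟩ := exists_idx (wp := wp) (e := e) (wm := wm) ho s ⟨v, hv⟩
      have e2 := H.lev_eq_idxLevel ho hD (s := s) (⟨v, hv⟩, i) hi
      have e3 := (H.lab_congr hv y.1.2 hvw).1
      refine Finset.mem_image.2 ⟨(⟨v, hv⟩, i), hfin.mem_toFinset.2 ⟨?_, ?_⟩, rfl⟩
      · rw [← e2, ← h1, ← e1]; exact e3
      · have key : ∀ n : ℕ, idxDepth wp e wm (⟨v, hv⟩, i) ≤ n ↔ idxDepth wp e wm y ≤ n := by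
          intro n
          rw [H.depth_le_iff_window, H.depth_le_iff_window, ← e1, ← e2]
          exact ⟨fun h => H.depth_congr y.1.2 hv hvw.symm h, fun h => H.depth_congr hv y.1.2 hvw h⟩
        rw [← h2]
        exact le_antisymm ((key _).2 le_rfl) ((key _).1 le_rfl)
  · intro y hy y' hy' h
    exact idx_ext h (((hfin.mem_toFinset.1 hy).1).trans ((hfin.mem_toFinset.1 hy').1).symm)

include ho hD in
theorem finprod_window {A : Type*} [CommMonoid A] (F : Vec ℚ → A) (t : ℕ) (s : ℤ) (n : ℕ) :
    ∏ᶠ v ∈ window a b wp e wm Φ D θ t s n, F v =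
      ∏ᶠ y ∈ {y : LevelIdx a b Φ D o | (Even (idxLevel wp e wm y + s) ∨ o = 0) ∧
        (0 ≤ idxLevel wp e wm y ∧ idxLevel wp e wm y < (2 * t : ℕ)) ∧
        idxDepth wp e wm y ∈ Finset.range (n + 1)}, F y.1.1 := by
  symm
  refine finprod_mem_eq_of_bijOn (fun y : LevelIdx a b Φ D o => y.1.1) ⟨?_, ?_, ?_⟩
    fun _ _ => rfl
  · rintro y ⟨h1, h2, h3⟩
    have e1 := H.lev_eq_idxLevel ho hD y h1
    rw [Finset.mem_range, Nat.lt_succ_iff, H.depth_le_iff_window, ← e1] at h3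
    rw [← e1] at h2
    exact ⟨y.1.2, ⟨h2.1, by have := h2.2; push_cast at this; exact this⟩, h3⟩
  · rintro y ⟨h1, -⟩ y' ⟨h1', -⟩ h
    refine idx_ext (wp := wp) (e := e) (wm := wm) h ?_
    rw [← H.lev_eq_idxLevel ho hD y h1, ← H.lev_eq_idxLevel ho hD y' h1']
    exact congrArg (fun v => lev p s (root θ v)) h
  · rintro v ⟨hv, h2, h3⟩
    obtain ⟨i, hi⟩ := exists_idx (wp := wp) (e := e) (wm := wm) ho s ⟨v, hv⟩
    have e1 := H.lev_eq_idxLevel ho hD (s := s) (⟨v, hv⟩, i) hi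
    simp only at e1
    refine ⟨(⟨v, hv⟩, i), ⟨hi, ?_, ?_⟩, rfl⟩
    · rw [← e1]; push_cast; exact h2
    · rw [Finset.mem_range, Nat.lt_succ_iff, H.depth_le_iff_window, ← e1]
      exact h3

end IsLengthData

end Levels

section Lattices

variable {a b : ℚ} {p : ℕ} [Fact p.Prime] {wp e wm : Vec ℚ_[p]}

local notation "cP" v:max => coordP a b wp e wm (toQp p v)
local notation "cE" v:max => coordE a b wp e wm (toQp p v)
local notation "cM" v:max => coordM a b wp e wm (toQp p v)

theorem toQp_pow_smul (k : ℕ) (v : Vec ℚ) :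
    toQp p ((p : ℚ) ^ k • v) = (p : ℚ_[p]) ^ k • toQp p v := by
  funext i; simp [toQp]

theorem norm_pow_p (k : ℕ) : ‖(p : ℚ_[p]) ^ k‖ = (p : ℝ) ^ (-(k : ℤ)) := by
  rw [← zpow_natCast, norm_p_zpow]

theorem mem_latticeJ_iff (h : IsFrame a b wp e wm) (j : ℕ) (v : Vec ℚ_[p]) :
    v ∈ latticeJ wp e wm j ↔ ‖coordP a b wp e wm v‖ ≤ (p : ℝ) ^ (-(j : ℤ)) ∧
      ‖coordE a b wp e wm v‖ ≤ 1 ∧ ‖coordM a b wp e wm v‖ ≤ (p : ℝ) ^ (j : ℤ) := by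
  set q : ℚ_[p] := (p : ℚ_[p]) ^ j with hq
  have hq0 : q ≠ 0 := pow_ne_zero _ pQ_ne_zero
  have hfr : IsFrame a b (q • wp) e (q⁻¹ • wm) := by
    refine ⟨?_, ?_, ?_, ?_, ?_, h.quad_e_ne⟩
    · rw [quadForm_smul, h.quad_wp, mul_zero]
    · rw [quadForm_smul, h.quad_wm, mul_zero]
    · rw [pairing_smul_left, h.pair_wp_e, mul_zero]
    · rw [pairing_smul_left, h.pair_wm_e, mul_zero]
    · rw [pairing_smul_left, pairing_smul_right, mul_inv_cancel_left₀ hq0]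
      exact h.pair_ne
  have hn : ‖q‖ = (p : ℝ) ^ (-(j : ℤ)) := norm_pow_p j
  rw [latticeJ, mem_lattice_iff hfr]
  simp only [coordP, coordE, coordM, pairing_smul_left, pairing_smul_right,
    inv_mul_cancel_left₀ hq0]
  rw [mul_div_assoc, mul_div_assoc, norm_mul, norm_mul, norm_inv, hn, zpow_neg, inv_inv,
    inv_mul_le_iff₀ (p_zpow_pos _), mul_one, ← le_div_iff₀' (p_zpow_pos _), one_div]

namespace IsLengthData

variable {Φ : Vec (AdeleAway p) → ℤ} {D : ℤ} {θ : ℂ_[p]} {o : ℕ}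
  (H : IsLengthData a b wp e wm Φ D θ) (ho : o ≤ 1)
  (hD : ‖((D : ℚ) : ℚ_[p])‖ = (p : ℝ) ^ (-(o : ℤ)))
  (hΦ : ∀ v : Vec ℚ, ratVal Φ ((p : ℚ) • v) = ratVal Φ v)
include H

theorem smul_mem_lPlus_iff (hDo : ‖((D : ℚ) : ℚ_[p])‖ ≤ 1) {v : Vec ℚ}
    (hv : v ∈ lengthSet a b Φ D) (j k : ℕ) :
    (((p : ℚ) ^ k • v ∈ lPlus a b wp e wm D j k) ↔
      ‖cE v‖ ≤ (p : ℝ) ^ (k : ℤ) ∧ ‖cM v‖ = (p : ℝ) ^ ((k : ℤ) + j)) ∧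
    (((p : ℚ) ^ k • v ∈ lMinus a b wp e wm D j k) ↔
      ‖cE v‖ ≤ (p : ℝ) ^ (k : ℤ) ∧ ‖cP v‖ = (p : ℝ) ^ ((k : ℤ) - j)) := by
  have hk := p_zpow_pos (p := p) k
  have hj := p_zpow_pos (p := p) j
  have hu := H.unit.frame.pair_ne
  have hQ : quadForm a b ((p : ℚ) ^ k • v) = (D : ℚ) * (p : ℚ) ^ (2 * k) := by
    rw [quadForm_smul, hv.1]; ring
  have e1 : pairing a b wp (toQp p v) = cM v * pairing a b wp wm := by
    rw [coordM, div_mul_cancel₀ _ hu]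
  have e2 : pairing a b wm (toQp p v) = cP v * pairing a b wp wm := by
    rw [coordP, div_mul_cancel₀ _ hu]
  have hprod := H.norm_coord_mul hv
  simp only at hprod
  have hle : ‖cE v‖ ≤ (p : ℝ) ^ (k : ℤ) → ‖cP v‖ * ‖cM v‖ ≤ (p : ℝ) ^ (k : ℤ) * (p : ℝ) ^ (k : ℤ) := by
    intro h1
    have h2 : 1 ≤ (p : ℝ) ^ (k : ℤ) := by rw [zpow_natCast]; exact one_le_pow₀ one_lt_p.le
    rw [hprod]
    refine max_le (hDo.trans (one_le_mul_of_one_le_of_one_le h2 h2)) ?_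
    rw [sq]
    exact mul_le_mul h1 h1 (norm_nonneg _) hk.le
  have hM := norm_pos_iff.2 (H.coordM_ne hv)
  have hP := norm_pos_iff.2 (H.coordP_ne hv)
  simp only at hM hP
  constructor
  · simp only [lPlus, Set.mem_ofPred_eq, hQ, true_and]
    rw [toQp_pow_smul, mem_latticeJ_iff H.unit.frame, coordP_smul, coordE_smul, coordM_smul,
      pairing_smul_left, pairing_smul_right, pairing_comm, e1]
    simp only [norm_mul, norm_pow_p, H.unit.norm_pair, mul_one, zpow_neg, zpow_add₀ p_pos.ne',
      inv_mul_le_iff₀ hk, inv_mul_eq_iff_eq_mul₀ hk.ne', inv_mul_eq_iff_eq_mul₀ hj.ne']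
    refine ⟨fun h => ⟨h.1.2.1, h.2.trans (mul_comm _ _)⟩,
      fun h => ⟨⟨?_, h.1, h.2.le⟩, h.2.trans (mul_comm _ _)⟩⟩
    have h3 := hle h.1
    rw [h.2, mul_left_comm] at h3
    rw [← div_eq_mul_inv, le_div_iff₀ hj]
    exact le_of_mul_le_mul_left h3 hk
  · simp only [lMinus, Set.mem_ofPred_eq, hQ, true_and]
    rw [toQp_pow_smul, mem_latticeJ_iff H.unit.frame, coordP_smul, coordE_smul, coordM_smul,
      pairing_smul_left, pairing_smul_right, pairing_comm, e2]
    simp only [norm_mul, norm_inv, norm_pow_p, H.unit.norm_pair, mul_one, zpow_neg, inv_inv,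
      zpow_sub₀ p_pos.ne', inv_mul_le_iff₀ hk, inv_mul_eq_iff_eq_mul₀ hk.ne',
      ← div_eq_mul_inv]
    rw [eq_div_iff hj.ne', mul_comm ‖cP v‖]
    refine ⟨fun h => ⟨h.1.2.1, h.2⟩, fun h => ⟨⟨?_, h.1, ?_⟩, h.2⟩⟩
    · rw [le_div_iff₀ hj, mul_comm]
      exact h.2.le
    · have h3 := mul_le_mul_of_nonneg_left (hle h.1) hj.le
      rw [← mul_assoc, h.2, mul_left_comm] at h3
      exact (le_of_mul_le_mul_left h3 hk).trans_eq (mul_comm _ _)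

end IsLengthData

end Lattices

section LatticeProducts

variable {a b : ℚ} {p : ℕ} [Fact p.Prime] {wp e wm : Vec ℚ_[p]}

local notation "cP" v:max => coordP a b wp e wm (toQp p v)
local notation "cE" v:max => coordE a b wp e wm (toQp p v)
local notation "cM" v:max => coordM a b wp e wm (toQp p v)

/-- The vector of a lattice attached to an index. -/
def idxVec {Φ : Vec (AdeleAway p) → ℤ} {D : ℚ} {o : ℕ} (m : ℕ) (y : LevelIdx a b Φ D o) : Vec ℚ :=
  (p : ℚ) ^ (m - y.2) • y.1.1

namespace IsLengthData

variable {Φ : Vec (AdeleAway p) → ℤ} {D : ℤ} {θ : ℂ_[p]} {o m : ℕ}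
  (H : IsLengthData a b wp e wm Φ D θ) (ho : o ≤ 1)
  (hD : ‖((D : ℚ) : ℚ_[p])‖ = (p : ℝ) ^ (-(o : ℤ))) (hom : o ≤ m)
  (hΦ : ∀ v : Vec ℚ, ratVal Φ ((p : ℚ) • v) = ratVal Φ v)

include hD hom in
theorem idxVec_injective : Function.Injective (idxVec m : LevelIdx a b Φ D o → Vec ℚ) := by
  have hp0 : (p : ℚ) ≠ 0 := Nat.cast_ne_zero.2 (Fact.out : p.Prime).ne_zero
  have hD0 : (D : ℚ) ≠ 0 := by
    intro h0
    rw [h0] at hD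
    simp only [Rat.cast_zero, norm_zero] at hD
    exact (p_zpow_pos (p := p) _).ne hD
  rintro ⟨⟨v, hv⟩, i⟩ ⟨⟨w, hw⟩, i'⟩ h
  simp only [idxVec] at h
  have h1 := congrArg (quadForm a b) h
  rw [quadForm_smul, quadForm_smul, hv.1, hw.1, mul_left_inj' hD0, ← pow_mul, ← pow_mul] at h1
  have h2 : (m - (i : ℕ)) * 2 = (m - (i' : ℕ)) * 2 :=
    Nat.pow_right_injective (Fact.out : p.Prime).two_le (by exact_mod_cast h1)
  have h3 : i = i' := Fin.ext (by omega)
  subst h3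
  have h4 := smul_right_injective (Vec ℚ) (pow_ne_zero (m - (i : ℕ)) hp0) h
  subst h4
  rfl

include hΦ in
theorem ratVal_idxVec (y : LevelIdx a b Φ D o) : ratVal Φ (idxVec m y) = ratVal Φ y.1.1 :=
  ratVal_smul_p hΦ _ _

include hΦ in
theorem exists_idxVec {w : Vec ℚ} {k : ℕ} (hw : quadForm a b w = (D : ℚ) * (p : ℚ) ^ (2 * k))
    (h0 : ratVal Φ w ≠ 0) : ∃ v : lengthSet a b Φ D, (p : ℚ) ^ k • v.1 = w := by
  have hp0 : (p : ℚ) ^ k ≠ 0 := pow_ne_zero _ (Nat.cast_ne_zero.2 (Fact.out : p.Prime).ne_zero)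
  have h1 : (p : ℚ) ^ k • ((p : ℚ) ^ k)⁻¹ • w = w := smul_inv_smul₀ hp0 w
  refine ⟨⟨((p : ℚ) ^ k)⁻¹ • w, ?_, ?_⟩, h1⟩
  · rw [quadForm_smul, hw, pow_mul']
    field_simp
  · rwa [← ratVal_smul_p hΦ k, h1]

theorem weightedProd_eq (A : Set (Vec ℚ)) (w : Vec ℚ_[p]) : weightedProd a b Φ w A =
    ∏ᶠ v ∈ A ∩ {v | ratVal Φ v ≠ 0}, pairing a b w (toQp p v) ^ ratVal Φ v := by
  refine finprod_mem_inter_mulSupport_eq' _ _ _ fun v hv => ?_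
  rw [Set.mem_inter_iff, iff_self_and]
  intro _ h0
  rw [Function.mem_mulSupport, h0, zpow_zero] at hv
  exact hv rfl

include H ho hD hom hΦ

theorem weightedProd_lPlus (j : ℕ) :
    weightedProd a b Φ wp {w | ∃ i : Fin (o + 1), w ∈ lPlus a b wp e wm D j (m - i)} =
      ∏ᶠ y ∈ {y : LevelIdx a b Φ D o | idxLevel wp e wm y = m + j ∧
        idxDepth wp e wm y ∈ Finset.range (m + 1)},
        ((p : ℚ_[p]) ^ (m - y.2 : ℕ) * (cM y.1.1 * pairing a b wp wm)) ^ ratVal Φ y.1.1 := by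
  have hDo : ‖((D : ℚ) : ℚ_[p])‖ ≤ 1 := by rw [hD, ← zpow_zero (p : ℝ), p_zpow_le]; omega
  rw [weightedProd_eq]
  symm
  refine finprod_mem_eq_of_bijOn (idxVec m) ⟨?_, (idxVec_injective hD hom).injOn, ?_⟩ ?_
  · rintro y ⟨h1, h2⟩
    have hy := y.2.2
    refine ⟨⟨y.2, (H.smul_mem_lPlus_iff hDo y.1.2 j _).1.2 ⟨?_, ?_⟩⟩, ?_⟩
    · rw [Finset.mem_range, Nat.lt_succ_iff, idxDepth_le_iff] at h2
      rwa [Nat.cast_sub (by omega)]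
    · rw [H.norm_coordM_eq, h1, Nat.cast_sub (by omega)]
      congr 1; ring
    · rw [Set.mem_ofPred_eq, ratVal_idxVec hΦ]
      exact y.1.2.2
  · rintro w ⟨⟨i, hi⟩, h0⟩
    obtain ⟨v, rfl⟩ := exists_idxVec hΦ hi.2.1 h0
    obtain ⟨h1, h2⟩ := (H.smul_mem_lPlus_iff hDo v.2 j _).1.1 hi
    have hlt := i.2
    refine ⟨(v, i), ⟨?_, ?_⟩, rfl⟩
    · have h3 := H.norm_coordM_eq (v, i)
      rw [h2] at h3
      have h4 := p_zpow_inj (p := p) h3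
      simp only at h4
      omega
    · rw [Finset.mem_range, Nat.lt_succ_iff, idxDepth_le_iff]
      rwa [Nat.cast_sub (by omega)] at h1
  · intro y _
    rw [ratVal_idxVec hΦ, idxVec, toQp_pow_smul, pairing_smul_right, coordM,
      div_mul_cancel₀ _ H.unit.frame.pair_ne]

theorem weightedProd_lMinus (j : ℕ) :
    weightedProd a b Φ wm {w | ∃ i : Fin (o + 1), w ∈ lMinus a b wp e wm D j (m - i)} =
      ∏ᶠ y ∈ {y : LevelIdx a b Φ D o | idxLevel wp e wm y = (2 * idxDepth wp e wm y - m) + j ∧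
        idxDepth wp e wm y ∈ Finset.range (m + 1)},
        ((p : ℚ_[p]) ^ (m - idxFlip wp e wm y : ℕ) * (cP y.1.1 * pairing a b wp wm)) ^
          ratVal Φ y.1.1 := by
  have hDo : ‖((D : ℚ) : ℚ_[p])‖ ≤ 1 := by rw [hD, ← zpow_zero (p : ℝ), p_zpow_le]; omega
  rw [weightedProd_eq]
  symm
  refine finprod_mem_eq_of_bijOn (fun y => idxVec m (y.1, idxFlip wp e wm y))
    ⟨?_, ?_, ?_⟩ ?_
  · rintro y ⟨h1, h2⟩
    have hy := (idxFlip wp e wm y).2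
    rw [Finset.mem_range, Nat.lt_succ_iff] at h2
    obtain ⟨f1, f2⟩ := idxFlip_val (wp := wp) (e := e) (wm := wm) y
    refine ⟨⟨idxFlip wp e wm y, (H.smul_mem_lPlus_iff hDo y.1.2 j _).2.2 ⟨?_, ?_⟩⟩, ?_⟩
    · rw [Nat.cast_sub (by omega)]
      rcases lt_or_ge ‖cE y.1.1‖ 1 with h | h
      · refine h.le.trans ?_
        rw [← zpow_zero (p : ℝ), p_zpow_le]
        omega
      · rw [f2 h]
        exact (idxDepth_le_iff y m).1 h2
    · rw [H.norm_coordP_eq ho hD, h1, Nat.cast_sub (by omega)]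
      congr 1; ring
    · rw [Set.mem_ofPred_eq, ratVal_idxVec hΦ]
      exact y.1.2.2
  · intro y _ y' _ h
    have h1 := idxVec_injective hD hom h
    refine Prod.ext (Prod.mk.inj h1).1 ?_
    rw [← idxFlip_idxFlip (wp := wp) (e := e) (wm := wm) y.1 y.2,
      ← idxFlip_idxFlip (wp := wp) (e := e) (wm := wm) y'.1 y'.2]
    exact congrArg (idxFlip wp e wm) h1
  · rintro w ⟨⟨i', hi⟩, h0⟩
    obtain ⟨v, rfl⟩ := exists_idxVec hΦ hi.2.1 h0
    obtain ⟨h1, h2⟩ := (H.smul_mem_lPlus_iff hDo v.2 j _).2.1 hi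
    have hlt := i'.2
    have hff := idxFlip_idxFlip (wp := wp) (e := e) (wm := wm) v i'
    set y : LevelIdx a b Φ D o := (v, idxFlip wp e wm (v, i')) with hy
    refine ⟨y, ⟨?_, ?_⟩, ?_⟩
    · have h3 := H.norm_coordP_eq ho hD y
      rw [h2] at h3
      have h4 := p_zpow_inj (p := p) h3
      rw [hff] at h4
      omega
    · rw [Finset.mem_range, Nat.lt_succ_iff]
      rcases lt_or_ge ‖cE y.1.1‖ 1 with h | h
      · rw [depth_eq_zero ho y h]
        exact Nat.zero_le _
      · have f2 := (idxFlip_val (wp := wp) (e := e) (wm := wm) y).2 h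
        rw [idxDepth_le_iff, ← f2, hff]
        rwa [Nat.cast_sub (by omega)] at h1
    · simp only
      rw [hff]
      rfl
  · intro y _
    rw [ratVal_idxVec hΦ, idxVec, toQp_pow_smul, pairing_smul_right, coordP,
      div_mul_cancel₀ _ H.unit.frame.pair_ne]

end IsLengthData

end LatticeProducts

section FiniteLevel

variable {a b : ℚ} {p : ℕ} [Fact p.Prime] {wp e wm : Vec ℚ_[p]}
  {R : Subalgebra (ZInv p) (Quat a b ℚ)}

local notation "cP" v:max => coordP a b wp e wm (toQp p v)
local notation "cE" v:max => coordE a b wp e wm (toQp p v)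
local notation "cM" v:max => coordM a b wp e wm (toQp p v)

variable (wp e wm) in
/-- A bijection of the indices that acts on coordinates like a hyperbolic element. -/
def IsIdxShift {Φ : Vec (AdeleAway p) → ℤ} {D : ℚ} {o : ℕ} (ϖ : ℚ_[p])
    (T : LevelIdx a b Φ D o ≃ LevelIdx a b Φ D o) : Prop :=
  ∀ y, (T y).2 = y.2 ∧ ratVal Φ (T y).1.1 = ratVal Φ y.1.1 ∧ cP (T y).1.1 = ϖ * cP y.1.1 ∧
    cE (T y).1.1 = cE y.1.1 ∧ cM (T y).1.1 = ϖ⁻¹ * cM y.1.1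

theorem exists_idxShift (h : IsFrame a b wp e wm) {par : Submodule ℤ_[p] (Vec ℚ_[p]) → Prop}
    {γ : (Quat a b ℚ)ˣ} (hγ : γ ∈ normOne R) {ϖ : ℚ_[p]} {t : ℕ}
    {L₀ : Submodule ℤ_[p] (Vec ℚ_[p])} (hf : IsHyperbolicFrame par γ ϖ t L₀ wp e wm)
    {Φ : Vec (AdeleAway p) → ℤ} (hΦ : IsConvenient R par Φ) (D : ℚ) (o : ℕ) :
    ∃ T : LevelIdx a b Φ D o ≃ LevelIdx a b Φ D o, IsIdxShift wp e wm ϖ T := by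
  obtain ⟨h1, h2, h3⟩ := hf.smul_eq
  have hc := coord_hyperbolic h (ne_zero_of_norm hf.norm_eq) h1 h2 h3
  have hΦγ := fun v => ratVal_smul (Φ := Φ) hΦ.unitInvariant hγ v
  have hmem : ∀ v, v ∈ lengthSet a b Φ D ↔ conjRat ℚ γ • v ∈ lengthSet a b Φ D := fun v => by
    rw [lengthSet, Set.mem_ofPred_eq, Set.mem_ofPred_eq, hΦγ,
      show quadForm a b (conjRat ℚ γ • v) = quadForm a b v from
        quadForm_conj (Units.map (baseChange (a := a) (b := b) ℚ).toMonoidHom γ) v]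
  exact ⟨((MulAction.toPerm (conjRat ℚ γ)).subtypeEquiv hmem).prodCongr (Equiv.refl _),
    fun y => ⟨rfl, hΦγ _, hc _⟩⟩

namespace IsLengthData

theorem finite_idx_window {Φ : Vec (AdeleAway p) → ℤ} {D : ℚ} {θ : ℂ_[p]} {o : ℕ}
    (H : IsLengthData a b wp e wm Φ D θ) (ho : o ≤ 1)
    (hD : ‖(D : ℚ_[p])‖ = (p : ℝ) ^ (-(o : ℤ))) (t m : ℕ) :
    {y : LevelIdx a b Φ D o | (0 ≤ idxLevel wp e wm y ∧
      idxLevel wp e wm y < (2 * t : ℕ)) ∧ idxDepth wp e wm y ∈ Finset.range (m + 1)}.Finite := by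
  refine ((Finset.range (2 * t)).finite_toSet.biUnion fun (j : ℕ) _ =>
    (finprod_level (F := fun y : LevelIdx a b Φ D o => (1 : ℚ_[p])) (H.finite_idx ho hD)
      (Finset.range (m + 1)) fun δ => j).1).subset ?_
  rintro y ⟨h1, h2⟩
  simp only [Set.mem_iUnion]
  exact ⟨(idxLevel wp e wm y).toNat, by rw [Finset.mem_coe, Finset.mem_range]; omega,
    (Int.toNat_of_nonneg h1.1).symm, h2⟩

variable {Φ : Vec (AdeleAway p) → ℤ} {D : ℤ} {θ : ℂ_[p]} {o m : ℕ}
  (H : IsLengthData a b wp e wm Φ D θ) (ho : o ≤ 1)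
  (hD : ‖((D : ℚ) : ℚ_[p])‖ = (p : ℝ) ^ (-(o : ℤ))) (hom : o ≤ m)
  (hΦ : ∀ v : Vec ℚ, ratVal Φ ((p : ℚ) • v) = ratVal Φ v)
  {ϖ : ℚ_[p]} {t : ℕ} (hϖ : ‖ϖ‖ = (p : ℝ) ^ (2 * t))
  {T : LevelIdx a b Φ D o ≃ LevelIdx a b Φ D o} (hT : IsIdxShift wp e wm ϖ T)
include H ho hD hϖ hT

theorem idx_shift (y : LevelIdx a b Φ D o) :
    idxLevel wp e wm (T y) = idxLevel wp e wm y - (2 * t : ℕ) ∧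
      idxDepth wp e wm (T y) = idxDepth wp e wm y ∧ idxFlip wp e wm (T y) = idxFlip wp e wm y := by
  obtain ⟨h1, -, -, h4, h5⟩ := hT y
  refine ⟨?_, ?_, ?_⟩
  · have e1 := H.norm_coordM_eq (T y)
    rw [h5, norm_mul, norm_inv, hϖ, H.norm_coordM_eq y, h1, ← zpow_natCast, ← zpow_neg,
      ← zpow_add₀ p_pos.ne'] at e1
    have e2 := p_zpow_inj (p := p) e1
    omega
  · rw [idxDepth, idxDepth, h1, h4]
  · rw [idxFlip, idxFlip, h1, h4]

theorem prod_flip_eq_one :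
    ∏ᶠ y ∈ {y : LevelIdx a b Φ D o | (0 ≤ idxLevel wp e wm y ∧ idxLevel wp e wm y < (2 * t : ℕ)) ∧
      idxDepth wp e wm y ∈ Finset.range (m + 1)},
      ((p : ℚ_[p]) ^ ((idxFlip wp e wm y : ℤ) - y.2)) ^ ratVal Φ y.1.1 = 1 := by
  classical
  set l : LevelIdx a b Φ D o → Fin (o + 1) × ℕ := fun y => (y.2, idxDepth wp e wm y) with hl
  have hfin : ∀ ρ δ, {y | idxLevel wp e wm y = ρ ∧ l y = δ}.Finite := fun ρ δ =>
    (H.finite_idx ho hD ρ δ.2).subset fun y hy => ⟨hy.1, congrArg Prod.snd hy.2⟩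
  have hI : ∀ y, l y ∈ (Finset.univ ×ˢ Finset.range (m + 1) : Finset (Fin (o + 1) × ℕ)) ↔
      idxDepth wp e wm y ∈ Finset.range (m + 1) := fun y => by simp [hl]
  have h1 := finprod_fundamental (r := idxLevel wp e wm) (l := l) (k := 2 * t)
    (F := fun y : LevelIdx a b Φ D o =>
      ((p : ℚ_[p]) ^ ((idxFlip wp e wm y : ℤ) - y.2)) ^ ratVal Φ y.1.1) hfin
    (finprod_periodic (c := 1) T (fun y => ⟨(hT y).2.1, (H.idx_shift ho hD hϖ hT y).1,
      Prod.ext (hT y).1 (H.idx_shift ho hD hϖ hT y).2.1⟩) (fun y => by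
        rw [(H.idx_shift ho hD hϖ hT y).2.2, (hT y).1, one_mul]) one_ne_zero hfin (Or.inl rfl))
    (Finset.univ ×ˢ Finset.range (m + 1)) fun δ => δ.1
  simp only [hI] at h1
  rw [← h1]
  refine Finset.prod_eq_one fun j _ => ?_
  have hfj := (finprod_level (F := fun y : LevelIdx a b Φ D o => (1 : ℚ_[p])) hfin
    (Finset.univ ×ˢ Finset.range (m + 1)) fun δ => δ.1 + j).1
  simp only [hI] at hfj
  rw [finprod_mem_eq_finite_toFinset_prod _ hfj]
  have hflip : ∀ y : LevelIdx a b Φ D o,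
      idxDepth wp e wm ((y.1, idxFlip wp e wm y) : LevelIdx a b Φ D o) = idxDepth wp e wm y := by
    intro y
    rcases lt_or_ge ‖cE y.1.1‖ 1 with h | h
    · rw [depth_eq_zero ho y h, depth_eq_zero ho (y.1, idxFlip wp e wm y) h]
    · rw [(idxFlip_val y).2 h]
  refine Finset.prod_involution (fun y _ => (y.1, idxFlip wp e wm y)) ?_ ?_ ?_ ?_
  · intro y _
    rw [idxFlip_idxFlip, ← mul_zpow, ← zpow_add₀ pQ_ne_zero]
    simp
  · intro y _ hne heq
    apply hne
    have : idxFlip wp e wm y = y.2 := congrArg Prod.snd heq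
    rw [this, sub_self, zpow_zero, one_zpow]
  · intro y hy
    rw [Set.Finite.mem_toFinset] at hy ⊢
    obtain ⟨h2, h3⟩ := hy
    refine ⟨?_, by rw [hflip]; exact h3⟩
    simp only [idxLevel, hl] at h2 ⊢
    omega
  · intro y _
    exact Prod.ext rfl (idxFlip_idxFlip y.1 y.2)

include hom hΦ in
theorem prod_lattices_eq (hsum : ∀ ρ δ, ∑ᶠ y ∈ {y : LevelIdx a b Φ D o |
      idxLevel wp e wm y = ρ ∧ idxDepth wp e wm y = δ}, ratVal Φ y.1.1 = 0) :
    ∏ j ∈ Finset.range (2 * t),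
      weightedProd a b Φ wp {w | ∃ i : Fin (o + 1), w ∈ lPlus a b wp e wm D j (m - i)} /
        weightedProd a b Φ wm {w | ∃ i : Fin (o + 1), w ∈ lMinus a b wp e wm D j (m - i)} =
    ∏ᶠ y ∈ {y : LevelIdx a b Φ D o | (0 ≤ idxLevel wp e wm y ∧ idxLevel wp e wm y < (2 * t : ℕ)) ∧
      idxDepth wp e wm y ∈ Finset.range (m + 1)}, (cM y.1.1 / cP y.1.1) ^ ratVal Φ y.1.1 := by
  have hfin := H.finite_idx ho hD
  have hϖ0 := ne_zero_of_norm hϖ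
  have hsh := H.idx_shift ho hD hϖ hT
  have hTl := fun y => (⟨(hT y).2.1, (hsh y).1, (hsh y).2.1⟩ :
    ratVal Φ (T y).1.1 = ratVal Φ y.1.1 ∧
      idxLevel wp e wm (T y) = idxLevel wp e wm y - (2 * t : ℕ) ∧
      idxDepth wp e wm (T y) = idxDepth wp e wm y)
  rw [Finset.prod_div_distrib, Finset.prod_congr rfl fun j _ => H.weightedProd_lPlus ho hD hom hΦ j,
    Finset.prod_congr (s₁ := Finset.range (2 * t)) rfl
      fun j _ => H.weightedProd_lMinus ho hD hom hΦ j,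
    finprod_fundamental hfin (finprod_periodic (c := ϖ⁻¹) T hTl (fun y => by
      rw [(hT y).1, (hT y).2.2.2.2]; ring) (inv_ne_zero hϖ0) hfin (Or.inr hsum)) _ fun _ => (m : ℤ),
    finprod_fundamental hfin (finprod_periodic (c := ϖ) T hTl (fun y => by
      rw [(hsh y).2.2, (hT y).2.2.1]; ring) hϖ0 hfin (Or.inr hsum)) _ fun δ => 2 * (δ : ℤ) - m,
    ← mul_one (∏ᶠ y ∈ _, (cM _ / cP _) ^ _), ← H.prod_flip_eq_one ho hD hϖ hT (m := m)]
  have hWfin := H.finite_idx_window ho hD t m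
  simp only [finprod_mem_eq_finite_toFinset_prod _ hWfin]
  rw [← Finset.prod_div_distrib, ← Finset.prod_mul_distrib]
  refine Finset.prod_congr rfl fun y _ => ?_
  have hP : cP y.1.1 ≠ 0 := H.coordP_ne y.1.2
  have hu := H.unit.frame.pair_ne
  have h1 := (idxFlip wp e wm y).2
  have h2 := y.2.2
  have hp : (p : ℚ_[p]) ≠ 0 := pQ_ne_zero
  rw [← div_zpow, ← mul_zpow, ← zpow_natCast, ← zpow_natCast, Nat.cast_sub (by omega),
    Nat.cast_sub (by omega), zpow_sub₀ hp, zpow_sub₀ hp, zpow_sub₀ hp]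
  congr 1
  have e1 := zpow_ne_zero (m : ℤ) hp
  have e2 := zpow_ne_zero ((y.2 : ℕ) : ℤ) hp
  have e3 := zpow_ne_zero ((idxFlip wp e wm y : ℕ) : ℤ) hp
  field_simp

end IsLengthData

end FiniteLevel

section ThetaLimit

variable {a b : ℚ} {p : ℕ} [Fact p.Prime] {wp e wm : Vec ℚ_[p]}
  {R : Subalgebra (ZInv p) (Quat a b ℚ)} {M : ℕ}

local notation "ι" => algebraMap ℚ_[p] ℂ_[p]
local notation "cP" v:max => coordP a b wp e wm (toQp p v)
local notation "cM" v:max => coordM a b wp e wm (toQp p v)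

variable (σ : Quat a b ℚ_[p] ≃ₐ[ℚ_[p]] Matrix (Fin 2) (Fin 2) ℚ_[p])
    (hinf : IsDivision a b ℝ) (hR : IsEichlerOrder R M) (hM : M ≠ 0)
    {par : Submodule ℤ_[p] (Vec ℚ_[p]) → Prop} (hpar : IsParity a b par)
    {γ : (Quat a b ℚ)ˣ} (hγ : γ ∈ normOne R) {ϖ : ℚ_[p]} {t : ℕ}
    {L₀ : Submodule ℤ_[p] (Vec ℚ_[p])} (hf : IsHyperbolicFrame par γ ϖ t L₀ wp e wm)
    {Φ : Vec (AdeleAway p) → ℤ} (hΦ : IsConvenient R par Φ) {D : ℤ} {θ : ℂ_[p]}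
    (H : IsLengthData a b wp e wm Φ (D : ℚ) θ)
include hinf hR hM hpar hγ hf hΦ H

/-- Theta values as limits of products over windows. -/
theorem thetaValue_tendsto {s : ℤ} {𝒟 : Pt p →₀ ℤ}
    (h𝒟 : IsStrongZero a b par s 𝒟) (hpush : pushforward R 𝒟 = heegnerDivisor R Φ D)
    {η : Pt p} (hη : IsBasePoint R 𝒟 η) :
    Multipliable (thetaFactor R σ 𝒟 η γ) ∧
    (∀ (P : ℤ × Set ℚ_[p]) (X : Finset (Vec ℚ)), (∀ v, v ∈ X ↔ v ∈ lengthSet a b Φ (D : ℚ) ∧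
      lab p s (vecRoot a b wp e wm θ v) = P) → ∑ v ∈ X, ratVal Φ v = 0) ∧
    Tendsto (fun n : ℕ => ι (∏ᶠ v ∈ window a b wp e wm Φ (D : ℚ) θ t s n,
      (cM v / cP v) ^ ratVal Φ v)) atTop (𝓝 (thetaValue R σ 𝒟 η γ)) := by
  obtain ⟨h1, h2, h3⟩ := thetaValue_hasProd σ H.ne_two hinf hR hpar hγ hf H.unit.frame h𝒟 hη
  have hm : ∀ ζ, Irrat p ζ → ∀ Y : Finset (Vec ℚ), (∀ v, v ∈ Y ↔
      v ∈ lengthSet a b Φ (D : ℚ) ∧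
        (ζ = vecRoot a b wp e wm θ v ∨ ζ = vecRoot a b wp e wm (-θ) v)) →
      transMult R H.unit.frame 𝒟 ζ = ∑ v ∈ Y, ratVal Φ v := by
    intro ζ hζ Y hY
    rw [transMult_eq_sum σ hinf hR hM hγ hf H.unit.frame hΦ H.notLength H.theta h𝒟.1 hpush hζ]
    congr 1
    ext v
    rw [Set.Finite.mem_toFinset, hY, lengthSet, Set.mem_ofPred_eq, Set.mem_ofPred_eq, and_assoc]
    refine and_congr_right fun hv => and_congr_right fun _ => ?_
    rw [orth_iff H.unit.frame H.notLength H.theta hv, sub_eq_add_neg]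
    rfl
  have h4 := fun P X hX => H.prod_part hm (s := s) (P := P) (h3 P) (X := X) hX
  exact ⟨h1, fun P X hX => (h4 P X hX).1, H.tendsto_window
    (g := fun P => ∏ᶠ ζ ∈ part (F := ℂ_[p]) p s P, ζ ^ (-transMult R H.unit.frame 𝒟 ζ)) h2
    fun P X hX => (h4 P X hX).2⟩

theorem thetaValue_eq_of_unit (hD : ‖((D : ℚ) : ℚ_[p])‖ = 1) {s : ℤ} {𝒟 : Pt p →₀ ℤ}
    (h𝒟 : IsStrongZero a b par s 𝒟) (hpush : pushforward R 𝒟 = heegnerDivisor R Φ D)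
    {η : Pt p} (hη : IsBasePoint R 𝒟 η) :
    Multipliable (thetaFactor R σ 𝒟 η γ) ∧
    Tendsto (fun n : ℕ => ι (∏ j ∈ Finset.range (2 * t),
      weightedProd a b Φ wp (lPlus a b wp e wm D j n) /
        weightedProd a b Φ wm (lMinus a b wp e wm D j n)))
      atTop (𝓝 (thetaValue R σ 𝒟 η γ)) := by
  obtain ⟨h1, h2, h3⟩ := thetaValue_tendsto σ hinf hR hM hpar hγ hf hΦ H h𝒟 hpush hη
  have hD0 : ‖((D : ℚ) : ℚ_[p])‖ = (p : ℝ) ^ (-((0 : ℕ) : ℤ)) := by simpa using hD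
  obtain ⟨T, hT⟩ := exists_idxShift H.unit.frame hγ hf hΦ (D : ℚ) 0
  refine ⟨h1, h3.congr fun n => congrArg ι ?_⟩
  have h4 := H.prod_lattices_eq zero_le_one hD0 (Nat.zero_le n) hΦ.mulInvariant hf.norm_eq hT
    fun ρ δ => H.sum_idx zero_le_one hD0 (s := s) (Or.inr rfl) h2 δ
  have h5 : ∀ A : ℕ → Set (Vec ℚ), {w | ∃ i : Fin (0 + 1), w ∈ A (n - i)} = A n := by
    intro A; ext w; simp
  simp only [h5] at h4
  rw [h4, H.finprod_window zero_le_one hD0]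
  simp

theorem thetaValue_mul_eq_of_uniformizer (hD : ‖((D : ℚ) : ℚ_[p])‖ = (p : ℝ)⁻¹)
    {𝒟₀ 𝒟₁ : Pt p →₀ ℤ} (h₀ : IsStrongZero a b par 0 𝒟₀) (h₁ : IsStrongZero a b par 1 𝒟₁)
    (hp₀ : pushforward R 𝒟₀ = heegnerDivisor R Φ D) (hp₁ : pushforward R 𝒟₁ = heegnerDivisor R Φ D)
    {η₀ η₁ : Pt p} (hη₀ : IsBasePoint R 𝒟₀ η₀) (hη₁ : IsBasePoint R 𝒟₁ η₁) :
    Multipliable (thetaFactor R σ 𝒟₀ η₀ γ) ∧ Multipliable (thetaFactor R σ 𝒟₁ η₁ γ) ∧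
    Tendsto (fun n : ℕ => ι (∏ j ∈ Finset.range (2 * t),
      weightedProd a b Φ wp (lPlus a b wp e wm D j n ∪ lPlus a b wp e wm D j (n + 1)) /
        weightedProd a b Φ wm (lMinus a b wp e wm D j n ∪ lMinus a b wp e wm D j (n + 1))))
      atTop (𝓝 (thetaValue R σ 𝒟₀ η₀ γ * thetaValue R σ 𝒟₁ η₁ γ)) := by
  obtain ⟨h1, h2, h3⟩ := thetaValue_tendsto σ hinf hR hM hpar hγ hf hΦ H h₀ hp₀ hη₀
  obtain ⟨h1', h2', h3'⟩ := thetaValue_tendsto σ hinf hR hM hpar hγ hf hΦ H h₁ hp₁ hη₁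
  have hD1 : ‖((D : ℚ) : ℚ_[p])‖ = (p : ℝ) ^ (-((1 : ℕ) : ℤ)) := by simpa using hD
  obtain ⟨T, hT⟩ := exists_idxShift H.unit.frame hγ hf hΦ (D : ℚ) 1
  refine ⟨h1, h1', ((h3.mul h3').comp (tendsto_add_atTop_nat 1)).congr fun n => ?_⟩
  have hsum : ∀ ρ δ, ∑ᶠ y ∈ {y : LevelIdx a b Φ (D : ℚ) 1 |
      idxLevel wp e wm y = ρ ∧ idxDepth wp e wm y = δ}, ratVal Φ y.1.1 = 0 := by
    intro ρ δ
    rcases Int.even_or_odd ρ with hρ | hρ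
    · exact H.sum_idx le_rfl hD1 (s := 0) (Or.inl (by simpa using hρ)) h2 δ
    · exact H.sum_idx le_rfl hD1 (s := 1) (Or.inl hρ.add_one) h2' δ
  have h4 := H.prod_lattices_eq le_rfl hD1 (Nat.le_add_left 1 n) hΦ.mulInvariant hf.norm_eq hT hsum
  have h5 : ∀ A : ℕ → Set (Vec ℚ),
      {w | ∃ i : Fin (1 + 1), w ∈ A (n + 1 - i)} = A n ∪ A (n + 1) := by
    intro A
    ext w
    rw [Set.mem_ofPred_eq, Fin.exists_fin_two, Set.mem_union, or_comm]
    rfl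
  simp only [h5] at h4
  have hWfin := H.finite_idx_window le_rfl hD1 t (n + 1)
  change ι _ * ι _ = ι _
  rw [h4, ← map_mul, H.finprod_window le_rfl hD1, H.finprod_window le_rfl hD1,
    ← finprod_mem_union _ (hWfin.subset fun y hy => hy.2) (hWfin.subset fun y hy => hy.2)]
  · congr 1
    refine finprod_mem_congr ?_ fun _ _ => rfl
    ext y
    rw [Set.mem_union]
    constructor
    · rintro (h | h) <;> exact h.2
    · intro h
      rcases Int.even_or_odd (idxLevel wp e wm y) with hρ | hρ
      · exact Or.inl ⟨Or.inl (by simpa using hρ), h⟩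
      · exact Or.inr ⟨Or.inl hρ.add_one, h⟩
  · rw [Set.disjoint_left]
    rintro y ⟨h, -⟩ ⟨h', -⟩
    have h6 := h.resolve_right one_ne_zero
    have h7 := h'.resolve_right one_ne_zero
    rw [add_zero] at h6
    rw [Int.even_add_one] at h7
    exact h7 h6

end ThetaLimit

end HeegnerTheta

end

theorem theorem6p4
    -- the prime `p`, the finite places in `S`, and the level
    (p : ℕ) [Fact p.Prime] (S : Finset ℕ) (hS : ∀ l ∈ S, l.Prime) (hpS : p ∈ S)
    (hcard : Even S.card) (Nplus : ℕ) (hsq : Squarefree Nplus)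
    (hcop : ∀ l ∈ S, ¬ l ∣ Nplus) (hodd : Odd (Nplus * ∏ l ∈ S, l))
    -- the quaternion algebra ramified exactly at `∞` and the primes of `S` different from `p`
    (a b : ℚ) (hinf : IsDivision a b ℝ)
    (hram : ∀ (l : ℕ) [Fact l.Prime], IsDivision a b ℚ_[l] ↔ l ∈ S ∧ l ≠ p)
    -- the Eichler order, and the group `Γ` with `Γ / {±1}` torsion-free
    (R : Subalgebra (ZInv p) (Quat a b ℚ)) (hR : IsEichlerOrder R Nplus)
    (htf : ∀ g ∈ GammaBar R ℚ, IsOfFinOrder g → g = 1)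
    -- a splitting of the quaternion algebra at `p`, and a choice of parity on the tree
    (ι : Quat a b ℚ_[p] ≃ₐ[ℚ_[p]] Matrix (Fin 2) (Fin 2) ℚ_[p])
    (par : Submodule ℤ_[p] (Vec ℚ_[p]) → Prop) (hpar : IsParity a b par)
    -- the Schwartz--Bruhat function and the discriminant
    (Φ : Vec (AdeleAway p) → ℤ) (hΦ : IsConvenient R par Φ)
    (D : ℤ) (hD : D ∈ discSet a b p)
    -- the hyperbolic element and its eigenvectors
    (γ : (Quat a b ℚ)ˣ) (hγ : γ ∈ normOne R)
    (ϖ : ℚ_[p]) (t : ℕ) (L₀ : Submodule ℤ_[p] (Vec ℚ_[p])) (wp e wm : Vec ℚ_[p])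
    (hframe : IsHyperbolicFrame par γ ϖ t L₀ wp e wm) :
    (padicValInt p D = 0 →
      ∀ 𝒟 : Pt p →₀ ℤ, (IsStrongZeroEven a b par 𝒟 ∨ IsStrongZeroOdd a b par 𝒟) →
        pushforward R 𝒟 = heegnerDivisor R Φ D →
        ∀ η : Pt p, IsBasePoint R 𝒟 η →
          Multipliable (thetaFactor R ι 𝒟 η γ) ∧
          Filter.Tendsto
            (fun n : ℕ => algebraMap ℚ_[p] ℂ_[p]
              (∏ j ∈ Finset.range (2 * t),
                weightedProd a b Φ wp (lPlus a b wp e wm D j n) /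
                  weightedProd a b Φ wm (lMinus a b wp e wm D j n)))
            Filter.atTop (nhds (thetaValue R ι 𝒟 η γ))) ∧
    (padicValInt p D = 1 →
      ∀ 𝒟e 𝒟o : Pt p →₀ ℤ, IsStrongZeroEven a b par 𝒟e → IsStrongZeroOdd a b par 𝒟o →
        pushforward R 𝒟e = heegnerDivisor R Φ D → pushforward R 𝒟o = heegnerDivisor R Φ D →
        ∀ ηe ηo : Pt p, IsBasePoint R 𝒟e ηe → IsBasePoint R 𝒟o ηo →
          Multipliable (thetaFactor R ι 𝒟e ηe γ) ∧
          Multipliable (thetaFactor R ι 𝒟o ηo γ) ∧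
          Filter.Tendsto
            (fun n : ℕ => algebraMap ℚ_[p] ℂ_[p]
              (∏ j ∈ Finset.range (2 * t),
                weightedProd a b Φ wp (lPlus a b wp e wm D j n ∪ lPlus a b wp e wm D j (n + 1)) /
                  weightedProd a b Φ wm
                    (lMinus a b wp e wm D j n ∪ lMinus a b wp e wm D j (n + 1))))
            Filter.atTop (nhds (thetaValue R ι 𝒟e ηe γ * thetaValue R ι 𝒟o ηo γ))) := by
  have hp2 : p ≠ 2 := by
    rintro rfl
    exact Nat.not_even_iff_odd.2 hodd
      ((even_iff_two_dvd.2 (Finset.dvd_prod_of_mem (fun l => l) hpS)).mul_left _)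
  have hM : Nplus ≠ 0 := by
    rintro rfl
    rw [zero_mul] at hodd
    exact absurd hodd (by decide)
  have hu := hframe.isUnitFrame hp2
  obtain ⟨hN, θ, hθ⟩ := exists_theta_of_discSet a b p hu.frame hD
  have H : IsLengthData a b wp e wm Φ (D : ℚ) θ :=
    ⟨hp2, hu, hN, hθ, finite_length hinf hu.frame hΦ.compactSupport _⟩
  have hD0 : (D : ℚ_[p]) ≠ 0 := by
    intro h0
    apply hN 0
    rw [zero_pow two_ne_zero, mul_zero, Rat.cast_intCast, h0]
  have hval := Padic.norm_eq_zpow_neg_valuation hD0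
  rw [Padic.valuation_intCast, ← Rat.cast_intCast] at hval
  constructor
  · intro h0 𝒟 h𝒟 hpush η hη
    rw [h0, Nat.cast_zero, neg_zero, zpow_zero] at hval
    rcases h𝒟 with h | h
    · exact thetaValue_eq_of_unit ι hinf hR hM hpar hγ hframe hΦ H hval h.isStrongZero hpush hη
    · exact thetaValue_eq_of_unit ι hinf hR hM hpar hγ hframe hΦ H hval h.isStrongZero hpush hη
  · intro h1 𝒟e 𝒟o he ho hpe hpo ηe ηo hηe hηo
    rw [h1, Nat.cast_one, zpow_neg_one] at hval
    exact thetaValue_mul_eq_of_uniformizer ι hinf hR hM hpar hγ hframe hΦ H hval he.isStrongZero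
      ho.isStrongZero hpe hpo hηe hηo
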